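/- Let $\mathbb K$ be a commutative ring. A DGA is a $\mathbb Z$-graded unital associative $\mathbb K$-algebra with a $\mathbb K$-linear differential of degree $-1$ satisfying the Leibniz rule; for a DGA $A$, $\mathcal D(A)$ (resp. $\mathcal D(A^{\mathrm{op}})$) is the derived category of DG left (resp. right) $A$-modules, obtained by inverting the quasi-isomorphisms. Let $R$ and $S$ be DGAs over $\mathbb K$ and let $M$ be a DG $R$-$S$-bimodule which is finitely built from $S_S$ in $\mathcal D(S^{\mathrm{op}})$, i.e. obtained from $S_S$ using finitely many distinguished triangles, suspensions and desuspensions, direct summands and finite coproducts. Then $Z=\mathrm{RHom}_{S^{\mathrm{op}}}(M,S)$ can be represented by a DG bimodule: there are a quasi-isomorphism of DGAs $R'\to R$ and a quasi-isomorphism $P\to M$ of DG $R'$-$S$-bimodules with $P$ K-projective as a DG right $S$-module (if $M$ has such a resolution over $R$ itself, $R'=R$ is allowed), and then $Z=\mathrm{Hom}_{S^{\mathrm{op}}}(P,S)$ is a DG $S$-$R'$-bimodule. For every such choice, where in (1)-(3) $\otimes^{\mathbf L}_R$ is computed over $R'$ (which is quasi-isomorphic to $R$) with $P$ in the place of $M$,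 the following conditions are equivalent: 1. The canonical (evaluation) map $Z\otimes^{\mathbf L}_R M\to S$ is an isomorphism (in $\mathcal D(S)$). 2. For all DG left $S$-modules $N$ the canonical map $Z\otimes^{\mathbf L}_R(M\otimes^{\mathbf L}_S N)\to N$ is an isomorphism in $\mathcal D(S)$. 3. For all DG right $S$-modules $N$ and DG left $S$-modules $N'$ the canonical map $(N\otimes^{\mathbf L}_S Z)\otimes^{\mathbf L}_R(M\otimes^{\mathbf L}_S N')\to N\otimes^{\mathbf L}_S N'$ is an isomorphism in $\mathcal D(\mathbb K)$. 4. For all DG left $S$-modules $N$ the canonical map $N\to \mathrm{RHom}_R(M,M\otimes^{\mathbf L}_S N)$ (the unit of the adjunction) is an isomorphism in $\mathcal D(S)$. 5. For all DG left $S$-modules $N$ and $N'$ the canonical map $\mathrm{RHom}_S(N,N')\to \mathrm{RHom}_R(M\otimes^{\mathbf L}_S N,M\otimes^{\mathbf L}_S N')$ is an isomorphism in $\mathcal D(\mathbb K)$. 6. The functor $M\otimes^{\mathbf L}_S-:\mathcal D(S)\to\mathcal D(R)$ is a full embedding, i.e. fully faithful. -/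

import Mathlib

open CategoryTheory
open scoped TensorProduct

universe u

namespace DG

/-- The Koszul sign `(-1)^n` as an integer. -/
def sgn (n : ℤ) : ℤ := (n.negOnePow : ℤˣ)

lemma sgn_add (m n : ℤ) : sgn (m + n) = sgn m * sgn n := by
  simp [sgn, Int.negOnePow_add]

lemma sgn_zero : sgn 0 = 1 := by simp [sgn]

lemma sgn_one : sgn 1 = -1 := by simp [sgn]

lemma sgn_cases (n : ℤ) : sgn n = 1 ∨ sgn n = -1 := by
  rcases Int.even_or_odd n with h | h
  · left; simp [sgn, Int.negOnePow_even n h]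
  · right; simp [sgn, Int.negOnePow_odd n h]

lemma sgn_mul_self (n : ℤ) : sgn n * sgn n = 1 := by
  rcases sgn_cases n with h | h <;> simp [h]

lemma sgn_sq (n : ℤ) : sgn (n * n) = sgn n := by
  simp [sgn, Int.negOnePow_mul_self]

lemma sgn_neg (n : ℤ) : sgn (-n) = sgn n := by
  simp [sgn]

lemma sgn_congr {m n : ℤ} (k : ℤ) (h : m - n = 2 * k) : sgn m = sgn n := by
  obtain rfl : m = 2 * k + n := by omega
  rw [sgn_add, sgn, Int.negOnePow_two_mul, Units.val_one, one_mul]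

/-- A differential graded algebra over `K`, with homological grading: a `ℤ`-graded unital
associative `K`-algebra `(X i)` with a `K`-linear differential of degree `-1` satisfying the
Leibniz rule. The product `X i × X j → X (i + j)` is indexed by a proof of `i + j = k`, and the
differential `X (j + 1) → X j` by a proof of `j + 1 = i`. -/
structure DGA (K : Type u) [CommRing K] where
  X : ℤ → Type u
  [grp : ∀ i, AddCommGroup (X i)]
  [mod : ∀ i, Module K (X i)]
  d {i j : ℤ} (h : j + 1 = i) : X i →ₗ[K] X j
  mul {i j k : ℤ} (h : i + j = k) : X i →ₗ[K] X j →ₗ[K] X k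
  one : X 0
  d_d {i j k : ℤ} (h : j + 1 = i) (h' : k + 1 = j) (a : X i) : d h' (d h a) = 0
  one_mul {i : ℤ} (h : 0 + i = i) (a : X i) : mul h one a = a
  mul_one {i : ℤ} (h : i + 0 = i) (a : X i) : mul h a one = a
  mul_assoc {i j k ij jk n : ℤ} (h₁ : i + j = ij) (h₂ : ij + k = n) (h₃ : j + k = jk)
    (h₄ : i + jk = n) (a : X i) (b : X j) (c : X k) :
    mul h₂ (mul h₁ a b) c = mul h₄ a (mul h₃ b c)
  leibniz {i j k i' j' k' : ℤ} (h : i + j = k) (hi : i' + 1 = i) (hj : j' + 1 = j)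
    (hk : k' + 1 = k) (hl : i' + j = k') (hr : i + j' = k') (a : X i) (b : X j) :
    d hk (mul h a b) = mul hl (d hi a) b + sgn i • mul hr a (d hj b)

attribute [instance] DGA.grp DGA.mod

/-- A morphism of DGAs over `K`. -/
structure DGA.Hom {K : Type u} [CommRing K] (A B : DGA K) where
  f (i : ℤ) : A.X i →ₗ[K] B.X i
  comm {i j : ℤ} (h : j + 1 = i) (a : A.X i) : f j (A.d h a) = B.d h (f i a)
  map_one : f 0 A.one = B.one
  map_mul {i j k : ℤ} (h : i + j = k) (a : A.X i) (b : A.X j) :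
    f k (A.mul h a b) = B.mul h (f i a) (f j b)

/-- The identity morphism of a DGA. -/
def DGA.Hom.id {K : Type u} [CommRing K] (A : DGA K) : DGA.Hom A A where
  f _ := LinearMap.id
  comm _ _ := rfl
  map_one := rfl
  map_mul _ _ _ := rfl

/-- A family of linear maps between two graded modules with differential induces bijections on
the homology modules `ker d / im d`. -/
def InducesIsoOnHomology {K : Type u} [CommRing K] {X Y : ℤ → Type u}
    [∀ i, AddCommGroup (X i)] [∀ i, Module K (X i)]
    [∀ i, AddCommGroup (Y i)] [∀ i, Module K (Y i)]
    (dX : ∀ {i j : ℤ}, j + 1 = i → (X i →ₗ[K] X j))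
    (dY : ∀ {i j : ℤ}, j + 1 = i → (Y i →ₗ[K] Y j))
    (f : ∀ i, X i →ₗ[K] Y i) : Prop :=
  ∀ (i j k : ℤ) (h : j + 1 = i) (h' : k + 1 = j),
    (∀ x : X j, dX h' x = 0 → (∃ y : Y i, dY h y = f j x) → ∃ w : X i, dX h w = x) ∧
    (∀ y : Y j, dY h' y = 0 → ∃ x : X j, dX h' x = 0 ∧ ∃ w : Y i, dY h w = y - f j x)

/-- A quasi-isomorphism of DGAs. -/
def DGA.Hom.QuasiIso {K : Type u} [CommRing K] {A B : DGA K} (φ : DGA.Hom A B) : Prop :=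
  InducesIsoOnHomology (fun h => A.d h) (fun h => B.d h) φ.f

section Ground

variable (K : Type u) [CommRing K]

/-- The degree `i` part of `K` concentrated in degree `0`. -/
def groundDeg (i : ℤ) : Submodule K K where
  carrier := {x | i ≠ 0 → x = 0}
  add_mem' {x y} hx hy h := by rw [hx h, hy h, add_zero]
  zero_mem' _ := rfl
  smul_mem' c x hx h := by rw [hx h, smul_zero]

/-- The ground ring `K` as a DGA concentrated in degree `0`. -/
def ground : DGA K where
  X i := groundDeg K i
  d _ := 0
  mul {i j k} h := LinearMap.mk₂ K
    (fun x y => ⟨x.1 * y.1, fun hk => by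
      by_cases hi : i = 0
      · rw [y.2 (by omega), mul_zero]
      · rw [x.2 hi, zero_mul]⟩)
    (fun x x' y => Subtype.ext (add_mul _ _ _))
    (fun c x y => Subtype.ext (smul_mul_assoc _ _ _))
    (fun x y y' => Subtype.ext (mul_add _ _ _))
    (fun c x y => Subtype.ext (mul_smul_comm _ _ _))
  one := ⟨1, fun h => (h rfl).elim⟩
  d_d _ _ _ := rfl
  one_mul _ a := Subtype.ext (_root_.one_mul a.1)
  mul_one _ a := Subtype.ext (_root_.mul_one a.1)
  mul_assoc _ _ _ _ a b c := Subtype.ext (_root_.mul_assoc a.1 b.1 c.1)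
  leibniz _ _ _ _ _ _ a b := by
    simp only [LinearMap.zero_apply, map_zero, smul_zero, add_zero]

variable {K}

/-- The unit morphism `K → A` of a DGA over `K`. -/
def DGA.unit (A : DGA K) : DGA.Hom (ground K) A where
  f i := if h : i = 0 then
      (LinearMap.toSpanSingleton K (A.X i) (h ▸ A.one)).comp (groundDeg K i).subtype
    else 0
  comm {i j} h a := by
    have d_one : ∀ {i j : ℤ} (h : j + 1 = i) (h0 : i = 0), A.d h (h0 ▸ A.one : A.X i) = 0 := by
      intro i j h h0
      subst h0
      have := A.leibniz (add_zero 0) h h h (by omega) (by omega) A.one A.one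
      rw [A.one_mul, A.mul_one, A.one_mul, sgn_zero, one_smul] at this
      simpa using this
    have h1 : (ground K).d h a = 0 := rfl
    rw [h1, map_zero]
    split_ifs with h0
    · change 0 = A.d h (a.1 • (h0 ▸ A.one : A.X i))
      rw [map_smul, d_one h h0, smul_zero]
    · simp
  map_one := by
    rw [dif_pos rfl]
    exact one_smul K A.one
  map_mul {i j k} h a b := by
    by_cases hi : i = 0
    · by_cases hj : j = 0
      · obtain rfl : k = 0 := by omega
        subst hi hj
        rw [dif_pos rfl]
        change (a.1 * b.1) • A.one = A.mul h (a.1 • A.one) (b.1 • A.one)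
        rw [map_smul, map_smul, LinearMap.smul_apply, A.one_mul, smul_smul, mul_comm]
      · rw [dif_neg (show k ≠ 0 by omega), dif_neg hj]
        simp
    · have ha : a = 0 := Subtype.ext (a.2 hi)
      subst ha
      simp

end Ground

variable {K : Type u} [CommRing K]

/-- A DG `A`-`B`-bimodule: a graded `K`-module with a differential of degree `-1`, a left action
of `A` and a right action of `B`, both satisfying the Leibniz rule, with `(a x) b = a (x b)`. -/
structure DGBimod (A B : DGA K) where
  X : ℤ → Type u
  [grp : ∀ i, AddCommGroup (X i)]
  [mod : ∀ i, Module K (X i)]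
  d {i j : ℤ} (h : j + 1 = i) : X i →ₗ[K] X j
  lsmul {i j k : ℤ} (h : i + j = k) : A.X i →ₗ[K] X j →ₗ[K] X k
  rsmul {i j k : ℤ} (h : i + j = k) : X i →ₗ[K] B.X j →ₗ[K] X k
  d_d {i j k : ℤ} (h : j + 1 = i) (h' : k + 1 = j) (x : X i) : d h' (d h x) = 0
  one_lsmul {i : ℤ} (h : 0 + i = i) (x : X i) : lsmul h A.one x = x
  rsmul_one {i : ℤ} (h : i + 0 = i) (x : X i) : rsmul h x B.one = x
  mul_lsmul {i j k ij jk n : ℤ} (h₁ : i + j = ij) (h₂ : ij + k = n) (h₃ : j + k = jk)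
    (h₄ : i + jk = n) (a : A.X i) (b : A.X j) (x : X k) :
    lsmul h₂ (A.mul h₁ a b) x = lsmul h₄ a (lsmul h₃ b x)
  rsmul_mul {i j k ij jk n : ℤ} (h₁ : i + j = ij) (h₂ : ij + k = n) (h₃ : j + k = jk)
    (h₄ : i + jk = n) (x : X i) (a : B.X j) (b : B.X k) :
    rsmul h₂ (rsmul h₁ x a) b = rsmul h₄ x (B.mul h₃ a b)
  lsmul_rsmul {i j k ij jk n : ℤ} (h₁ : i + j = ij) (h₂ : ij + k = n) (h₃ : j + k = jk)
    (h₄ : i + jk = n) (a : A.X i) (x : X j) (b : B.X k) :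
    rsmul h₂ (lsmul h₁ a x) b = lsmul h₄ a (rsmul h₃ x b)
  lleibniz {i j k i' j' k' : ℤ} (h : i + j = k) (hi : i' + 1 = i) (hj : j' + 1 = j)
    (hk : k' + 1 = k) (hl : i' + j = k') (hr : i + j' = k') (a : A.X i) (x : X j) :
    d hk (lsmul h a x) = lsmul hl (A.d hi a) x + sgn i • lsmul hr a (d hj x)
  rleibniz {i j k i' j' k' : ℤ} (h : i + j = k) (hi : i' + 1 = i) (hj : j' + 1 = j)
    (hk : k' + 1 = k) (hl : i' + j = k') (hr : i + j' = k') (x : X i) (b : B.X j) :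
    d hk (rsmul h x b) = rsmul hl (d hi x) b + sgn i • rsmul hr x (B.d hj b)

attribute [instance] DGBimod.grp DGBimod.mod

/-- DG left `A`-modules: the right action of `K` is forced to be the given `K`-module structure. -/
abbrev DGMod (A : DGA K) := DGBimod A (ground K)

/-- DG right `A`-modules, that is, DG `Aᵒᵖ`-modules. -/
abbrev DGModOp (A : DGA K) := DGBimod (ground K) A

namespace DGBimod

variable {A B C D : DGA K}

/-- A morphism of DG bimodules: a bilinear map of degree `0` commuting with the differentials. -/
@[ext]
structure Hom (M N : DGBimod A B) where
  f (i : ℤ) : M.X i →ₗ[K] N.X i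
  comm {i j : ℤ} (h : j + 1 = i) (x : M.X i) : f j (M.d h x) = N.d h (f i x)
  map_lsmul {i j k : ℤ} (h : i + j = k) (a : A.X i) (x : M.X j) :
    f k (M.lsmul h a x) = N.lsmul h a (f j x)
  map_rsmul {i j k : ℤ} (h : i + j = k) (x : M.X i) (b : B.X j) :
    f k (M.rsmul h x b) = N.rsmul h (f i x) b

instance : Category (DGBimod A B) where
  Hom M N := Hom M N
  id M :=
    { f := fun _ => LinearMap.id
      comm := fun _ _ => rfl
      map_lsmul := fun _ _ _ => rfl
      map_rsmul := fun _ _ _ => rfl }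
  comp f g :=
    { f := fun i => (g.f i).comp (f.f i)
      comm := fun h x => by simp [f.comm, g.comm]
      map_lsmul := fun h a x => by simp [f.map_lsmul, g.map_lsmul]
      map_rsmul := fun h x b => by simp [f.map_rsmul, g.map_rsmul] }

lemma hom_ext {M N : DGBimod A B} {f g : M ⟶ N} (h : ∀ i x, f.f i x = g.f i x) : f = g :=
  Hom.ext (funext fun i => LinearMap.ext (h i))

@[simp] lemma id_f (M : DGBimod A B) (i : ℤ) (x : M.X i) : Hom.f (𝟙 M) i x = x := rfl

@[simp] lemma comp_f {M N P : DGBimod A B} (f : M ⟶ N) (g : N ⟶ P) (i : ℤ) (x : M.X i) :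
    Hom.f (f ≫ g) i x = g.f i (f.f i x) := rfl

variable (A B) in
/-- The class of quasi-isomorphisms of DG bimodules. -/
def quasiIso : MorphismProperty (DGBimod A B) := fun M N f =>
  InducesIsoOnHomology (fun h => M.d h) (fun h => N.d h) f.f

variable (A B) in
/-- The derived category of DG `A`-`B`-bimodules, obtained by formally inverting the
quasi-isomorphisms. -/
abbrev Derived := (quasiIso A B).Localization

/-- The localization functor to the derived category. -/
abbrev Q : DGBimod A B ⥤ Derived A B := (quasiIso A B).Q

variable (A) in
/-- A DGA as a DG bimodule over itself. -/
def regular : DGBimod A A where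
  X := A.X
  d h := A.d h
  lsmul h := A.mul h
  rsmul h := A.mul h
  d_d h h' x := A.d_d h h' x
  one_lsmul h x := A.one_mul h x
  rsmul_one h x := A.mul_one h x
  mul_lsmul h₁ h₂ h₃ h₄ a b x := A.mul_assoc h₁ h₂ h₃ h₄ a b x
  rsmul_mul h₁ h₂ h₃ h₄ a b x := A.mul_assoc h₁ h₂ h₃ h₄ a b x
  lsmul_rsmul h₁ h₂ h₃ h₄ a b x := A.mul_assoc h₁ h₂ h₃ h₄ a b x
  lleibniz h hi hj hk hl hr a b := A.leibniz h hi hj hk hl hr a b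
  rleibniz h hi hj hk hl hr a b := A.leibniz h hi hj hk hl hr a b

/-- Restriction of scalars of a DG bimodule along morphisms of DGAs on both sides. -/
def restrict {A' B' : DGA K} (φ : DGA.Hom A' A) (ψ : DGA.Hom B' B) (M : DGBimod A B) :
    DGBimod A' B' where
  X := M.X
  grp := M.grp
  mod := M.mod
  d h := M.d h
  lsmul {i _ _} h := (M.lsmul h).comp (φ.f i)
  rsmul {_ j _} h := (M.rsmul h).compl₂ (ψ.f j)
  d_d h h' x := M.d_d h h' x
  one_lsmul h x := by simp [φ.map_one, M.one_lsmul]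
  rsmul_one h x := by simp [ψ.map_one, M.rsmul_one]
  mul_lsmul h₁ h₂ h₃ h₄ a b x := by simp [φ.map_mul, M.mul_lsmul h₁ h₂ h₃ h₄]
  rsmul_mul h₁ h₂ h₃ h₄ x a b := by simp [ψ.map_mul, M.rsmul_mul h₁ h₂ h₃ h₄]
  lsmul_rsmul h₁ h₂ h₃ h₄ a x b := by simp [M.lsmul_rsmul h₁ h₂ h₃ h₄]
  lleibniz h hi hj hk hl hr a x := by simp [φ.comm, M.lleibniz h hi hj hk hl hr]
  rleibniz h hi hj hk hl hr x b := by simp [ψ.comm, M.rleibniz h hi hj hk hl hr]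

/-- The underlying DG left module of a DG bimodule. -/
abbrev left (M : DGBimod A B) : DGMod A := M.restrict (DGA.Hom.id A) B.unit

/-- The underlying DG right module of a DG bimodule. -/
abbrev right (M : DGBimod A B) : DGModOp B := M.restrict A.unit (DGA.Hom.id B)

/-- The suspension `Σⁿ M`: `(Σⁿ M)_i = M_{i-n}`, with differential `(-1)ⁿ d`, left action
twisted by the Koszul sign and unchanged right action. -/
def shift (n : ℤ) (M : DGBimod A B) : DGBimod A B where
  X i := M.X (i - n)
  d h := sgn n • M.d (by omega)
  lsmul {i _ _} h := sgn (n * i) • M.lsmul (by omega)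
  rsmul h := M.rsmul (by omega)
  d_d h h' x := by simp [M.d_d]
  one_lsmul {i} h x := by
    simp only [mul_zero, sgn_zero, one_smul]
    exact M.one_lsmul _ x
  rsmul_one {i} h x := M.rsmul_one _ x
  mul_lsmul {i j k ij jk m} h₁ h₂ h₃ h₄ a b x := by
    subst h₁
    simp [M.mul_lsmul rfl (by omega : i + j + (k - n) = m - n) (by omega : j + (k - n) = jk - n)
      (by omega), mul_add, sgn_add, smul_smul]
  rsmul_mul h₁ h₂ h₃ h₄ x a b := M.rsmul_mul _ _ _ _ x a b
  lsmul_rsmul {i j k ij jk m} h₁ h₂ h₃ h₄ a x b := by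
    simp [M.lsmul_rsmul (by omega : i + (j - n) = ij - n) (by omega : ij - n + k = m - n)
      (by omega : j - n + k = jk - n) (by omega)]
  lleibniz {i j k i' j' k'} h hi hj hk hl hr a x := by
    subst hi
    simp only [LinearMap.smul_apply, map_zsmul]
    rw [M.lleibniz (by omega : i' + 1 + (j - n) = k - n) rfl (by omega : j' - n + 1 = j - n)
      (by omega : k' - n + 1 = k - n) (by omega) (by omega)]
    simp only [smul_smul, smul_add, mul_add, sgn_add, mul_one]
    congr 2
    · rw [_root_.mul_assoc, sgn_mul_self, _root_.mul_one]
    · ring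
  rleibniz {i j k i' j' k'} h hi hj hk hl hr x b := by
    subst hi
    simp only [LinearMap.smul_apply, smul_add,
      M.rleibniz (by omega : i' + 1 - n + j = k - n) (by omega : i' - n + 1 = i' + 1 - n) hj
      (by omega : k' - n + 1 = k - n) (by omega) (by omega)]
    simp only [map_zsmul, LinearMap.smul_apply, smul_smul, sgn_add, sub_eq_add_neg, sgn_neg]
    congr 2
    linear_combination (sgn i' * sgn 1) * sgn_mul_self n

/-- The identification of the components of a DG bimodule in two equal degrees. -/
def castX (M : DGBimod A B) {i j : ℤ} (h : i = j) : M.X i →ₗ[K] M.X j :=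
  h ▸ LinearMap.id

lemma castX_d (M : DGBimod A B) {i j i' j' : ℤ} (h : j + 1 = i) (h' : j' + 1 = i')
    (hi : i = i') (hj : j = j') (x : M.X i) :
    M.castX hj (M.d h x) = M.d h' (M.castX hi x) := by
  subst hi hj; rfl

lemma castX_lsmul (M : DGBimod A B) {i j k j' k' : ℤ} (h : i + j = k) (h' : i + j' = k')
    (hj : j = j') (hk : k = k') (a : A.X i) (x : M.X j) :
    M.castX hk (M.lsmul h a x) = M.lsmul h' a (M.castX hj x) := by
  subst hj hk; rfl

lemma castX_rsmul (M : DGBimod A B) {i j k i' k' : ℤ} (h : i + j = k) (h' : i' + j = k')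
    (hi : i = i') (hk : k = k') (x : M.X i) (b : B.X j) :
    M.castX hk (M.rsmul h x b) = M.rsmul h' (M.castX hi x) b := by
  subst hi hk; rfl

/-- The mapping cone of a morphism `f : M ⟶ N`: `Cone_i = N_i × M_{i-1}` with differential
`(y, x) ↦ (d y + f x, - d x)`; the two actions are those of `N` and `Σ M`. -/
def cone {M N : DGBimod A B} (f : M ⟶ N) : DGBimod A B where
  X i := N.X i × M.X (i - 1)
  d {i j} h := LinearMap.prod
    ((N.d h).comp (LinearMap.fst K _ _) +
      ((f.f j).comp (M.castX (by omega : i - 1 = j))).comp (LinearMap.snd K _ _))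
    (-(M.d (show j - 1 + 1 = i - 1 by omega)).comp (LinearMap.snd K _ _))
  lsmul {i j k} h := LinearMap.mk₂ K
    (fun a p => (N.lsmul h a p.1, sgn i • M.lsmul (by omega : i + (j - 1) = k - 1) a p.2))
    (fun a a' p => by simp) (fun c a p => by simp [smul_comm (sgn i) c])
    (fun a p p' => by simp) (fun c a p => by simp [smul_comm (sgn i) c])
  rsmul {i j k} h := LinearMap.mk₂ K
    (fun p b => (N.rsmul h p.1 b, M.rsmul (by omega : i - 1 + j = k - 1) p.2 b))
    (fun a a' p => by simp) (fun c a p => by simp)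
    (fun a p p' => by simp) (fun c a p => by simp)
  d_d {i j k} h h' p := by
    ext
    · simp [N.d_d, ← f.comm h', M.castX_d (by omega : j - 1 + 1 = i - 1) h' (by omega)]
    · simp [M.d_d]
  one_lsmul h p := by
    ext
    · simp [N.one_lsmul]
    · simp [M.one_lsmul, sgn_zero]
  rsmul_one h p := by
    ext
    · simp [N.rsmul_one]
    · simp [M.rsmul_one]
  mul_lsmul {i j k ij jk n} h₁ h₂ h₃ h₄ a b p := by
    ext
    · simp [N.mul_lsmul h₁ h₂ h₃ h₄]
    · simp [M.mul_lsmul h₁ (by omega : ij + (k - 1) = n - 1) (by omega : j + (k - 1) = jk - 1) (by omega), ← h₁,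
        sgn_add, smul_smul]
  rsmul_mul {i j k ij jk n} h₁ h₂ h₃ h₄ p a b := by
    ext
    · simp [N.rsmul_mul h₁ h₂ h₃ h₄]
    · simp [M.rsmul_mul (by omega : i - 1 + j = ij - 1) (by omega : ij - 1 + k = n - 1) h₃ (by omega)]
  lsmul_rsmul {i j k ij jk n} h₁ h₂ h₃ h₄ a p b := by
    ext
    · simp [N.lsmul_rsmul h₁ h₂ h₃ h₄]
    · simp [M.lsmul_rsmul (by omega : i + (j - 1) = ij - 1) (by omega : ij - 1 + k = n - 1)
        (by omega : j - 1 + k = jk - 1) (by omega)]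
  lleibniz {i j k i' j' k'} h hi hj hk hl hr a p := by
    ext
    · simp [N.lleibniz h hi hj hk hl hr, M.castX_lsmul _ hr (by omega : j - 1 = j'),
        f.map_lsmul hr, add_assoc]
    · subst hi
      simp [M.lleibniz (by omega : i' + 1 + (j - 1) = k - 1) rfl
        (by omega : j' - 1 + 1 = j - 1) (by omega : k' - 1 + 1 = k - 1) (by omega) (by omega),
        sgn_add, sgn_one, smul_smul, sgn_mul_self]
  rleibniz {i j k i' j' k'} h hi hj hk hl hr p b := by
    ext
    · simp [N.rleibniz h hi hj hk hl hr, M.castX_rsmul _ hl (by omega : i - 1 = i'),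
        f.map_rsmul hl]
      abel
    · subst hi
      simp [M.rleibniz (by omega : i' + 1 - 1 + j = k - 1) (by omega : i' - 1 + 1 = i' + 1 - 1)
        hj (by omega : k' - 1 + 1 = k - 1) (by omega) (by omega),
        sgn_add, sgn_one, sub_eq_add_neg]
      abel

/-- The objects of the derived category that are finitely built from `G`: those obtained from `G`
using finitely many (de)suspensions, distinguished triangles (up to isomorphism in the derived
category, the mapping cone triangles), direct summands and finite coproducts. -/
inductive FinitelyBuilt (G : DGBimod A B) : Derived A B → Prop
  | base : FinitelyBuilt G (Q.obj G)
  | iso {X Y : Derived A B} (e : X ≅ Y) : FinitelyBuilt G X → FinitelyBuilt G Y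
  | shift (n : ℤ) (M : DGBimod A B) :
      FinitelyBuilt G (Q.obj M) → FinitelyBuilt G (Q.obj (M.shift n))
  | cone {M N : DGBimod A B} (f : M ⟶ N) :
      FinitelyBuilt G (Q.obj M) → FinitelyBuilt G (Q.obj N) → FinitelyBuilt G (Q.obj (cone f))
  | summand {X Y : Derived A B} (r : Retract X Y) : FinitelyBuilt G Y → FinitelyBuilt G X
  | emptyCoprod {X : Derived A B} (h : Limits.IsInitial X) : FinitelyBuilt G X
  | coprod {X Y : Derived A B} (c : Limits.BinaryCofan X Y) (h : Limits.IsColimit c) :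
      FinitelyBuilt G X → FinitelyBuilt G Y → FinitelyBuilt G c.pt

section Tensor

variable (M : DGBimod A B) (N : DGBimod B C)

/-- The degree `n` part of `M ⊗_K N`. -/
abbrev PreTensor (n : ℤ) : Type u :=
  DirectSum {p : ℤ × ℤ // p.1 + p.2 = n} fun p => M.X p.1.1 ⊗[K] N.X p.1.2

/-- The elementary tensors of `M ⊗_K N`. -/
noncomputable def preTmul {i j n : ℤ} (h : i + j = n) :
    M.X i →ₗ[K] N.X j →ₗ[K] PreTensor M N n :=
  (TensorProduct.mk K (M.X i) (N.X j)).compr₂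
    (DirectSum.lof K {p : ℤ × ℤ // p.1 + p.2 = n} (fun p => M.X p.1.1 ⊗[K] N.X p.1.2) ⟨(i, j), h⟩)

/-- The relations `(x b) ⊗ y = x ⊗ (b y)`. -/
def tensorRel (n : ℤ) : Submodule K (PreTensor M N n) :=
  Submodule.span K {t | ∃ (i j l il lj : ℤ) (h₁ : i + l = il) (h₂ : il + j = n) (h₃ : l + j = lj)
    (h₄ : i + lj = n) (x : M.X i) (b : B.X l) (y : N.X j),
    t = preTmul M N h₂ (M.rsmul h₁ x b) y - preTmul M N h₄ x (N.lsmul h₃ b y)}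

/-- The degree `n` part of `M ⊗_B N`. -/
def TensorX (n : ℤ) : Type u := PreTensor M N n ⧸ tensorRel M N n

instance (n : ℤ) : AddCommGroup (TensorX M N n) :=
  inferInstanceAs (AddCommGroup (PreTensor M N n ⧸ tensorRel M N n))

instance (n : ℤ) : Module K (TensorX M N n) :=
  inferInstanceAs (Module K (PreTensor M N n ⧸ tensorRel M N n))

/-- The elementary tensors of `M ⊗_B N`. -/
noncomputable def tmul {i j n : ℤ} (h : i + j = n) : M.X i →ₗ[K] N.X j →ₗ[K] TensorX M N n :=
  (preTmul M N h).compr₂ (tensorRel M N n).mkQ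

variable {M N}

lemma rsmul_tmul {i j l il lj n : ℤ} (h₁ : i + l = il) (h₂ : il + j = n) (h₃ : l + j = lj)
    (h₄ : i + lj = n) (x : M.X i) (b : B.X l) (y : N.X j) :
    tmul M N h₂ (M.rsmul h₁ x b) y = tmul M N h₄ x (N.lsmul h₃ b y) := by
  rw [← sub_eq_zero]
  change (tensorRel M N n).mkQ _ - (tensorRel M N n).mkQ _ = 0
  rw [← map_sub, Submodule.mkQ_apply, Submodule.Quotient.mk_eq_zero]
  exact Submodule.subset_span ⟨i, j, l, il, lj, h₁, h₂, h₃, h₄, x, b, y, rfl⟩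

/-- A family of bilinear maps is `B`-balanced. -/
def Balanced {n : ℤ} {W : Type u} [AddCommGroup W] [Module K W]
    (φ : ∀ i j : ℤ, i + j = n → (M.X i →ₗ[K] N.X j →ₗ[K] W)) : Prop :=
  ∀ (i j l il lj : ℤ) (h₁ : i + l = il) (h₂ : il + j = n) (h₃ : l + j = lj) (h₄ : i + lj = n)
    (x : M.X i) (b : B.X l) (y : N.X j),
    φ il j h₂ (M.rsmul h₁ x b) y = φ i lj h₄ x (N.lsmul h₃ b y)

lemma tensor_ext {n : ℤ} {W : Type u} [AddCommGroup W] [Module K W]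
    {f g : TensorX M N n →ₗ[K] W}
    (h : ∀ (i j : ℤ) (hij : i + j = n) (x : M.X i) (y : N.X j),
      f (tmul M N hij x y) = g (tmul M N hij x y)) : f = g := by
  apply Submodule.linearMap_qext
  apply DirectSum.linearMap_ext
  rintro ⟨⟨i, j⟩, hij⟩
  exact TensorProduct.ext' fun x y => h i j hij x y

/-- The linear map out of `M ⊗_B N` induced by a balanced family of bilinear maps. -/
noncomputable def tlift {n : ℤ} {W : Type u} [AddCommGroup W] [Module K W]
    (φ : ∀ i j : ℤ, i + j = n → (M.X i →ₗ[K] N.X j →ₗ[K] W)) (hφ : Balanced φ) :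
    TensorX M N n →ₗ[K] W :=
  (tensorRel M N n).liftQ
    (DirectSum.toModule K _ W fun p => TensorProduct.lift (φ p.1.1 p.1.2 p.2)) (by
      rw [tensorRel, Submodule.span_le]
      rintro _ ⟨i, j, l, il, lj, h₁, h₂, h₃, h₄, x, b, y, rfl⟩
      simp only [SetLike.mem_coe, LinearMap.mem_ker, map_sub, preTmul, LinearMap.compr₂_apply,
        TensorProduct.mk_apply, DirectSum.toModule_lof, TensorProduct.lift.tmul]
      rw [sub_eq_zero]
      exact hφ i j l il lj h₁ h₂ h₃ h₄ x b y)

@[simp] lemma tlift_tmul {n : ℤ} {W : Type u} [AddCommGroup W] [Module K W]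
    (φ : ∀ i j : ℤ, i + j = n → (M.X i →ₗ[K] N.X j →ₗ[K] W)) (hφ : Balanced φ)
    {i j : ℤ} (h : i + j = n) (x : M.X i) (y : N.X j) :
    tlift φ hφ (tmul M N h x y) = φ i j h x y := by
  change (tensorRel M N n).liftQ _ _ ((tensorRel M N n).mkQ _) = _
  rw [Submodule.mkQ_apply, Submodule.liftQ_apply]
  simp [preTmul]

variable (M N)

/-- The differential `d (x ⊗ y) = d x ⊗ y + (-1)^|x| x ⊗ d y`. -/
noncomputable def tensorD {n n' : ℤ} (hn : n' + 1 = n) : TensorX M N n →ₗ[K] TensorX M N n' :=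
  tlift (fun i j h =>
    (tmul M N (by omega : (i - 1) + j = n')).comp (M.d (by omega : (i - 1) + 1 = i)) +
    sgn i • (tmul M N (by omega : i + (j - 1) = n')).compl₂ (N.d (by omega : (j - 1) + 1 = j))) (by
    intro i j l il lj h₁ h₂ h₃ h₄ x b y
    simp only [LinearMap.add_apply, LinearMap.comp_apply, LinearMap.smul_apply,
      LinearMap.compl₂_apply]
    rw [M.rleibniz h₁ (by omega : (i - 1) + 1 = i) (by omega : (l - 1) + 1 = l) _
        (by omega : i - 1 + l = il - 1) (by omega : i + (l - 1) = il - 1),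
      N.lleibniz h₃ (by omega : (l - 1) + 1 = l) (by omega : (j - 1) + 1 = j) _
        (by omega : l - 1 + j = lj - 1) (by omega : l + (j - 1) = lj - 1)]
    simp only [map_add, map_zsmul, LinearMap.add_apply, LinearMap.smul_apply, smul_add, smul_smul]
    rw [rsmul_tmul _ _ h₃ (by omega : i - 1 + lj = n'),
      rsmul_tmul _ _ (by omega : l - 1 + j = lj - 1) (by omega : i + (lj - 1) = n'),
      rsmul_tmul h₁ _ (by omega : l + (j - 1) = lj - 1) (by omega : i + (lj - 1) = n'),
      show sgn il = sgn i * sgn l by rw [← h₁, sgn_add], add_assoc])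

variable {M N}

lemma tensorD_tmul {i j n i' j' n' : ℤ} (h : i + j = n) (hn : n' + 1 = n) (hi : i' + 1 = i)
    (hj : j' + 1 = j) (hl : i' + j = n') (hr : i + j' = n') (x : M.X i) (y : N.X j) :
    tensorD M N hn (tmul M N h x y) =
      tmul M N hl (M.d hi x) y + sgn i • tmul M N hr x (N.d hj y) := by
  obtain rfl : i' = i - 1 := by omega
  obtain rfl : j' = j - 1 := by omega
  exact tlift_tmul _ _ h x y

variable (M N)

/-- The bilinear maps `(x, y) ↦ (a ↦ (a x) ⊗ y)`. -/
noncomputable def tensorLAux {i j k : ℤ} (h : i + j = k) (p q : ℤ) (hpq : p + q = j) :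
    M.X p →ₗ[K] N.X q →ₗ[K] A.X i →ₗ[K] TensorX M N k :=
  LinearMap.mk₂ K
    (fun x y => ((tmul M N (by omega : (i + p) + q = k)).flip y).comp
      ((M.lsmul (rfl : i + p = i + p)).flip x))
    (fun x x' y => by ext; simp) (fun c x y => by ext; simp)
    (fun x y y' => by ext; simp) (fun c x y => by ext; simp)

lemma tensorLAux_balanced {i j k : ℤ} (h : i + j = k) : Balanced (tensorLAux M N h) := by
  intro p q l pl lq h₁ h₂ h₃ h₄ x b y
  ext a
  simp only [tensorLAux, LinearMap.mk₂_apply, LinearMap.comp_apply, LinearMap.flip_apply]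
  rw [← M.lsmul_rsmul rfl (by omega : i + p + l = i + pl) h₁ rfl,
    rsmul_tmul _ _ h₃ (by omega : i + p + lq = k)]

/-- The left action `a (x ⊗ y) = (a x) ⊗ y`. -/
noncomputable def tensorL {i j k : ℤ} (h : i + j = k) :
    A.X i →ₗ[K] TensorX M N j →ₗ[K] TensorX M N k :=
  LinearMap.flip (tlift (tensorLAux M N h) (tensorLAux_balanced M N h))

/-- The bilinear maps `(x, y) ↦ (c ↦ x ⊗ (y c))`. -/
noncomputable def tensorRAux {i j k : ℤ} (h : i + j = k) (p q : ℤ) (hpq : p + q = i) :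
    M.X p →ₗ[K] N.X q →ₗ[K] C.X j →ₗ[K] TensorX M N k :=
  LinearMap.mk₂ K
    (fun x y => (tmul M N (by omega : p + (q + j) = k) x).comp
      (N.rsmul (rfl : q + j = q + j) y))
    (fun x x' y => by ext; simp) (fun c x y => by ext; simp)
    (fun x y y' => by ext; simp) (fun c x y => by ext; simp)

lemma tensorRAux_balanced {i j k : ℤ} (h : i + j = k) : Balanced (tensorRAux M N h) := by
  intro p q l pl lq h₁ h₂ h₃ h₄ x b y
  ext c
  simp only [tensorRAux, LinearMap.mk₂_apply, LinearMap.comp_apply]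
  rw [N.lsmul_rsmul h₃ (by omega : lq + j = lq + j) rfl (by omega : l + (q + j) = lq + j),
    rsmul_tmul h₁ _ (by omega : l + (q + j) = lq + j) (by omega : p + (lq + j) = k)]

/-- The right action `(x ⊗ y) c = x ⊗ (y c)`. -/
noncomputable def tensorR {i j k : ℤ} (h : i + j = k) :
    TensorX M N i →ₗ[K] C.X j →ₗ[K] TensorX M N k :=
  tlift (tensorRAux M N h) (tensorRAux_balanced M N h)

variable {M N}

lemma tensorL_tmul {i j k p q ip : ℤ} (h : i + j = k) (hpq : p + q = j) (hip : i + p = ip)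
    (hk : ip + q = k) (a : A.X i) (x : M.X p) (y : N.X q) :
    tensorL M N h a (tmul M N hpq x y) = tmul M N hk (M.lsmul hip a x) y := by
  subst hip
  rw [tensorL, LinearMap.flip_apply, tlift_tmul]
  rfl

lemma tensorR_tmul {i j k p q qj : ℤ} (h : i + j = k) (hpq : p + q = i) (hqj : q + j = qj)
    (hk : p + qj = k) (x : M.X p) (y : N.X q) (c : C.X j) :
    tensorR M N h (tmul M N hpq x y) c = tmul M N hk x (N.rsmul hqj y c) := by
  subst hqj
  rw [tensorR, tlift_tmul]
  rfl

lemma tensor_induction {n : ℤ} {P : TensorX M N n → Prop}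
    (h0 : ∀ (i j : ℤ) (h : i + j = n) (x : M.X i) (y : N.X j), P (tmul M N h x y))
    (hz : P 0) (hadd : ∀ s t, P s → P t → P (s + t)) (t : TensorX M N n) : P t := by
  obtain ⟨t, rfl⟩ := (tensorRel M N n).mkQ_surjective t
  induction t using DirectSum.induction_on with
  | zero => rw [map_zero]; exact hz
  | of p t =>
    obtain ⟨⟨i, j⟩, h⟩ := p
    induction t using TensorProduct.induction_on with
    | zero => rw [map_zero, map_zero]; exact hz
    | tmul x y => exact h0 i j h x y
    | add s t hs ht => rw [map_add, map_add]; exact hadd _ _ hs ht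
  | add s t hs ht => rw [map_add]; exact hadd _ _ hs ht

variable (M N)

/-- The tensor product `M ⊗_B N` of DG bimodules, graded by total degree. -/
noncomputable def tensor : DGBimod A C where
  X := TensorX M N
  d h := tensorD M N h
  lsmul h := tensorL M N h
  rsmul h := tensorR M N h
  d_d {i j k} h h' t := by
    induction t using tensor_induction with
    | h0 p q hpq x y =>
      rw [tensorD_tmul hpq h (by omega : p - 1 + 1 = p) (by omega : q - 1 + 1 = q)
          (by omega) (by omega), map_add, map_zsmul,
        tensorD_tmul _ h' (by omega : p - 2 + 1 = p - 1) (by omega : q - 1 + 1 = q)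
          (by omega) (by omega),
        tensorD_tmul _ h' (by omega : p - 1 + 1 = p) (by omega : q - 2 + 1 = q - 1)
          (by omega) (by omega), M.d_d, N.d_d]
      simp [sub_eq_add_neg, sgn_add, sgn_neg, sgn_one]
    | hz => simp
    | hadd s t hs ht => simp only [map_add, hs, ht, add_zero]
  one_lsmul h t := by
    induction t using tensor_induction with
    | h0 p q hpq x y =>
      rw [tensorL_tmul h hpq (zero_add p) hpq, M.one_lsmul]
    | hz => simp
    | hadd s t hs ht => simp only [map_add, hs, ht]
  rsmul_one h t := by
    induction t using tensor_induction with
    | h0 p q hpq x y =>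
      rw [tensorR_tmul h hpq (add_zero q) hpq, N.rsmul_one]
    | hz => simp
    | hadd s t hs ht => simp only [map_add, LinearMap.add_apply, hs, ht]
  mul_lsmul {i j k ij jk n} h₁ h₂ h₃ h₄ a b t := by
    induction t using tensor_induction with
    | h0 p q hpq x y =>
      rw [tensorL_tmul h₂ hpq rfl (by omega), tensorL_tmul h₃ hpq rfl (by omega),
        tensorL_tmul h₄ _ (by omega : i + (j + p) = ij + p) (by omega),
        M.mul_lsmul h₁ _ rfl (by omega)]
    | hz => simp
    | hadd s t hs ht => simp only [map_add, hs, ht]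
  rsmul_mul {i j k ij jk n} h₁ h₂ h₃ h₄ t b c := by
    induction t using tensor_induction with
    | h0 p q hpq x y =>
      rw [tensorR_tmul h₁ hpq rfl (by omega),
        tensorR_tmul h₂ _ (by omega : q + j + k = q + jk) (by omega),
        tensorR_tmul h₄ hpq rfl (by omega), N.rsmul_mul rfl _ h₃ rfl]
    | hz => simp
    | hadd s t hs ht => simp only [map_add, LinearMap.add_apply, hs, ht]
  lsmul_rsmul {i j k ij jk n} h₁ h₂ h₃ h₄ a t b := by
    induction t using tensor_induction with
    | h0 p q hpq x y =>
      rw [tensorL_tmul h₁ hpq rfl (by omega),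
        tensorR_tmul h₂ _ rfl (by omega : i + p + (q + k) = n),
        tensorR_tmul h₃ hpq rfl (by omega), tensorL_tmul h₄ _ rfl]
    | hz => simp
    | hadd s t hs ht => simp only [map_add, LinearMap.add_apply, hs, ht]
  lleibniz {i j k i' j' k'} h hi hj hk hl hr a t := by
    induction t using tensor_induction with
    | h0 p q hpq x y =>
      subst h
      rw [tensorL_tmul rfl hpq rfl (by omega),
        tensorD_tmul _ hk (by omega : i + (p - 1) + 1 = i + p) (by omega : q - 1 + 1 = q)
          (by omega) (by omega),
        tensorL_tmul hl hpq (by omega : i' + p = i + (p - 1)) (by omega),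
        tensorD_tmul hpq hj (by omega : p - 1 + 1 = p) (by omega : q - 1 + 1 = q)
          (by omega) (by omega), map_add, map_zsmul,
        tensorL_tmul hr _ rfl (by omega), tensorL_tmul hr _ rfl (by omega),
        M.lleibniz rfl hi (by omega : p - 1 + 1 = p) _ (by omega : i' + p = i + (p - 1)) rfl]
      simp only [map_add, map_zsmul, LinearMap.add_apply, LinearMap.smul_apply, smul_add,
        smul_smul, sgn_add, add_assoc]
    | hz => simp
    | hadd s t hs ht =>
      simp only [map_add, hs, ht, smul_add]
      abel
  rleibniz {i j k i' j' k'} h hi hj hk hl hr t b := by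
    induction t using tensor_induction with
    | h0 p q hpq x y =>
      subst h
      rw [tensorR_tmul rfl hpq rfl (by omega),
        tensorD_tmul _ hk (by omega : p - 1 + 1 = p) (by omega : q - 1 + j + 1 = q + j)
          (by omega) (by omega),
        tensorR_tmul hr hpq (by omega : q + j' = q - 1 + j) (by omega),
        tensorD_tmul hpq hi (by omega : p - 1 + 1 = p) (by omega : q - 1 + 1 = q)
          (by omega) (by omega), map_add, map_zsmul, LinearMap.add_apply, LinearMap.smul_apply,
        tensorR_tmul hl _ rfl (by omega), tensorR_tmul hl _ rfl (by omega),
        N.rleibniz rfl (by omega : q - 1 + 1 = q) hj _ rfl (by omega : q + j' = q - 1 + j)]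
      simp only [map_add, map_zsmul, smul_add, smul_smul, ← hpq, sgn_add, add_assoc]
    | hz => simp
    | hadd s t hs ht =>
      simp only [map_add, LinearMap.add_apply, hs, ht, smul_add]
      abel

/-- The elementary tensors of `M ⊗_B N`, as elements of the DG bimodule. -/
noncomputable def tm {i j n : ℤ} (h : i + j = n) :
    M.X i →ₗ[K] N.X j →ₗ[K] (tensor M N).X n := tmul M N h

variable {M N}

lemma tm_rsmul {i j l il lj n : ℤ} (h₁ : i + l = il) (h₂ : il + j = n) (h₃ : l + j = lj)
    (h₄ : i + lj = n) (x : M.X i) (b : B.X l) (y : N.X j) :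
    tm M N h₂ (M.rsmul h₁ x b) y = tm M N h₄ x (N.lsmul h₃ b y) :=
  rsmul_tmul h₁ h₂ h₃ h₄ x b y

lemma d_tm {i j n i' j' n' : ℤ} (h : i + j = n) (hn : n' + 1 = n) (hi : i' + 1 = i)
    (hj : j' + 1 = j) (hl : i' + j = n') (hr : i + j' = n') (x : M.X i) (y : N.X j) :
    (tensor M N).d hn (tm M N h x y) =
      tm M N hl (M.d hi x) y + sgn i • tm M N hr x (N.d hj y) :=
  tensorD_tmul h hn hi hj hl hr x y

lemma lsmul_tm {i j k p q ip : ℤ} (h : i + j = k) (hpq : p + q = j) (hip : i + p = ip)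
    (hk : ip + q = k) (a : A.X i) (x : M.X p) (y : N.X q) :
    (tensor M N).lsmul h a (tm M N hpq x y) = tm M N hk (M.lsmul hip a x) y :=
  tensorL_tmul h hpq hip hk a x y

lemma rsmul_tm {i j k p q qj : ℤ} (h : i + j = k) (hpq : p + q = i) (hqj : q + j = qj)
    (hk : p + qj = k) (x : M.X p) (y : N.X q) (c : C.X j) :
    (tensor M N).rsmul h (tm M N hpq x y) c = tm M N hk x (N.rsmul hqj y c) :=
  tensorR_tmul h hpq hqj hk x y c

lemma tm_ext {n : ℤ} {W : Type u} [AddCommGroup W] [Module K W]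
    {f g : (tensor M N).X n →ₗ[K] W}
    (h : ∀ (i j : ℤ) (hij : i + j = n) (x : M.X i) (y : N.X j),
      f (tm M N hij x y) = g (tm M N hij x y)) : f = g :=
  tensor_ext (M := M) (N := N) h

/-- The linear map out of `(M ⊗_B N)_n` induced by a balanced family of bilinear maps. -/
noncomputable def tmLift {n : ℤ} {W : Type u} [AddCommGroup W] [Module K W]
    (φ : ∀ i j : ℤ, i + j = n → (M.X i →ₗ[K] N.X j →ₗ[K] W)) (hφ : Balanced φ) :
    (tensor M N).X n →ₗ[K] W := tlift φ hφ

lemma tmLift_tm {n : ℤ} {W : Type u} [AddCommGroup W] [Module K W]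
    (φ : ∀ i j : ℤ, i + j = n → (M.X i →ₗ[K] N.X j →ₗ[K] W)) (hφ : Balanced φ)
    {i j : ℤ} (h : i + j = n) (x : M.X i) (y : N.X j) :
    tmLift φ hφ (tm M N h x y) = φ i j h x y :=
  tlift_tmul φ hφ h x y

lemma tm_induction {n : ℤ} {P : (tensor M N).X n → Prop}
    (h0 : ∀ (i j : ℤ) (h : i + j = n) (x : M.X i) (y : N.X j), P (tm M N h x y))
    (hz : P 0) (hadd : ∀ s t, P s → P t → P (s + t)) (t : (tensor M N).X n) : P t :=
  tensor_induction (M := M) (N := N) h0 hz hadd t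

/-- A morphism out of a tensor product is determined on elementary tensors. -/
lemma tensor_hom_ext {P : DGBimod A C} {f g : tensor M N ⟶ P}
    (h : ∀ (i j n : ℤ) (hij : i + j = n) (x : M.X i) (y : N.X j),
      f.f n (tm M N hij x y) = g.f n (tm M N hij x y)) : f = g :=
  Hom.ext (funext fun n => tm_ext fun i j hij x y => h i j n hij x y)

variable (M N) in
/-- A `B`-balanced bilinear map `M × N → P` of degree `0` which satisfies the Leibniz rule and is
compatible with the left action of `A` and the right action of `C`. -/
structure Pairing (P : DGBimod A C) where
  φ (n i j : ℤ) (h : i + j = n) : M.X i →ₗ[K] N.X j →ₗ[K] P.X n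
  bal (n i j l il lj : ℤ) (h₁ : i + l = il) (h₂ : il + j = n) (h₃ : l + j = lj)
    (h₄ : i + lj = n) (x : M.X i) (b : B.X l) (y : N.X j) :
    φ n il j h₂ (M.rsmul h₁ x b) y = φ n i lj h₄ x (N.lsmul h₃ b y)
  leibniz (i j n i' j' n' : ℤ) (h : i + j = n) (hn : n' + 1 = n) (hi : i' + 1 = i)
    (hj : j' + 1 = j) (hl : i' + j = n') (hr : i + j' = n') (x : M.X i) (y : N.X j) :
    P.d hn (φ n i j h x y) = φ n' i' j hl (M.d hi x) y + sgn i • φ n' i j' hr x (N.d hj y)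
  map_lsmul (i j k p q ip : ℤ) (h : i + j = k) (hpq : p + q = j) (hip : i + p = ip)
    (hk : ip + q = k) (a : A.X i) (x : M.X p) (y : N.X q) :
    φ k ip q hk (M.lsmul hip a x) y = P.lsmul h a (φ j p q hpq x y)
  map_rsmul (i j k p q qj : ℤ) (h : i + j = k) (hpq : p + q = i) (hqj : q + j = qj)
    (hk : p + qj = k) (x : M.X p) (y : N.X q) (c : C.X j) :
    φ k p qj hk x (N.rsmul hqj y c) = P.rsmul h (φ i p q hpq x y) c

lemma Pairing.balanced {P : DGBimod A C} (p : Pairing M N P) (n : ℤ) : Balanced (p.φ n) :=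
  p.bal n

/-- The morphism of DG bimodules out of `M ⊗_B N` induced by a pairing. -/
noncomputable def Pairing.desc {P : DGBimod A C} (p : Pairing M N P) : tensor M N ⟶ P where
  f n := tmLift (p.φ n) (p.balanced n)
  comm {n n'} h t := by
    induction t using tm_induction with
    | h0 i j hij x y =>
      rw [d_tm hij h (by omega : i - 1 + 1 = i) (by omega : j - 1 + 1 = j) (by omega) (by omega),
        map_add, map_zsmul, tmLift_tm, tmLift_tm, tmLift_tm]
      exact (p.leibniz _ _ _ _ _ _ hij h _ _ _ _ x y).symm
    | hz => simp only [map_zero]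
    | hadd s t hs ht => simp only [map_add, hs, ht]
  map_lsmul {i j k} h a t := by
    induction t using tm_induction with
    | h0 i' j' hij x y =>
      rw [lsmul_tm h hij rfl (by omega), tmLift_tm, tmLift_tm]
      exact p.map_lsmul _ _ _ _ _ _ h hij rfl _ a x y
    | hz => simp only [map_zero]
    | hadd s t hs ht => simp only [map_add, hs, ht]
  map_rsmul {i j k} h t c := by
    induction t using tm_induction with
    | h0 i' j' hij x y =>
      rw [rsmul_tm h hij rfl (by omega), tmLift_tm, tmLift_tm]
      exact p.map_rsmul _ _ _ _ _ _ h hij rfl _ x y c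
    | hz => simp only [map_zero, LinearMap.zero_apply]
    | hadd s t hs ht => simp only [map_add, LinearMap.add_apply, hs, ht]

lemma Pairing.desc_tm {P : DGBimod A C} (p : Pairing M N P) {i j n : ℤ} (h : i + j = n)
    (x : M.X i) (y : N.X j) : p.desc.f n (tm M N h x y) = p.φ n i j h x y :=
  tmLift_tm (p.φ n) (p.balanced n) h x y

/-- The pairing `(x, y) ↦ f x ⊗ g y`. -/
noncomputable def mapPairing {M' : DGBimod A B} {N' : DGBimod B C} (f : M ⟶ M') (g : N ⟶ N') :
    Pairing M N (tensor M' N') where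
  φ n i j h := (tm M' N' h).compl₁₂ (f.f i) (g.f j)
  bal n i j l il lj h₁ h₂ h₃ h₄ x b y := by
    rw [LinearMap.compl₁₂_apply, LinearMap.compl₁₂_apply, f.map_rsmul h₁, g.map_lsmul h₃]
    exact tm_rsmul _ _ _ _ _ _ _
  leibniz i j n i' j' n' h hn hi hj hl hr x y := by
    simp only [LinearMap.compl₁₂_apply]
    rw [f.comm, g.comm, d_tm h hn hi hj hl hr]
  map_lsmul i j k p q ip h hpq hip hk a x y := by
    simp only [LinearMap.compl₁₂_apply]
    rw [f.map_lsmul, lsmul_tm h hpq hip hk]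
  map_rsmul i j k p q qj h hpq hqj hk x y c := by
    simp only [LinearMap.compl₁₂_apply]
    rw [g.map_rsmul, rsmul_tm h hpq hqj hk]

/-- Functoriality `f ⊗ g` of the tensor product. -/
noncomputable def tensorMap {M' : DGBimod A B} {N' : DGBimod B C} (f : M ⟶ M') (g : N ⟶ N') :
    tensor M N ⟶ tensor M' N' := (mapPairing f g).desc

@[simp] lemma tensorMap_tm {M' : DGBimod A B} {N' : DGBimod B C} (f : M ⟶ M') (g : N ⟶ N')
    {i j n : ℤ} (h : i + j = n) (x : M.X i) (y : N.X j) :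
    (tensorMap f g).f n (tm M N h x y) = tm M' N' h (f.f i x) (g.f j y) := by
  rw [tensorMap, Pairing.desc_tm]
  rfl

variable (C) in
/-- The functor `M ⊗_B -`. -/
noncomputable def tensorFunctor (M : DGBimod A B) : DGBimod B C ⥤ DGBimod A C where
  obj N := tensor M N
  map g := tensorMap (𝟙 M) g
  map_id N := tensor_hom_ext fun i j n h x y => by rw [tensorMap_tm]; rfl
  map_comp f g := tensor_hom_ext fun i j n h x y => by
    rw [comp_f, tensorMap_tm, tensorMap_tm, tensorMap_tm]; rfl

end Tensor
section HomRight

variable (X : DGBimod B C) (Y : DGBimod A C)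

/-- The degree `n` part of `Hom_{Cᵒᵖ}(X, Y)`: families of `K`-linear maps `X_i → Y_{i+n}` with
`f (x c) = (f x) c`. -/
def homRSub (n : ℤ) :
    Submodule K (∀ p : {p : ℤ × ℤ // p.1 + n = p.2}, X.X p.1.1 →ₗ[K] Y.X p.1.2) where
  carrier := {f | ∀ (i j l i' j' : ℤ) (h : i + n = j) (h' : i' + n = j') (hl : i + l = i')
    (hl' : j + l = j') (x : X.X i) (c : C.X l),
    f ⟨(i', j'), h'⟩ (X.rsmul hl x c) = Y.rsmul hl' (f ⟨(i, j), h⟩ x) c}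
  add_mem' hf hg i j l i' j' h h' hl hl' x c := by
    simp [hf i j l i' j' h h' hl hl' x c, hg i j l i' j' h h' hl hl' x c]
  zero_mem' i j l i' j' h h' hl hl' x c := by simp
  smul_mem' a f hf i j l i' j' h h' hl hl' x c := by simp [hf i j l i' j' h h' hl hl' x c]

/-- The degree `n` part of `Hom_{Cᵒᵖ}(X, Y)`, as a type. -/
def HomRX (n : ℤ) : Type u := homRSub X Y n

instance (n : ℤ) : AddCommGroup (HomRX X Y n) := inferInstanceAs (AddCommGroup (homRSub X Y n))

instance (n : ℤ) : Module K (HomRX X Y n) := inferInstanceAs (Module K (homRSub X Y n))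

variable {X Y}

/-- The component `X_i → Y_{i+n}` of a homogeneous map of degree `n`. -/
def HomRX.app {n : ℤ} (f : HomRX X Y n) {i j : ℤ} (h : i + n = j) : X.X i →ₗ[K] Y.X j :=
  f.1 ⟨(i, j), h⟩

lemma HomRX.app_rsmul {n : ℤ} (f : HomRX X Y n) {i j l i' j' : ℤ} (h' : i' + n = j')
    (hl : i + l = i') (h : i + n = j) (hl' : j + l = j') (x : X.X i) (c : C.X l) :
    f.app h' (X.rsmul hl x c) = Y.rsmul hl' (f.app h x) c :=
  f.2 i j l i' j' h h' hl hl' x c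

lemma HomRX.ext' {n : ℤ} {f g : HomRX X Y n}
    (h : ∀ (i j : ℤ) (hij : i + n = j) (x : X.X i), f.app hij x = g.app hij x) : f = g := by
  apply Subtype.ext
  funext ⟨⟨i, j⟩, hij⟩
  exact LinearMap.ext fun x => h i j hij x

/-- Constructor for homogeneous maps. -/
def HomRX.mk {n : ℤ} (φ : ∀ i j : ℤ, i + n = j → (X.X i →ₗ[K] Y.X j))
    (hφ : ∀ (i j l i' j' : ℤ) (h : i + n = j) (h' : i' + n = j') (hl : i + l = i')
      (hl' : j + l = j') (x : X.X i) (c : C.X l),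
      φ i' j' h' (X.rsmul hl x c) = Y.rsmul hl' (φ i j h x) c) : HomRX X Y n :=
  ⟨fun p => φ p.1.1 p.1.2 p.2, hφ⟩

@[simp] lemma HomRX.app_mk {n : ℤ} (φ : ∀ i j : ℤ, i + n = j → (X.X i →ₗ[K] Y.X j)) (hφ)
    {i j : ℤ} (h : i + n = j) (x : X.X i) : (HomRX.mk φ hφ).app h x = φ i j h x := rfl

@[simp] lemma HomRX.app_add {n : ℤ} (f g : HomRX X Y n) {i j : ℤ} (h : i + n = j) (x : X.X i) :
    (f + g).app h x = f.app h x + g.app h x := rfl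

@[simp] lemma HomRX.app_smul {n : ℤ} (c : K) (f : HomRX X Y n) {i j : ℤ} (h : i + n = j)
    (x : X.X i) : (c • f).app h x = c • f.app h x := rfl

@[simp] lemma HomRX.app_zsmul {n : ℤ} (c : ℤ) (f : HomRX X Y n) {i j : ℤ} (h : i + n = j)
    (x : X.X i) : (c • f).app h x = c • f.app h x := rfl

@[simp] lemma HomRX.app_zero {n : ℤ} {i j : ℤ} (h : i + n = j)
    (x : X.X i) : (0 : HomRX X Y n).app h x = 0 := rfl

variable (X Y)

/-- The differential `(d f) x = d (f x) - (-1)^|f| f (d x)`. -/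
def homRD {n n' : ℤ} (hn : n' + 1 = n) : HomRX X Y n →ₗ[K] HomRX X Y n' where
  toFun f := HomRX.mk (fun i j h =>
    (Y.d (rfl : j + 1 = j + 1)).comp (f.app (by omega : i + n = j + 1)) -
      sgn n • (f.app (by omega : (i - 1) + n = j)).comp (X.d (by omega : (i - 1) + 1 = i))) (by
    intro i j l i' j' h h' hl hl' x c
    simp only [LinearMap.sub_apply, LinearMap.comp_apply, LinearMap.smul_apply]
    rw [f.app_rsmul _ hl (by omega : i + n = j + 1) (by omega : j + 1 + l = j' + 1),
      Y.rleibniz _ rfl (by omega : (l - 1) + 1 = l) _ hl' (by omega : j + 1 + (l - 1) = j'),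
      X.rleibniz hl (by omega : (i - 1) + 1 = i) (by omega : (l - 1) + 1 = l) _
        (by omega : i - 1 + l = i' - 1) (by omega : i + (l - 1) = i' - 1),
      map_add, map_zsmul,
      f.app_rsmul _ _ (by omega : (i - 1) + n = j) hl',
      f.app_rsmul _ _ (by omega : i + n = j + 1) (by omega : j + 1 + (l - 1) = j')]
    have e : sgn (j + 1) = sgn n * sgn i := by rw [← sgn_add]; congr 1; omega
    simp only [e, smul_add, smul_smul, map_sub, map_zsmul, LinearMap.sub_apply,
      LinearMap.smul_apply]
    abel)
  map_add' f g := HomRX.ext' fun i j h x => by simp; abel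
  map_smul' c f := HomRX.ext' fun i j h x => by simp [smul_sub, smul_comm (sgn n) c]

/-- The left action `(a f) x = a (f x)`. -/
def homRL {i j k : ℤ} (h : i + j = k) : A.X i →ₗ[K] HomRX X Y j →ₗ[K] HomRX X Y k :=
  LinearMap.mk₂ K (fun a f => HomRX.mk (fun p q hpq =>
      (Y.lsmul (by omega : i + (p + j) = q) a).comp (f.app (rfl : p + j = p + j))) (by
    intro p q l p' q' hp hp' hl hl' x c
    simp only [LinearMap.comp_apply]
    rw [f.app_rsmul _ hl rfl (by omega : p + j + l = p' + j), Y.lsmul_rsmul]))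
    (fun a a' f => HomRX.ext' fun _ _ _ _ => by simp)
    (fun c a f => HomRX.ext' fun _ _ _ _ => by simp)
    (fun a f f' => HomRX.ext' fun _ _ _ _ => by simp)
    (fun c a f => HomRX.ext' fun _ _ _ _ => by simp)

/-- The right action `(f b) x = f (b x)`. -/
def homRR {i j k : ℤ} (h : i + j = k) : HomRX X Y i →ₗ[K] B.X j →ₗ[K] HomRX X Y k :=
  LinearMap.mk₂ K (fun f b => HomRX.mk (fun p q hpq =>
      (f.app (by omega : j + p + i = q)).comp (X.lsmul (rfl : j + p = j + p) b)) (by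
    intro p q l p' q' hp hp' hl hl' x c
    simp only [LinearMap.comp_apply]
    rw [← X.lsmul_rsmul rfl (by omega : j + p + l = j + p'),
      f.app_rsmul _ _ (by omega : j + p + i = q)]))
    (fun a a' f => HomRX.ext' fun _ _ _ _ => by simp)
    (fun c a f => HomRX.ext' fun _ _ _ _ => by simp)
    (fun a f f' => HomRX.ext' fun _ _ _ _ => by simp)
    (fun c a f => HomRX.ext' fun _ _ _ _ => by simp)

variable {X Y}

lemma homRD_app {n n' : ℤ} (hn : n' + 1 = n) (f : HomRX X Y n) {i j i' j' : ℤ}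
    (h : i + n' = j) (hi : i' + 1 = i) (hj : j + 1 = j') (h₁ : i + n = j') (h₂ : i' + n = j)
    (x : X.X i) : (homRD X Y hn f).app h x =
      Y.d hj (f.app h₁ x) - sgn n • f.app h₂ (X.d hi x) := by
  obtain rfl : i' = i - 1 := by omega
  subst hj
  rfl

lemma homRL_app {i j k p q r : ℤ} (h : i + j = k) (a : A.X i) (f : HomRX X Y j)
    (hpq : p + k = q) (hr : p + j = r) (hq : i + r = q) (x : X.X p) :
    (homRL X Y h a f).app hpq x = Y.lsmul hq a (f.app hr x) := by
  subst hr
  rfl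

lemma homRR_app {i j k p q r : ℤ} (h : i + j = k) (f : HomRX X Y i) (b : B.X j)
    (hpq : p + k = q) (hr : j + p = r) (hq : r + i = q) (x : X.X p) :
    (homRR X Y h f b).app hpq x = f.app hq (X.lsmul hr b x) := by
  subst hr
  rfl

variable (X Y)

/-- The DG `A`-`B`-bimodule `Hom_{Cᵒᵖ}(X, Y)` of right `C`-linear maps, for a DG
`B`-`C`-bimodule `X` and a DG `A`-`C`-bimodule `Y`. -/
def homR : DGBimod A B where
  X := HomRX X Y
  d h := homRD X Y h
  lsmul h := homRL X Y h
  rsmul h := homRR X Y h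
  d_d {n m k} h h' f := HomRX.ext' fun i j hij x => by
    rw [homRD_app h' _ hij (by omega : i - 1 + 1 = i) rfl (by omega : i + m = j + 1)
        (by omega : i - 1 + m = j),
      homRD_app h _ _ (by omega : i - 1 + 1 = i) rfl (by omega : i + n = j + 1 + 1)
        (by omega : i - 1 + n = j + 1),
      homRD_app h _ _ (by omega : i - 2 + 1 = i - 1) rfl (by omega : i - 1 + n = j + 1)
        (by omega : i - 2 + n = j), X.d_d, map_sub, Y.d_d, map_zsmul,
      show sgn n = -sgn m by rw [← h, sgn_add, sgn_one, mul_neg_one]]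
    simp
  one_lsmul h f := HomRX.ext' fun i j hij x => by
    rw [homRL_app h _ _ hij hij (zero_add j), Y.one_lsmul]
  rsmul_one h f := HomRX.ext' fun i j hij x => by
    rw [homRR_app h _ _ hij (zero_add i) hij, X.one_lsmul]
  mul_lsmul {i j k ij jk n} h₁ h₂ h₃ h₄ a b f := HomRX.ext' fun p q hpq x => by
    rw [homRL_app h₂ _ _ hpq rfl (by omega), homRL_app h₄ _ _ hpq rfl (by omega),
      homRL_app h₃ _ _ rfl rfl (by omega), Y.mul_lsmul]
  rsmul_mul {i j k ij jk n} h₁ h₂ h₃ h₄ f a b := HomRX.ext' fun p q hpq x => by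
    rw [homRR_app h₂ _ _ hpq rfl (by omega), homRR_app h₄ _ _ hpq rfl (by omega),
      homRR_app h₁ _ _ _ (by omega : j + (k + p) = jk + p) (by omega), X.mul_lsmul]
  lsmul_rsmul {i j k ij jk n} h₁ h₂ h₃ h₄ a f b := HomRX.ext' fun p q hpq x => by
    rw [homRR_app h₂ _ _ hpq rfl (by omega), homRL_app h₁ _ _ _ rfl (by omega),
      homRL_app h₄ _ _ hpq (by omega : p + jk = k + p + j) (by omega),
      homRR_app h₃ _ _ _ rfl (by omega)]
  lleibniz {i j k i' j' k'} h hi hj hk hl hr a f := HomRX.ext' fun p q hpq x => by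
    rw [HomRX.app_add, HomRX.app_zsmul,
      homRD_app hk _ hpq (by omega : p - 1 + 1 = p) rfl (by omega : p + k = q + 1) (by omega),
      homRL_app h _ _ _ rfl (by omega), homRL_app h _ _ _ rfl (by omega),
      homRL_app hl _ _ hpq rfl (by omega),
      homRL_app hr _ _ hpq (by omega : p + j' = p - 1 + j) (by omega),
      homRD_app hj _ _ (by omega : p - 1 + 1 = p) (by omega : p - 1 + j + 1 = p + j) rfl rfl,
      Y.lleibniz _ hi (by omega : p - 1 + j + 1 = p + j) _ (by omega : i' + (p + j) = q)
        (by omega : i + (p - 1 + j) = q), map_sub, map_zsmul,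
      show sgn k = sgn i * sgn j by rw [← h, sgn_add]]
    simp only [smul_sub, smul_smul]
    abel
  rleibniz {i j k i' j' k'} h hi hj hk hl hr f b := HomRX.ext' fun p q hpq x => by
    rw [HomRX.app_add, HomRX.app_zsmul,
      homRD_app hk _ hpq (by omega : p - 1 + 1 = p) rfl (by omega : p + k = q + 1) (by omega),
      homRR_app h _ _ _ rfl (by omega), homRR_app h _ _ _ rfl (by omega),
      homRR_app hl _ _ hpq rfl (by omega),
      homRR_app hr _ _ hpq (by omega : j' + p = j + (p - 1)) (by omega),
      homRD_app hi _ _ (by omega : j + (p - 1) + 1 = j + p) rfl (by omega) (by omega),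
      X.lleibniz rfl hj (by omega : p - 1 + 1 = p) _ (by omega : j' + p = j + (p - 1)) rfl,
      map_add, map_zsmul, show sgn k = sgn i * sgn j by rw [← h, sgn_add]]
    simp only [smul_add, smul_smul]
    abel

variable {X Y}

/-- The component `X_i → Y_{i+n}` of an element of degree `n` of `Hom_{Cᵒᵖ}(X, Y)`. -/
def evR {n i j : ℤ} (h : i + n = j) : (homR X Y).X n →ₗ[K] X.X i →ₗ[K] Y.X j where
  toFun f := HomRX.app f h
  map_add' _ _ := rfl
  map_smul' _ _ := rfl

lemma evR_ext {n : ℤ} {f g : (homR X Y).X n}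
    (h : ∀ (i j : ℤ) (hij : i + n = j) (x : X.X i), evR hij f x = evR hij g x) : f = g :=
  HomRX.ext' h

lemma evR_x_rsmul {n : ℤ} (f : (homR X Y).X n) {i j l i' j' : ℤ} (h' : i' + n = j')
    (hl : i + l = i') (h : i + n = j) (hl' : j + l = j') (x : X.X i) (c : C.X l) :
    evR h' f (X.rsmul hl x c) = Y.rsmul hl' (evR h f x) c :=
  HomRX.app_rsmul f h' hl h hl' x c

lemma evR_d {n n' : ℤ} (hn : n' + 1 = n) (f : (homR X Y).X n) {i j i' j' : ℤ}
    (h : i + n' = j) (hi : i' + 1 = i) (hj : j + 1 = j') (h₁ : i + n = j') (h₂ : i' + n = j)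
    (x : X.X i) : evR h ((homR X Y).d hn f) x =
      Y.d hj (evR h₁ f x) - sgn n • evR h₂ f (X.d hi x) :=
  homRD_app hn f h hi hj h₁ h₂ x

lemma evR_lsmul {i j k p q r : ℤ} (h : i + j = k) (a : A.X i) (f : (homR X Y).X j)
    (hpq : p + k = q) (hr : p + j = r) (hq : i + r = q) (x : X.X p) :
    evR hpq ((homR X Y).lsmul h a f) x = Y.lsmul hq a (evR hr f x) :=
  homRL_app h a f hpq hr hq x

lemma evR_rsmul {i j k p q r : ℤ} (h : i + j = k) (f : (homR X Y).X i) (b : B.X j)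
    (hpq : p + k = q) (hr : j + p = r) (hq : r + i = q) (x : X.X p) :
    evR hpq ((homR X Y).rsmul h f b) x = evR hq f (X.lsmul hr b x) :=
  homRR_app h f b hpq hr hq x

/-- Constructor for elements of `Hom_{Cᵒᵖ}(X, Y)`. -/
def homRMk {n : ℤ} (φ : ∀ i j : ℤ, i + n = j → (X.X i →ₗ[K] Y.X j))
    (hφ : ∀ (i j l i' j' : ℤ) (h : i + n = j) (h' : i' + n = j') (hl : i + l = i')
      (hl' : j + l = j') (x : X.X i) (c : C.X l),
      φ i' j' h' (X.rsmul hl x c) = Y.rsmul hl' (φ i j h x) c) : (homR X Y).X n :=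
  HomRX.mk φ hφ

lemma evR_mk {n : ℤ} (φ : ∀ i j : ℤ, i + n = j → (X.X i →ₗ[K] Y.X j)) (hφ)
    {i j : ℤ} (h : i + n = j) (x : X.X i) : evR h (homRMk φ hφ) x = φ i j h x := rfl

variable (X)

/-- Postcomposition `Hom_{Cᵒᵖ}(X, Y) → Hom_{Cᵒᵖ}(X, Y')`. -/
def homRMap {Y' : DGBimod A C} (g : Y ⟶ Y') : homR X Y ⟶ homR X Y' where
  f n :=
    { toFun := fun f => homRMk (fun i j h => (g.f j).comp (evR h f))
        (fun i j l i' j' h h' hl hl' x c => by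
          simp only [LinearMap.comp_apply]
          rw [evR_x_rsmul f h' hl h hl', g.map_rsmul])
      map_add' := fun f f' => evR_ext fun i j h x => by simp [evR_mk]
      map_smul' := fun c f => evR_ext fun i j h x => by simp [evR_mk] }
  comm {n n'} hn f := evR_ext fun i j h x => by
    simp only [LinearMap.coe_mk, AddHom.coe_mk]
    rw [evR_mk, LinearMap.comp_apply, evR_d hn _ h (by omega : i - 1 + 1 = i) rfl (by omega)
      (by omega), evR_d hn _ h (by omega : i - 1 + 1 = i) rfl (by omega) (by omega), map_sub,
      map_zsmul, g.comm, evR_mk, evR_mk]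
    rfl
  map_lsmul {i j k} h a f := evR_ext fun p q hpq x => by
    simp only [LinearMap.coe_mk, AddHom.coe_mk]
    rw [evR_mk, LinearMap.comp_apply, evR_lsmul h _ _ hpq rfl (by omega),
      evR_lsmul h _ _ hpq rfl (by omega), g.map_lsmul, evR_mk]
    rfl
  map_rsmul {i j k} h f b := evR_ext fun p q hpq x => by
    simp only [LinearMap.coe_mk, AddHom.coe_mk]
    rw [evR_mk, LinearMap.comp_apply, evR_rsmul h _ _ hpq rfl (by omega),
      evR_rsmul h _ _ hpq rfl (by omega), evR_mk]
    rfl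

end HomRight

section HomLeft

variable (X : DGBimod A B) (Y : DGBimod A C)

/-- The degree `n` part of `Hom_A(X, Y)`, as a submodule of the families of `K`-linear maps
`X_i → Y_{i+n}`: those with `f (a x) = (-1)^{n|a|} a (f x)`. -/
def homLSub (n : ℤ) :
    Submodule K (∀ p : {p : ℤ × ℤ // p.1 + n = p.2}, X.X p.1.1 →ₗ[K] Y.X p.1.2) where
  carrier := {f | ∀ (i j l i' j' : ℤ) (h : i + n = j) (h' : i' + n = j') (hl : l + i = i')
    (hl' : l + j = j') (a : A.X l) (x : X.X i),
    f ⟨(i', j'), h'⟩ (X.lsmul hl a x) = sgn (n * l) • Y.lsmul hl' a (f ⟨(i, j), h⟩ x)}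
  add_mem' hf hg i j l i' j' h h' hl hl' a x := by
    simp [hf i j l i' j' h h' hl hl' a x, hg i j l i' j' h h' hl hl' a x]
  zero_mem' i j l i' j' h h' hl hl' a x := by simp
  smul_mem' c f hf i j l i' j' h h' hl hl' a x := by
    simp [hf i j l i' j' h h' hl hl' a x, smul_comm c]

/-- The degree `n` part of `Hom_A(X, Y)`, as a type. -/
def HomLX (n : ℤ) : Type u := homLSub X Y n

instance (n : ℤ) : AddCommGroup (HomLX X Y n) := inferInstanceAs (AddCommGroup (homLSub X Y n))

instance (n : ℤ) : Module K (HomLX X Y n) := inferInstanceAs (Module K (homLSub X Y n))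

variable {X Y}

/-- The component `X_i → Y_{i+n}` of a homogeneous map of degree `n`. -/
def HomLX.app {n : ℤ} (f : HomLX X Y n) {i j : ℤ} (h : i + n = j) : X.X i →ₗ[K] Y.X j :=
  f.1 ⟨(i, j), h⟩

lemma HomLX.app_lsmul {n : ℤ} (f : HomLX X Y n) {i j l i' j' : ℤ} (h' : i' + n = j')
    (hl : l + i = i') (h : i + n = j) (hl' : l + j = j') (a : A.X l) (x : X.X i) :
    f.app h' (X.lsmul hl a x) = sgn (n * l) • Y.lsmul hl' a (f.app h x) :=
  f.2 i j l i' j' h h' hl hl' a x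

lemma HomLX.ext' {n : ℤ} {f g : HomLX X Y n}
    (h : ∀ (i j : ℤ) (hij : i + n = j) (x : X.X i), f.app hij x = g.app hij x) : f = g := by
  apply Subtype.ext
  funext ⟨⟨i, j⟩, hij⟩
  exact LinearMap.ext fun x => h i j hij x

/-- Constructor for homogeneous maps. -/
def HomLX.mk {n : ℤ} (φ : ∀ i j : ℤ, i + n = j → (X.X i →ₗ[K] Y.X j))
    (hφ : ∀ (i j l i' j' : ℤ) (h : i + n = j) (h' : i' + n = j') (hl : l + i = i')
      (hl' : l + j = j') (a : A.X l) (x : X.X i),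
      φ i' j' h' (X.lsmul hl a x) = sgn (n * l) • Y.lsmul hl' a (φ i j h x)) : HomLX X Y n :=
  ⟨fun p => φ p.1.1 p.1.2 p.2, hφ⟩

@[simp] lemma HomLX.app_mk {n : ℤ} (φ : ∀ i j : ℤ, i + n = j → (X.X i →ₗ[K] Y.X j)) (hφ)
    {i j : ℤ} (h : i + n = j) (x : X.X i) : (HomLX.mk φ hφ).app h x = φ i j h x := rfl

@[simp] lemma HomLX.app_add {n : ℤ} (f g : HomLX X Y n) {i j : ℤ} (h : i + n = j) (x : X.X i) :
    (f + g).app h x = f.app h x + g.app h x := rfl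

@[simp] lemma HomLX.app_smul {n : ℤ} (c : K) (f : HomLX X Y n) {i j : ℤ} (h : i + n = j)
    (x : X.X i) : (c • f).app h x = c • f.app h x := rfl

@[simp] lemma HomLX.app_zsmul {n : ℤ} (c : ℤ) (f : HomLX X Y n) {i j : ℤ} (h : i + n = j)
    (x : X.X i) : (c • f).app h x = c • f.app h x := rfl

@[simp] lemma HomLX.app_zero {n : ℤ} {i j : ℤ} (h : i + n = j)
    (x : X.X i) : (0 : HomLX X Y n).app h x = 0 := rfl

variable (X Y)

/-- The differential `(d f) x = d (f x) - (-1)^|f| f (d x)`. -/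
def homLD {n n' : ℤ} (hn : n' + 1 = n) : HomLX X Y n →ₗ[K] HomLX X Y n' where
  toFun f := HomLX.mk (fun i j h =>
    (Y.d (rfl : j + 1 = j + 1)).comp (f.app (by omega : i + n = j + 1)) -
      sgn n • (f.app (by omega : (i - 1) + n = j)).comp (X.d (by omega : (i - 1) + 1 = i))) (by
    intro i j l i' j' h h' hl hl' a x
    simp only [LinearMap.sub_apply, LinearMap.comp_apply, LinearMap.smul_apply]
    rw [f.app_lsmul _ hl (by omega : i + n = j + 1) (by omega : l + (j + 1) = j' + 1), map_zsmul,
      Y.lleibniz _ (by omega : (l - 1) + 1 = l) rfl _ (by omega : l - 1 + (j + 1) = j') hl',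
      X.lleibniz hl (by omega : (l - 1) + 1 = l) (by omega : (i - 1) + 1 = i) _
        (by omega : l - 1 + i = i' - 1) (by omega : l + (i - 1) = i' - 1),
      map_add, map_zsmul,
      f.app_lsmul _ _ (by omega : i + n = j + 1) (by omega : l - 1 + (j + 1) = j'),
      f.app_lsmul _ _ (by omega : i - 1 + n = j) hl']
    have e₁ : sgn n * sgn (n * (l - 1)) = sgn (n * l) := by
      rw [← sgn_add]; exact sgn_congr 0 (by ring)
    have e₂ : sgn (n * l) * sgn l = sgn (n' * l) := by
      rw [← sgn_add]; exact sgn_congr l (by rw [← hn]; ring)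
    have e₃ : sgn n * (sgn l * sgn (n * l)) = sgn (n' * l) * sgn n := by
      rw [← e₂]; ring
    simp only [smul_add, smul_sub, smul_smul, map_sub, map_zsmul, e₁, e₂, e₃]
    abel)
  map_add' f g := HomLX.ext' fun i j h x => by simp; abel
  map_smul' c f := HomLX.ext' fun i j h x => by simp [smul_sub, smul_comm (sgn n) c]

/-- The left action `(b f) x = (-1)^{|b|(|f|+|x|)} f (x b)`. -/
def homLL {i j k : ℤ} (h : i + j = k) : B.X i →ₗ[K] HomLX X Y j →ₗ[K] HomLX X Y k :=
  LinearMap.mk₂ K (fun b f => HomLX.mk (fun p q hpq =>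
      sgn (i * (j + p)) • (f.app (by omega : p + i + j = q)).comp
        ((X.rsmul (rfl : p + i = p + i)).flip b)) (by
    intro p q l p' q' hp hp' hl hl' a x
    simp only [LinearMap.comp_apply, LinearMap.smul_apply, LinearMap.flip_apply]
    rw [X.lsmul_rsmul hl rfl rfl (by omega : l + (p + i) = p' + i),
      f.app_lsmul _ _ (by omega : p + i + j = q) hl', map_zsmul, smul_smul, smul_smul,
      ← sgn_add, ← sgn_add]
    congr 1
    exact sgn_congr 0 (by rw [← hl, ← h]; ring)))
    (fun a a' f => HomLX.ext' fun _ _ _ _ => by simp)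
    (fun c a f => HomLX.ext' fun _ _ _ _ => by simp [smul_comm _ c])
    (fun a f f' => HomLX.ext' fun _ _ _ _ => by simp)
    (fun c a f => HomLX.ext' fun _ _ _ _ => by simp [smul_comm _ c])

/-- The right action `(f c) x = (-1)^{|c||x|} (f x) c`. -/
def homLR {i j k : ℤ} (h : i + j = k) : HomLX X Y i →ₗ[K] C.X j →ₗ[K] HomLX X Y k :=
  LinearMap.mk₂ K (fun f c => HomLX.mk (fun p q hpq =>
      sgn (j * p) • ((Y.rsmul (by omega : p + i + j = q)).flip c).comp
        (f.app (rfl : p + i = p + i))) (by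
    intro p q l p' q' hp hp' hl hl' a x
    simp only [LinearMap.comp_apply, LinearMap.smul_apply, LinearMap.flip_apply]
    rw [f.app_lsmul _ hl rfl (by omega : l + (p + i) = p' + i), map_zsmul, LinearMap.smul_apply,
      Y.lsmul_rsmul _ _ (by omega : p + i + j = q) hl', map_zsmul, smul_smul, smul_smul,
      ← sgn_add, ← sgn_add]
    congr 1
    exact sgn_congr 0 (by rw [← hl, ← h]; ring)))
    (fun a a' f => HomLX.ext' fun _ _ _ _ => by simp)
    (fun c a f => HomLX.ext' fun _ _ _ _ => by simp [smul_comm _ c])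
    (fun a f f' => HomLX.ext' fun _ _ _ _ => by simp)
    (fun c a f => HomLX.ext' fun _ _ _ _ => by simp [smul_comm _ c])

variable {X Y}

lemma homLD_app {n n' : ℤ} (hn : n' + 1 = n) (f : HomLX X Y n) {i j i' j' : ℤ}
    (h : i + n' = j) (hi : i' + 1 = i) (hj : j + 1 = j') (h₁ : i + n = j') (h₂ : i' + n = j)
    (x : X.X i) : (homLD X Y hn f).app h x =
      Y.d hj (f.app h₁ x) - sgn n • f.app h₂ (X.d hi x) := by
  obtain rfl : i' = i - 1 := by omega
  subst hj
  rfl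

lemma homLL_app {i j k p q r : ℤ} (h : i + j = k) (b : B.X i) (f : HomLX X Y j)
    (hpq : p + k = q) (hr : p + i = r) (hq : r + j = q) (x : X.X p) :
    (homLL X Y h b f).app hpq x = sgn (i * (j + p)) • f.app hq (X.rsmul hr x b) := by
  subst hr
  rfl

lemma homLR_app {i j k p q r : ℤ} (h : i + j = k) (f : HomLX X Y i) (c : C.X j)
    (hpq : p + k = q) (hr : p + i = r) (hq : r + j = q) (x : X.X p) :
    (homLR X Y h f c).app hpq x = sgn (j * p) • Y.rsmul hq (f.app hr x) c := by
  subst hr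
  rfl

variable (X Y)

/-- The DG `B`-`C`-bimodule `Hom_A(X, Y)` of graded left `A`-linear maps, for a DG
`A`-`B`-bimodule `X` and a DG `A`-`C`-bimodule `Y`. -/
def homL : DGBimod B C where
  X := HomLX X Y
  d h := homLD X Y h
  lsmul h := homLL X Y h
  rsmul h := homLR X Y h
  d_d {n m k} h h' f := HomLX.ext' fun i j hij x => by
    rw [homLD_app h' _ hij (by omega : i - 1 + 1 = i) rfl (by omega : i + m = j + 1)
        (by omega : i - 1 + m = j),
      homLD_app h _ _ (by omega : i - 1 + 1 = i) rfl (by omega : i + n = j + 1 + 1)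
        (by omega : i - 1 + n = j + 1),
      homLD_app h _ _ (by omega : i - 2 + 1 = i - 1) rfl (by omega : i - 1 + n = j + 1)
        (by omega : i - 2 + n = j), X.d_d, map_sub, Y.d_d, map_zsmul,
      show sgn n = -sgn m by rw [← h, sgn_add, sgn_one, mul_neg_one]]
    simp
  one_lsmul h f := HomLX.ext' fun i j hij x => by
    rw [homLL_app h _ _ hij (add_zero i) hij, X.rsmul_one, zero_mul, sgn_zero, one_smul]
  rsmul_one h f := HomLX.ext' fun i j hij x => by
    rw [homLR_app h _ _ hij hij (add_zero j), Y.rsmul_one, zero_mul, sgn_zero, one_smul]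
  mul_lsmul {i j k ij jk n} h₁ h₂ h₃ h₄ a b f := HomLX.ext' fun p q hpq x => by
    rw [homLL_app h₂ _ _ hpq rfl (by omega), homLL_app h₄ _ _ hpq rfl (by omega),
      homLL_app h₃ _ _ _ (by omega : p + i + j = p + ij) (by omega),
      X.rsmul_mul rfl _ h₁ rfl, smul_smul, ← sgn_add]
    congr 1
    exact sgn_congr (- i * j) (by rw [← h₁, ← h₃]; ring)
  rsmul_mul {i j k ij jk n} h₁ h₂ h₃ h₄ f a b := HomLX.ext' fun p q hpq x => by
    rw [homLR_app h₂ _ _ hpq rfl (by omega), homLR_app h₄ _ _ hpq rfl (by omega),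
      homLR_app h₁ _ _ _ rfl (by omega), map_zsmul, LinearMap.smul_apply,
      Y.rsmul_mul _ _ h₃ (by omega), smul_smul, ← sgn_add]
    congr 1
    exact sgn_congr 0 (by rw [← h₃]; ring)
  lsmul_rsmul {i j k ij jk n} h₁ h₂ h₃ h₄ b f c := HomLX.ext' fun p q hpq x => by
    rw [homLR_app h₂ _ _ hpq rfl (by omega), homLL_app h₁ _ _ _ rfl (by omega),
      homLL_app h₄ _ _ hpq rfl (by omega),
      homLR_app h₃ _ _ _ (by omega : p + i + j = p + ij) (by omega), map_zsmul,
      LinearMap.smul_apply, smul_smul, smul_smul, ← sgn_add, ← sgn_add]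
    congr 1
    exact sgn_congr (- k * i) (by rw [← h₃]; ring)
  lleibniz {i j k i' j' k'} h hi hj hk hl hr b f := HomLX.ext' fun p q hpq x => by
    rw [HomLX.app_add, HomLX.app_zsmul,
      homLD_app hk _ hpq (by omega : p - 1 + 1 = p) rfl (by omega : p + k = q + 1) (by omega),
      homLL_app h _ _ _ rfl (by omega), homLL_app h _ _ _ rfl (by omega),
      homLL_app hl _ _ hpq (by omega : p + i' = p - 1 + i) (by omega),
      homLL_app hr _ _ hpq rfl (by omega),
      homLD_app hj _ _ (by omega : p - 1 + i + 1 = p + i) rfl (by omega) (by omega),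
      X.rleibniz rfl (by omega : p - 1 + 1 = p) hi _ rfl (by omega : p + i' = p - 1 + i),
      map_zsmul, map_add, map_zsmul]
    have e₁ : sgn i * sgn (i * (j' + p)) = sgn (i * (j + p)) := by
      rw [← sgn_add]; exact sgn_congr 0 (by rw [← hj]; ring)
    have e₂ : sgn k * sgn (i * (j + (p - 1))) = sgn (i * (j + p)) * sgn j := by
      rw [← sgn_add, ← sgn_add]; exact sgn_congr 0 (by rw [← h]; ring)
    have e₃ : sgn (i * (j + p)) * (sgn j * sgn p) = sgn (i' * (j + p)) := by
      rw [← sgn_add, ← sgn_add]; exact sgn_congr (j + p) (by rw [← hi]; ring)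
    simp only [smul_add, smul_sub, smul_smul, ← mul_assoc, e₁, e₂]
    rw [mul_assoc, e₃]
    abel
  rleibniz {i j k i' j' k'} h hi hj hk hl hr f c := HomLX.ext' fun p q hpq x => by
    rw [HomLX.app_add, HomLX.app_zsmul,
      homLD_app hk _ hpq (by omega : p - 1 + 1 = p) rfl (by omega : p + k = q + 1) (by omega),
      homLR_app h _ _ _ rfl (by omega), homLR_app h _ _ _ rfl (by omega),
      homLR_app hl _ _ hpq (by omega : p + i' = p - 1 + i) (by omega),
      homLR_app hr _ _ hpq rfl (by omega),
      homLD_app hi _ _ (by omega : p - 1 + 1 = p) (by omega : p - 1 + i + 1 = p + i) rfl rfl,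
      map_zsmul, Y.rleibniz _ (by omega : p - 1 + i + 1 = p + i) hj _
        (by omega : p - 1 + i + j = q) (by omega : p + i + j' = q), map_sub, map_zsmul,
      LinearMap.sub_apply, LinearMap.smul_apply]
    have e₁ : sgn k * sgn (j * (p - 1)) = sgn (j * p) * sgn i := by
      rw [← sgn_add, ← sgn_add]; exact sgn_congr 0 (by rw [← h]; ring)
    have e₂ : sgn (j * p) * sgn (p + i) = sgn i * sgn (j' * p) := by
      rw [← sgn_add, ← sgn_add]; exact sgn_congr p (by rw [← hj]; ring)
    simp only [smul_add, smul_sub, smul_smul, e₁, e₂]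
    abel

variable {X Y}

/-- The component `X_i → Y_{i+n}` of an element of degree `n` of `Hom_A(X, Y)`. -/
def evL {n i j : ℤ} (h : i + n = j) : (homL X Y).X n →ₗ[K] X.X i →ₗ[K] Y.X j where
  toFun f := HomLX.app f h
  map_add' _ _ := rfl
  map_smul' _ _ := rfl

lemma evL_ext {n : ℤ} {f g : (homL X Y).X n}
    (h : ∀ (i j : ℤ) (hij : i + n = j) (x : X.X i), evL hij f x = evL hij g x) : f = g :=
  HomLX.ext' h

lemma evL_x_lsmul {n : ℤ} (f : (homL X Y).X n) {i j l i' j' : ℤ} (h' : i' + n = j')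
    (hl : l + i = i') (h : i + n = j) (hl' : l + j = j') (a : A.X l) (x : X.X i) :
    evL h' f (X.lsmul hl a x) = sgn (n * l) • Y.lsmul hl' a (evL h f x) :=
  HomLX.app_lsmul f h' hl h hl' a x

lemma evL_d {n n' : ℤ} (hn : n' + 1 = n) (f : (homL X Y).X n) {i j i' j' : ℤ}
    (h : i + n' = j) (hi : i' + 1 = i) (hj : j + 1 = j') (h₁ : i + n = j') (h₂ : i' + n = j)
    (x : X.X i) : evL h ((homL X Y).d hn f) x =
      Y.d hj (evL h₁ f x) - sgn n • evL h₂ f (X.d hi x) :=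
  homLD_app hn f h hi hj h₁ h₂ x

lemma evL_lsmul {i j k p q r : ℤ} (h : i + j = k) (b : B.X i) (f : (homL X Y).X j)
    (hpq : p + k = q) (hr : p + i = r) (hq : r + j = q) (x : X.X p) :
    evL hpq ((homL X Y).lsmul h b f) x = sgn (i * (j + p)) • evL hq f (X.rsmul hr x b) :=
  homLL_app h b f hpq hr hq x

lemma evL_rsmul {i j k p q r : ℤ} (h : i + j = k) (f : (homL X Y).X i) (c : C.X j)
    (hpq : p + k = q) (hr : p + i = r) (hq : r + j = q) (x : X.X p) :
    evL hpq ((homL X Y).rsmul h f c) x = sgn (j * p) • Y.rsmul hq (evL hr f x) c :=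
  homLR_app h f c hpq hr hq x

/-- Constructor for elements of `Hom_A(X, Y)`. -/
def homLMk {n : ℤ} (φ : ∀ i j : ℤ, i + n = j → (X.X i →ₗ[K] Y.X j))
    (hφ : ∀ (i j l i' j' : ℤ) (h : i + n = j) (h' : i' + n = j') (hl : l + i = i')
      (hl' : l + j = j') (a : A.X l) (x : X.X i),
      φ i' j' h' (X.lsmul hl a x) = sgn (n * l) • Y.lsmul hl' a (φ i j h x)) : (homL X Y).X n :=
  HomLX.mk φ hφ

lemma evL_mk {n : ℤ} (φ : ∀ i j : ℤ, i + n = j → (X.X i →ₗ[K] Y.X j)) (hφ)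
    {i j : ℤ} (h : i + n = j) (x : X.X i) : evL h (homLMk φ hφ) x = φ i j h x := rfl

variable (X) in
/-- Postcomposition `Hom_A(X, Y) → Hom_A(X, Y')`. -/
def homLMap {Y' : DGBimod A C} (g : Y ⟶ Y') : homL X Y ⟶ homL X Y' where
  f n :=
    { toFun := fun f => homLMk (fun i j h => (g.f j).comp (evL h f))
        (fun i j l i' j' h h' hl hl' a x => by
          simp only [LinearMap.comp_apply]
          rw [evL_x_lsmul f h' hl h hl', map_zsmul, g.map_lsmul])
      map_add' := fun f f' => evL_ext fun i j h x => by simp [evL_mk]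
      map_smul' := fun c f => evL_ext fun i j h x => by simp [evL_mk] }
  comm {n n'} hn f := evL_ext fun i j h x => by
    simp only [LinearMap.coe_mk, AddHom.coe_mk]
    rw [evL_mk, LinearMap.comp_apply, evL_d hn _ h (by omega : i - 1 + 1 = i) rfl (by omega)
      (by omega), evL_d hn _ h (by omega : i - 1 + 1 = i) rfl (by omega) (by omega), map_sub,
      map_zsmul, g.comm, evL_mk, evL_mk]
    rfl
  map_lsmul {i j k} h a f := evL_ext fun p q hpq x => by
    simp only [LinearMap.coe_mk, AddHom.coe_mk]
    rw [evL_mk, LinearMap.comp_apply, evL_lsmul h _ _ hpq rfl (by omega),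
      evL_lsmul h _ _ hpq rfl (by omega), map_zsmul, evL_mk]
    rfl
  map_rsmul {i j k} h f b := evL_ext fun p q hpq x => by
    simp only [LinearMap.coe_mk, AddHom.coe_mk]
    rw [evL_mk, LinearMap.comp_apply, evL_rsmul h _ _ hpq rfl (by omega),
      evL_rsmul h _ _ hpq rfl (by omega), map_zsmul, g.map_rsmul, evL_mk]
    rfl

variable (Y) in
/-- Precomposition `Hom_A(X', Y) → Hom_A(X, Y)`. -/
def homLPre {X' : DGBimod A B} (g : X ⟶ X') : homL X' Y ⟶ homL X Y where
  f n :=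
    { toFun := fun f => homLMk (fun i j h => (evL h f).comp (g.f i))
        (fun i j l i' j' h h' hl hl' a x => by
          simp only [LinearMap.comp_apply]
          rw [g.map_lsmul, evL_x_lsmul f h' hl h hl'])
      map_add' := fun f f' => evL_ext fun i j h x => by simp [evL_mk]
      map_smul' := fun c f => evL_ext fun i j h x => by simp [evL_mk] }
  comm {n n'} hn f := evL_ext fun i j h x => by
    simp only [LinearMap.coe_mk, AddHom.coe_mk]
    rw [evL_mk, LinearMap.comp_apply, evL_d hn _ h (by omega : i - 1 + 1 = i) rfl (by omega)
      (by omega), evL_d hn _ h (by omega : i - 1 + 1 = i) rfl (by omega) (by omega),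
      ← g.comm, evL_mk, evL_mk]
    rfl
  map_lsmul {i j k} h a f := evL_ext fun p q hpq x => by
    simp only [LinearMap.coe_mk, AddHom.coe_mk]
    rw [evL_mk, LinearMap.comp_apply, evL_lsmul h _ _ hpq rfl (by omega),
      evL_lsmul h _ _ hpq rfl (by omega), evL_mk, LinearMap.comp_apply, g.map_rsmul]
  map_rsmul {i j k} h f b := evL_ext fun p q hpq x => by
    simp only [LinearMap.coe_mk, AddHom.coe_mk]
    rw [evL_mk, LinearMap.comp_apply, evL_rsmul h _ _ hpq rfl (by omega),
      evL_rsmul h _ _ hpq rfl (by omega), evL_mk]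
    rfl

end HomLeft

section Canonical

/-- The underlying pairing of left modules of a pairing of bimodules. -/
def Pairing.left {M : DGBimod A B} {N : DGBimod B C} {P : DGBimod A C} (p : Pairing M N P) :
    Pairing M N.left P.left where
  φ := p.φ
  bal := p.bal
  leibniz := p.leibniz
  map_lsmul := p.map_lsmul
  map_rsmul i j k r s sj h hrs hsj hk x y c :=
    p.map_rsmul i j k r s sj h hrs hsj hk x y (C.unit.f j c)

/-- The `B`-dual `Hom_{Bᵒᵖ}(P, B)` of a DG `A`-`B`-bimodule, a DG `B`-`A`-bimodule. -/
abbrev dual (P : DGBimod A B) : DGBimod B A := homR P (regular B)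

/-- The evaluation `(z, x) ↦ z x` of an element of the `B`-dual. -/
def evD {P : DGBimod A B} {i j n : ℤ} (h : j + i = n) :
    (dual P).X i →ₗ[K] P.X j →ₗ[K] B.X n :=
  evR (X := P) (Y := regular B) h

lemma evD_x_rsmul {P : DGBimod A B} {n : ℤ} (f : (dual P).X n) {i j l i' j' : ℤ}
    (h' : i' + n = j') (hl : i + l = i') (h : i + n = j) (hl' : j + l = j') (x : P.X i)
    (c : B.X l) : evD h' f (P.rsmul hl x c) = B.mul hl' (evD h f x) c :=
  evR_x_rsmul f h' hl h hl' x c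

lemma evD_d {P : DGBimod A B} {n n' : ℤ} (hn : n' + 1 = n) (f : (dual P).X n) {i j i' j' : ℤ}
    (h : i + n' = j) (hi : i' + 1 = i) (hj : j + 1 = j') (h₁ : i + n = j') (h₂ : i' + n = j)
    (x : P.X i) : evD h ((dual P).d hn f) x =
      B.d hj (evD h₁ f x) - sgn n • evD h₂ f (P.d hi x) :=
  evR_d hn f h hi hj h₁ h₂ x

lemma evD_lsmul {P : DGBimod A B} {i j k p q r : ℤ} (h : i + j = k) (a : B.X i)
    (f : (dual P).X j) (hpq : p + k = q) (hr : p + j = r) (hq : i + r = q) (x : P.X p) :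
    evD hpq ((dual P).lsmul h a f) x = B.mul hq a (evD hr f x) :=
  evR_lsmul h a f hpq hr hq x

lemma evD_rsmul {P : DGBimod A B} {i j k p q r : ℤ} (h : i + j = k) (f : (dual P).X i)
    (b : A.X j) (hpq : p + k = q) (hr : j + p = r) (hq : r + i = q) (x : P.X p) :
    evD hpq ((dual P).rsmul h f b) x = evD hq f (P.lsmul hr b x) :=
  evR_rsmul h f b hpq hr hq x

/-- The evaluation pairing `(z, x) ↦ z x` of `Hom_{Bᵒᵖ}(P, B)` and `P` with values in `B`. -/
def evalPairing (P : DGBimod A B) : Pairing (dual P) P (regular B) where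
  φ n i j h := evR (by omega : j + i = n)
  bal n i j l il lj h₁ h₂ h₃ h₄ z a x := evR_rsmul h₁ z a _ h₃ _ x
  leibniz i j n i' j' n' h hn hi hj hl hr z x := by
    rw [evR_d hi z _ hj hn (by omega) (by omega), sub_add_cancel]
  map_lsmul i j k p q ip h hpq hip hk b z x := evR_lsmul hip b z _ _ _ x
  map_rsmul i j k p q qj h hpq hqj hk z x b := evR_x_rsmul z _ hqj _ _ x b

/-- The evaluation morphism `Hom_{Bᵒᵖ}(P, B) ⊗_A P → B`, `z ⊗ x ↦ z x`, of DG left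
`B`-modules. -/
noncomputable def evalLeft (P : DGBimod A B) : tensor (dual P) P.left ⟶ (regular B).left :=
  (evalPairing P).left.desc

/-- The bilinear maps `(x, y) ↦ (z ↦ (z x) y)`. -/
noncomputable def evalTensorAux (P : DGBimod A B) (F : DGBimod B C) {i j n : ℤ} (h : i + j = n)
    (p q : ℤ) (hpq : p + q = j) : P.X p →ₗ[K] F.X q →ₗ[K] (dual P).X i →ₗ[K] F.X n :=
  LinearMap.mk₂ K
    (fun x y => ((F.lsmul (by omega : p + i + q = n)).flip y).comp
      ((evD (rfl : p + i = p + i)).flip x))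
    (fun x x' y => by rw [map_add, LinearMap.comp_add])
    (fun c x y => by rw [map_smul, LinearMap.comp_smul])
    (fun x y y' => by rw [map_add, LinearMap.add_comp])
    (fun c x y => by rw [map_smul, LinearMap.smul_comp])

lemma evalTensorAux_apply (P : DGBimod A B) (F : DGBimod B C) {i j n p q r : ℤ} (h : i + j = n)
    (hpq : p + q = j) (hr : p + i = r) (hq : r + q = n) (x : P.X p) (y : F.X q)
    (z : (dual P).X i) :
    evalTensorAux P F h p q hpq x y z = F.lsmul hq (evD hr z x) y := by
  subst hr; rfl

lemma evalTensorAux_balanced (P : DGBimod A B) (F : DGBimod B C) {i j n : ℤ} (h : i + j = n) :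
    Balanced (evalTensorAux P F h) := by
  intro p q l pl lq h₁ h₂ h₃ h₄ x b y
  ext z
  rw [evalTensorAux_apply P F h h₂ rfl (by omega), evalTensorAux_apply P F h h₄ rfl (by omega),
    evD_x_rsmul z rfl h₁ rfl (by omega : p + i + l = pl + i)]
  exact F.mul_lsmul _ _ _ _ _ _ _

/-- The pairing `(z, x ⊗ y) ↦ (z x) y` of `Hom_{Bᵒᵖ}(P, B)` and `P ⊗_B F` with values in `F`. -/
noncomputable def evalTensorPairing (P : DGBimod A B) (F : DGBimod B C) :
    Pairing (dual P) (tensor P F) F where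
  φ n i j h := (tmLift (evalTensorAux P F h) (evalTensorAux_balanced P F h)).flip
  bal n i j l il lj h₁ h₂ h₃ h₄ z a t := by
    simp only [LinearMap.flip_apply]
    induction t using tm_induction with
    | h0 p q hpq x y =>
      rw [lsmul_tm h₃ hpq rfl (by omega), tmLift_tm, tmLift_tm,
        evalTensorAux_apply P F _ _ (by omega : p + il = l + p + i) (by omega),
        evalTensorAux_apply P F _ _ rfl (by omega), evD_rsmul h₁ z a _ rfl rfl]
    | hz => simp only [map_zero, LinearMap.zero_apply]
    | hadd s t hs ht => simp only [map_add, LinearMap.add_apply, hs, ht]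
  leibniz i j n i' j' n' h hn hi hj hl hr z t := by
    simp only [LinearMap.flip_apply]
    induction t using tm_induction with
    | h0 p q hpq x y =>
      rw [d_tm hpq hj (by omega : p - 1 + 1 = p) (by omega : q - 1 + 1 = q) (by omega) (by omega),
        map_add, map_zsmul, LinearMap.add_apply, LinearMap.smul_apply,
        tmLift_tm, tmLift_tm, tmLift_tm, tmLift_tm,
        evalTensorAux_apply P F h hpq rfl (by omega),
        evalTensorAux_apply P F hl hpq (by omega : p + i' = p - 1 + i) (by omega),
        evalTensorAux_apply P F hr _ rfl (by omega),
        evalTensorAux_apply P F hr _ rfl (by omega),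
        F.lleibniz _ (by omega : p - 1 + i + 1 = p + i) (by omega : q - 1 + 1 = q) hn
          (by omega : p - 1 + i + q = n') (by omega),
        evD_d hi z _ (by omega : p - 1 + 1 = p) (by omega : p - 1 + i + 1 = p + i) rfl rfl,
        map_sub, map_zsmul, LinearMap.sub_apply, LinearMap.smul_apply]
      simp only [smul_add, smul_smul, sgn_add, mul_comm (sgn p)]
      abel
    | hz => simp only [map_zero, LinearMap.zero_apply, smul_zero, add_zero]
    | hadd s t hs ht =>
      simp only [map_add, LinearMap.add_apply, smul_add, hs, ht]
      abel
  map_lsmul i j k p q ip h hpq hip hk b z t := by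
    simp only [LinearMap.flip_apply]
    induction t using tm_induction with
    | h0 r s hrs x y =>
      rw [tmLift_tm, tmLift_tm,
        evalTensorAux_apply P F hk hrs rfl (by omega),
        evalTensorAux_apply P F hpq hrs rfl (by omega),
        evD_lsmul hip b z _ rfl (by omega : i + (r + p) = r + ip)]
      exact F.mul_lsmul _ _ _ _ _ _ _
    | hz => simp only [map_zero, LinearMap.zero_apply]
    | hadd s t hs ht => simp only [map_add, LinearMap.add_apply, hs, ht]
  map_rsmul i j k p q qj h hpq hqj hk z t c := by
    simp only [LinearMap.flip_apply]
    induction t using tm_induction with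
    | h0 r s hrs x y =>
      rw [rsmul_tm hqj hrs rfl (by omega), tmLift_tm, tmLift_tm,
        evalTensorAux_apply P F hk _ rfl (by omega),
        evalTensorAux_apply P F hpq hrs rfl (by omega), F.lsmul_rsmul]
    | hz => simp only [map_zero, LinearMap.zero_apply]
    | hadd s t hs ht => simp only [map_add, LinearMap.add_apply, hs, ht]

/-- The canonical morphism `Hom_{Bᵒᵖ}(P, B) ⊗_A (P ⊗_B F) → F`, `z ⊗ (x ⊗ y) ↦ (z x) y`. -/
noncomputable def evalTensor (P : DGBimod A B) (F : DGBimod B C) :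
    tensor (dual P) (tensor P F) ⟶ F := (evalTensorPairing P F).desc

/-- The bilinear maps `(x, y) ↦ (z ↦ x ⊗ (y ⊗ z))`. -/
noncomputable def assocAux (M : DGBimod A B) (N : DGBimod B C) (P : DGBimod C D) {i j n : ℤ}
    (h : i + j = n) (p q : ℤ) (hpq : p + q = i) :
    M.X p →ₗ[K] N.X q →ₗ[K] P.X j →ₗ[K] (tensor M (tensor N P)).X n :=
  LinearMap.mk₂ K
    (fun x y => (tm M (tensor N P) (by omega : p + (q + j) = n) x).comp
      (tm N P (rfl : q + j = q + j) y))
    (fun x x' y => by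
      ext z
      simp only [LinearMap.comp_apply, LinearMap.add_apply, map_add])
    (fun c x y => by
      ext z
      simp only [LinearMap.comp_apply, LinearMap.smul_apply, map_smul])
    (fun x y y' => by
      ext z
      simp only [LinearMap.comp_apply, LinearMap.add_apply, map_add])
    (fun c x y => by
      ext z
      simp only [LinearMap.comp_apply, LinearMap.smul_apply, map_smul])

lemma assocAux_apply (M : DGBimod A B) (N : DGBimod B C) (P : DGBimod C D) {i j n p q r : ℤ}
    (h : i + j = n) (hpq : p + q = i) (hr : q + j = r) (hn : p + r = n) (x : M.X p) (y : N.X q)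
    (z : P.X j) :
    assocAux M N P h p q hpq x y z = tm M (tensor N P) hn x (tm N P hr y z) := by
  subst hr; rfl

lemma assocAux_balanced (M : DGBimod A B) (N : DGBimod B C) (P : DGBimod C D) {i j n : ℤ}
    (h : i + j = n) : Balanced (assocAux M N P h) := by
  intro p q l pl lq h₁ h₂ h₃ h₄ x b y
  ext z
  rw [assocAux_apply M N P h h₂ rfl (by omega), assocAux_apply M N P h h₄ rfl (by omega),
    tm_rsmul h₁ _ (by omega : l + (q + j) = lq + j) (by omega),
    lsmul_tm _ rfl h₃ rfl]

/-- The pairing `(x ⊗ y, z) ↦ x ⊗ (y ⊗ z)`. -/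
noncomputable def assocPairing (M : DGBimod A B) (N : DGBimod B C) (P : DGBimod C D) :
    Pairing (tensor M N) P (tensor M (tensor N P)) where
  φ n i j h := tmLift (assocAux M N P h) (assocAux_balanced M N P h)
  bal n i j l il lj h₁ h₂ h₃ h₄ t c z := by
    induction t using tm_induction with
    | h0 p q hpq x y =>
      rw [rsmul_tm h₁ hpq rfl (by omega), tmLift_tm, tmLift_tm,
        assocAux_apply M N P _ _ rfl (by omega),
        assocAux_apply M N P _ _ (by omega : q + lj = q + l + j) (by omega),
        tm_rsmul rfl rfl h₃ (by omega)]
    | hz => simp only [map_zero, LinearMap.zero_apply]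
    | hadd s t hs ht => simp only [map_add, LinearMap.add_apply, hs, ht]
  leibniz i j n i' j' n' h hn hi hj hl hr t z := by
    induction t using tm_induction with
    | h0 p q hpq x y =>
      rw [d_tm hpq hi (by omega : p - 1 + 1 = p) (by omega : q - 1 + 1 = q) (by omega) (by omega),
        map_add, map_zsmul, LinearMap.add_apply, LinearMap.smul_apply,
        tmLift_tm, tmLift_tm, tmLift_tm, tmLift_tm,
        assocAux_apply M N P h hpq rfl (by omega),
        assocAux_apply M N P hl _ rfl (by omega),
        assocAux_apply M N P hl _ rfl (by omega),
        assocAux_apply M N P hr hpq (by omega : q + j' = q - 1 + j) (by omega),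
        d_tm _ hn (by omega : p - 1 + 1 = p) (by omega : q - 1 + j + 1 = q + j)
          (by omega) (by omega),
        d_tm rfl _ (by omega : q - 1 + 1 = q) hj rfl (by omega), map_add, map_zsmul,
        show sgn i = sgn p * sgn q by rw [← hpq, sgn_add]]
      simp only [smul_add, smul_smul, add_assoc]
    | hz => simp only [map_zero, LinearMap.zero_apply, smul_zero, add_zero]
    | hadd s t hs ht =>
      simp only [map_add, LinearMap.add_apply, smul_add, hs, ht]
      abel
  map_lsmul i j k p q ip h hpq hip hk a t z := by
    induction t using tm_induction with
    | h0 r s hrs x y =>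
      rw [lsmul_tm hip hrs rfl (by omega), tmLift_tm, tmLift_tm,
        assocAux_apply M N P hk _ rfl (by omega),
        assocAux_apply M N P hpq hrs rfl (by omega), lsmul_tm h _ rfl (by omega)]
    | hz => simp only [map_zero, LinearMap.zero_apply]
    | hadd s t hs ht => simp only [map_add, LinearMap.add_apply, hs, ht]
  map_rsmul i j k p q qj h hpq hqj hk t z c := by
    induction t using tm_induction with
    | h0 r s hrs x y =>
      rw [tmLift_tm, tmLift_tm,
        assocAux_apply M N P hk hrs rfl (by omega),
        assocAux_apply M N P hpq hrs rfl (by omega),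
        rsmul_tm h _ (by omega : s + q + j = s + qj) (by omega), rsmul_tm _ rfl hqj (by omega)]
    | hz => simp only [map_zero, LinearMap.zero_apply]
    | hadd s t hs ht => simp only [map_add, LinearMap.add_apply, hs, ht]

/-- The associativity morphism `(M ⊗ N) ⊗ P → M ⊗ (N ⊗ P)`. -/
noncomputable def assocHom (M : DGBimod A B) (N : DGBimod B C) (P : DGBimod C D) :
    tensor (tensor M N) P ⟶ tensor M (tensor N P) := (assocPairing M N P).desc

/-- The canonical morphism `F → Hom_A(M, M ⊗_B F)`, `y ↦ (x ↦ (-1)^{|x||y|} x ⊗ y)`, which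
corresponds to the identity of `M ⊗_B F` under the tensor-Hom adjunction. -/
noncomputable def coev (M : DGBimod A B) (F : DGBimod B C) : F ⟶ homL M (tensor M F) where
  f n :=
    { toFun := fun y => homLMk (fun i j h => sgn (i * n) • (tm M F h).flip y)
        (fun i j l i' j' h h' hl hl' a x => by
          simp only [LinearMap.smul_apply, LinearMap.flip_apply]
          rw [map_zsmul, lsmul_tm hl' h hl h', smul_smul, ← sgn_add]
          congr 1
          exact sgn_congr 0 (by rw [← hl]; ring))
      map_add' := fun y y' => evL_ext fun i j h x => by simp [evL_mk]
      map_smul' := fun c y => evL_ext fun i j h x => by simp [evL_mk, smul_comm _ c] }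
  comm {n n'} hn y := evL_ext fun i j h x => by
    simp only [LinearMap.coe_mk, AddHom.coe_mk]
    rw [evL_d hn _ h (by omega : i - 1 + 1 = i) rfl (by omega) (by omega), evL_mk, evL_mk, evL_mk]
    simp only [LinearMap.smul_apply, LinearMap.flip_apply]
    rw [map_zsmul, d_tm _ rfl (by omega : i - 1 + 1 = i) hn (by omega) h]
    have e₁ : sgn n * sgn ((i - 1) * n) = sgn (i * n) := by
      rw [← sgn_add]; exact sgn_congr 0 (by ring)
    have e₂ : sgn (i * n) * sgn i = sgn (i * n') := by
      rw [← sgn_add]; exact sgn_congr i (by rw [← hn]; ring)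
    simp only [smul_add, smul_smul, e₁, e₂]
    abel
  map_lsmul {i j k} h b y := evL_ext fun p q hpq x => by
    simp only [LinearMap.coe_mk, AddHom.coe_mk]
    rw [evL_lsmul h _ _ hpq rfl (by omega), evL_mk, evL_mk]
    simp only [LinearMap.smul_apply, LinearMap.flip_apply]
    rw [tm_rsmul rfl _ h hpq, smul_smul, ← sgn_add]
    congr 1
    exact sgn_congr (-(i * j)) (by rw [← h]; ring)
  map_rsmul {i j k} h y c := evL_ext fun p q hpq x => by
    simp only [LinearMap.coe_mk, AddHom.coe_mk]
    rw [evL_rsmul h _ _ hpq rfl (by omega), evL_mk, evL_mk]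
    simp only [LinearMap.smul_apply, LinearMap.flip_apply]
    rw [map_zsmul, LinearMap.smul_apply, rsmul_tm _ _ h hpq, smul_smul, ← sgn_add]
    congr 1
    exact sgn_congr 0 (by rw [← h]; ring)

/-- The bilinear maps `(x, y) ↦ (-1)^{|f||x|} x ⊗ f y`. -/
noncomputable def tensorHomAux (M : DGBimod A B) {F : DGBimod B C} {F' : DGBimod B D} {n : ℤ}
    (f : (homL F F').X n) {i j : ℤ} (h : i + n = j) (p q : ℤ) (hpq : p + q = i) :
    M.X p →ₗ[K] F.X q →ₗ[K] (tensor M F').X j :=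
  sgn (n * p) • (tm M F' (by omega : p + (q + n) = j)).compl₂ (evL rfl f)

lemma tensorHomAux_apply (M : DGBimod A B) {F : DGBimod B C} {F' : DGBimod B D} {n : ℤ}
    (f : (homL F F').X n) {i j p q r : ℤ} (h : i + n = j) (hpq : p + q = i) (hr : q + n = r)
    (hj : p + r = j) (x : M.X p) (y : F.X q) :
    tensorHomAux M f h p q hpq x y = sgn (n * p) • tm M F' hj x (evL hr f y) := by
  subst hr; rfl

lemma tensorHomAux_balanced (M : DGBimod A B) {F : DGBimod B C} {F' : DGBimod B D} {n : ℤ}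
    (f : (homL F F').X n) {i j : ℤ} (h : i + n = j) : Balanced (tensorHomAux M f h) := by
  intro p q l pl lq h₁ h₂ h₃ h₄ x b y
  rw [tensorHomAux_apply M f h h₂ rfl (by omega), tensorHomAux_apply M f h h₄ rfl (by omega),
    evL_x_lsmul f _ h₃ rfl (by omega : l + (q + n) = lq + n), map_zsmul, smul_smul, ← sgn_add,
    tm_rsmul h₁ _ (by omega : l + (q + n) = lq + n) (by omega)]
  congr 1
  exact sgn_congr 0 (by rw [← h₁]; ring)

/-- The canonical morphism `Hom_B(F, F') → Hom_A(M ⊗_B F, M ⊗_B F')`, `f ↦ M ⊗ f`, where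
`(M ⊗ f) (x ⊗ y) = (-1)^{|f||x|} x ⊗ f y`. -/
noncomputable def tensorHom (M : DGBimod A B) (F : DGBimod B C) (F' : DGBimod B D) :
    homL F F' ⟶ homL (tensor M F) (tensor M F') where
  f n :=
    { toFun := fun f => homLMk
        (fun i j h => tmLift (tensorHomAux M f h) (tensorHomAux_balanced M f h))
        (fun i j l i' j' h h' hl hl' a t => by
          induction t using tm_induction with
          | h0 p q hpq x y =>
            rw [lsmul_tm hl hpq rfl (by omega), tmLift_tm, tmLift_tm,
              tensorHomAux_apply M f h' _ rfl (by omega), tensorHomAux_apply M f h hpq rfl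
              (by omega), map_zsmul, lsmul_tm hl' _ rfl (by omega), smul_smul, ← sgn_add]
            congr 1
            exact sgn_congr 0 (by ring)
          | hz => simp only [map_zero, smul_zero]
          | hadd s t hs ht => simp only [map_add, smul_add, hs, ht])
      map_add' := fun f f' => evL_ext fun i j h t => by
        induction t using tm_induction with
        | h0 p q hpq x y =>
          rw [map_add, LinearMap.add_apply, evL_mk, evL_mk, evL_mk, tmLift_tm, tmLift_tm,
            tmLift_tm, tensorHomAux_apply M _ h hpq rfl (by omega),
            tensorHomAux_apply M _ h hpq rfl (by omega),
            tensorHomAux_apply M _ h hpq rfl (by omega), map_add, LinearMap.add_apply, map_add,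
            smul_add]
        | hz => simp only [map_zero]
        | hadd s t hs ht => simp only [map_add, hs, ht]
      map_smul' := fun c f => evL_ext fun i j h t => by
        induction t using tm_induction with
        | h0 p q hpq x y =>
          rw [map_smul, LinearMap.smul_apply, evL_mk, evL_mk, tmLift_tm, tmLift_tm,
            tensorHomAux_apply M _ h hpq rfl (by omega),
            tensorHomAux_apply M _ h hpq rfl (by omega), map_smul, LinearMap.smul_apply,
            map_smul, smul_comm _ c]
          rfl
        | hz => simp only [map_zero]
        | hadd s t hs ht => simp only [map_add, hs, ht] }
  comm {n n'} hn f := evL_ext fun i j h t => by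
    simp only [LinearMap.coe_mk, AddHom.coe_mk]
    rw [evL_d hn _ h (by omega : i - 1 + 1 = i) rfl (by omega) (by omega), evL_mk, evL_mk, evL_mk]
    induction t using tm_induction with
    | h0 p q hpq x y =>
      rw [d_tm hpq _ (by omega : p - 1 + 1 = p) (by omega : q - 1 + 1 = q) (by omega) (by omega),
        map_add, map_zsmul, tmLift_tm, tmLift_tm, tmLift_tm, tmLift_tm,
        tensorHomAux_apply M _ h hpq rfl (by omega),
        tensorHomAux_apply M f _ hpq rfl (by omega),
        tensorHomAux_apply M f _ _ rfl (by omega),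
        tensorHomAux_apply M f _ _ (by omega : q - 1 + n = q + n') (by omega),
        evL_d hn f _ (by omega : q - 1 + 1 = q) (by omega : q + n' + 1 = q + n) rfl (by omega),
        map_zsmul, d_tm _ rfl (by omega : p - 1 + 1 = p) (by omega : q + n' + 1 = q + n)
          (by omega) (by omega), map_sub, map_zsmul]
      have e₁ : sgn n * sgn (n * (p - 1)) = sgn (n * p) := by
        rw [← sgn_add]; exact sgn_congr 0 (by ring)
      have e₂ : sgn (n * p) * sgn p = sgn (n' * p) := by
        rw [← sgn_add]; exact sgn_congr p (by rw [← hn]; ring)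
      have e₃ : sgn n * (sgn p * sgn (n * p)) = sgn (n' * p) * sgn n := by rw [← e₂]; ring
      simp only [smul_add, smul_sub, smul_smul, e₁, e₂, e₃]
      abel
    | hz => simp only [map_zero, smul_zero, sub_zero]
    | hadd s t hs ht =>
      simp only [map_add, smul_add, hs, ht]
      abel
  map_lsmul {i j k} h c f := evL_ext fun r s hrs t => by
    simp only [LinearMap.coe_mk, AddHom.coe_mk]
    rw [evL_lsmul h _ _ hrs rfl (by omega), evL_mk, evL_mk]
    induction t using tm_induction with
    | h0 p q hpq x y =>
      rw [rsmul_tm rfl hpq rfl (by omega), tmLift_tm, tmLift_tm,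
        tensorHomAux_apply M _ hrs hpq rfl (by omega),
        tensorHomAux_apply M f _ _ (by omega : q + i + j = q + k) (by omega),
        evL_lsmul h _ _ rfl rfl (by omega), map_zsmul, smul_smul, smul_smul, ← sgn_add, ← sgn_add]
      congr 1
      exact sgn_congr 0 (by rw [← hpq, ← h]; ring)
    | hz => simp only [map_zero, LinearMap.zero_apply, smul_zero]
    | hadd s t hs ht => simp only [map_add, LinearMap.add_apply, smul_add, hs, ht]
  map_rsmul {i j k} h f c := evL_ext fun r s hrs t => by
    simp only [LinearMap.coe_mk, AddHom.coe_mk]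
    rw [evL_rsmul h _ _ hrs rfl (by omega), evL_mk, evL_mk]
    induction t using tm_induction with
    | h0 p q hpq x y =>
      rw [tmLift_tm, tmLift_tm,
        tensorHomAux_apply M _ hrs hpq rfl (by omega),
        tensorHomAux_apply M f _ hpq rfl (by omega),
        evL_rsmul h _ _ rfl rfl (by omega), map_zsmul, map_zsmul, LinearMap.smul_apply,
        rsmul_tm _ _ (by omega : q + i + j = q + k) (by omega),
        smul_smul, smul_smul, ← sgn_add, ← sgn_add]
      congr 1
      exact sgn_congr 0 (by rw [← hpq, ← h]; ring)
    | hz => simp only [map_zero, LinearMap.zero_apply, smul_zero]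
    | hadd s t hs ht => simp only [map_add, LinearMap.add_apply, smul_add, hs, ht]

end Canonical

section Resolutions

/-- A DG left module `F` is K-flat if `- ⊗_A F` preserves quasi-isomorphisms. -/
def KFlat (F : DGMod A) : Prop :=
  ∀ (N N' : DGModOp A) (f : N ⟶ N'), quasiIso _ _ f → quasiIso _ _ (tensorMap f (𝟙 F))

/-- A DG right module `E` is K-flat if `E ⊗_A -` preserves quasi-isomorphisms. -/
def KFlatOp (E : DGModOp A) : Prop :=
  ∀ (N N' : DGMod A) (f : N ⟶ N'), quasiIso _ _ f → quasiIso _ _ (tensorMap (𝟙 E) f)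

/-- A DG left module `P` is K-projective if `Hom_A(P, -)` preserves quasi-isomorphisms. -/
def KProj (P : DGMod A) : Prop :=
  ∀ (N N' : DGMod A) (f : N ⟶ N'), quasiIso _ _ f → quasiIso _ _ (homLMap P f)

/-- A DG right module `P` is K-projective if `Hom_{Aᵒᵖ}(P, -)` preserves quasi-isomorphisms. -/
def KProjOp (P : DGModOp A) : Prop :=
  ∀ (N N' : DGModOp A) (f : N ⟶ N'), quasiIso _ _ f → quasiIso _ _ (homRMap P f)

/-- A DG left module `J` is K-injective if `Hom_A(-, J)` preserves quasi-isomorphisms. -/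
def KInj (J : DGMod A) : Prop :=
  ∀ (N N' : DGMod A) (f : N ⟶ N'), quasiIso _ _ f → quasiIso _ _ (homLPre J f)

/-- A K-flat resolution of a DG left module. -/
structure KFlatRes (N : DGMod A) where
  obj : DGMod A
  flat : obj.KFlat
  π : obj ⟶ N
  qis : quasiIso _ _ π

/-- A K-flat resolution of a DG right module. -/
structure KFlatResOp (N : DGModOp A) where
  obj : DGModOp A
  flat : obj.KFlatOp
  π : obj ⟶ N
  qis : quasiIso _ _ π

/-- A K-projective resolution of a DG left module. -/
structure KProjRes (N : DGMod A) where
  obj : DGMod A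
  proj : obj.KProj
  π : obj ⟶ N
  qis : quasiIso _ _ π

/-- A K-injective resolution of a DG left module. -/
structure KInjRes (N : DGMod A) where
  obj : DGMod A
  inj : obj.KInj
  ι : N ⟶ obj
  qis : quasiIso _ _ ι

/-- The isomorphism `F ≅ N` in the derived category given by a K-flat resolution `F → N`. -/
noncomputable def KFlatRes.iso {N : DGMod A} (F : KFlatRes N) : Q.obj F.obj ≅ Q.obj N :=
  Localization.isoOfHom Q (quasiIso _ _) F.π F.qis

/-- Data computing `RHom_{Sᵒᵖ}(M, S)` together with its bimodule structure, for a DG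
`R`-`S`-bimodule `M`: a quasi-isomorphism of DGAs `ρ : R' → R` and a quasi-isomorphism
`π : P → M` of DG `R'`-`S`-bimodules where `P` is K-projective as a DG right `S`-module. The
resolution `R' = R`, `ρ = id` is allowed; a general `R'` is needed because, over an arbitrary
ground ring, a K-projective resolution of `M` over `Sᵒᵖ` need not carry an action of `R`. -/
structure BimodRes {R S : DGA K} (M : DGBimod R S) where
  R' : DGA K
  ρ : DGA.Hom R' R
  hρ : ρ.QuasiIso
  P : DGBimod R' S
  π : P ⟶ M.restrict ρ (DGA.Hom.id S)
  qis : quasiIso _ _ π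
  proj : P.right.KProjOp

/-- The DG `S`-`R'`-bimodule `Z = Hom_{Sᵒᵖ}(P, S)` representing `RHom_{Sᵒᵖ}(M, S)`. -/
abbrev BimodRes.Z {R S : DGA K} {M : DGBimod R S} (T : BimodRes M) : DGBimod S T.R' := dual T.P

end Resolutions

section Conditions

variable {R S : DGA K} {M : DGBimod R S}

/-- The canonical map `Z ⊗ᴸ_{R'} P → S` in `D(S)` is an isomorphism, the derived tensor product
being computed by a K-flat resolution of the DG left `R'`-module `P ≃ M`. -/
def EvalIsIso (T : BimodRes M) : Prop :=
  ∀ F : KFlatRes T.P.left, IsIso (Q.map (tensorMap (𝟙 T.Z) F.π) ≫ Q.map (evalLeft T.P))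

/-- For all `N` the canonical map `Z ⊗ᴸ_{R'} (P ⊗ᴸ_S N) → N` in `D(S)` is an isomorphism. -/
def EvalTensorIsIso (T : BimodRes M) : Prop :=
  ∀ (N : DGMod S) (F : KFlatRes N) (G : KFlatRes (tensor T.P F.obj)),
    IsIso (Q.map (tensorMap (𝟙 T.Z) G.π) ≫ Q.map (evalTensor T.P F.obj) ≫ F.iso.hom)

/-- For all `N` and `N'` the canonical map
`(N ⊗ᴸ_S Z) ⊗ᴸ_{R'} (P ⊗ᴸ_S N') → N ⊗ᴸ_S N'` in `D(K)` is an isomorphism. -/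
def TensorEvalTensorIsIso (T : BimodRes M) : Prop :=
  ∀ (N : DGModOp S) (N' : DGMod S) (E : KFlatResOp N) (F : KFlatRes N')
    (G : KFlatRes (tensor T.P F.obj)),
    IsIso (Q.map (tensorMap (𝟙 (tensor E.obj T.Z)) G.π) ≫
      Q.map (assocHom E.obj T.Z (tensor T.P F.obj)) ≫
      Q.map (tensorMap (𝟙 E.obj) (evalTensor T.P F.obj)))

variable (M)

/-- For all `N` the canonical map `N → RHom_R(M, M ⊗ᴸ_S N)` in `D(S)` is an isomorphism. -/
def CoevIsIso : Prop :=
  ∀ (N : DGMod S) (F : KFlatRes N) (J : KInjRes (tensor M F.obj)),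
    IsIso (F.iso.inv ≫ Q.map (coev M F.obj) ≫ Q.map (homLMap M J.ι))

/-- For all `N` and `N'` the canonical map
`RHom_S(N, N') → RHom_R(M ⊗ᴸ_S N, M ⊗ᴸ_S N')` in `D(K)` is an isomorphism. -/
def TensorHomIsIso : Prop :=
  ∀ (N N' : DGMod S) (F : KProjRes N) (F' : KFlatRes N') (J : KInjRes (tensor M F'.obj)),
    IsIso (Q.map (tensorHom M F.obj F'.obj) ≫ Q.map (homLMap (tensor M F.obj) J.ι))

/-- The total left derived functor `M ⊗ᴸ_S - : D(S) ⥤ D(R)` is fully faithful. -/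
def DerivedTensorFullyFaithful : Prop :=
  ∃ (L : Derived S (ground K) ⥤ Derived R (ground K))
    (α : Q ⋙ L ⟶ tensorFunctor (ground K) M ⋙ Q),
    L.IsLeftDerivedFunctor α (quasiIso S (ground K)) ∧ L.Full ∧ L.Faithful

end Conditions

end DGBimod
end DG

namespace DG
namespace DGBimod

variable {K : Type u} [CommRing K]
variable {i j k l m n k' n' : ℤ}

section KMap

variable {A B A' B' A'' B'' A₃ B₃ : DGA K}

/-- Homogeneous `K`-linear maps of degree `k` between DG bimodules (over possibly different
algebras), not required to commute with the actions or the differentials. -/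
def KMap (M : DGBimod A B) (N : DGBimod A' B') (k : ℤ) : Type u :=
  ∀ p : {p : ℤ × ℤ // p.1 + k = p.2}, M.X p.1.1 →ₗ[K] N.X p.1.2

instance (M : DGBimod A B) (N : DGBimod A' B') (k : ℤ) : AddCommGroup (KMap M N k) :=
  inferInstanceAs (AddCommGroup (∀ p : {p : ℤ × ℤ // p.1 + k = p.2}, M.X p.1.1 →ₗ[K] N.X p.1.2))

variable {M : DGBimod A B} {N : DGBimod A' B'} {L : DGBimod A'' B''} {O : DGBimod A₃ B₃}

namespace KMap

/-- The components of a homogeneous map. -/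
def app (f : KMap M N k) (h : i + k = j) : M.X i →ₗ[K] N.X j := f ⟨(i, j), h⟩

/-- Constructor for homogeneous maps. -/
def mk (f : ∀ i j : ℤ, i + k = j → (M.X i →ₗ[K] N.X j)) : KMap M N k :=
  fun p => f p.1.1 p.1.2 p.2

@[simp] lemma mk_app (f : ∀ i j : ℤ, i + k = j → (M.X i →ₗ[K] N.X j))
    (h : i + k = j) : (mk f).app h = f i j h := rfl

lemma ext {f g : KMap M N k}
    (h : ∀ (i j : ℤ) (hij : i + k = j) (x : M.X i), f.app hij x = g.app hij x) : f = g := by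
  funext ⟨⟨i, j⟩, hij⟩
  exact LinearMap.ext fun x => h i j hij x

@[simp] lemma add_app (f g : KMap M N k) (h : i + k = j) (x : M.X i) :
    (f + g).app h x = f.app h x + g.app h x := rfl

@[simp] lemma sub_app (f g : KMap M N k) (h : i + k = j) (x : M.X i) :
    (f - g).app h x = f.app h x - g.app h x := rfl

@[simp] lemma neg_app (f : KMap M N k) (h : i + k = j) (x : M.X i) :
    (-f).app h x = -f.app h x := rfl

@[simp] lemma zero_app (h : i + k = j) (x : M.X i) :
    (0 : KMap M N k).app h x = 0 := rfl

@[simp] lemma zsmul_app (c : ℤ) (f : KMap M N k) (h : i + k = j) (x : M.X i) :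
    (c • f).app h x = c • f.app h x := rfl

/-- The differential `d f - (-1)^|f| f d`. -/
def D (_ : k' + 1 = k) (f : KMap M N k) : KMap M N k' :=
  mk fun i j h => (N.d (rfl : j + 1 = j + 1)).comp (f.app (by omega : i + k = j + 1)) -
    sgn k • (f.app (by omega : (i - 1) + k = j)).comp (M.d (by omega : (i - 1) + 1 = i))

lemma D_app (hk : k' + 1 = k) (f : KMap M N k) {i j i' j' : ℤ} (h : i + k' = j)
    (hi : i' + 1 = i) (hj : j + 1 = j') (h₁ : i + k = j') (h₂ : i' + k = j) (x : M.X i) :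
    (f.D hk).app h x = N.d hj (f.app h₁ x) - sgn k • f.app h₂ (M.d hi x) := by
  obtain rfl : i' = i - 1 := by omega
  subst hj
  rfl

@[simp] lemma D_add (hk : k' + 1 = k) (f g : KMap M N k) :
    (f + g).D hk = f.D hk + g.D hk := ext fun i j h x => by
  simp only [add_app, D_app hk _ h (by omega : i - 1 + 1 = i) rfl (by omega : i + k = j + 1)
    (by omega : i - 1 + k = j), map_add, smul_add]
  abel

@[simp] lemma D_neg (hk : k' + 1 = k) (f : KMap M N k) :
    (-f).D hk = -f.D hk := ext fun i j h x => by
  simp only [neg_app, D_app hk _ h (by omega : i - 1 + 1 = i) rfl (by omega : i + k = j + 1)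
    (by omega : i - 1 + k = j), map_neg, smul_neg]
  abel

@[simp] lemma D_zero (hk : k' + 1 = k) : (0 : KMap M N k).D hk = 0 :=
  ext fun i j h x => by
  simp only [zero_app, D_app hk _ h (by omega : i - 1 + 1 = i) rfl (by omega : i + k = j + 1)
    (by omega : i - 1 + k = j), map_zero, smul_zero, sub_zero]

@[simp] lemma D_sub (hk : k' + 1 = k) (f g : KMap M N k) :
    (f - g).D hk = f.D hk - g.D hk := by rw [sub_eq_add_neg, D_add, D_neg, ← sub_eq_add_neg]

@[simp] lemma D_zsmul (hk : k' + 1 = k) (c : ℤ) (f : KMap M N k) :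
    (c • f).D hk = c • f.D hk :=
  map_zsmul (AddMonoidHom.mk' (fun f : KMap M N k => f.D hk) (D_add hk)) c f

lemma D_D {k k' k'' : ℤ} (hk : k' + 1 = k) (hk' : k'' + 1 = k') (f : KMap M N k) :
    (f.D hk).D hk' = 0 := ext fun i j h x => by
  rw [D_app hk' _ h (by omega : i - 1 + 1 = i) rfl (by omega : i + k' = j + 1)
      (by omega : i - 1 + k' = j),
    D_app hk _ _ (by omega : i - 1 + 1 = i) rfl (by omega : i + k = j + 1 + 1)
      (by omega : i - 1 + k = j + 1),
    D_app hk _ _ (by omega : i - 2 + 1 = i - 1) rfl (by omega : i - 1 + k = j + 1)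
      (by omega : i - 2 + k = j), M.d_d, map_sub, N.d_d, map_zsmul,
    show sgn k = -sgn k' by rw [← hk, sgn_add, sgn_one, mul_neg_one]]
  simp

/-- The composition `g ∘ f`. -/
def comp (f : KMap M N k) (g : KMap N L l) (_ : k + l = n) : KMap M L n :=
  mk fun i j h => (g.app (by omega : (i + k) + l = j)).comp (f.app rfl)

lemma comp_app (f : KMap M N k) (g : KMap N L l) (h : k + l = n)
    (hij : i + n = j) (hf : i + k = m) (hg : m + l = j) (x : M.X i) :
    (f.comp g h).app hij x = g.app hg (f.app hf x) := by
  subst hf; rfl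

lemma comp_assoc {k l m kl lm n : ℤ} (f : KMap M N k) (g : KMap N L l) (h : KMap L O m)
    (h₁ : k + l = kl) (h₂ : kl + m = n) (h₃ : l + m = lm) (h₄ : k + lm = n) :
    (f.comp g h₁).comp h h₂ = f.comp (g.comp h h₃) h₄ := ext fun i j hij x => by
  rw [comp_app _ _ _ _ (rfl : i + kl = i + kl) (by omega),
    comp_app _ _ _ _ (rfl : i + k = i + k) (by omega),
    comp_app _ _ _ _ (rfl : i + k = i + k) (by omega),
    comp_app _ _ _ _ (by omega : i + k + l = i + kl) (by omega)]

lemma add_comp (f f' : KMap M N k) (g : KMap N L l) (h : k + l = n) :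
    (f + f').comp g h = f.comp g h + f'.comp g h := ext fun i j hij x => by
  simp [comp_app _ _ _ _ (rfl : i + k = i + k) (by omega : i + k + l = j)]

lemma sub_comp (f f' : KMap M N k) (g : KMap N L l) (h : k + l = n) :
    (f - f').comp g h = f.comp g h - f'.comp g h := ext fun i j hij x => by
  simp [comp_app _ _ _ _ (rfl : i + k = i + k) (by omega : i + k + l = j)]

lemma comp_add (f : KMap M N k) (g g' : KMap N L l) (h : k + l = n) :
    f.comp (g + g') h = f.comp g h + f.comp g' h := ext fun i j hij x => by
  simp [comp_app _ _ _ _ (rfl : i + k = i + k) (by omega : i + k + l = j)]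

lemma comp_sub (f : KMap M N k) (g g' : KMap N L l) (h : k + l = n) :
    f.comp (g - g') h = f.comp g h - f.comp g' h := ext fun i j hij x => by
  simp [comp_app _ _ _ _ (rfl : i + k = i + k) (by omega : i + k + l = j)]

@[simp] lemma zero_comp (g : KMap N L l) (h : k + l = n) :
    (0 : KMap M N k).comp g h = 0 := ext fun i j hij x => by
  simp [comp_app _ _ _ _ (rfl : i + k = i + k) (by omega : i + k + l = j)]

@[simp] lemma comp_zero (f : KMap M N k) (h : k + l = n) :
    f.comp (0 : KMap N L l) h = 0 := ext fun i j hij x => by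
  simp [comp_app _ _ _ _ (rfl : i + k = i + k) (by omega : i + k + l = j)]

lemma zsmul_comp (c : ℤ) (f : KMap M N k) (g : KMap N L l) (h : k + l = n) :
    (c • f).comp g h = c • f.comp g h := ext fun i j hij x => by
  simp [comp_app _ _ _ _ (rfl : i + k = i + k) (by omega : i + k + l = j)]

lemma neg_comp (f : KMap M N k) (g : KMap N L l) (h : k + l = n) :
    (-f).comp g h = -f.comp g h := by rw [← neg_one_zsmul, zsmul_comp, neg_one_zsmul]

lemma comp_neg (f : KMap M N k) (g : KMap N L l) (h : k + l = n) :
    f.comp (-g) h = -f.comp g h := by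
  rw [← zero_sub, ← zero_sub, comp_sub, comp_zero]

/-- The Leibniz rule `D (g ∘ f) = D g ∘ f + (-1)^|g| g ∘ D f`. -/
lemma D_comp {k l n k' l' n' : ℤ} (f : KMap M N k) (g : KMap N L l) (h : k + l = n)
    (hn : n' + 1 = n) (hk : k' + 1 = k) (hl : l' + 1 = l) (h₁ : k + l' = n') (h₂ : k' + l = n') :
    (f.comp g h).D hn = f.comp (g.D hl) h₁ + sgn l • (f.D hk).comp g h₂ :=
  ext fun i j hij x => by
  rw [add_app, zsmul_app, D_app hn _ hij (by omega : i - 1 + 1 = i) rfl (by omega) (by omega),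
    comp_app _ _ _ _ (rfl : i + k = i + k) (by omega),
    comp_app _ _ _ _ (rfl : i - 1 + k = i - 1 + k) (by omega),
    comp_app _ _ _ _ (rfl : i + k = i + k) (by omega),
    comp_app _ _ _ _ (rfl : i + k' = i + k') (by omega),
    D_app hl _ _ (by omega : i + k' + 1 = i + k) rfl (by omega) (by omega),
    D_app hk _ _ (by omega : i - 1 + 1 = i) (by omega : i + k' + 1 = i + k) (by omega) (by omega),
    map_sub, map_zsmul, smul_sub, smul_smul, ← sgn_add, add_comm l k, h]
  have e : ∀ (m : ℤ) (hm : m = i + k') (h1 : i - 1 + k = m) (h2 : m + l = j) (y : M.X (i - 1)),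
      g.app h2 (f.app h1 y) = g.app (by omega) (f.app (by omega : i - 1 + k = i + k') y) := by
    intro m hm h1 h2 y; subst hm; rfl
  rw [e _ (by omega)]
  abel

/-- Being closed under the differential. -/
def Closed (f : KMap M N k) : Prop := f.D (sub_add_cancel k 1) = 0

lemma closed_iff (hk : k' + 1 = k) (f : KMap M N k) : f.Closed ↔ f.D hk = 0 := by
  obtain rfl : k' = k - 1 := by omega
  rfl

lemma closed_D (hk : k' + 1 = k) (f : KMap M N k) : (f.D hk).Closed := D_D _ _ _

lemma Closed.d_app {f : KMap M N k} (hf : f.Closed) {i j i' j' : ℤ} (h : i + k = j)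
    (hi : i' + 1 = i) (hj : j' + 1 = j) (h' : i' + k = j') (x : M.X i) :
    N.d hj (f.app h x) = sgn k • f.app h' (M.d hi x) := by
  have := congrArg (fun g => g.app (by omega : i + (k - 1) = j') x) hf
  simp only [zero_app] at this
  rw [D_app _ _ _ hi hj h h', sub_eq_zero] at this
  exact this

lemma closed_of {f : KMap M N k}
    (hf : ∀ (i j i' j' : ℤ) (h : i + k = j) (hi : i' + 1 = i) (hj : j' + 1 = j) (h' : i' + k = j')
      (x : M.X i), N.d hj (f.app h x) = sgn k • f.app h' (M.d hi x)) : f.Closed :=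
  ext fun i j h x => by
    rw [D_app _ _ _ (by omega : i - 1 + 1 = i) rfl (by omega) (by omega),
      hf i _ (i - 1) j (by omega) (by omega) _ (by omega), sub_self, zero_app]

lemma Closed.comp {f : KMap M N k} {g : KMap N L l} (hf : f.Closed) (hg : g.Closed)
    (h : k + l = n) : (f.comp g h).Closed := by
  rw [closed_iff (sub_add_cancel n 1), D_comp f g h _ (sub_add_cancel k 1) (sub_add_cancel l 1)
    (by omega) (by omega), hf, hg]
  simp

lemma Closed.add {f g : KMap M N k} (hf : f.Closed) (hg : g.Closed) : (f + g).Closed := by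
  rw [Closed, D_add, hf, hg, add_zero]

lemma Closed.sub {f g : KMap M N k} (hf : f.Closed) (hg : g.Closed) : (f - g).Closed := by
  rw [Closed, D_sub, hf, hg, sub_zero]

/-- Precomposition with a closed map commutes with the differential. -/
lemma Closed.D_comp_left {k l n l' n' : ℤ} {f : KMap M N k} (hf : f.Closed) (g : KMap N L l)
    (h : k + l = n) (hn : n' + 1 = n) (hl : l' + 1 = l) (h₁ : k + l' = n') :
    (f.comp g h).D hn = f.comp (g.D hl) h₁ := by
  rw [D_comp f g h hn (sub_add_cancel k 1) hl h₁ (by omega), hf]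
  simp

/-- Postcomposition with a closed map commutes with the differential up to sign. -/
lemma Closed.D_comp_right (f : KMap M N k) {g : KMap N L l} (hg : g.Closed)
    (h : k + l = n) (hn : n' + 1 = n) (hk : k' + 1 = k) (h₂ : k' + l = n') :
    (f.comp g h).D hn = sgn l • (f.D hk).comp g h₂ := by
  rw [D_comp f g h hn hk (sub_add_cancel l 1) (by omega) h₂, hg]
  simp

/-- The map of degree `0` underlying a morphism. -/
def ofHom {M N : DGBimod A B} (f : M ⟶ N) : KMap M N 0 :=
  mk fun i _ h => (N.castX (by omega)).comp (f.f i)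

@[simp] lemma ofHom_app {M N : DGBimod A B} (f : M ⟶ N) (h : i + 0 = i) (x : M.X i) :
    (ofHom f).app h x = f.f i x := rfl

lemma ofHom_closed {M N : DGBimod A B} (f : M ⟶ N) : (ofHom f).Closed :=
  closed_of fun i j i' j' h hi hj h' x => by
    obtain rfl : j = i := by omega
    obtain rfl : j' = i' := by omega
    rw [ofHom_app, ofHom_app, sgn_zero, one_smul, f.comm]

lemma ofHom_comp {M N L : DGBimod A B} (f : M ⟶ N) (g : N ⟶ L) :
    ofHom (f ≫ g) = (ofHom f).comp (ofHom g) (add_zero 0) := ext fun i j h x => by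
  obtain rfl : j = i := by omega
  rw [comp_app _ _ _ _ (add_zero j) (add_zero j)]
  rfl

variable (M) in
/-- The identity. -/
def one : KMap M M 0 := mk fun _ _ h => M.castX (by omega)

@[simp] lemma one_app (h : i + 0 = i) (x : M.X i) : (one M).app h x = x := rfl

lemma ofHom_id {M : DGBimod A B} : ofHom (𝟙 M) = one M := rfl

@[simp] lemma one_comp (f : KMap M N k) (h : 0 + k = k) : (one M).comp f h = f :=
  ext fun i j hij x => by rw [comp_app _ _ _ _ (add_zero i) hij, one_app]

@[simp] lemma comp_one (f : KMap M N k) (h : k + 0 = k) : f.comp (one N) h = f :=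
  ext fun i j hij x => by rw [comp_app _ _ _ _ hij (add_zero j), one_app]

lemma one_closed : (one M).Closed := closed_of fun i j i' j' h hi hj h' x => by
  obtain rfl : j = i := by omega
  obtain rfl : j' = i' := by omega
  rw [one_app, one_app, sgn_zero, one_smul]

/-- Left linearity with the Koszul sign. -/
def LLin {M : DGBimod A B} {N : DGBimod A B'} (f : KMap M N k) : Prop :=
  ∀ (i j l i' j' : ℤ) (h : i + k = j) (h' : i' + k = j') (hl : l + i = i') (hl' : l + j = j')
    (a : A.X l) (x : M.X i), f.app h' (M.lsmul hl a x) = sgn (k * l) • N.lsmul hl' a (f.app h x)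

/-- Right linearity. -/
def RLin {M : DGBimod A B} {N : DGBimod A' B} (f : KMap M N k) : Prop :=
  ∀ (i j l i' j' : ℤ) (h : i + k = j) (h' : i' + k = j') (hl : i + l = i') (hl' : j + l = j')
    (x : M.X i) (b : B.X l), f.app h' (M.rsmul hl x b) = N.rsmul hl' (f.app h x) b

section LLin

variable {B₀ B₁ B₂ : DGA K} {M : DGBimod A B₀} {N : DGBimod A B₁} {L : DGBimod A B₂} {k l : ℤ}

lemma LLin.zero : (0 : KMap M N k).LLin := fun i j l i' j' h h' hl hl' a x => by simp

lemma LLin.add {f g : KMap M N k} (hf : f.LLin) (hg : g.LLin) : (f + g).LLin :=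
  fun i j l i' j' h h' hl hl' a x => by
    simp [hf i j l i' j' h h' hl hl' a x, hg i j l i' j' h h' hl hl' a x]

lemma LLin.sub {f g : KMap M N k} (hf : f.LLin) (hg : g.LLin) : (f - g).LLin :=
  fun i j l i' j' h h' hl hl' a x => by
    simp [hf i j l i' j' h h' hl hl' a x, hg i j l i' j' h h' hl hl' a x, smul_sub]

lemma LLin.zsmul (c : ℤ) {f : KMap M N k} (hf : f.LLin) : (c • f).LLin :=
  fun i j l i' j' h h' hl hl' a x => by
    simp [hf i j l i' j' h h' hl hl' a x, smul_smul, mul_comm c]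

lemma LLin.comp {f : KMap M N k} {g : KMap N L l} (hf : f.LLin) (hg : g.LLin)
    (h : k + l = n) : (f.comp g h).LLin := fun i j m i' j' hi hi' hl hl' a x => by
  rw [comp_app _ _ _ _ (rfl : i + k = i + k) (by omega),
    comp_app _ _ _ _ (rfl : i' + k = i' + k) (by omega),
    hf i _ m i' _ rfl rfl hl (by omega), map_zsmul, hg _ _ m _ _ (by omega) _ _ hl', smul_smul,
    ← sgn_add]
  congr 1
  exact sgn_congr 0 (by rw [← h]; ring)

lemma LLin.D (hk : k' + 1 = k) {f : KMap M N k} (hf : f.LLin) : (f.D hk).LLin :=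
  fun i j l i' j' h h' hl hl' a x => by
    rw [D_app _ _ _ (by omega : i - 1 + 1 = i) rfl (by omega) (by omega),
      D_app _ _ _ (by omega : i' - 1 + 1 = i') rfl (by omega) (by omega),
      hf i (j + 1) l i' (j' + 1) (by omega) _ hl (by omega), map_zsmul,
      N.lleibniz _ (by omega : (l - 1) + 1 = l) rfl _ (by omega : l - 1 + (j + 1) = j') hl',
      M.lleibniz hl (by omega : (l - 1) + 1 = l) (by omega : (i - 1) + 1 = i) _
        (by omega : l - 1 + i = i' - 1) (by omega : l + (i - 1) = i' - 1),
      map_add, map_zsmul, hf i (j + 1) (l - 1) _ _ (by omega) _ _ (by omega),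
      hf (i - 1) j l _ _ (by omega) _ _ hl']
    have e₁ : sgn k * sgn (k * (l - 1)) = sgn (k * l) := by
      rw [← sgn_add]; exact sgn_congr 0 (by ring)
    have e₂ : sgn (k * l) * sgn l = sgn (k' * l) := by
      rw [← sgn_add]; exact sgn_congr l (by rw [← hk]; ring)
    have e₃ : sgn k * (sgn l * sgn (k * l)) = sgn (k' * l) * sgn k := by
      rw [← e₂]; ring
    simp only [smul_add, smul_sub, smul_smul, map_sub, map_zsmul, e₁, e₂, e₃]
    abel

end LLin

section RLin

variable {A₀ A₁ A₂ : DGA K} {M : DGBimod A₀ B} {N : DGBimod A₁ B} {L : DGBimod A₂ B} {k l : ℤ}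

lemma RLin.zero : (0 : KMap M N k).RLin := fun i j l i' j' h h' hl hl' x b => by simp

lemma RLin.add {f g : KMap M N k} (hf : f.RLin) (hg : g.RLin) : (f + g).RLin :=
  fun i j l i' j' h h' hl hl' x b => by
    simp [hf i j l i' j' h h' hl hl' x b, hg i j l i' j' h h' hl hl' x b]

lemma RLin.sub {f g : KMap M N k} (hf : f.RLin) (hg : g.RLin) : (f - g).RLin :=
  fun i j l i' j' h h' hl hl' x b => by
    simp [hf i j l i' j' h h' hl hl' x b, hg i j l i' j' h h' hl hl' x b]

lemma RLin.zsmul (c : ℤ) {f : KMap M N k} (hf : f.RLin) : (c • f).RLin :=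
  fun i j l i' j' h h' hl hl' x b => by
    simp [hf i j l i' j' h h' hl hl' x b]

lemma RLin.comp {f : KMap M N k} {g : KMap N L l} (hf : f.RLin) (hg : g.RLin)
    (h : k + l = n) : (f.comp g h).RLin := fun i j m i' j' hi hi' hl hl' x b => by
  rw [comp_app _ _ _ _ (rfl : i + k = i + k) (by omega),
    comp_app _ _ _ _ (rfl : i' + k = i' + k) (by omega),
    hf i _ m i' _ rfl rfl hl (by omega), hg _ _ m _ _ (by omega) _ _ hl']

lemma RLin.D (hk : k' + 1 = k) {f : KMap M N k} (hf : f.RLin) : (f.D hk).RLin :=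
  fun i j l i' j' h h' hl hl' x b => by
    rw [D_app _ _ _ (by omega : i - 1 + 1 = i) rfl (by omega) (by omega),
      D_app _ _ _ (by omega : i' - 1 + 1 = i') rfl (by omega) (by omega),
      hf i (j + 1) l i' (j' + 1) (by omega) _ hl (by omega),
      N.rleibniz _ rfl (by omega : (l - 1) + 1 = l) _ hl' (by omega : j + 1 + (l - 1) = j'),
      M.rleibniz hl (by omega : (i - 1) + 1 = i) (by omega : (l - 1) + 1 = l) _
        (by omega : i - 1 + l = i' - 1) (by omega : i + (l - 1) = i' - 1),
      map_add, map_zsmul, hf (i - 1) j l _ _ (by omega) _ _ hl',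
      hf i (j + 1) (l - 1) _ _ (by omega) _ _ (by omega)]
    have e : sgn (j + 1) = sgn k * sgn i := by rw [← sgn_add]; congr 1; omega
    simp only [e, smul_add, smul_smul, map_sub, map_zsmul, LinearMap.sub_apply,
      LinearMap.smul_apply]
    abel

end RLin

section BLin

variable {M N L : DGBimod A B} {k l : ℤ}

/-- Graded bimodule maps. -/
def BLin (f : KMap M N k) : Prop := f.LLin ∧ f.RLin

lemma BLin.zero : (0 : KMap M N k).BLin := ⟨.zero, .zero⟩

lemma BLin.add {f g : KMap M N k} (hf : f.BLin) (hg : g.BLin) : (f + g).BLin :=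
  ⟨hf.1.add hg.1, hf.2.add hg.2⟩

lemma BLin.sub {f g : KMap M N k} (hf : f.BLin) (hg : g.BLin) : (f - g).BLin :=
  ⟨hf.1.sub hg.1, hf.2.sub hg.2⟩

lemma BLin.zsmul (c : ℤ) {f : KMap M N k} (hf : f.BLin) : (c • f).BLin :=
  ⟨hf.1.zsmul c, hf.2.zsmul c⟩

lemma BLin.comp {f : KMap M N k} {g : KMap N L l} (hf : f.BLin) (hg : g.BLin)
    (h : k + l = n) : (f.comp g h).BLin := ⟨hf.1.comp hg.1 h, hf.2.comp hg.2 h⟩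

lemma BLin.D (hk : k' + 1 = k) {f : KMap M N k} (hf : f.BLin) : (f.D hk).BLin :=
  ⟨hf.1.D hk, hf.2.D hk⟩

lemma ofHom_bLin (f : M ⟶ N) : (ofHom f).BLin := by
  constructor
  · intro i j l i' j' h h' hl hl' a x
    obtain rfl : j = i := by omega
    obtain rfl : j' = i' := by omega
    rw [ofHom_app, ofHom_app, zero_mul, sgn_zero, one_smul, f.map_lsmul]
  · intro i j l i' j' h h' hl hl' a x
    obtain rfl : j = i := by omega
    obtain rfl : j' = i' := by omega
    rw [ofHom_app, ofHom_app, f.map_rsmul]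

/-- Closed graded bimodule maps of degree `0` are morphisms. -/
def toHom (f : KMap M N 0) (hf : f.Closed) (hb : f.BLin) : M ⟶ N where
  f i := f.app (add_zero i)
  comm {i j} h x := by
    rw [hf.d_app (add_zero i) h h (add_zero j), sgn_zero, one_smul]
  map_lsmul {i j k} h a x := by
    rw [hb.1 j j i k k (add_zero j) (add_zero k) h h, zero_mul, sgn_zero, one_smul]
  map_rsmul {i j k} h x b := hb.2 i i j k k (add_zero i) (add_zero k) h h x b

@[simp] lemma ofHom_toHom (f : KMap M N 0) (hf : f.Closed) (hb : f.BLin) :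
    ofHom (f.toHom hf hb) = f := ext fun i j h x => by
  obtain rfl : j = i := by omega
  rfl

lemma ofHom_injective {f g : M ⟶ N} (h : ofHom f = ofHom g) : f = g :=
  hom_ext fun i x => by rw [← ofHom_app f (add_zero i), h, ofHom_app]

end BLin

end KMap

section Qis

open KMap

/-- The cycles of degree `i`. -/
def cyc (M : DGBimod A B) (i : ℤ) : Submodule K (M.X i) := LinearMap.ker (M.d (sub_add_cancel i 1))

/-- The boundaries of degree `i`. -/
def bdry (M : DGBimod A B) (i : ℤ) : Submodule K (M.X i) :=
  LinearMap.range (M.d (rfl : i + 1 = i + 1))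

lemma mem_cyc (h : j + 1 = i) {x : M.X i} : x ∈ cyc M i ↔ M.d h x = 0 := by
  obtain rfl : j = i - 1 := by omega
  rfl

lemma mem_bdry (h : j + 1 = i) {x : M.X j} : x ∈ bdry M j ↔ ∃ w, M.d h w = x := by
  subst h; rfl

lemma d_mem_bdry (h : j + 1 = i) (x : M.X i) : M.d h x ∈ bdry M j :=
  (mem_bdry h).2 ⟨x, rfl⟩

lemma d_mem_cyc (h : j + 1 = i) (x : M.X i) : M.d h x ∈ cyc M j := M.d_d _ _ _

lemma KMap.Closed.map_cyc {f : KMap M N k} (hf : f.Closed) (h : i + k = j)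
    {x : M.X i} (hx : x ∈ cyc M i) : f.app h x ∈ cyc N j := by
  rw [mem_cyc (sub_add_cancel j 1), hf.d_app h (sub_add_cancel i 1) _ (by omega), hx]
  simp

lemma KMap.Closed.map_bdry {f : KMap M N k} (hf : f.Closed) (h : i + k = j)
    {x : M.X i} (hx : x ∈ bdry M i) : f.app h x ∈ bdry N j := by
  obtain ⟨w, rfl⟩ := hx
  have : f.app h (M.d rfl w) = sgn k • N.d rfl (f.app (by omega : i + 1 + k = j + 1) w) := by
    rw [hf.d_app _ rfl rfl h, smul_smul, sgn_mul_self, one_smul]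
  rw [this]
  exact Submodule.smul_of_tower_mem _ _ (d_mem_bdry _ _)

/-- A homogeneous map inducing bijections on homology. -/
def KMap.Qis (f : KMap M N k) : Prop :=
  ∀ (i j : ℤ) (h : i + k = j),
    (∀ x ∈ cyc M i, f.app h x ∈ bdry N j → x ∈ bdry M i) ∧
    (∀ y ∈ cyc N j, ∃ x ∈ cyc M i, y - f.app h x ∈ bdry N j)

lemma qis_ofHom_iff {M N : DGBimod A B} (f : M ⟶ N) : (ofHom f).Qis ↔ quasiIso A B f := by
  constructor
  · intro H i j k h h'
    obtain ⟨h₁, h₂⟩ := H j j (add_zero j)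
    refine ⟨fun x hx hy => (mem_bdry h).1 (h₁ x ((mem_cyc h').2 hx) ((mem_bdry h).2 hy)),
      fun y hy => ?_⟩
    obtain ⟨x, hx, hb⟩ := h₂ y ((mem_cyc h').2 hy)
    exact ⟨x, (mem_cyc h').1 hx, (mem_bdry h).1 hb⟩
  · intro H i j h
    obtain rfl : j = i := by omega
    obtain ⟨h₁, h₂⟩ := H (j + 1) j (j - 1) rfl (sub_add_cancel j 1)
    exact ⟨fun x hx hy => h₁ x hx hy, fun y hy => h₂ y hy⟩

lemma KMap.Qis.comp {f : KMap M N k} {g : KMap N L l} (hf : f.Qis) (hg : g.Qis)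
    (hfc : f.Closed) (hgc : g.Closed) (h : k + l = n) : (f.comp g h).Qis := by
  intro i j hij
  simp only [comp_app f g h hij rfl (by omega)]
  obtain ⟨f₁, f₂⟩ := hf i _ rfl
  obtain ⟨g₁, g₂⟩ := hg (i + k) j (by omega)
  refine ⟨fun x hx hb => f₁ x hx (g₁ _ (hfc.map_cyc _ hx) hb), fun y hy => ?_⟩
  obtain ⟨z, hz, hyz⟩ := g₂ y hy
  obtain ⟨x, hx, hzx⟩ := f₂ z hz
  refine ⟨x, hx, ?_⟩
  have := add_mem hyz (hgc.map_bdry (by omega) hzx)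
  rwa [map_sub, sub_add_sub_cancel] at this

lemma KMap.Qis.of_comp_left {f : KMap M N k} {g : KMap N L l} {h : k + l = n}
    (hf : f.Qis) (hfg : (f.comp g h).Qis) (hfc : f.Closed) (hgc : g.Closed) : g.Qis := by
  intro i j hij
  have e : i - k + n = j := by omega
  obtain ⟨f₁, f₂⟩ := hf (i - k) i (by omega)
  obtain ⟨c₁, c₂⟩ := hfg (i - k) j e
  simp only [comp_app f g h e (by omega) hij] at c₁ c₂
  constructor
  · intro y hy hb
    obtain ⟨x, hx, hyx⟩ := f₂ y hy
    have h1 := hgc.map_bdry hij hyx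
    rw [map_sub] at h1
    have h2 := c₁ x hx (by simpa using sub_mem hb h1)
    simpa using add_mem hyx (hfc.map_bdry (by omega) h2)
  · intro y hy
    obtain ⟨x, hx, hyx⟩ := c₂ y hy
    exact ⟨_, hfc.map_cyc _ hx, hyx⟩

lemma KMap.Qis.of_comp_right {f : KMap M N k} {g : KMap N L l} {h : k + l = n}
    (hg : g.Qis) (hfg : (f.comp g h).Qis) (hfc : f.Closed) (hgc : g.Closed) : f.Qis := by
  intro i j hij
  have e : i + n = j + l := by omega
  obtain ⟨g₁, g₂⟩ := hg j _ rfl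
  obtain ⟨c₁, c₂⟩ := hfg i _ e
  simp only [comp_app f g h e hij rfl] at c₁ c₂
  refine ⟨fun x hx hb => c₁ x hx (hgc.map_bdry _ hb), fun y hy => ?_⟩
  obtain ⟨x, hx, hyx⟩ := c₂ _ (hgc.map_cyc rfl hy)
  refine ⟨x, hx, g₁ _ (sub_mem hy (hfc.map_cyc _ hx)) (by rwa [map_sub])⟩

lemma KMap.qis_of_comp_qis {f : KMap M N k} {g : KMap N M l} {h : k + l = n}
    {h' : l + k = n} (hfg : (f.comp g h).Qis) (hgf : (g.comp f h').Qis) (hgc : g.Closed) :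
    f.Qis := by
  intro i j hij
  obtain ⟨c₁, -⟩ := hfg i (j + l) (by omega)
  obtain ⟨-, c₂⟩ := hgf (j - n) j (by omega)
  simp only [comp_app f g h _ hij rfl] at c₁
  simp only [comp_app g f h' _ (by omega : j - n + l = i) hij] at c₂
  refine ⟨fun x hx hb => c₁ x hx (hgc.map_bdry _ hb), fun y hy => ?_⟩
  obtain ⟨x, hx, hyx⟩ := c₂ y hy
  exact ⟨_, hgc.map_cyc _ hx, hyx⟩

lemma KMap.qis_of_bijective {f : KMap M N k} (hf : f.Closed)
    (hb : ∀ (i j : ℤ) (h : i + k = j), Function.Bijective (f.app h)) : f.Qis := by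
  intro i j h
  have key : ∀ x, f.app h x ∈ cyc N j → x ∈ cyc M i := by
    intro x hx
    rw [mem_cyc (sub_add_cancel j 1), hf.d_app h (sub_add_cancel i 1) _ (by omega)] at hx
    apply (hb (i - 1) (j - 1) (by omega)).1
    rw [map_zero]
    have := congrArg (sgn k • ·) hx
    simpa [smul_smul, sgn_mul_self] using this
  constructor
  · rintro x hx ⟨w, hw⟩
    obtain ⟨v, rfl⟩ := (hb (i + 1) (j + 1) (by omega)).2 w
    rw [hf.d_app _ rfl rfl h, ← map_zsmul] at hw
    rw [← (hb i j h).1 hw]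
    exact Submodule.smul_of_tower_mem _ _ (d_mem_bdry _ _)
  · intro y hy
    obtain ⟨x, rfl⟩ := (hb i j h).2 y
    exact ⟨x, key x hy, by simp⟩

/-- Homotopic maps are simultaneously quasi-isomorphisms. -/
lemma KMap.Qis.of_homotopy {f g : KMap M N k} (hf : f.Qis) (hk : k + 1 = k')
    (s : KMap M N k') (hs : s.D hk = f - g) : g.Qis := by
  have key : ∀ (i j : ℤ) (h : i + k = j), ∀ x ∈ cyc M i, f.app h x - g.app h x ∈ bdry N j := by
    intro i j h x hx
    rw [← sub_app, ← hs, D_app hk s h (sub_add_cancel i 1) rfl (by omega) (by omega),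
      (mem_cyc _).1 hx]
    simpa using d_mem_bdry _ _
  intro i j h
  obtain ⟨f₁, f₂⟩ := hf i j h
  refine ⟨fun x hx hb => f₁ x hx (by simpa using add_mem (key i j h x hx) hb), fun y hy => ?_⟩
  obtain ⟨x, hx, hyx⟩ := f₂ y hy
  exact ⟨x, hx, by simpa using add_mem hyx (key i j h x hx)⟩

lemma one_qis : (KMap.one M).Qis := qis_of_bijective one_closed fun i j h => by
  obtain rfl : j = i := by omega
  exact Function.bijective_id

end Qis

section Homology

open KMap

variable {A B : DGA K}

/-- The homology in degree `j`. -/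
abbrev homology (M : DGBimod A B) (j : ℤ) : Type u :=
  cyc M j ⧸ (bdry M j).submoduleOf (cyc M j)

lemma homology_mk_eq_iff {M : DGBimod A B} (x y : cyc M j) :
    (Submodule.Quotient.mk x : homology M j) = Submodule.Quotient.mk y ↔
      (x : M.X j) - y ∈ bdry M j :=
  Submodule.Quotient.eq _

/-- The map induced on cycles. -/
def cycMap {M N : DGBimod A B} (f : M ⟶ N) (j : ℤ) : cyc M j →ₗ[K] cyc N j :=
  (f.f j).restrict fun _ hx => (ofHom_closed f).map_cyc (add_zero j) hx

/-- The map induced on homology. -/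
def homologyMap {M N : DGBimod A B} (f : M ⟶ N) (j : ℤ) : homology M j →ₗ[K] homology N j :=
  Submodule.mapQ _ _ (cycMap f j) fun _ hx => (ofHom_closed f).map_bdry (add_zero j) hx

lemma homologyMap_mk {M N : DGBimod A B} (f : M ⟶ N) (j : ℤ) (x : cyc M j) :
    homologyMap f j (Submodule.Quotient.mk x) = Submodule.Quotient.mk (cycMap f j x) := rfl

variable (A B) in
/-- Homology in degree `j` as a functor to types. -/
def homologyType (j : ℤ) : DGBimod A B ⥤ Type u where
  obj M := homology M j
  map f := ↾(homologyMap f j)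
  map_id M := by
    ext x
    obtain ⟨x, rfl⟩ := Submodule.Quotient.mk_surjective _ x
    rfl
  map_comp f g := by
    ext x
    obtain ⟨x, rfl⟩ := Submodule.Quotient.mk_surjective _ x
    rfl

lemma homologyMap_bijective_iff {M N : DGBimod A B} (f : M ⟶ N) :
    (∀ j, Function.Bijective (homologyMap f j)) ↔ quasiIso A B f := by
  rw [← qis_ofHom_iff]
  constructor
  · intro H i j h
    obtain rfl : j = i := by omega
    obtain ⟨h₁, h₂⟩ := H j
    constructor
    · intro x hx hb
      have : homologyMap f j (Submodule.Quotient.mk ⟨x, hx⟩) =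
          homologyMap f j (Submodule.Quotient.mk 0) := by
        rw [homologyMap_mk, homologyMap_mk, homology_mk_eq_iff, map_zero, ZeroMemClass.coe_zero,
          sub_zero]
        exact hb
      simpa using (homology_mk_eq_iff _ _).1 (h₁ this)
    · intro y hy
      obtain ⟨q, hq⟩ := h₂ (Submodule.Quotient.mk ⟨y, hy⟩)
      obtain ⟨⟨x, hx⟩, rfl⟩ := Submodule.Quotient.mk_surjective _ q
      rw [homologyMap_mk, eq_comm, homology_mk_eq_iff] at hq
      exact ⟨x, hx, hq⟩
  · intro H j
    obtain ⟨h₁, h₂⟩ := H j j (add_zero j)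
    constructor
    · intro p q hpq
      obtain ⟨x, rfl⟩ := Submodule.Quotient.mk_surjective _ p
      obtain ⟨y, rfl⟩ := Submodule.Quotient.mk_surjective _ q
      rw [homologyMap_mk, homologyMap_mk, homology_mk_eq_iff] at hpq
      rw [homology_mk_eq_iff]
      refine h₁ _ (x - y).2 ?_
      rw [map_sub]
      exact hpq
    · intro q
      obtain ⟨⟨y, hy⟩, rfl⟩ := Submodule.Quotient.mk_surjective _ q
      obtain ⟨x, hx, hyx⟩ := h₂ y hy
      refine ⟨Submodule.Quotient.mk ⟨x, hx⟩, ?_⟩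
      rw [homologyMap_mk, eq_comm, homology_mk_eq_iff]
      exact hyx

/-- A morphism becomes invertible in the derived category exactly when it is a
quasi-isomorphism. -/
lemma isIso_Q_map_iff {M N : DGBimod A B} (f : M ⟶ N) :
    IsIso ((Q : DGBimod A B ⥤ Derived A B).map f) ↔ quasiIso A B f := by
  constructor
  · intro h
    rw [← homologyMap_bijective_iff]
    intro j
    have hj : (quasiIso A B).IsInvertedBy (homologyType A B j) := fun X Y g hg =>
      (isIso_iff_bijective _).2 ((homologyMap_bijective_iff g).2 hg j)
    have := Functor.map_isIso (Localization.lift (homologyType A B j) hj Q) (Q.map f)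
    have h2 := NatIso.isIso_map_iff (Localization.fac (homologyType A B j) hj Q) f
    exact (isIso_iff_bijective _).1 (h2.1 this)
  · intro h
    exact Localization.inverts Q (quasiIso A B) f h

end Homology

end KMap

section Constructions

open KMap

variable {A B A' B' : DGA K}

/-- Acyclic DG bimodules. -/
def Acyclic (M : DGBimod A B) : Prop := ∀ i, cyc M i ≤ bdry M i

section Cone

variable {M N : DGBimod A B} (f : M ⟶ N)

/-- The inclusion of the target into the cone. -/
def coneInl : KMap N (cone f) 0 :=
  KMap.mk fun i j h => LinearMap.inl K (N.X j) (M.X (j - 1)) ∘ₗ N.castX (by omega : i = j)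

/-- The inclusion of the suspended source into the cone. -/
def coneInr : KMap M (cone f) 1 :=
  KMap.mk fun i j h => LinearMap.inr K (N.X j) (M.X (j - 1)) ∘ₗ M.castX (by omega : i = j - 1)

/-- The projection of the cone to the target, a graded map. -/
def coneFst : KMap (cone f) N 0 :=
  KMap.mk fun i j h => N.castX (by omega : i = j) ∘ₗ LinearMap.fst K (N.X i) (M.X (i - 1))

/-- The projection of the cone to the source, of degree `-1`. -/
def coneSnd : KMap (cone f) M (-1) :=
  KMap.mk fun i j h => M.castX (by omega : i - 1 = j) ∘ₗ LinearMap.snd K (N.X i) (M.X (i - 1))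

lemma coneInl_comp_coneFst : (coneInl f).comp (coneFst f) (add_zero 0) = one N :=
  KMap.ext fun i j h x => by
    obtain rfl : j = i := by omega
    rw [comp_app _ _ _ _ (add_zero j) (add_zero j)]
    rfl

lemma coneInr_comp_coneSnd : (coneInr f).comp (coneSnd f) (by omega : 1 + -1 = 0) = one M :=
  KMap.ext fun i j h x => by
    obtain ⟨j, rfl⟩ : ∃ m, j = m - 1 := ⟨j + 1, by omega⟩
    obtain rfl : i = j - 1 := by omega
    rw [comp_app _ _ _ _ (by omega : j - 1 + 1 = j) (by omega)]
    rfl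

lemma coneInl_comp_coneSnd (h : 0 + -1 = k) : (coneInl f).comp (coneSnd f) h = 0 :=
  KMap.ext fun i j h' x => by
    rw [comp_app _ _ _ _ (add_zero i) (by omega)]
    exact map_zero (M.castX (by omega : i - 1 = j))

lemma coneInr_comp_coneFst (h : 1 + 0 = k) : (coneInr f).comp (coneFst f) h = 0 :=
  KMap.ext fun i j h' x => by
    rw [comp_app _ _ _ _ rfl (by omega)]
    exact map_zero (N.castX (by omega : i + 1 = j))

lemma coneFst_comp_coneInl_add : (coneFst f).comp (coneInl f) (add_zero 0) +
    (coneSnd f).comp (coneInr f) (by omega : -1 + 1 = 0) = one (cone f) :=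
  KMap.ext fun i j h x => by
    obtain rfl : j = i := by omega
    rw [add_app, comp_app _ _ _ _ (add_zero j) (add_zero j),
      comp_app _ _ _ _ (by omega : j + -1 = j - 1) (by omega)]
    exact Prod.ext (add_zero x.1) (zero_add x.2)

lemma cone_decomp (h : i + 0 = i) (h₁ : i + -1 = j) (h₂ : j + 1 = i)
    (x : (cone f).X i) : (coneInl f).app h ((coneFst f).app h x) +
      (coneInr f).app h₂ ((coneSnd f).app h₁ x) = x := by
  have := congrArg (fun g => g.app h x) (coneFst_comp_coneInl_add f)
  simp only [add_app, one_app] at this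
  rwa [comp_app _ _ _ _ h h, comp_app _ _ _ _ h₁ h₂] at this

lemma coneInl_closed : (coneInl f).Closed := closed_of fun i j i' j' h hi hj h' x => by
  obtain rfl : j = i := by omega
  obtain rfl : j' = i' := by omega
  rw [sgn_zero, one_smul]
  refine Prod.ext ?_ ?_
  · change N.d hj x + f.f j' (M.castX _ 0) = N.d hi x
    simp
  · change -M.d _ 0 = 0
    simp

lemma coneSnd_closed : (coneSnd f).Closed := closed_of fun i j i' j' h hi hj h' x => by
  subst hi
  obtain rfl : j' = i' - 1 := by omega
  obtain rfl : j = i' + 1 - 1 := by omega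
  change M.d _ (x.2) = sgn (-1) • (-M.d _ x.2)
  rw [sgn_neg, sgn_one]
  simp

lemma D_coneInr : (coneInr f).D (zero_add 1) = (ofHom f).comp (coneInl f) (add_zero 0) :=
  KMap.ext fun i j h x => by
    obtain rfl : j = i := by omega
    rw [D_app _ _ _ (by omega : j - 1 + 1 = j) rfl rfl (by omega),
      comp_app _ _ _ _ (add_zero j) (add_zero j), sgn_one, neg_smul, one_smul, sub_neg_eq_add]
    refine Prod.ext ?_ ?_
    · change N.d _ 0 + f.f j (M.castX _ (M.castX _ x)) + 0 = f.f j x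
      have : ∀ (m : ℤ) (h₁ : j = m) (h₂ : m = j), M.castX h₂ (M.castX h₁ x) = x := by
        intro m h₁ h₂; subst h₁; rfl
      rw [this, map_zero, zero_add, add_zero]
    · change -M.d _ (M.castX (by omega : j = j + 1 - 1) x) +
      M.castX (by omega : j - 1 = j - 1) (M.d _ x) = 0
      rw [castX_d M (by omega : j - 1 + 1 = j) (by omega : j - 1 + 1 = j + 1 - 1)
        (by omega : j = j + 1 - 1)]
      simp

lemma D_coneFst (hk : k + 1 = 0) :
    (coneFst f).D hk = -(coneSnd f).comp (ofHom f) (by omega) := KMap.ext fun i j h x => by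
  obtain rfl : i = j + 1 := by omega
  rw [D_app _ _ _ rfl rfl (by omega) (by omega), neg_app,
    comp_app _ _ _ _ (by omega : j + 1 + -1 = j) (by omega), ofHom_app, sgn_zero, one_smul]
  change N.d _ x.1 - (N.d _ x.1 + f.f j (M.castX _ x.2)) = -f.f j (M.castX _ x.2)
  abel

lemma coneInl_bLin : (coneInl f).BLin := by
  constructor
  · intro i j l i' j' h h' hl hl' a x
    obtain rfl : j = i := by omega
    obtain rfl : j' = i' := by omega
    rw [zero_mul, sgn_zero, one_smul]
    refine Prod.ext rfl ?_
    change 0 = sgn l • M.lsmul _ a 0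
    simp
  · intro i j l i' j' h h' hl hl' x b
    obtain rfl : j = i := by omega
    obtain rfl : j' = i' := by omega
    refine Prod.ext rfl ?_
    change 0 = M.rsmul _ 0 b
    simp

lemma coneInr_bLin : (coneInr f).BLin := by
  constructor
  · intro i j l i' j' h h' hl hl' a x
    rw [one_mul]
    refine Prod.ext ?_ ?_
    · change 0 = sgn l • N.lsmul _ a 0
      simp
    · change M.castX (by omega : i' = j' - 1) _ =
        sgn l • sgn l • M.lsmul _ a (M.castX (by omega : i = j - 1) x)
      rw [smul_smul, sgn_mul_self, one_smul, M.castX_lsmul hl]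
  · intro i j l i' j' h h' hl hl' x b
    refine Prod.ext ?_ ?_
    · change 0 = N.rsmul _ 0 b
      simp
    · change M.castX (by omega : i' = j' - 1) _ = M.rsmul _ (M.castX (by omega : i = j - 1) x) b
      rw [M.castX_rsmul hl]

lemma coneFst_bLin : (coneFst f).BLin := by
  constructor
  · intro i j l i' j' h h' hl hl' a x
    obtain rfl : j = i := by omega
    obtain rfl : j' = i' := by omega
    rw [zero_mul, sgn_zero, one_smul]
    rfl
  · intro i j l i' j' h h' hl hl' x b
    obtain rfl : j = i := by omega
    obtain rfl : j' = i' := by omega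
    rfl

lemma coneSnd_bLin : (coneSnd f).BLin := by
  constructor
  · intro i j l i' j' h h' hl hl' a x
    change M.castX _ (sgn l • M.lsmul _ a x.2) = sgn (-1 * l) • M.lsmul _ a (M.castX _ x.2)
    rw [map_zsmul, neg_one_mul, sgn_neg, M.castX_lsmul _ hl']
  · intro i j l i' j' h h' hl hl' x b
    change M.castX _ (M.rsmul _ x.2 b) = M.rsmul _ (M.castX _ x.2) b
    rw [M.castX_rsmul _ hl']

/-- The inclusion of the target into the cone, as a morphism. -/
def coneInclusion : N ⟶ cone f := (coneInl f).toHom (coneInl_closed f) (coneInl_bLin f)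

lemma ofHom_coneInclusion : ofHom (coneInclusion f) = coneInl f := ofHom_toHom _ _ _

/-- The morphism out of a cone given by a morphism and a null-homotopy. -/
def coneDesc {L : DGBimod A B} (a : N ⟶ L) (t : KMap M L 1) (ht : t.BLin)
    (et : t.D (zero_add 1) = ofHom (f ≫ a)) : cone f ⟶ L :=
  ((coneFst f).comp (ofHom a) (add_zero 0) + (coneSnd f).comp t (by omega : -1 + 1 = 0)).toHom (by
    rw [closed_iff (neg_add_cancel 1), D_add, (ofHom_closed _).D_comp_right _ _ _
      (neg_add_cancel 1) (by omega), (coneSnd_closed f).D_comp_left t _ _ (zero_add 1) (by omega),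
      et, D_coneFst, sgn_zero, one_smul, neg_comp, comp_assoc _ _ _ _ _ (add_zero 0) (by omega),
      ofHom_comp, neg_add_cancel])
    (((coneFst_bLin f).comp (ofHom_bLin _) _).add ((coneSnd_bLin f).comp ht _))

lemma ofHom_coneDesc {L : DGBimod A B} (a : N ⟶ L) (t : KMap M L 1) (ht : t.BLin)
    (et : t.D (zero_add 1) = ofHom (f ≫ a)) : ofHom (coneDesc f a t ht et) =
      (coneFst f).comp (ofHom a) (add_zero 0) + (coneSnd f).comp t (by omega : -1 + 1 = 0) :=
  ofHom_toHom _ _ _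

lemma coneInclusion_desc {L : DGBimod A B} (a : N ⟶ L) (t : KMap M L 1) (ht : t.BLin)
    (et : t.D (zero_add 1) = ofHom (f ≫ a)) : coneInclusion f ≫ coneDesc f a t ht et = a := by
  apply ofHom_injective
  rw [ofHom_comp, ofHom_coneDesc, ofHom_coneInclusion, comp_add,
    ← comp_assoc _ _ _ (add_zero 0) (add_zero 0), coneInl_comp_coneFst, one_comp,
    ← comp_assoc _ _ _ (by omega : 0 + -1 = -1) (by omega), coneInl_comp_coneSnd, zero_comp,
    add_zero]

lemma coneInr_comp_desc {L : DGBimod A B} (a : N ⟶ L) (t : KMap M L 1) (ht : t.BLin)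
    (et : t.D (zero_add 1) = ofHom (f ≫ a)) :
    (coneInr f).comp (ofHom (coneDesc f a t ht et)) (add_zero 1) = t := by
  rw [ofHom_coneDesc, comp_add, ← comp_assoc _ _ _ (add_zero 1) (add_zero 1),
    coneInr_comp_coneFst, zero_comp, ← comp_assoc _ _ _ (by omega : 1 + -1 = 0) (by omega),
    coneInr_comp_coneSnd, one_comp, zero_add]

lemma cone_hom_ext {L : DGBimod A B} {p q : cone f ⟶ L}
    (h₁ : coneInclusion f ≫ p = coneInclusion f ≫ q)
    (h₂ : (coneInr f).comp (ofHom p) (add_zero 1) = (coneInr f).comp (ofHom q) (add_zero 1)) :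
    p = q := by
  apply ofHom_injective
  have e : ∀ r : cone f ⟶ L, ofHom r = (coneFst f).comp (ofHom (coneInclusion f ≫ r)) (add_zero 0) +
      (coneSnd f).comp ((coneInr f).comp (ofHom r) (add_zero 1)) (by omega) := fun r => by
    rw [ofHom_comp, ofHom_coneInclusion, ← comp_assoc _ _ _ (add_zero 0) (add_zero 0),
      ← comp_assoc _ _ _ (by omega : -1 + 1 = 0) (add_zero 0), ← add_comp,
      coneFst_comp_coneInl_add, one_comp]
  rw [e p, e q, h₁, h₂]

variable {f} in
/-- The cone of a quasi-isomorphism is acyclic. -/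
lemma acyclic_cone (hf : quasiIso A B f) : (cone f).Acyclic := by
  intro i p hp
  have hq := (qis_ofHom_iff f).2 hf
  obtain ⟨f₁, -⟩ := hq (i - 1) (i - 1) (add_zero _)
  obtain ⟨-, f₂⟩ := hq i i (add_zero _)
  simp only [ofHom_app] at f₁ f₂
  set y := (coneFst f).app (add_zero i) p with hy
  set x := (coneSnd f).app (by omega : i + -1 = i - 1) p with hx
  have hxc : x ∈ cyc M (i - 1) := (coneSnd_closed f).map_cyc _ hp
  have hdy : N.d (sub_add_cancel i 1) y = -f.f (i - 1) x := by
    have := congrArg (fun g => g.app (by omega : i + -1 = i - 1) p)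
      (D_coneFst f (by omega : -1 + 1 = 0))
    simp only [neg_app] at this
    rw [D_app _ _ _ (sub_add_cancel i 1) (sub_add_cancel i 1) (add_zero i) (by omega),
      comp_app _ _ _ _ (by omega : i + -1 = i - 1) (by omega), (mem_cyc _).1 hp, map_zero,
      smul_zero, sub_zero, ofHom_app] at this
    exact this
  obtain ⟨w, hw⟩ := (mem_bdry (sub_add_cancel i 1)).1 (f₁ x hxc
    ((mem_bdry (sub_add_cancel i 1)).2 ⟨-y, by rw [map_neg, hdy, neg_neg]⟩))
  obtain ⟨x', hx', hz⟩ := f₂ (y + f.f i w) ((mem_cyc (sub_add_cancel i 1)).2 (by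
    rw [map_add, hdy, ← f.comm, hw, neg_add_cancel]))
  obtain ⟨v, hv⟩ := (mem_bdry rfl).1 hz
  refine (mem_bdry rfl).2 ⟨(coneInl f).app (add_zero _) v +
    (coneInr f).app (rfl : i + 1 = i + 1) (x' - w), ?_⟩
  have e₁ : (cone f).d (rfl : i + 1 = i + 1) ((coneInr f).app rfl (x' - w)) =
      (coneInl f).app (add_zero i) (f.f i (x' - w)) -
        (coneInr f).app (sub_add_cancel i 1) (M.d (sub_add_cancel i 1) (x' - w)) := by
    have := congrArg (fun g => g.app (add_zero i) (x' - w)) (D_coneInr f)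
    rw [D_app _ _ _ (sub_add_cancel i 1) rfl rfl (by omega),
      comp_app _ _ _ _ (add_zero i) (add_zero i), ofHom_app, sgn_one, neg_smul, one_smul,
      sub_neg_eq_add] at this
    rw [← this, add_sub_cancel_right]
  rw [map_add, e₁, (coneInl_closed f).d_app _ rfl rfl (add_zero i), hv, sgn_zero, one_smul,
    map_sub (M.d _), (mem_cyc _).1 hx', hw, zero_sub, map_neg, sub_neg_eq_add, ← add_assoc,
    ← map_add, map_sub (f.f i), sub_add_sub_cancel, add_sub_cancel_right]
  exact cone_decomp f _ _ _ p

end Cone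

section Shift

variable (M : DGBimod A B) (n : ℤ)

/-- The canonical closed isomorphism of degree `n` from `M` to `Σⁿ M`. -/
def toShift : KMap M (M.shift n) n := KMap.mk fun _ _ h => M.castX (by omega)

/-- The inverse of `toShift`. -/
def ofShift {m : ℤ} (hm : n + m = 0) : KMap (M.shift n) M m :=
  KMap.mk fun _ _ h => M.castX (by omega)

lemma toShift_comp_ofShift {m : ℤ} (hm : n + m = 0) :
    (toShift M n).comp (ofShift M n hm) hm = one M := KMap.ext fun i j h x => by
  obtain rfl : j = i := by omega
  rw [comp_app _ _ _ _ rfl (by omega)]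
  change M.castX _ (M.castX _ x) = x
  have : ∀ (m : ℤ) (h₁ : j = m) (h₂ : m = j), M.castX h₂ (M.castX h₁ x) = x := by
    intro m h₁ h₂; subst h₁; rfl
  exact this _ _ _

lemma ofShift_comp_toShift {m : ℤ} (hm : n + m = 0) :
    (ofShift M n hm).comp (toShift M n) (by omega : m + n = 0) = one (M.shift n) :=
  KMap.ext fun i j h x => by
  obtain rfl : j = i := by omega
  rw [comp_app _ _ _ _ (by omega : j + m = j - n) (by omega)]
  rfl

lemma toShift_closed : (toShift M n).Closed := closed_of fun i j i' j' h hi hj h' x => by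
  change sgn n • M.d _ (M.castX _ x) = sgn n • M.castX _ (M.d _ x)
  rw [M.castX_d hi (by omega : j' - n + 1 = j - n)]

lemma ofShift_closed {m : ℤ} (hm : n + m = 0) : (ofShift M n hm).Closed :=
  closed_of fun i j i' j' h hi hj h' x => by
  have key : ∀ x : M.X (i - n), M.d hj (M.castX (by omega) x) =
      sgn m • M.castX (by omega) (sgn n • M.d (by omega : i' - n + 1 = i - n) x) := fun x => by
    rw [map_zsmul, smul_smul, ← sgn_add, show m + n = 0 by omega, sgn_zero, one_smul,
      M.castX_d _ hj]
  exact key x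

lemma toShift_bLin : (toShift M n).BLin := by
  constructor
  · intro i j l i' j' h h' hl hl' a x
    change M.castX _ _ = sgn (n * l) • sgn (n * l) • M.lsmul _ a (M.castX _ x)
    rw [smul_smul, sgn_mul_self, one_smul, M.castX_lsmul hl]
  · intro i j l i' j' h h' hl hl' x b
    change M.castX _ _ = M.rsmul _ (M.castX _ x) b
    rw [M.castX_rsmul hl]

lemma ofShift_bLin {m : ℤ} (hm : n + m = 0) : (ofShift M n hm).BLin := by
  obtain rfl : m = -n := by omega
  constructor
  · intro i j l i' j' h h' hl hl' a x
    have key : ∀ x : M.X (i - n), M.castX (by omega)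
        (sgn (n * l) • M.lsmul (by omega : l + (i - n) = i' - n) a x) =
        sgn (-n * l) • M.lsmul hl' a (M.castX (by omega) x) := fun x => by
      rw [map_zsmul, neg_mul, sgn_neg, M.castX_lsmul _ hl']
    exact key x
  · intro i j l i' j' h h' hl hl' x b
    have key : ∀ x : M.X (i - n), M.castX (by omega)
        (M.rsmul (by omega : i - n + l = i' - n) x b) =
        M.rsmul hl' (M.castX (by omega) x) b := fun x => by
      rw [M.castX_rsmul _ hl']
    exact key x

variable {M} in
lemma Acyclic.shift (hM : M.Acyclic) : (M.shift n).Acyclic := by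
  intro i x hx
  have h1 := hM (i - n) ((ofShift_closed M n (add_neg_cancel n)).map_cyc
    (by omega : i + -n = i - n) hx)
  have h2 := (toShift_closed M n).map_bdry (by omega : i - n + n = i) h1
  rw [← comp_app _ _ (neg_add_cancel n) (add_zero i)] at h2
  rwa [ofShift_comp_toShift, one_app] at h2

end Shift

/-- The zero DG bimodule. -/
def zeroBimod (A B : DGA K) : DGBimod A B where
  X _ := PUnit
  d _ := 0
  lsmul _ := 0
  rsmul _ := 0
  d_d _ _ _ := rfl
  one_lsmul _ _ := rfl
  rsmul_one _ _ := rfl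
  mul_lsmul _ _ _ _ _ _ _ := rfl
  rsmul_mul _ _ _ _ _ _ _ := rfl
  lsmul_rsmul _ _ _ _ _ _ _ := rfl
  lleibniz _ _ _ _ _ _ _ _ := rfl
  rleibniz _ _ _ _ _ _ _ _ := rfl

/-- The direct sum of two DG bimodules. -/
def sum (M N : DGBimod A B) : DGBimod A B where
  X i := M.X i × N.X i
  d h := (M.d h).prodMap (N.d h)
  lsmul h := LinearMap.mk₂ K (fun a p => (M.lsmul h a p.1, N.lsmul h a p.2))
    (fun a a' p => by simp) (fun c a p => by simp) (fun a p p' => by simp) (fun c a p => by simp)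
  rsmul h := LinearMap.mk₂ K (fun p b => (M.rsmul h p.1 b, N.rsmul h p.2 b))
    (fun a a' p => by simp) (fun c a p => by simp) (fun a p p' => by simp) (fun c a p => by simp)
  d_d h h' x := Prod.ext (M.d_d h h' x.1) (N.d_d h h' x.2)
  one_lsmul h x := Prod.ext (M.one_lsmul h x.1) (N.one_lsmul h x.2)
  rsmul_one h x := Prod.ext (M.rsmul_one h x.1) (N.rsmul_one h x.2)
  mul_lsmul h₁ h₂ h₃ h₄ a b x :=
    Prod.ext (M.mul_lsmul h₁ h₂ h₃ h₄ a b x.1) (N.mul_lsmul h₁ h₂ h₃ h₄ a b x.2)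
  rsmul_mul h₁ h₂ h₃ h₄ x a b :=
    Prod.ext (M.rsmul_mul h₁ h₂ h₃ h₄ x.1 a b) (N.rsmul_mul h₁ h₂ h₃ h₄ x.2 a b)
  lsmul_rsmul h₁ h₂ h₃ h₄ a x b :=
    Prod.ext (M.lsmul_rsmul h₁ h₂ h₃ h₄ a x.1 b) (N.lsmul_rsmul h₁ h₂ h₃ h₄ a x.2 b)
  lleibniz h hi hj hk hl hr a x :=
    Prod.ext (M.lleibniz h hi hj hk hl hr a x.1) (N.lleibniz h hi hj hk hl hr a x.2)
  rleibniz h hi hj hk hl hr x b :=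
    Prod.ext (M.rleibniz h hi hj hk hl hr x.1 b) (N.rleibniz h hi hj hk hl hr x.2 b)

section Sum

variable (M N : DGBimod A B)

/-- The first inclusion. -/
def sumInl : M ⟶ sum M N where
  f i := LinearMap.inl K _ _
  comm h x := Prod.ext rfl (map_zero (N.d h)).symm
  map_lsmul h a x := Prod.ext rfl (map_zero (N.lsmul h a)).symm
  map_rsmul h x b := Prod.ext rfl (by
    change 0 = N.rsmul h 0 b
    simp)

/-- The second inclusion. -/
def sumInr : N ⟶ sum M N where
  f i := LinearMap.inr K _ _
  comm h x := Prod.ext (map_zero (M.d h)).symm rfl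
  map_lsmul h a x := Prod.ext (map_zero (M.lsmul h a)).symm rfl
  map_rsmul h x b := Prod.ext (by
    change 0 = M.rsmul h 0 b
    simp) rfl

/-- The first projection. -/
def sumFst : sum M N ⟶ M where
  f _ := LinearMap.fst K _ _
  comm _ _ := rfl
  map_lsmul _ _ _ := rfl
  map_rsmul _ _ _ := rfl

/-- The second projection. -/
def sumSnd : sum M N ⟶ N where
  f _ := LinearMap.snd K _ _
  comm _ _ := rfl
  map_lsmul _ _ _ := rfl
  map_rsmul _ _ _ := rfl

variable {M N}

/-- The morphism out of a direct sum with given components. -/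
def sumDesc {L : DGBimod A B} (f : M ⟶ L) (g : N ⟶ L) : sum M N ⟶ L where
  f i := (f.f i).coprod (g.f i)
  comm h x := by
    change f.f _ (M.d h x.1) + g.f _ (N.d h x.2) = L.d h (f.f _ x.1 + g.f _ x.2)
    rw [map_add, f.comm, g.comm]
  map_lsmul h a x := by
    change f.f _ (M.lsmul h a x.1) + g.f _ (N.lsmul h a x.2) = L.lsmul h a (f.f _ x.1 + g.f _ x.2)
    rw [map_add, f.map_lsmul, g.map_lsmul]
  map_rsmul h x b := by
    change f.f _ (M.rsmul h x.1 b) + g.f _ (N.rsmul h x.2 b) = L.rsmul h (f.f _ x.1 + g.f _ x.2) b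
    rw [map_add, LinearMap.add_apply, f.map_rsmul, g.map_rsmul]

lemma sumInl_desc {L : DGBimod A B} (f : M ⟶ L) (g : N ⟶ L) : sumInl M N ≫ sumDesc f g = f :=
  hom_ext fun i x => by
    change f.f i x + g.f i 0 = f.f i x
    rw [map_zero, add_zero]

lemma sumInr_desc {L : DGBimod A B} (f : M ⟶ L) (g : N ⟶ L) : sumInr M N ≫ sumDesc f g = g :=
  hom_ext fun i x => by
    change f.f i 0 + g.f i x = g.f i x
    rw [map_zero, zero_add]

end Sum

/-- Morphisms of DG bimodules which differ by the boundary of a graded bimodule map. -/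
def Homotopic {M N : DGBimod A B} (f g : M ⟶ N) : Prop :=
  ∃ h : KMap M N 1, h.BLin ∧ h.D (zero_add 1) = ofHom f - ofHom g

/-- The zero morphism. -/
def zeroHom (M N : DGBimod A B) : M ⟶ N where
  f _ := 0
  comm h x := by simp
  map_lsmul h a x := by simp
  map_rsmul h x b := by simp

lemma ofHom_zeroHom (M N : DGBimod A B) : ofHom (zeroHom M N) = 0 := KMap.ext fun i j h x => by
  obtain rfl : j = i := by omega
  rfl

section Homotopic

variable {M N L : DGBimod A B}

lemma Homotopic.refl (f : M ⟶ N) : Homotopic f f := ⟨0, .zero, by simp⟩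

lemma Homotopic.symm {f g : M ⟶ N} (h : Homotopic f g) : Homotopic g f := by
  obtain ⟨s, hs, e⟩ := h
  exact ⟨(-1 : ℤ) • s, hs.zsmul _, by rw [D_zsmul, e]; simp⟩

lemma Homotopic.trans {f g h : M ⟶ N} (h₁ : Homotopic f g) (h₂ : Homotopic g h) :
    Homotopic f h := by
  obtain ⟨s, hs, e⟩ := h₁
  obtain ⟨t, ht, e'⟩ := h₂
  exact ⟨s + t, hs.add ht, by rw [D_add, e, e']; simp⟩

lemma Homotopic.comp_right {f g : M ⟶ N} (h : Homotopic f g) (k : N ⟶ L) :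
    Homotopic (f ≫ k) (g ≫ k) := by
  obtain ⟨s, hs, e⟩ := h
  refine ⟨s.comp (ofHom k) (add_zero 1), hs.comp (ofHom_bLin k) _, ?_⟩
  rw [(ofHom_closed k).D_comp_right s _ _ (zero_add 1) (add_zero 0), e, sub_comp, ofHom_comp,
    ofHom_comp, sgn_zero, one_smul]

lemma Homotopic.comp_left {f g : M ⟶ N} (k : L ⟶ M) (h : Homotopic f g) :
    Homotopic (k ≫ f) (k ≫ g) := by
  obtain ⟨s, hs, e⟩ := h
  refine ⟨(ofHom k).comp s (zero_add 1), (ofHom_bLin k).comp hs _, ?_⟩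
  rw [(ofHom_closed k).D_comp_left s _ _ (zero_add 1) (add_zero 0), e, comp_sub, ofHom_comp,
    ofHom_comp]

end Homotopic

end Constructions

section HProj

open KMap

variable {A B : DGA K}

/-- Homotopically projective bimodules: every closed graded bimodule map to an acyclic bimodule is
a boundary. -/
def HProj (P : DGBimod A B) : Prop :=
  ∀ (N : DGBimod A B), N.Acyclic → ∀ (k k' : ℤ) (hk : k + 1 = k') (g : KMap P N k), g.Closed →
    g.BLin → ∃ h : KMap P N k', h.BLin ∧ h.D hk = g

variable {P P' N N' : DGBimod A B}

/-- Closed maps from a homotopically projective bimodule lift along quasi-isomorphisms up to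
homotopy. -/
lemma HProj.exists_lift (hP : P.HProj) {f : N ⟶ N'} (hf : quasiIso A B f)
    (hk : k + 1 = k') (g : KMap P N' k) (hg : g.Closed) (hgb : g.BLin) :
    ∃ g₀ : KMap P N k, g₀.Closed ∧ g₀.BLin ∧ ∃ h : KMap P N' k', h.BLin ∧
      h.D hk = g - g₀.comp (ofHom f) (add_zero k) := by
  obtain ⟨h, hb, e⟩ := hP _ (acyclic_cone hf) k k' hk (g.comp (coneInl f) (add_zero k))
    (hg.comp (coneInl_closed f) _) (hgb.comp (coneInl_bLin f) _)
  refine ⟨h.comp (coneSnd f) (by omega), ?_, hb.comp (coneSnd_bLin f) _,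
    h.comp (coneFst f) (add_zero k'), hb.comp (coneFst_bLin f) _, ?_⟩
  · rw [closed_iff (sub_add_cancel k 1), (coneSnd_closed f).D_comp_right h _ _ hk (by omega), e,
      comp_assoc _ _ _ _ _ (zero_add (-1)) (by omega), coneInl_comp_coneSnd]
    simp
  · rw [D_comp h (coneFst f) _ hk hk (neg_add_cancel 1) (by omega) (add_zero k), e,
      comp_assoc _ _ _ _ _ (add_zero 0) (add_zero k), coneInl_comp_coneFst, comp_one, D_coneFst,
      sgn_zero, one_smul, comp_assoc _ _ _ _ _ (by omega : -1 + 0 = -1) (by omega), comp_neg]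
    abel

/-- Closed maps from a homotopically projective bimodule which become boundaries after a
quasi-isomorphism are boundaries. -/
lemma HProj.exists_of_comp (hP : P.HProj) {f : N ⟶ N'} (hf : quasiIso A B f)
    (hk : k + 1 = k') (g : KMap P N k) (hg : g.Closed) (hgb : g.BLin) (w : KMap P N' k')
    (hw : w.BLin) (e : w.D hk = g.comp (ofHom f) (add_zero k)) :
    ∃ h : KMap P N k', h.BLin ∧ h.D hk = g := by
  obtain ⟨v, hv, ev⟩ := hP _ (acyclic_cone hf) k' (k' + 1) rfl
    (g.comp (coneInr f) hk - w.comp (coneInl f) (add_zero k')) (by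
      rw [closed_iff hk, D_sub, hg.D_comp_left _ _ hk (zero_add 1) (add_zero k), D_coneInr,
        (coneInl_closed f).D_comp_right w _ _ hk (add_zero k), e, sgn_zero, one_smul,
        comp_assoc _ _ _ _ _ (add_zero 0) (add_zero k), sub_self])
    ((hgb.comp (coneInr_bLin f) _).sub (hw.comp (coneInl_bLin f) _))
  refine ⟨(-1 : ℤ) • v.comp (coneSnd f) (by omega), (hv.comp (coneSnd_bLin f) _).zsmul _, ?_⟩
  rw [D_zsmul, (coneSnd_closed f).D_comp_right v _ _ rfl (by omega), ev, sub_comp,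
    comp_assoc _ _ _ _ _ (by omega : 1 + -1 = 0) (add_zero k), coneInr_comp_coneSnd,
    comp_assoc _ _ _ _ _ (by omega : 0 + -1 = -1) (by omega), coneInl_comp_coneSnd, sgn_neg,
    sgn_one]
  simp

/-- Being homotopically projective is invariant under homotopy retracts. -/
lemma HProj.of_retract (hP : P'.HProj) (i : P ⟶ P') (r : P' ⟶ P) (h : Homotopic (i ≫ r) (𝟙 P)) :
    P.HProj := by
  intro N hN k k' hk g hg hgb
  obtain ⟨w, hw, e⟩ := hP N hN k k' hk ((ofHom r).comp g (zero_add k))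
    ((ofHom_closed r).comp hg _) ((ofHom_bLin r).comp hgb _)
  obtain ⟨s, hs, es⟩ := h
  refine ⟨(ofHom i).comp w (zero_add k') - sgn k • s.comp g (by omega),
    ((ofHom_bLin i).comp hw _).sub ((hs.comp hgb _).zsmul _), ?_⟩
  rw [D_sub, D_zsmul, (ofHom_closed i).D_comp_left w _ _ hk (zero_add k), e,
    hg.D_comp_right s _ _ (zero_add 1) (zero_add k), es, smul_smul, sgn_mul_self, one_smul,
    sub_comp, ofHom_comp, ofHom_id, one_comp, comp_assoc _ _ _ _ _ (zero_add k) (zero_add k)]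
  abel

lemma HProj.shift (hP : P.HProj) (n : ℤ) : (P.shift n).HProj := by
  intro N hN k k' hk g hg hgb
  obtain ⟨w, hw, e⟩ := hP N hN (n + k) (n + k') (by omega) ((toShift P n).comp g rfl)
    ((toShift_closed P n).comp hg _) ((toShift_bLin P n).comp hgb _)
  refine ⟨(ofShift P n (add_neg_cancel n)).comp w (by omega),
    (ofShift_bLin P n _).comp hw _, ?_⟩
  rw [(ofShift_closed P n _).D_comp_left w _ hk (by omega : n + k + 1 = n + k') (by omega), e,
    ← comp_assoc _ _ _ (neg_add_cancel n) (zero_add k), ofShift_comp_toShift, one_comp]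

/-- A quasi-isomorphism between homotopically projective bimodules has a homotopy inverse. -/
lemma HProj.exists_homotopy_inverse (hP : P.HProj) (hP' : P'.HProj) {f : P ⟶ P'}
    (hf : quasiIso A B f) :
    ∃ g : P' ⟶ P, Homotopic (g ≫ f) (𝟙 P') ∧ Homotopic (f ≫ g) (𝟙 P) := by
  obtain ⟨g, hg, hgb, h, hb, e⟩ := hP'.exists_lift hf (zero_add 1) (one P') one_closed
    (ofHom_bLin (𝟙 P'))
  have h1 : Homotopic (g.toHom hg hgb ≫ f) (𝟙 P') :=
    Homotopic.symm ⟨h, hb, by rw [e, ofHom_comp, ofHom_toHom, ofHom_id]⟩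
  refine ⟨g.toHom hg hgb, h1, ?_⟩
  obtain ⟨s, hs, es⟩ := Homotopic.comp_left f h1
  obtain ⟨w, hw, ew⟩ := hP.exists_of_comp hf (zero_add 1)
    (ofHom (f ≫ g.toHom hg hgb) - ofHom (𝟙 P)) ((ofHom_closed _).sub (ofHom_closed _))
    ((ofHom_bLin _).sub (ofHom_bLin _)) s hs (by
      rw [es, sub_comp, ← ofHom_comp, ← ofHom_comp, Category.assoc, Category.id_comp,
        Category.comp_id])
  exact ⟨w, hw, ew⟩

/-- Homotopic morphisms agree in the derived category. -/
lemma Homotopic.Q_map_eq {M N : DGBimod A B} {f g : M ⟶ N} (h : Homotopic f g) :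
    (Q : DGBimod A B ⥤ Derived A B).map f = Q.map g := by
  obtain ⟨s, hs, e⟩ := h
  let m : M ⟶ sum M M := ((ofHom (sumInl M M)) - ofHom (sumInr M M)).toHom
    ((ofHom_closed _).sub (ofHom_closed _)) ((ofHom_bLin _).sub (ofHom_bLin _))
  have hm : ofHom m = ofHom (sumInl M M) - ofHom (sumInr M M) := ofHom_toHom _ _ _
  let c : sum M M ⟶ cone m := (coneInl m).toHom (coneInl_closed m) (coneInl_bLin m)
  have hc : ofHom c = coneInl m := ofHom_toHom _ _ _
  have hmd : ∀ {L : DGBimod A B} (a b : M ⟶ L), ofHom (m ≫ sumDesc a b) =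
      ofHom a - ofHom b := fun a b => by
    rw [ofHom_comp, hm, sub_comp, ← ofHom_comp, ← ofHom_comp, sumInl_desc, sumInr_desc]
  let p := coneDesc m (sumDesc (𝟙 M) (𝟙 M)) 0 .zero (by rw [hmd]; simp)
  let q := coneDesc m (sumDesc f g) s hs (by rw [hmd, e])
  let i := sumInr M M ≫ coneInclusion m
  have hpr : i ≫ p = 𝟙 M := by rw [Category.assoc, coneInclusion_desc, sumInr_desc]
  have hpi : (sumInl M M ≫ coneInclusion m) ≫ p = 𝟙 M := by
    rw [Category.assoc, coneInclusion_desc, sumInl_desc]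
  have hqp : quasiIso A B p := by
    rw [← qis_ofHom_iff]
    refine KMap.qis_of_comp_qis (g := ofHom i) (h := add_zero 0) (h' := add_zero 0) ?_ ?_
      (ofHom_closed _)
    · refine (one_qis (M := cone m)).of_homotopy (zero_add 1)
        ((coneFst m).comp ((ofHom (sumFst M M)).comp (coneInr m) (zero_add 1)) (zero_add 1)) ?_
      have h₁ : (ofHom m).comp (ofHom (sumFst M M)) (add_zero 0) = one M := by
        rw [hm, sub_comp, ← ofHom_comp, ← ofHom_comp]
        refine KMap.ext fun i j h x => ?_
        obtain rfl : j = i := by omega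
        rw [sub_app, one_app, ofHom_app, ofHom_app]
        exact sub_zero x
      have h₂ : (ofHom (sumFst M M)).comp (ofHom m) (add_zero 0) = one (sum M M) -
          (ofHom (sumDesc (𝟙 M) (𝟙 M))).comp (ofHom (sumInr M M)) (add_zero 0) := by
        rw [hm]
        refine KMap.ext fun i j h x => ?_
        obtain rfl : j = i := by omega
        rw [sub_app, comp_app _ _ _ _ h h, comp_app _ _ _ _ h h]
        refine Prod.ext ?_ ?_
        · change x.1 - 0 = x.1 - 0
          rfl
        · change 0 - x.1 = x.2 - (x.1 + x.2)
          abel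
      have h₃ : ((coneFst m).comp (ofHom (sumFst M M)) (add_zero 0)).comp
          ((ofHom m).comp (coneInl m) (add_zero 0)) (add_zero 0) =
          (coneFst m).comp (coneInl m) (add_zero 0) -
            (ofHom p).comp (ofHom i) (add_zero 0) := by
        rw [comp_assoc _ _ _ _ _ (add_zero 0) (add_zero 0),
          ← comp_assoc _ _ (coneInl m) (add_zero 0) (add_zero 0), h₂, sub_comp, one_comp, comp_sub,
          ofHom_coneDesc, ofHom_comp, ofHom_coneInclusion, comp_zero, add_zero,
          comp_assoc _ _ _ _ _ (add_zero 0) (add_zero 0),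
          comp_assoc _ _ _ _ _ (add_zero 0) (add_zero 0)]
      have h₄ : ((coneSnd m).comp (ofHom m) (add_zero (-1))).comp
          ((ofHom (sumFst M M)).comp (coneInr m) (zero_add 1)) (by omega) =
          (coneSnd m).comp (coneInr m) (by omega : -1 + 1 = 0) := by
        rw [comp_assoc _ _ _ _ _ (zero_add 1) (by omega),
          ← comp_assoc _ _ (coneInr m) (add_zero 0) (by omega), h₁, one_comp]
      rw [comp_assoc _ _ _ _ _ (add_zero 0) (add_zero 0)] at h₃
      rw [D_comp _ _ _ (zero_add 1) (neg_add_cancel 1) (zero_add 1) (add_zero 0) (by omega),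
        (ofHom_closed _).D_comp_left _ _ _ (zero_add 1) (add_zero 0), D_coneInr, D_coneFst,
        neg_comp, h₃, h₄, sgn_one, neg_smul, one_smul, neg_neg, ← coneFst_comp_coneInl_add]
      abel
    · rw [← ofHom_comp, hpr, ofHom_id]
      exact one_qis
  have : IsIso (Q.map p) := (isIso_Q_map_iff p).2 hqp
  have e1 : Q.map (sumInl M M ≫ coneInclusion m) = Q.map i := by
    rw [← cancel_mono (Q.map p), ← Functor.map_comp, ← Functor.map_comp, hpi, hpr]
  have e2 := congrArg (fun z => z ≫ Q.map q) e1
  simpa only [i, q, ← Functor.map_comp, Category.assoc, coneInclusion_desc, sumInl_desc,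
    sumInr_desc] using e2

/-- Homotopy classes of morphisms out of `P`. -/
def homotopyClasses (P : DGBimod A B) : DGBimod A B ⥤ Type u where
  obj N := Quot (Homotopic (M := P) (N := N))
  map f := ↾(Quot.map (fun g => g ≫ f) fun _ _ h => h.comp_right f)
  map_id N := by
    ext ⟨g⟩
    exact congrArg (Quot.mk _) (Category.comp_id g)
  map_comp f f' := by
    ext ⟨g⟩
    exact congrArg (Quot.mk _) (Category.assoc g f f').symm

lemma homotopic_of_quot_eq {M N : DGBimod A B} {f g : M ⟶ N}
    (h : Quot.mk Homotopic f = Quot.mk Homotopic g) : Homotopic f g := by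
  rw [Quot.eq] at h
  induction h with
  | rel _ _ h => exact h
  | refl _ => exact .refl _
  | symm _ _ _ h => exact h.symm
  | trans _ _ _ _ _ h h' => exact h.trans h'

lemma HProj.exists_comp_homotopic (hP : P.HProj) {f : N ⟶ N'} (hf : quasiIso A B f) (g : P ⟶ N') :
    ∃ g₀ : P ⟶ N, Homotopic (g₀ ≫ f) g := by
  obtain ⟨g₀, hc, hb, h, hhb, e⟩ := hP.exists_lift hf (zero_add 1) (ofHom g) (ofHom_closed g)
    (ofHom_bLin g)
  exact ⟨g₀.toHom hc hb, Homotopic.symm ⟨h, hhb, by rw [e, ofHom_comp, ofHom_toHom]⟩⟩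

lemma HProj.homotopic_of_comp (hP : P.HProj) {f : N ⟶ N'} (hf : quasiIso A B f) {g g' : P ⟶ N}
    (h : Homotopic (g ≫ f) (g' ≫ f)) : Homotopic g g' := by
  obtain ⟨s, hs, e⟩ := h
  obtain ⟨t, ht, e'⟩ := hP.exists_of_comp hf (zero_add 1) (ofHom g - ofHom g')
    ((ofHom_closed g).sub (ofHom_closed g')) ((ofHom_bLin g).sub (ofHom_bLin g')) s hs
    (by rw [e, sub_comp, ofHom_comp, ofHom_comp])
  exact ⟨t, ht, e'⟩

lemma HProj.homotopyClasses_inverts (hP : P.HProj) :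
    (quasiIso A B).IsInvertedBy (homotopyClasses P) := fun N N' f hf =>
  (isIso_iff_bijective _).2 ⟨by
    rintro ⟨g⟩ ⟨g'⟩ h
    exact Quot.sound (hP.homotopic_of_comp hf (homotopic_of_quot_eq h)), by
    rintro ⟨g⟩
    obtain ⟨g₀, h⟩ := hP.exists_comp_homotopic hf g
    exact ⟨Quot.mk _ g₀, Quot.sound h⟩⟩

/-- Morphisms from a homotopically projective bimodule which agree in the derived category are
homotopic. -/
lemma HProj.homotopic_of_Q_map_eq (hP : P.HProj) {f g : P ⟶ N}
    (h : (Q : DGBimod A B ⥤ Derived A B).map f = Q.map g) : Homotopic f g := by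
  have e := NatIso.naturality_1 (Localization.fac (homotopyClasses P)
    hP.homotopyClasses_inverts (Q : DGBimod A B ⥤ Derived A B)) f
  have e' := NatIso.naturality_1 (Localization.fac (homotopyClasses P)
    hP.homotopyClasses_inverts (Q : DGBimod A B ⥤ Derived A B)) g
  rw [Functor.comp_map, h] at e
  rw [Functor.comp_map, e] at e'
  have := homotopic_of_quot_eq (ConcreteCategory.congr_hom e' (Quot.mk _ (𝟙 P)))
  change Homotopic (𝟙 P ≫ f) (𝟙 P ≫ g) at this
  rwa [Category.id_comp, Category.id_comp] at this

/-- Every morphism in the derived category out of a homotopically projective bimodule comes from a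
morphism of bimodules. -/
lemma HProj.exists_Q_map_eq (hP : P.HProj)
    (φ : (Q : DGBimod A B ⥤ Derived A B).obj P ⟶ Q.obj N) : ∃ f : P ⟶ N, Q.map f = φ := by
  let q : DGBimod A B ⥤ Derived A B := Q
  let G := Localization.lift (homotopyClasses P) hP.homotopyClasses_inverts q
  let e : q ⋙ G ≅ homotopyClasses P := Localization.fac _ hP.homotopyClasses_inverts q
  let τ : homotopyClasses P ⋙ uliftFunctor.{u + 1} ⟶
      q ⋙ coyoneda.obj (Opposite.op (q.obj P)) :=
    { app := fun N => ↾(fun g => Quot.lift (fun f => q.map f) (fun _ _ h => h.Q_map_eq) g.down)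
      naturality := fun N N' f => by
        ext ⟨⟨g⟩⟩
        exact q.map_comp g f }
  let τ' : G ⋙ uliftFunctor.{u + 1} ⟶ coyoneda.obj (Opposite.op (q.obj P)) :=
    Localization.liftNatTrans q (quasiIso A B) (q ⋙ G ⋙ uliftFunctor.{u + 1})
      (q ⋙ coyoneda.obj (Opposite.op (q.obj P))) (G ⋙ uliftFunctor.{u + 1})
      (coyoneda.obj (Opposite.op (q.obj P)))
      (Functor.whiskerRight e.hom uliftFunctor.{u + 1} ≫ τ)
  have h1 : ∀ N, τ'.app (q.obj N) = uliftFunctor.{u + 1}.map (e.hom.app N) ≫ τ.app N := fun N => by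
    simp [τ', Localization.liftNatTrans_app]
  let u : G.obj (q.obj P) := e.inv.app P (Quot.mk _ (𝟙 P))
  have h2 : τ'.app (q.obj P) ⟨u⟩ = 𝟙 (q.obj P) := by
    rw [h1]
    change τ.app P ⟨e.hom.app P (e.inv.app P _)⟩ = _
    have : e.hom.app P (e.inv.app P (Quot.mk _ (𝟙 P))) = Quot.mk _ (𝟙 P) :=
      ConcreteCategory.congr_hom (e.inv_hom_id_app P) _
    rw [this]
    exact q.map_id P
  have h3 : τ'.app (q.obj N) ⟨G.map φ u⟩ = φ := by
    have := ConcreteCategory.congr_hom (τ'.naturality φ) ⟨u⟩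
    refine this.trans ?_
    change τ'.app (q.obj P) ⟨u⟩ ≫ φ = φ
    rw [h2, Category.id_comp]
  rw [h1] at h3
  obtain ⟨f, hf⟩ := Quot.exists_rep (e.hom.app N (G.map φ u))
  refine ⟨f, ?_⟩
  change τ.app N ⟨e.hom.app N (G.map φ u)⟩ = φ at h3
  rw [← hf] at h3
  exact h3

end HProj

section DirectSums

variable {A B : DGA K} {ι : Type u} (M : ι → DGBimod A B)

open Classical in
/-- The direct sum of a family of DG bimodules. -/
noncomputable def bigSum : DGBimod A B where
  X i := DirectSum ι fun v => (M v).X i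
  d {_ j} h := DirectSum.toModule K ι _ fun v =>
    (DirectSum.lof K ι (fun v => (M v).X j) v).comp ((M v).d h)
  lsmul {_ _ k} h := LinearMap.flip (DirectSum.toModule K ι _ fun v =>
    ((M v).lsmul h).flip.compr₂ (DirectSum.lof K ι (fun v => (M v).X k) v))
  rsmul {_ _ k} h := DirectSum.toModule K ι _ fun v =>
    ((M v).rsmul h).compr₂ (DirectSum.lof K ι (fun v => (M v).X k) v)
  d_d h h' x := by
    induction x using DirectSum.induction_on with
    | zero => simp only [map_zero]
    | of v x =>
      simp only [← DirectSum.lof_eq_of K, DirectSum.toModule_lof, LinearMap.comp_apply, (M v).d_d,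
        map_zero]
    | add x y hx hy => simp only [map_add, hx, hy, add_zero]
  one_lsmul h x := by
    induction x using DirectSum.induction_on with
    | zero => simp only [map_zero]
    | of v x =>
      simp only [← DirectSum.lof_eq_of K, LinearMap.flip_apply, DirectSum.toModule_lof,
        LinearMap.compr₂_apply, (M v).one_lsmul]
    | add x y hx hy => simp only [map_add, hx, hy]
  rsmul_one h x := by
    induction x using DirectSum.induction_on with
    | zero => simp only [map_zero, LinearMap.zero_apply]
    | of v x =>
      simp only [← DirectSum.lof_eq_of K, DirectSum.toModule_lof,
        LinearMap.compr₂_apply, (M v).rsmul_one]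
    | add x y hx hy => simp only [map_add, LinearMap.add_apply, hx, hy]
  mul_lsmul h₁ h₂ h₃ h₄ a b x := by
    induction x using DirectSum.induction_on with
    | zero => simp only [map_zero]
    | of v x =>
      simp only [← DirectSum.lof_eq_of K, LinearMap.flip_apply, DirectSum.toModule_lof,
        LinearMap.compr₂_apply, (M v).mul_lsmul h₁ h₂ h₃ h₄]
    | add x y hx hy => simp only [map_add, hx, hy]
  rsmul_mul h₁ h₂ h₃ h₄ x a b := by
    induction x using DirectSum.induction_on with
    | zero => simp only [map_zero, LinearMap.zero_apply]
    | of v x =>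
      simp only [← DirectSum.lof_eq_of K, DirectSum.toModule_lof,
        LinearMap.compr₂_apply, (M v).rsmul_mul h₁ h₂ h₃ h₄]
    | add x y hx hy => simp only [map_add, LinearMap.add_apply, hx, hy]
  lsmul_rsmul h₁ h₂ h₃ h₄ a x b := by
    induction x using DirectSum.induction_on with
    | zero => simp only [map_zero, LinearMap.zero_apply]
    | of v x =>
      simp only [← DirectSum.lof_eq_of K, LinearMap.flip_apply, DirectSum.toModule_lof,
        LinearMap.compr₂_apply, (M v).lsmul_rsmul h₁ h₂ h₃ h₄]
    | add x y hx hy => simp only [map_add, LinearMap.add_apply, hx, hy]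
  lleibniz h hi hj hk hl hr a x := by
    induction x using DirectSum.induction_on with
    | zero => simp only [map_zero, smul_zero, add_zero]
    | of v x =>
      simp only [← DirectSum.lof_eq_of K, LinearMap.flip_apply, DirectSum.toModule_lof,
        LinearMap.compr₂_apply, LinearMap.comp_apply, (M v).lleibniz h hi hj hk hl hr, map_add,
        map_zsmul]
    | add x y hx hy => simp only [map_add, hx, hy, smul_add]; abel
  rleibniz h hi hj hk hl hr x b := by
    induction x using DirectSum.induction_on with
    | zero => simp only [map_zero, LinearMap.zero_apply, smul_zero, add_zero]
    | of v x =>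
      simp only [← DirectSum.lof_eq_of K, DirectSum.toModule_lof,
        LinearMap.compr₂_apply, LinearMap.comp_apply, (M v).rleibniz h hi hj hk hl hr, map_add,
        map_zsmul]
    | add x y hx hy => simp only [map_add, LinearMap.add_apply, hx, hy, smul_add]; abel

open Classical in
/-- The inclusion of a summand. -/
noncomputable def bigIn (v : ι) : M v ⟶ bigSum M where
  f i := DirectSum.lof K ι (fun v => (M v).X i) v
  comm {i j} h x := (DirectSum.toModule_lof (M := fun v => (M v).X i) K (φ := fun v =>
    (DirectSum.lof K ι (fun v => (M v).X j) v).comp ((M v).d h)) v x).symm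
  map_lsmul {_ j k} h a x := (LinearMap.congr_fun
    (DirectSum.toModule_lof (M := fun v => (M v).X j) K (φ := fun v =>
      ((M v).lsmul h).flip.compr₂ (DirectSum.lof K ι (fun v => (M v).X k) v)) v x) a).symm
  map_rsmul {i _ k} h x b := (LinearMap.congr_fun
    (DirectSum.toModule_lof (M := fun v => (M v).X i) K (φ := fun v =>
      ((M v).rsmul h).compr₂ (DirectSum.lof K ι (fun v => (M v).X k) v)) v x) b).symm

variable {M}

lemma bigSum_induction {P : (bigSum M).X i → Prop} (hz : P 0)
    (hof : ∀ v x, P ((bigIn M v).f i x)) (hadd : ∀ x y, P x → P y → P (x + y))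
    (x : (bigSum M).X i) : P x := by
  classical
  exact DirectSum.induction_on (motive := P) x hz (fun v x => hof v x) hadd

open Classical in
/-- The graded map out of a direct sum with given components. -/
noncomputable def bigDesc {A' B' : DGA K} {L : DGBimod A' B'} (t : ∀ v, KMap (M v) L k) :
    KMap (bigSum M) L k :=
  KMap.mk fun _ _ h => DirectSum.toModule K ι _ fun v => (t v).app h

lemma bigDesc_in {A' B' : DGA K} {L : DGBimod A' B'} (t : ∀ v, KMap (M v) L k)
    (h : i + k = j) (v : ι) (x : (M v).X i) :
    (bigDesc t).app h ((bigIn M v).f i x) = (t v).app h x := by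
  classical
  exact DirectSum.toModule_lof (M := fun v => (M v).X i) K (φ := fun v => (t v).app h) v x

lemma bigDesc_bLin {L : DGBimod A B} {t : ∀ v, KMap (M v) L k} (ht : ∀ v, (t v).BLin) :
    (bigDesc t).BLin := by
  constructor
  · intro i j l i' j' h h' hl hl' a x
    induction x using bigSum_induction with
    | hz => simp only [map_zero, smul_zero]
    | hof v x =>
      rw [← (bigIn M v).map_lsmul, bigDesc_in, bigDesc_in, (ht v).1 i j l i' j' h h' hl hl' a x]
    | hadd x y hx hy => simp only [map_add, smul_add, hx, hy]
  · intro i j l i' j' h h' hl hl' x b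
    induction x using bigSum_induction with
    | hz => simp only [map_zero, LinearMap.zero_apply]
    | hof v x =>
      rw [← (bigIn M v).map_rsmul, bigDesc_in, bigDesc_in, (ht v).2 i j l i' j' h h' hl hl' x b]
    | hadd x y hx hy => simp only [map_add, LinearMap.add_apply, hx, hy]

end DirectSums

section Free

open KMap

variable (A B : DGA K)

/-- The free DG bimodule `A ⊗_K B` on one generator of degree `0`. -/
noncomputable def freeOne : DGBimod A B := tensor (regular A).left (regular B).right

variable {A B}

/-- The elements `a ⊗ b` of the free bimodule. -/
noncomputable def freeTm (h : i + j = n) :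
    A.X i →ₗ[K] B.X j →ₗ[K] (freeOne A B).X n :=
  tm (regular A).left (regular B).right h

lemma d_freeTm {i j n i' j' n' : ℤ} (h : i + j = n) (hn : n' + 1 = n) (hi : i' + 1 = i)
    (hj : j' + 1 = j) (hl : i' + j = n') (hr : i + j' = n') (a : A.X i) (b : B.X j) :
    (freeOne A B).d hn (freeTm h a b) =
      freeTm hl (A.d hi a) b + sgn i • freeTm hr a (B.d hj b) :=
  d_tm (M := (regular A).left) (N := (regular B).right) h hn hi hj hl hr a b

variable (A B) in
/-- The generator of the free bimodule. -/
noncomputable def freeGen : (freeOne A B).X 0 := freeTm (add_zero 0) A.one B.one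

lemma freeOne_lsmul {i p q m n ip : ℤ} (h : i + m = n) (hm : p + q = m) (hip : i + p = ip)
    (hn : ip + q = n) (a : A.X i) (b : A.X p) (c : B.X q) :
    (freeOne A B).lsmul h a (freeTm hm b c) = freeTm hn (A.mul hip a b) c :=
  lsmul_tm (M := (regular A).left) (N := (regular B).right) h hm hip hn a b c

lemma freeOne_rsmul {i p q m n qi : ℤ} (h : m + i = n) (hm : p + q = m) (hqi : q + i = qi)
    (hn : p + qi = n) (a : A.X p) (b : B.X q) (c : B.X i) :
    (freeOne A B).rsmul h (freeTm hm a b) c = freeTm hn a (B.mul hqi b c) :=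
  rsmul_tm (M := (regular A).left) (N := (regular B).right) h hm hqi hn a b c

lemma d_one (h : j + 1 = 0) : A.d h A.one = 0 := by
  have := A.leibniz (add_zero 0) h h h (by omega) (by omega) A.one A.one
  rw [A.one_mul, A.mul_one, A.one_mul, sgn_zero, one_smul] at this
  simpa using this

lemma d_freeGen (h : j + 1 = 0) : (freeOne A B).d h (freeGen A B) = 0 := by
  rw [freeGen, d_freeTm (add_zero 0) h h h (by omega) (by omega), d_one, d_one, map_zero,
    map_zero, smul_zero, LinearMap.zero_apply, add_zero]

lemma freeOne_induction {P : (freeOne A B).X n → Prop}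
    (h0 : ∀ (i j : ℤ) (h : i + j = n) (a : A.X i) (b : B.X j), P (freeTm h a b))
    (hz : P 0) (hadd : ∀ s t, P s → P t → P (s + t)) (t : (freeOne A B).X n) : P t :=
  tm_induction (M := (regular A).left) (N := (regular B).right) h0 hz hadd t

/-- The bilinear maps `(a, b) ↦ (-1)^{|y||a|} a y b`. -/
def freeAux {L : DGBimod A B} (y : L.X k) (h : n + k = j) (p q : ℤ)
    (hpq : p + q = n) : A.X p →ₗ[K] B.X q →ₗ[K] L.X j :=
  sgn (k * p) • (L.rsmul (by omega : p + k + q = j)).comp ((L.lsmul rfl).flip y)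

lemma freeAux_apply {L : DGBimod A B} (y : L.X k) {n j p q r : ℤ} (h : n + k = j)
    (hpq : p + q = n) (hr : p + k = r) (hj : r + q = j) (a : A.X p) (b : B.X q) :
    freeAux y h p q hpq a b = sgn (k * p) • L.rsmul hj (L.lsmul hr a y) b := by
  subst hr; rfl

lemma unit_app_zero (u : (ground K).X 0) : A.unit.f 0 u = u.1 • A.one := by
  simp only [DGA.unit, dite_true]
  rfl

lemma ground_eq_zero (hi : i ≠ 0) (u : (ground K).X i) : u = 0 := Subtype.ext (u.2 hi)

lemma freeAux_balanced {L : DGBimod A B} (y : L.X k) (h : n + k = j) :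
    Balanced (M := (regular A).left) (N := (regular B).right) (freeAux y h) := by
  intro p q l pl lq h₁ h₂ h₃ h₄ x b z
  have key : ∀ (x : A.X p) (z : B.X q), freeAux y h pl q h₂ (A.mul h₁ x (A.unit.f l b)) z =
      freeAux y h p lq h₄ x (B.mul h₃ (B.unit.f l b) z) := fun x z => by
    by_cases hl : l = 0
    · subst hl
      obtain rfl : pl = p := by omega
      obtain rfl : lq = q := by omega
      rw [unit_app_zero, unit_app_zero]
      simp only [map_smul, LinearMap.smul_apply, A.mul_one, B.one_mul]
    · rw [ground_eq_zero hl b]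
      simp only [map_zero, LinearMap.zero_apply]
  exact key x z

/-- The graded map out of the free bimodule sending the generator to a given element. -/
noncomputable def freeMap {L : DGBimod A B} (y : L.X k) : KMap (freeOne A B) L k :=
  KMap.mk fun _ _ h => tmLift (M := (regular A).left) (N := (regular B).right) (freeAux y h)
    (freeAux_balanced y h)

lemma freeMap_tm {L : DGBimod A B} (y : L.X k) {n j p q r : ℤ} (h : n + k = j)
    (hpq : p + q = n) (hr : p + k = r) (hj : r + q = j) (a : A.X p) (b : B.X q) :
    (freeMap y).app h (freeTm hpq a b) = sgn (k * p) • L.rsmul hj (L.lsmul hr a y) b :=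
  (tmLift_tm (M := (regular A).left) (N := (regular B).right) _ (freeAux_balanced y h) hpq a
    b).trans (freeAux_apply y h hpq hr hj a b)

lemma freeMap_gen {L : DGBimod A B} (y : L.X k) (h : 0 + k = k) :
    (freeMap y).app h (freeGen A B) = y := by
  rw [freeGen, freeMap_tm y h (add_zero 0) (zero_add k) (add_zero k), L.rsmul_one, L.one_lsmul,
    mul_zero, sgn_zero, one_smul]

lemma freeMap_bLin {L : DGBimod A B} (y : L.X k) : (freeMap (A := A) (B := B) y).BLin := by
  constructor
  · intro i j l i' j' h h' hl hl' a x
    induction x using freeOne_induction with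
    | hz => simp only [map_zero, smul_zero]
    | h0 p q hpq b c =>
      rw [freeOne_lsmul hl hpq rfl (by omega), freeMap_tm y h' _ (by omega : l + p + k = l + (p + k)) (by omega),
        freeMap_tm y h _ rfl (by omega), map_zsmul, smul_smul, ← sgn_add,
        L.mul_lsmul _ _ rfl rfl,
        L.lsmul_rsmul _ _ (by omega : p + k + q = j) hl']
      congr 1
      exact sgn_congr 0 (by ring)
    | hadd x y hx hy => simp only [map_add, smul_add, hx, hy]
  · intro i j l i' j' h h' hl hl' x b
    induction x using freeOne_induction with
    | hz => simp only [map_zero, LinearMap.zero_apply]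
    | h0 p q hpq a c =>
      rw [freeOne_rsmul hl hpq rfl (by omega), freeMap_tm y h' _ rfl (by omega),
        freeMap_tm y h _ rfl (by omega), map_zsmul, LinearMap.smul_apply,
        L.rsmul_mul _ _ _ _]
    | hadd x y hx hy => simp only [map_add, LinearMap.add_apply, hx, hy]

lemma freeOne_ext {L : DGBimod A B} {t : KMap (freeOne A B) L k} (ht : t.BLin)
    (h : t.app (zero_add k) (freeGen A B) = 0) : t = 0 := KMap.ext fun i j hij x => by
  induction x using freeOne_induction with
  | hz => simp only [map_zero]
  | h0 p q hpq a b =>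
    have e : freeTm hpq a b = (freeOne A B).rsmul hpq
        ((freeOne A B).lsmul (add_zero p) a (freeGen A B)) b := by
      rw [freeGen, freeOne_lsmul _ _ (add_zero p) (add_zero p),
        freeOne_rsmul _ _ (zero_add q) hpq, A.mul_one, B.one_mul]
    rw [e, ht.2 p (p + k) q i j rfl hij hpq (by omega), ht.1 0 k p p (p + k) (zero_add k) rfl _ rfl, h]
    simp
  | hadd x y hx hy => simp only [map_add, hx, hy]

/-- A bimodule which is free as a graded bimodule on generators with zero differential. -/
structure IsFree (U : DGBimod A B) {Γ : ℤ → Type u} (γ : ∀ m, Γ m → U.X m) : Prop where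
  d_gen {m m' : ℤ} (h : m' + 1 = m) (v : Γ m) : U.d h (γ m v) = 0
  exists_map (L : DGBimod A B) (k : ℤ) (y : ∀ m j, m + k = j → Γ m → L.X j) :
    ∃ t : KMap U L k, t.BLin ∧ ∀ m j (h : m + k = j) v, t.app h (γ m v) = y m j h v
  eq_zero {L : DGBimod A B} {k : ℤ} {t : KMap U L k} (ht : t.BLin)
    (h : ∀ m j (h : m + k = j) v, t.app h (γ m v) = 0) : t = 0

lemma exists_isFree (Γ : ℤ → Type u) : ∃ (U : DGBimod A B) (γ : ∀ m, Γ m → U.X m), IsFree U γ := by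
  let M : (Σ m : ULift.{u} ℤ, Γ m.down) → DGBimod A B := fun v => (freeOne A B).shift v.1.down
  refine ⟨bigSum M, fun m v => (bigIn M ⟨⟨m⟩, v⟩).f m
    ((toShift (freeOne A B) m).app (zero_add m) (freeGen A B)), ?_, ?_, ?_⟩
  · intro m m' h v
    rw [← (bigIn M _).comm]
    have := (toShift_closed (freeOne A B) m).d_app (zero_add m) (by omega : -1 + 1 = 0) h (by omega)
      (freeGen A B)
    rw [d_freeGen, map_zero, smul_zero] at this
    exact (congrArg _ this).trans (map_zero _)
  · intro L k y
    refine ⟨bigDesc fun v => (ofShift (freeOne A B) v.1.down (add_neg_cancel _)).comp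
      (freeMap (y v.1.down (v.1.down + k) rfl v.2)) (by omega), bigDesc_bLin fun v =>
        (ofShift_bLin _ _ _).comp (freeMap_bLin _) _, fun m j h v => ?_⟩
    subst h
    refine (bigDesc_in (M := M) _ _ ⟨⟨m⟩, v⟩ _).trans ?_
    rw [comp_app _ _ _ _ (add_neg_cancel m) (zero_add (m + k)),
      ← comp_app _ _ (add_neg_cancel m) (add_zero 0), toShift_comp_ofShift, one_app, freeMap_gen]
  · intro L k t ht h
    refine KMap.ext fun i j hij x => ?_
    induction x using bigSum_induction with
    | hz => simp only [map_zero]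
    | hof v x =>
      obtain ⟨⟨m⟩, v⟩ := v
      have h1 : (toShift (freeOne A B) m).comp ((ofHom (bigIn M ⟨⟨m⟩, v⟩)).comp t (zero_add k))
          (rfl : m + k = m + k) = 0 := by
        refine freeOne_ext ((toShift_bLin _ _).comp ((ofHom_bLin _).comp ht _) _) ?_
        rw [comp_app _ _ _ _ (zero_add m) rfl, comp_app _ _ _ _ (add_zero m) rfl]
        exact h m _ rfl v
      have h2 : (ofHom (bigIn M ⟨⟨m⟩, v⟩)).comp t (zero_add k) = 0 := by
        rw [← one_comp ((ofHom (bigIn M ⟨⟨m⟩, v⟩)).comp t (zero_add k)) (zero_add k),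
          ← ofShift_comp_toShift (freeOne A B) m (add_neg_cancel m),
          comp_assoc _ _ _ _ _ rfl (by omega), h1, comp_zero]
      have h3 := congrArg (fun f => f.app hij x) h2
      simp only [comp_app _ _ _ hij (add_zero i) hij] at h3
      exact h3
    | hadd x y hx hy => simp only [map_add, hx, hy]

end Free

section SeqColim

variable {A B : DGA K} (F : ℕ ⥤ DGBimod A B)

/-- The components of a sequential colimit. -/
abbrev SeqColimX (n : ℤ) : Type u :=
  Module.DirectLimit (fun i => (F.obj i).X n) fun _ _ h => (F.map (homOfLE h)).f n

/-- The canonical maps to the components of a sequential colimit. -/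
noncomputable abbrev seqOf (i : ℕ) (n : ℤ) : (F.obj i).X n →ₗ[K] SeqColimX F n :=
  Module.DirectLimit.of K ℕ (fun i => (F.obj i).X n) (fun _ _ h => (F.map (homOfLE h)).f n) i

variable {F} in
lemma seqOf_map {i j : ℕ} (h : i ≤ j) (x : (F.obj i).X n) :
    seqOf F j n ((F.map (homOfLE h)).f n x) = seqOf F i n x := Module.DirectLimit.of_f

/-- Maps out of the components of a sequential colimit. -/
noncomputable abbrev seqLift {W : Type u} [AddCommGroup W] [Module K W]
    (g : ∀ i, (F.obj i).X n →ₗ[K] W)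
    (hg : ∀ i j (h : i ≤ j) x, g j ((F.map (homOfLE h)).f n x) = g i x) : SeqColimX F n →ₗ[K] W :=
  Module.DirectLimit.lift K ℕ (fun i => (F.obj i).X n) (fun _ _ h => (F.map (homOfLE h)).f n) g hg

lemma seqLift_of {W : Type u} [AddCommGroup W] [Module K W]
    (g : ∀ i, (F.obj i).X n →ₗ[K] W)
    (hg : ∀ i j (h : i ≤ j) x, g j ((F.map (homOfLE h)).f n x) = g i x) (i : ℕ)
    (x : (F.obj i).X n) : seqLift F g hg (seqOf F i n x) = g i x :=
  Module.DirectLimit.lift_of (G := fun i => (F.obj i).X n) g hg x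

/-- The colimit of a sequence of DG bimodules. -/
noncomputable def seqColim : DGBimod A B where
  X := SeqColimX F
  d {_ m} h := seqLift F (fun i => (seqOf F i m).comp ((F.obj i).d h)) fun i j hij x => by
    rw [LinearMap.comp_apply, LinearMap.comp_apply, ← (F.map _).comm, seqOf_map]
  lsmul {_ _ m} h := LinearMap.flip <|
    seqLift F (fun i => ((F.obj i).lsmul h).flip.compr₂ (seqOf F i m)) fun i j hij x => by
      ext a
      simp only [LinearMap.compr₂_apply, LinearMap.flip_apply]
      rw [← (F.map _).map_lsmul, seqOf_map]
  rsmul {_ _ m} h :=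
    seqLift F (fun i => ((F.obj i).rsmul h).compr₂ (seqOf F i m)) fun i j hij x => by
      ext a
      simp only [LinearMap.compr₂_apply]
      rw [← (F.map _).map_rsmul, seqOf_map]
  d_d h h' x := by
    induction x using Module.DirectLimit.induction_on with
    | ih i x =>
      simp only [Module.DirectLimit.lift_of, LinearMap.comp_apply, (F.obj i).d_d, map_zero]
  one_lsmul h x := by
    induction x using Module.DirectLimit.induction_on with
    | ih i x =>
      simp only [LinearMap.flip_apply, Module.DirectLimit.lift_of, LinearMap.compr₂_apply,
        (F.obj i).one_lsmul]
  rsmul_one h x := by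
    induction x using Module.DirectLimit.induction_on with
    | ih i x =>
      simp only [Module.DirectLimit.lift_of, LinearMap.compr₂_apply, (F.obj i).rsmul_one]
  mul_lsmul h₁ h₂ h₃ h₄ a b x := by
    induction x using Module.DirectLimit.induction_on with
    | ih i x =>
      simp only [LinearMap.flip_apply, Module.DirectLimit.lift_of, LinearMap.compr₂_apply,
        (F.obj i).mul_lsmul h₁ h₂ h₃ h₄]
  rsmul_mul h₁ h₂ h₃ h₄ x a b := by
    induction x using Module.DirectLimit.induction_on with
    | ih i x =>
      simp only [Module.DirectLimit.lift_of, LinearMap.compr₂_apply,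
        (F.obj i).rsmul_mul h₁ h₂ h₃ h₄]
  lsmul_rsmul h₁ h₂ h₃ h₄ a x b := by
    induction x using Module.DirectLimit.induction_on with
    | ih i x =>
      simp only [LinearMap.flip_apply, Module.DirectLimit.lift_of, LinearMap.compr₂_apply,
        (F.obj i).lsmul_rsmul h₁ h₂ h₃ h₄]
  lleibniz h hi hj hk hl hr a x := by
    induction x using Module.DirectLimit.induction_on with
    | ih i x =>
      simp only [LinearMap.flip_apply, Module.DirectLimit.lift_of, LinearMap.compr₂_apply,
        LinearMap.comp_apply, (F.obj i).lleibniz h hi hj hk hl hr, map_add, map_zsmul]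
  rleibniz h hi hj hk hl hr x b := by
    induction x using Module.DirectLimit.induction_on with
    | ih i x =>
      simp only [Module.DirectLimit.lift_of, LinearMap.compr₂_apply,
        LinearMap.comp_apply, (F.obj i).rleibniz h hi hj hk hl hr, map_add, map_zsmul]

/-- The canonical morphisms to a sequential colimit. -/
noncomputable def seqIn (i : ℕ) : F.obj i ⟶ seqColim F where
  f n := seqOf F i n
  comm {_ m} h x := (seqLift_of F (fun i => (seqOf F i m).comp ((F.obj i).d h))
    (fun i j hij x => by
      rw [LinearMap.comp_apply, LinearMap.comp_apply, ← (F.map _).comm, seqOf_map]) i x).symm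
  map_lsmul {_ _ m} h a x := (LinearMap.congr_fun (seqLift_of F
    (fun i => ((F.obj i).lsmul h).flip.compr₂ (seqOf F i m)) (fun i j hij x => by
      ext a
      simp only [LinearMap.compr₂_apply, LinearMap.flip_apply]
      rw [← (F.map _).map_lsmul, seqOf_map]) i x) a).symm
  map_rsmul {_ _ m} h x b := (LinearMap.congr_fun (seqLift_of F
    (fun i => ((F.obj i).rsmul h).compr₂ (seqOf F i m)) (fun i j hij x => by
      ext a
      simp only [LinearMap.compr₂_apply]
      rw [← (F.map _).map_rsmul, seqOf_map]) i x) b).symm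

variable {F}

lemma map_seqIn {i j : ℕ} (h : i ≤ j) : F.map (homOfLE h) ≫ seqIn F j = seqIn F i :=
  hom_ext fun _ x => seqOf_map h x

lemma exists_seqIn (x : (seqColim F).X n) : ∃ i x', (seqIn F i).f n x' = x :=
  Module.DirectLimit.exists_of x

lemma seqIn_eq_zero {i : ℕ} {x : (F.obj i).X n} (h : (seqIn F i).f n x = 0) :
    ∃ (j : ℕ) (hij : i ≤ j), (F.map (homOfLE hij)).f n x = 0 := by
  have : DirectedSystem (fun i => (F.obj i).X n)
      (fun i j (h : i ≤ j) => ((F.map (homOfLE h)).f n : (F.obj i).X n → (F.obj j).X n)) :=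
    { map_self := fun i x => by
        change (F.map (𝟙 i)).f n x = x
        rw [F.map_id, id_f]
      map_map := fun k j i hij hjk x => by
        rw [← comp_f, ← F.map_comp]
        rfl }
  exact Module.DirectLimit.of.zero_exact h

lemma seq_compat {L : DGBimod A B} {g : ∀ i, F.obj i ⟶ L}
    (hg : ∀ i, F.map (homOfLE (i.le_add_right 1)) ≫ g (i + 1) = g i) {i j : ℕ} (h : i ≤ j)
    (x : (F.obj i).X n) : (g j).f n ((F.map (homOfLE h)).f n x) = (g i).f n x := by
  have e : F.map (homOfLE h) ≫ g j = g i :=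
    ((NatTrans.ofSequence (G := (Functor.const ℕ).obj L) g (by
      intro i; rw [hg]; exact (Category.comp_id _).symm)).naturality (homOfLE h)).trans
      (Category.comp_id _)
  rw [← e, comp_f]

/-- Morphisms out of a sequential colimit. -/
noncomputable def seqDesc {L : DGBimod A B} (g : ∀ i, F.obj i ⟶ L)
    (hg : ∀ i, F.map (homOfLE (i.le_add_right 1)) ≫ g (i + 1) = g i) : seqColim F ⟶ L where
  f n := seqLift F (fun i => (g i).f n) fun i j hij x => seq_compat hg hij x
  comm {n m} h x := by
    obtain ⟨i, x, rfl⟩ := exists_seqIn x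
    rw [← (seqIn F i).comm]
    exact (seqLift_of F (fun i => (g i).f m) _ i _).trans (((g i).comm h x).trans
      (congrArg _ (seqLift_of F (fun i => (g i).f n) _ i x).symm))
  map_lsmul {_ n m} h a x := by
    obtain ⟨i, x, rfl⟩ := exists_seqIn x
    rw [← (seqIn F i).map_lsmul]
    exact (seqLift_of F (fun i => (g i).f m) _ i _).trans (((g i).map_lsmul h a x).trans
      (congrArg _ (seqLift_of F (fun i => (g i).f n) _ i x).symm))
  map_rsmul {n _ m} h x b := by
    obtain ⟨i, x, rfl⟩ := exists_seqIn x
    rw [← (seqIn F i).map_rsmul]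
    exact (seqLift_of F (fun i => (g i).f m) _ i _).trans (((g i).map_rsmul h x b).trans
      (congrArg (fun y => L.rsmul h y b) (seqLift_of F (fun i => (g i).f n) _ i x).symm))

lemma seqIn_desc {L : DGBimod A B} (g : ∀ i, F.obj i ⟶ L)
    (hg : ∀ i, F.map (homOfLE (i.le_add_right 1)) ≫ g (i + 1) = g i) (i : ℕ) :
    seqIn F i ≫ seqDesc g hg = g i :=
  hom_ext fun n x =>
    seqLift_of F (fun i => (g i).f n) (fun _ _ hij x => seq_compat hg hij x) i x

lemma seqColim_hom_ext {L : DGBimod A B} {f g : seqColim F ⟶ L}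
    (h : ∀ i, seqIn F i ≫ f = seqIn F i ≫ g) : f = g := hom_ext fun n x => by
  obtain ⟨i, x, rfl⟩ := exists_seqIn x
  rw [← comp_f, h, comp_f]

end SeqColim

section Resolution

open KMap

variable {A B : DGA K}

/-- Surjective quasi-isomorphisms. -/
def TrivFib {L L' : DGBimod A B} (p : L ⟶ L') : Prop :=
  quasiIso A B p ∧ ∀ i, Function.Surjective (p.f i)

lemma TrivFib.exists_lift {L L' : DGBimod A B} {p : L ⟶ L'} (hp : TrivFib p)
    (h : m + 1 = n) {z : L.X m} (hz : z ∈ cyc L m) {y : L'.X n} (e : L'.d h y = p.f m z) :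
    ∃ w, L.d h w = z ∧ p.f n w = y := by
  have hq := (qis_ofHom_iff p).2 hp.1
  obtain ⟨w, rfl⟩ := (mem_bdry h).1 ((hq m m (add_zero m)).1 z hz
    (by rw [ofHom_app, ← e]; exact d_mem_bdry h y))
  obtain ⟨c, hc, hc'⟩ := (hq n n (add_zero n)).2 (y - p.f n w)
    ((mem_cyc h).2 (by rw [map_sub, e, p.comm, sub_self]))
  rw [ofHom_app, mem_bdry rfl] at hc'
  obtain ⟨v, hv⟩ := hc'
  obtain ⟨v, rfl⟩ := hp.2 _ v
  refine ⟨w + c + L.d rfl v, ?_, ?_⟩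
  · rw [map_add, map_add, (mem_cyc h).1 hc, L.d_d, add_zero, add_zero]
  · rw [map_add, map_add, p.comm, hv]
    abel

/-- Morphisms with the left lifting property against surjective quasi-isomorphisms. -/
def RelLift {P P' : DGBimod A B} (ι : P ⟶ P') : Prop :=
  ∀ (L L' : DGBimod A B) (p : L ⟶ L'), TrivFib p → ∀ (a : P ⟶ L) (g : P' ⟶ L'),
    a ≫ p = ι ≫ g → ∃ g' : P' ⟶ L, ι ≫ g' = a ∧ g' ≫ p = g

/-- Bimodules with the lifting property against surjective quasi-isomorphisms. -/
def Cof (P : DGBimod A B) : Prop :=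
  ∀ (L L' : DGBimod A B) (p : L ⟶ L'), TrivFib p → ∀ g : P ⟶ L', ∃ g' : P ⟶ L, g' ≫ p = g

lemma IsFree.D_eq {U : DGBimod A B} {Γ : ℤ → Type u} {γ : ∀ m, Γ m → U.X m} (hU : IsFree U γ)
    {L : DGBimod A B} (hk : k' + 1 = k) {t : KMap U L k} (ht : t.BLin)
    {g : KMap U L k'} (hg : g.BLin)
    (h : ∀ m j j' (h : m + k = j) (h' : m + k' = j') (hj : j' + 1 = j) v,
      L.d hj (t.app h (γ m v)) = g.app h' (γ m v)) : t.D hk = g := by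
  rw [← sub_eq_zero]
  refine hU.eq_zero ((ht.D hk).sub hg) fun m j hm v => ?_
  rw [sub_app, D_app hk t hm (sub_add_cancel m 1) rfl (by omega) (by omega), hU.d_gen, map_zero,
    smul_zero, sub_zero, h m _ _ _ hm rfl, sub_self]

lemma IsFree.relLift {U : DGBimod A B} {Γ : ℤ → Type u} {γ : ∀ m, Γ m → U.X m} (hU : IsFree U γ)
    {P : DGBimod A B} (ζ : U ⟶ P) : RelLift (coneInclusion ζ) := by
  intro L L' p hp a g e
  have key : ∀ m j, m + 1 = j → ∀ v : Γ m, ∃ w : L.X j,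
      (∀ h : m + 1 = j, L.d h w = a.f m (ζ.f m (γ m v))) ∧
      ∀ h : m + 1 = j, p.f j w = g.f j ((coneInr ζ).app h (γ m v)) := by
    intro m j h v
    obtain ⟨w, h1, h2⟩ := hp.exists_lift h (z := a.f m (ζ.f m (γ m v)))
      ((mem_cyc (sub_add_cancel m 1)).2 (by
        rw [← a.comm, ← ζ.comm, hU.d_gen, map_zero, map_zero]))
      (y := g.f j ((coneInr ζ).app h (γ m v))) (by
        have e1 := congrArg (fun f => f.app (add_zero m) (γ m v)) (D_coneInr ζ)
        simp only [D_app _ _ (add_zero m) (sub_add_cancel m 1) h h (by omega), hU.d_gen, map_zero,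
          smul_zero, sub_zero, comp_app _ _ _ (add_zero m) (add_zero m) (add_zero m)] at e1
        rw [← g.comm, e1, ← comp_f a p, e]
        rfl)
    exact ⟨w, fun _ => h1, fun _ => h2⟩
  choose y hy hy' using key
  obtain ⟨t, ht, hty⟩ := hU.exists_map L 1 fun m j h v => y m j h v
  have et : t.D (zero_add 1) = ofHom (ζ ≫ a) := hU.D_eq _ ht (ofHom_bLin _) fun m j j' h h' hj v => by
    obtain rfl : j' = m := by omega
    rw [hty, hy, ofHom_app]
    rfl
  refine ⟨coneDesc ζ a t ht et, coneInclusion_desc _ _ _ _ _, cone_hom_ext _ ?_ ?_⟩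
  · rw [← Category.assoc, coneInclusion_desc, e]
  · rw [ofHom_comp, ← comp_assoc _ _ _ (add_zero 1) (add_zero 1), coneInr_comp_desc, ← sub_eq_zero]
    refine hU.eq_zero ((ht.comp (ofHom_bLin p) _).sub
      ((coneInr_bLin ζ).comp (ofHom_bLin g) _)) fun m j h v => ?_
    rw [sub_app, comp_app _ _ _ h h (add_zero j), comp_app _ _ _ h h (add_zero j), ofHom_app,
      ofHom_app, hty, hy' _ _ _ _ h, sub_self]

lemma exists_attach {N P : DGBimod A B} (π : P ⟶ N) :
    ∃ (P' : DGBimod A B) (ι : P ⟶ P') (π' : P' ⟶ N), ι ≫ π' = π ∧ RelLift ι ∧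
      ∀ (m n : ℤ) (h : m + 1 = n) (z : P.X m) (y : N.X n), z ∈ cyc P m → N.d h y = π.f m z →
        ∃ w : P'.X n, P'.d h w = ι.f m z ∧ π'.f n w = y := by
  obtain ⟨U, γ, hU⟩ := exists_isFree (A := A) (B := B) fun m =>
    {p : P.X m × N.X (m + 1) // p.1 ∈ cyc P m ∧ N.d rfl p.2 = π.f m p.1}
  obtain ⟨z, hz, hzγ⟩ := hU.exists_map P 0 fun m j h v => P.castX (by omega) v.1.1
  have hzc : z.Closed := (closed_iff (neg_add_cancel 1) z).2 <|
    hU.D_eq _ hz .zero fun m j j' h h' hj v => by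
      obtain rfl : j = m := by omega
      rw [hzγ, zero_app]
      exact (mem_cyc hj).1 v.2.1
  let ζ : U ⟶ P := z.toHom hzc hz
  have hζ : ∀ m v, ζ.f m (γ m v) = v.1.1 := fun m v => hzγ m m (add_zero m) v
  obtain ⟨s, hs, hsγ⟩ := hU.exists_map N 1 fun m j h v => N.castX h v.1.2
  have hsD : s.D (zero_add 1) = ofHom (ζ ≫ π) := hU.D_eq _ hs (ofHom_bLin _)
    fun m j j' h h' hj v => by
      obtain rfl : j' = m := by omega
      subst h
      rw [hsγ, ofHom_app, comp_f, hζ]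
      exact v.2.2
  refine ⟨cone ζ, coneInclusion ζ, coneDesc ζ π s hs hsD, coneInclusion_desc _ _ _ _ _,
    hU.relLift ζ, fun m n h x y hx hy => ?_⟩
  subst h
  let v : {p : P.X m × N.X (m + 1) // p.1 ∈ cyc P m ∧ N.d rfl p.2 = π.f m p.1} := ⟨(x, y), hx, hy⟩
  refine ⟨(coneInr ζ).app rfl (γ m v), ?_, ?_⟩
  · have e1 := congrArg (fun f => f.app (add_zero m) (γ m v)) (D_coneInr ζ)
    simp only [D_app _ _ (add_zero m) (sub_add_cancel m 1) rfl rfl (by omega), hU.d_gen, map_zero,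
      smul_zero, sub_zero, comp_app _ _ _ (add_zero m) (add_zero m) (add_zero m)] at e1
    rw [e1, ofHom_app, hζ]
    rfl
  · have e1 := congrArg (fun f => f.app (rfl : m + 1 = m + 1) (γ m v))
      (coneInr_comp_desc ζ π s hs hsD)
    simp only [comp_app _ _ _ rfl rfl (add_zero (m + 1)), ofHom_app] at e1
    rw [e1, hsγ]
    rfl

lemma exists_tower (N : DGBimod A B) : ∃ (F : ℕ ⥤ DGBimod A B) (π : ∀ j, F.obj j ⟶ N),
    (∀ j, F.map (homOfLE (Nat.le_add_right j 1)) ≫ π (j + 1) = π j) ∧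
    (∀ j, RelLift (F.map (homOfLE (Nat.le_add_right j 1)))) ∧
    (∀ i (x : (F.obj 0).X i), x = 0) ∧
    ∀ (j : ℕ) (m n : ℤ) (h : m + 1 = n) (z : (F.obj j).X m) (y : N.X n), z ∈ cyc _ m →
      N.d h y = (π j).f m z → ∃ w : (F.obj (j + 1)).X n,
        (F.obj (j + 1)).d h w = (F.map (homOfLE (Nat.le_add_right j 1))).f m z ∧
          (π (j + 1)).f n w = y := by
  choose P' ι π' h₁ h₂ h₃ using fun P π => @exists_attach K _ A B N P π
  let st : ℕ → Σ P : DGBimod A B, P ⟶ N := fun n => Nat.rec ⟨zeroBimod A B, zeroHom _ _⟩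
    (fun _ s => ⟨P' s.1 s.2, π' s.1 s.2⟩) n
  let f : ∀ n, (st n).1 ⟶ (st (n + 1)).1 := fun n => ι (st n).1 (st n).2
  have hF : ∀ n, (Functor.ofSequence f).map (homOfLE (n.le_add_right 1)) = f n :=
    Functor.ofSequence_map_homOfLE_succ f
  refine ⟨Functor.ofSequence f, fun j => (st j).2, fun j => ?_, fun j => ?_, fun i x => ?_,
    fun j m n h z y hz hy => ?_⟩
  · rw [hF]
    exact h₁ (st j).1 (st j).2
  · refine (congrArg (fun f => RelLift f) (hF j)).mpr (h₂ (st j).1 (st j).2)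
  · exact Subsingleton.elim (α := PUnit) _ _
  · rw [hF]
    exact h₃ (st j).1 (st j).2 m n h z y hz hy

/-- Every DG bimodule is the target of a surjective quasi-isomorphism from a cofibrant one. -/
theorem exists_cof (N : DGBimod A B) : ∃ (P : DGBimod A B) (π : P ⟶ N), P.Cof ∧ TrivFib π := by
  obtain ⟨F, ϖ, h₁, h₂, h₀, h₃⟩ := exists_tower N
  let π : seqColim F ⟶ N := seqDesc ϖ h₁
  have hπ : ∀ n i (x : (F.obj n).X i), π.f i ((seqIn F n).f i x) = (ϖ n).f i x :=
    fun n i x => by rw [← comp_f, seqIn_desc]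
  have mp : ∀ (i j : ℕ) (hij : i ≤ j) (m : ℤ) (x : (F.obj i).X m),
      (seqIn F j).f m ((F.map (homOfLE hij)).f m x) = (seqIn F i).f m x :=
    fun i j hij m x => by rw [← comp_f, map_seqIn]
  have attach : ∀ (m n : ℤ) (h : m + 1 = n) (z : (seqColim F).X m) (y : N.X n),
      z ∈ cyc _ m → N.d h y = π.f m z → ∃ w, (seqColim F).d h w = z ∧ π.f n w = y := by
    intro m n h z y hz hy
    obtain ⟨i, z, rfl⟩ := exists_seqIn z
    rw [mem_cyc (sub_add_cancel m 1), ← (seqIn F i).comm] at hz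
    obtain ⟨j, hij, hz⟩ := seqIn_eq_zero hz
    rw [(F.map _).comm] at hz
    obtain ⟨w, hw, hw'⟩ := h₃ j m n h ((F.map (homOfLE hij)).f m z) y
      ((mem_cyc _).2 hz) (by rw [hy, ← hπ j, mp])
    refine ⟨(seqIn F (j + 1)).f n w, ?_, ?_⟩
    · rw [← (seqIn F (j + 1)).comm, hw, mp, mp]
    · rw [hπ, hw']
  have lift_cyc : ∀ n, ∀ y ∈ cyc N n, ∃ x ∈ cyc (seqColim F) n, π.f n x = y := by
    intro n y hy
    obtain ⟨w, hw, hw'⟩ := attach (n - 1) n (sub_add_cancel n 1) 0 y (Submodule.zero_mem _) (by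
      rw [map_zero]; exact hy)
    exact ⟨w, hw, hw'⟩
  refine ⟨seqColim F, π, ?_, ?_, ?_⟩
  · intro L L' p hp g
    have step : ∀ n (a : {a : F.obj n ⟶ L // a ≫ p = seqIn F n ≫ g}),
        ∃ b : {a : F.obj (n + 1) ⟶ L // a ≫ p = seqIn F (n + 1) ≫ g},
          F.map (homOfLE (n.le_add_right 1)) ≫ b.1 = a.1 := fun n a => by
      obtain ⟨b, hb, hb'⟩ := h₂ n L L' p hp a.1 (seqIn F (n + 1) ≫ g) (by
        rw [← Category.assoc, map_seqIn, a.2])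
      exact ⟨⟨b, hb'⟩, hb⟩
    choose nx hnx using step
    let s : ∀ n, {a : F.obj n ⟶ L // a ≫ p = seqIn F n ≫ g} := fun n => Nat.rec
      ⟨zeroHom _ _, hom_ext fun i x => by rw [h₀ i x, map_zero, map_zero]⟩ (fun n a => nx n a) n
    refine ⟨seqDesc (fun n => (s n).1) fun n => hnx n (s n), seqColim_hom_ext fun n => ?_⟩
    rw [← Category.assoc, seqIn_desc]
    exact (s n).2
  · rw [← qis_ofHom_iff]
    intro i j h
    obtain rfl : j = i := by omega
    refine ⟨fun x hx hx' => ?_, fun y hy => ?_⟩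
    · obtain ⟨y, hy⟩ := hx'
      obtain ⟨w, hw, -⟩ := attach j _ rfl x y hx hy
      exact ⟨w, hw⟩
    · obtain ⟨x, hx, rfl⟩ := lift_cyc j y hy
      exact ⟨x, hx, by rw [ofHom_app, sub_self]; exact Submodule.zero_mem _⟩
  · intro i y
    obtain ⟨x, hx, hxy⟩ := lift_cyc (i - 1) (N.d (sub_add_cancel i 1) y) (d_mem_cyc _ y)
    obtain ⟨w, -, hw⟩ := attach _ _ (sub_add_cancel i 1) x y hx hxy.symm
    exact ⟨w, hw⟩

end Resolution

section Cofibrant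

open KMap

variable {A B : DGA K}

lemma Acyclic.quasiIso {M N : DGBimod A B} (hM : M.Acyclic) (hN : N.Acyclic) (f : M ⟶ N) :
    quasiIso A B f := by
  rw [← qis_ofHom_iff]
  exact fun i j h => ⟨fun x hx _ => hM i hx, fun y hy => ⟨0, Submodule.zero_mem _, by
    rw [map_zero, sub_zero]; exact hN j hy⟩⟩

lemma quasiIso_id (M : DGBimod A B) : quasiIso A B (𝟙 M) := (qis_ofHom_iff _).1 one_qis

lemma acyclic_cone_id (M : DGBimod A B) : (cone (𝟙 M)).Acyclic := acyclic_cone (quasiIso_id M)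

/-- A graded map lifts along a closed graded map from a cofibrant bimodule when it is closed and
the map is a surjection between acyclic bimodules. -/
lemma Cof.exists_lift {P : DGBimod A B} (hP : P.Cof) {L L' : DGBimod A B} (hL : L.Acyclic)
    (hL' : L'.Acyclic) (p : KMap L L' l) (hp : p.Closed) (hpb : p.BLin)
    (hps : ∀ i j (h : i + l = j), Function.Surjective (p.app h)) (h : k + l = n)
    (g : KMap P L' n) (hg : g.Closed) (hgb : g.BLin) :
    ∃ f : KMap P L k, f.Closed ∧ f.BLin ∧ f.comp p h = g := by
  let q : L.shift (-k) ⟶ L'.shift (-n) :=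
    ((ofShift L (-k) (neg_add_cancel k)).comp (p.comp (toShift L' (-n))
      (by omega : l + -n = -k)) (by omega)).toHom
      ((ofShift_closed _ _ _).comp (hp.comp (toShift_closed _ _) _) _)
      ((ofShift_bLin _ _ _).comp (hpb.comp (toShift_bLin _ _) _) _)
  have hq : ofHom q = _ := ofHom_toHom _ _ _
  let g' : P ⟶ L'.shift (-n) := (g.comp (toShift L' (-n)) (add_neg_cancel n)).toHom
      (hg.comp (toShift_closed _ _) _) (hgb.comp (toShift_bLin _ _) _)
  have hg' : ofHom g' = _ := ofHom_toHom _ _ _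
  have hqs : TrivFib q := by
    refine ⟨(hL.shift _).quasiIso (hL'.shift _) q, fun i y => ?_⟩
    obtain ⟨x, hx⟩ := hps (i + k) (i + n) (by omega)
      ((ofShift L' (-n) (neg_add_cancel n)).app rfl y)
    refine ⟨(toShift L (-k)).app (by omega) x, ?_⟩
    rw [← ofHom_app q (add_zero i), hq, comp_app _ _ _ _ rfl (by omega),
      ← comp_app _ _ (add_comm (-k) k ▸ add_neg_cancel k) (add_zero (i + k)),
      toShift_comp_ofShift, one_app, comp_app _ _ _ _ (by omega : i + k + l = i + n) (by omega), hx,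
      ← comp_app _ _ (add_comm n (-n) ▸ neg_add_cancel n) (add_zero i), ofShift_comp_toShift,
      one_app]
  obtain ⟨f, hf⟩ := hP _ _ q hqs g'
  refine ⟨(ofHom f).comp (ofShift L (-k) (neg_add_cancel k)) (zero_add k),
    (ofHom_closed _).comp (ofShift_closed _ _ _) _, (ofHom_bLin _).comp (ofShift_bLin _ _ _) _, ?_⟩
  have e := congrArg (fun f => (ofHom f).comp (ofShift L' (-n) (neg_add_cancel n)) (zero_add n)) hf
  simp only [ofHom_comp, hg', hq] at e
  rw [comp_assoc _ _ _ _ _ (by omega : -n + n = 0) (add_zero n), toShift_comp_ofShift,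
    comp_one] at e
  rw [← e, comp_assoc _ _ _ _ _ (by omega : k + l = n) (by omega),
    comp_assoc _ _ _ _ _ (zero_add n) (by omega),
    comp_assoc _ _ _ _ _ (by omega : -k + n = l) (by omega),
    comp_assoc _ _ _ _ _ (by omega : -n + n = 0) (by omega), toShift_comp_ofShift, comp_one]

lemma Cof.hProj {P : DGBimod A B} (hP : P.Cof) : P.HProj := by
  intro N hN k k' hk g hg hgb
  obtain ⟨f, hf, hfb, e⟩ := hP.exists_lift (acyclic_cone_id N) hN (coneSnd (𝟙 N))
    (coneSnd_closed _) (coneSnd_bLin _) (fun i j h y => ⟨(coneInr (𝟙 N)).app (by omega) y, by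
      rw [← comp_app _ _ (by omega : 1 + -1 = 0) (add_zero j), coneInr_comp_coneSnd, one_app]⟩)
    (by omega : k' + -1 = k) g hg hgb
  refine ⟨(-1 : ℤ) • f.comp (coneFst (𝟙 N)) (add_zero k'), (hfb.comp (coneFst_bLin _) _).zsmul _,
    ?_⟩
  rw [D_zsmul, hf.D_comp_left _ _ hk (neg_add_cancel 1) (by omega), D_coneFst, comp_neg, ofHom_id,
    comp_one, e]
  simp

/-- Graded maps out of a cofibrant bimodule lift along surjections. -/
lemma Cof.exists_graded_lift {P : DGBimod A B} (hP : P.Cof) {L L' : DGBimod A B} (p : L ⟶ L')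
    (hp : ∀ i, Function.Surjective (p.f i)) (g : KMap P L' k) (hg : g.BLin) :
    ∃ f : KMap P L k, f.BLin ∧ f.comp (ofHom p) (add_zero k) = g := by
  have hc : ((coneFst (𝟙 L)).comp ((ofHom p).comp (coneInl (𝟙 L')) (add_zero 0)) (add_zero 0) +
      (coneSnd (𝟙 L)).comp ((ofHom p).comp (coneInr (𝟙 L')) (zero_add 1))
        (by omega : -1 + 1 = 0)).Closed := by
    rw [closed_iff (neg_add_cancel 1), D_add,
      ((ofHom_closed p).comp (coneInl_closed _) _).D_comp_right _ _ _ (neg_add_cancel 1) (add_zero _),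
      (coneSnd_closed _).D_comp_left _ _ _ (zero_add 1) (by omega),
      (ofHom_closed p).D_comp_left _ _ _ (zero_add 1) (add_zero 0), D_coneInr, D_coneFst, ofHom_id,
      ofHom_id, one_comp, comp_one, neg_comp, sgn_zero, one_smul, neg_add_cancel]
  obtain ⟨f, hf, hfb, e⟩ := hP.exists_lift (acyclic_cone_id L) (acyclic_cone_id L') _ hc
    (((coneFst_bLin _).comp ((ofHom_bLin p).comp (coneInl_bLin _) _) _).add
      ((coneSnd_bLin _).comp ((ofHom_bLin p).comp (coneInr_bLin _) _) _))
    (fun i j h y => by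
      obtain rfl : j = i := by omega
      obtain ⟨a, ha⟩ := hp j ((coneFst (𝟙 L')).app (add_zero j) y)
      obtain ⟨b, hb⟩ := hp (j - 1) ((coneSnd (𝟙 L')).app rfl y)
      refine ⟨(coneInl (𝟙 L)).app (add_zero j) a + (coneInr (𝟙 L)).app (sub_add_cancel j 1) b, ?_⟩
      rw [← cone_decomp (𝟙 L') (add_zero j) rfl (sub_add_cancel j 1) y]
      rw [add_app, comp_app _ _ _ _ (add_zero j) (add_zero j),
        comp_app _ _ _ _ (rfl : j + -1 = j - 1) (by omega), comp_app _ _ _ _ (add_zero j) (add_zero j),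
        comp_app _ _ _ _ (add_zero (j - 1)) (by omega), ofHom_app, ofHom_app]
      simp only [map_add]
      rw [← comp_app _ _ (add_zero 0) (add_zero j), ← comp_app _ _ (add_zero 1) (sub_add_cancel j 1),
        ← comp_app _ _ (zero_add (-1)) rfl, ← comp_app _ _ (add_neg_cancel 1) (add_zero (j - 1)),
        coneInl_comp_coneFst, coneInr_comp_coneFst, coneInl_comp_coneSnd, coneInr_comp_coneSnd,
        one_app, one_app, zero_app, zero_app, map_zero, map_zero, map_zero, map_zero, add_zero,
        zero_add, ha, hb])
    (add_zero k) ((g.comp (coneInr (𝟙 L')) rfl).D rfl) (closed_D _ _)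
    ((hg.comp (coneInr_bLin _) _).D _)
  refine ⟨f.comp (coneFst (𝟙 L)) (add_zero k), hfb.comp (coneFst_bLin _) _, ?_⟩
  have e' := congrArg (fun f => f.comp (coneFst (𝟙 L')) (add_zero k)) e
  simp only [comp_assoc _ _ (coneFst (𝟙 L')) (add_zero k) (add_zero k) (add_zero 0) (add_zero k),
    add_comp, comp_assoc _ _ (coneFst (𝟙 L')) (add_zero 0) (add_zero 0) (add_zero 0) (add_zero 0),
    comp_assoc _ _ (coneFst (𝟙 L')) (by omega : -1 + 1 = 0) (add_zero 0) (add_zero 1)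
      (by omega : -1 + 1 = 0), comp_assoc _ _ (coneFst (𝟙 L')) (zero_add 1) (add_zero 1) (add_zero 1)
      (zero_add 1),
    coneInl_comp_coneFst, coneInr_comp_coneFst, comp_zero, comp_one, add_zero] at e'
  rw [comp_assoc _ _ _ _ _ (add_zero 0) (add_zero k), e',
    D_comp _ _ _ _ (sub_add_cancel k 1) (zero_add 1) (add_zero k) (by omega), D_coneInr, ofHom_id,
    one_comp, add_comp, zsmul_comp, comp_assoc _ _ _ _ _ (add_zero 0) (add_zero k),
    comp_assoc _ _ _ _ _ (add_zero 1) (by omega), coneInl_comp_coneFst, coneInr_comp_coneFst,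
    comp_zero, smul_zero, comp_one, add_zero]

end Cofibrant

section HomElements

open KMap

variable {A B B' C C' : DGA K} {X : DGBimod A B} {X' : DGBimod A B'} {Y : DGBimod A C}
  {Y' : DGBimod A C'}

/-- The graded map underlying an element of `Hom_A(X, Y)`. -/
def ofL (f : (homL X Y).X n) : KMap X Y n := KMap.mk fun _ _ h => evL h f

/-- The element of `Hom_A(X, Y)` given by an `A`-linear graded map. -/
def toL (f : KMap X Y n) (hf : f.LLin) : (homL X Y).X n :=
  homLMk (fun _ _ h => f.app h) fun _ _ _ _ _ h h' hl hl' a x => hf _ _ _ _ _ h h' hl hl' a x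

@[simp] lemma ofL_app (f : (homL X Y).X n) (h : i + n = j) (x : X.X i) :
    (ofL f).app h x = evL h f x := rfl

@[simp] lemma evL_toL (f : KMap X Y n) (hf : f.LLin) (h : i + n = j) (x : X.X i) :
    evL h (toL f hf) x = f.app h x := rfl

lemma ofL_lLin (f : (homL X Y).X n) : (ofL f).LLin :=
  fun _ _ _ _ _ h h' hl hl' a x => evL_x_lsmul f h' hl h hl' a x

lemma ofL_toL (f : KMap X Y n) (hf : f.LLin) : ofL (toL f hf) = f := rfl

lemma ofL_injective {f g : (homL X Y).X n} (h : ofL f = ofL g) : f = g :=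
  evL_ext fun _ _ hij x => congrArg (fun f => f.app hij x) h

lemma ofL_d (hn : n' + 1 = n) (f : (homL X Y).X n) :
    ofL ((homL X Y).d hn f) = (ofL f).D hn := KMap.ext fun i j h x => by
  rw [ofL_app, evL_d hn f h (sub_add_cancel i 1) rfl (by omega) (by omega),
    D_app hn _ h (sub_add_cancel i 1) rfl (by omega) (by omega)]
  rfl

lemma ofL_add (f g : (homL X Y).X n) : ofL (f + g) = ofL f + ofL g := rfl

lemma ofL_sub (f g : (homL X Y).X n) : ofL (f - g) = ofL f - ofL g :=
  KMap.ext fun i j h x => by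
    rw [ofL_app, map_sub]
    rfl

lemma ofL_zsmul (c : ℤ) (f : (homL X Y).X n) : ofL (c • f) = c • ofL f :=
  KMap.ext fun i j h x => by
    rw [ofL_app, map_zsmul]
    rfl

lemma mem_cyc_homL {f : (homL X Y).X n} : f ∈ cyc (homL X Y) n ↔ (ofL f).Closed := by
  rw [mem_cyc (sub_add_cancel n 1), KMap.Closed, ← ofL_d]
  exact ⟨fun h => h ▸ rfl, fun h => ofL_injective h⟩

lemma mem_bdry_homL (hn : n + 1 = n') {f : (homL X Y).X n} :
    f ∈ bdry (homL X Y) n ↔ ∃ w : KMap X Y n', w.LLin ∧ w.D hn = ofL f := by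
  rw [mem_bdry hn]
  constructor
  · rintro ⟨w, rfl⟩
    exact ⟨ofL w, ofL_lLin w, (ofL_d _ _).symm⟩
  · rintro ⟨w, hw, e⟩
    exact ⟨toL w hw, ofL_injective (by rw [ofL_d, ofL_toL, e])⟩

lemma ofL_homLMap {Y' : DGBimod A C} (g : Y ⟶ Y') (f : (homL X Y).X n) :
    ofL ((homLMap X g).f n f) = (ofL f).comp (ofHom g) (add_zero n) := KMap.ext fun i j h x => by
  rw [comp_app _ _ _ h h (add_zero j)]
  rfl

lemma ofL_homLPre {X' : DGBimod A B} (g : X' ⟶ X) (f : (homL X Y).X n) :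
    ofL ((homLPre Y g).f n f) = (ofHom g).comp (ofL f) (zero_add n) := KMap.ext fun i j h x => by
  rw [comp_app _ _ _ h (add_zero i) h]
  rfl

variable (X) in
/-- Postcomposition with a graded map. -/
def postL (g : KMap Y Y' k) (hg : g.LLin) : KMap (homL X Y) (homL X Y') k :=
  KMap.mk fun _ _ h =>
    { toFun := fun f => toL ((ofL f).comp g h) ((ofL_lLin f).comp hg h)
      map_add' := fun f f' => ofL_injective (by
        simp only [ofL_add, ofL_toL, add_comp])
      map_smul' := fun c f => evL_ext fun i j h x => by
        simp only [evL_toL, map_smul, LinearMap.smul_apply, RingHom.id_apply]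
        rw [comp_app _ _ _ _ rfl (by omega), comp_app _ _ _ _ rfl (by omega), ofL_app, map_smul,
          LinearMap.smul_apply, map_smul]
        rfl }

lemma ofL_postL (g : KMap Y Y' k) (hg : g.LLin) (h : i + k = j)
    (f : (homL X Y).X i) : ofL ((postL X g hg).app h f) = (ofL f).comp g h := rfl

variable (Y) in
/-- Precomposition with a graded map, with the Koszul sign. -/
def preL (g : KMap X' X k) (hg : g.LLin) : KMap (homL X Y) (homL X' Y) k :=
  KMap.mk fun i _ h =>
    { toFun := fun f => toL (sgn (k * i) • g.comp (ofL f) (by omega))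
        ((hg.comp (ofL_lLin f) _).zsmul _)
      map_add' := fun f f' => ofL_injective (by
        simp only [ofL_add, ofL_toL, comp_add, smul_add])
      map_smul' := fun c f => evL_ext fun i j h x => by
        simp only [evL_toL, map_smul, LinearMap.smul_apply, RingHom.id_apply, zsmul_app]
        rw [comp_app _ _ _ _ rfl (by omega), comp_app _ _ _ _ rfl (by omega), ofL_app, map_smul,
          LinearMap.smul_apply, smul_comm]
        rfl }

lemma ofL_preL (g : KMap X' X k) (hg : g.LLin) (h : i + k = j)
    (f : (homL X Y).X i) :
    ofL ((preL Y g hg).app h f) = sgn (k * i) • g.comp (ofL f) (by omega) := rfl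

lemma D_postL (hk : k' + 1 = k) (g : KMap Y Y' k) (hg : g.LLin) :
    (postL X g hg).D hk = postL X (g.D hk) (hg.D hk) := KMap.ext fun i j h f => ofL_injective <| by
  rw [D_app hk _ h (sub_add_cancel i 1) rfl (by omega) (by omega), ofL_sub, ofL_d, ofL_zsmul,
    ofL_postL, ofL_postL, ofL_postL, ofL_d, D_comp _ _ _ _ (sub_add_cancel i 1) hk h (by omega)]
  abel

lemma D_preL (hk : k' + 1 = k) (g : KMap X' X k) (hg : g.LLin) :
    (preL Y g hg).D hk = preL Y (g.D hk) (hg.D hk) := KMap.ext fun i j h f => ofL_injective <| by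
  rw [D_app hk _ h (sub_add_cancel i 1) rfl (by omega) (by omega), ofL_sub, ofL_d, ofL_zsmul,
    ofL_preL, ofL_preL, ofL_preL, ofL_d, D_zsmul,
    D_comp _ _ _ _ hk (sub_add_cancel i 1) (by omega) (by omega), smul_add, smul_smul, smul_smul,
    ← sgn_add, ← sgn_add, show sgn (k + k * (i - 1)) = sgn (k * i) from sgn_congr 0 (by ring),
    show sgn (k * i + i) = sgn (k' * i) from sgn_congr i (by rw [← hk]; ring)]
  abel

lemma postL_closed {g : KMap Y Y' k} (hg : g.LLin) (hc : g.Closed) :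
    (postL X g hg).Closed := by
  rw [KMap.Closed, D_postL]
  refine KMap.ext fun i j h f => ofL_injective ?_
  rw [ofL_postL, hc, comp_zero]
  rfl

lemma preL_closed {g : KMap X' X k} (hg : g.LLin) (hc : g.Closed) :
    (preL Y g hg).Closed := by
  rw [KMap.Closed, D_preL]
  refine KMap.ext fun i j h f => ofL_injective ?_
  rw [ofL_preL, hc, zero_comp, smul_zero]
  rfl

end HomElements

section HomRElements

open KMap

variable {A A' B B' C : DGA K} {X : DGBimod B C} {X' : DGBimod B' C} {Y : DGBimod A C}
  {Y' : DGBimod A' C}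

/-- The graded map underlying an element of `Hom_{Cᵒᵖ}(X, Y)`. -/
def ofR (f : (homR X Y).X n) : KMap X Y n := KMap.mk fun _ _ h => evR h f

/-- The element of `Hom_{Cᵒᵖ}(X, Y)` given by a right `C`-linear graded map. -/
def toR (f : KMap X Y n) (hf : f.RLin) : (homR X Y).X n :=
  homRMk (fun _ _ h => f.app h) fun _ _ _ _ _ h h' hl hl' a x => hf _ _ _ _ _ h h' hl hl' a x

@[simp] lemma ofR_app (f : (homR X Y).X n) (h : i + n = j) (x : X.X i) :
    (ofR f).app h x = evR h f x := rfl

@[simp] lemma evR_toR (f : KMap X Y n) (hf : f.RLin) (h : i + n = j) (x : X.X i) :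
    evR h (toR f hf) x = f.app h x := rfl

lemma ofR_rLin (f : (homR X Y).X n) : (ofR f).RLin :=
  fun _ _ _ _ _ h h' hl hl' x c => evR_x_rsmul f h' hl h hl' x c

lemma ofR_toR (f : KMap X Y n) (hf : f.RLin) : ofR (toR f hf) = f := rfl

lemma ofR_injective {f g : (homR X Y).X n} (h : ofR f = ofR g) : f = g :=
  evR_ext fun _ _ hij x => congrArg (fun f => f.app hij x) h

lemma ofR_d (hn : n' + 1 = n) (f : (homR X Y).X n) :
    ofR ((homR X Y).d hn f) = (ofR f).D hn := KMap.ext fun i j h x => by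
  rw [ofR_app, evR_d hn f h (sub_add_cancel i 1) rfl (by omega) (by omega),
    D_app hn _ h (sub_add_cancel i 1) rfl (by omega) (by omega)]
  rfl

lemma ofR_add (f g : (homR X Y).X n) : ofR (f + g) = ofR f + ofR g := rfl

lemma ofR_sub (f g : (homR X Y).X n) : ofR (f - g) = ofR f - ofR g :=
  KMap.ext fun i j h x => by
    rw [ofR_app, map_sub]
    rfl

lemma ofR_zero : ofR (0 : (homR X Y).X n) = 0 := rfl

lemma ofR_zsmul (c : ℤ) (f : (homR X Y).X n) : ofR (c • f) = c • ofR f :=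
  KMap.ext fun i j h x => by
    rw [ofR_app, map_zsmul]
    rfl

lemma mem_cyc_homR {f : (homR X Y).X n} : f ∈ cyc (homR X Y) n ↔ (ofR f).Closed := by
  rw [mem_cyc (sub_add_cancel n 1), KMap.Closed, ← ofR_d]
  exact ⟨fun h => h ▸ rfl, fun h => ofR_injective h⟩

lemma mem_bdry_homR (hn : n + 1 = n') {f : (homR X Y).X n} :
    f ∈ bdry (homR X Y) n ↔ ∃ w : KMap X Y n', w.RLin ∧ w.D hn = ofR f := by
  rw [mem_bdry hn]
  constructor
  · rintro ⟨w, rfl⟩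
    exact ⟨ofR w, ofR_rLin w, (ofR_d _ _).symm⟩
  · rintro ⟨w, hw, e⟩
    exact ⟨toR w hw, ofR_injective (by rw [ofR_d, ofR_toR, e])⟩

variable (X) in
/-- Postcomposition with a graded map. -/
def postR (g : KMap Y Y' k) (hg : g.RLin) : KMap (homR X Y) (homR X Y') k :=
  KMap.mk fun _ _ h =>
    { toFun := fun f => toR ((ofR f).comp g h) ((ofR_rLin f).comp hg h)
      map_add' := fun f f' => ofR_injective (by
        simp only [ofR_add, ofR_toR, add_comp])
      map_smul' := fun c f => evR_ext fun i j h x => by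
        simp only [evR_toR, map_smul, LinearMap.smul_apply, RingHom.id_apply]
        rw [comp_app _ _ _ _ rfl (by omega), comp_app _ _ _ _ rfl (by omega), ofR_app, map_smul,
          LinearMap.smul_apply, map_smul]
        rfl }

lemma ofR_postR (g : KMap Y Y' k) (hg : g.RLin) (h : i + k = j)
    (f : (homR X Y).X i) : ofR ((postR X g hg).app h f) = (ofR f).comp g h := rfl

variable (Y) in
/-- Precomposition with a graded map, with the Koszul sign. -/
def preR (g : KMap X' X k) (hg : g.RLin) : KMap (homR X Y) (homR X' Y) k :=
  KMap.mk fun i _ h =>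
    { toFun := fun f => toR (sgn (k * i) • g.comp (ofR f) (by omega))
        ((hg.comp (ofR_rLin f) _).zsmul _)
      map_add' := fun f f' => ofR_injective (by
        simp only [ofR_add, ofR_toR, comp_add, smul_add])
      map_smul' := fun c f => evR_ext fun i j h x => by
        simp only [evR_toR, map_smul, LinearMap.smul_apply, RingHom.id_apply, zsmul_app]
        rw [comp_app _ _ _ _ rfl (by omega), comp_app _ _ _ _ rfl (by omega), ofR_app, map_smul,
          LinearMap.smul_apply, smul_comm]
        rfl }

lemma ofR_preR (g : KMap X' X k) (hg : g.RLin) (h : i + k = j)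
    (f : (homR X Y).X i) :
    ofR ((preR Y g hg).app h f) = sgn (k * i) • g.comp (ofR f) (by omega) := rfl

lemma D_postR (hk : k' + 1 = k) (g : KMap Y Y' k) (hg : g.RLin) :
    (postR X g hg).D hk = postR X (g.D hk) (hg.D hk) := KMap.ext fun i j h f => ofR_injective <| by
  rw [D_app hk _ h (sub_add_cancel i 1) rfl (by omega) (by omega), ofR_sub, ofR_d, ofR_zsmul,
    ofR_postR, ofR_postR, ofR_postR, ofR_d, D_comp _ _ _ _ (sub_add_cancel i 1) hk h (by omega)]
  abel

lemma D_preR (hk : k' + 1 = k) (g : KMap X' X k) (hg : g.RLin) :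
    (preR Y g hg).D hk = preR Y (g.D hk) (hg.D hk) := KMap.ext fun i j h f => ofR_injective <| by
  rw [D_app hk _ h (sub_add_cancel i 1) rfl (by omega) (by omega), ofR_sub, ofR_d, ofR_zsmul,
    ofR_preR, ofR_preR, ofR_preR, ofR_d, D_zsmul,
    D_comp _ _ _ _ hk (sub_add_cancel i 1) (by omega) (by omega), smul_add, smul_smul, smul_smul,
    ← sgn_add, ← sgn_add, show sgn (k + k * (i - 1)) = sgn (k * i) from sgn_congr 0 (by ring),
    show sgn (k * i + i) = sgn (k' * i) from sgn_congr i (by rw [← hk]; ring)]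
  abel

lemma postR_closed {g : KMap Y Y' k} (hg : g.RLin) (hc : g.Closed) :
    (postR X g hg).Closed := by
  rw [KMap.Closed, D_postR]
  refine KMap.ext fun i j h f => ofR_injective ?_
  rw [ofR_postR, hc, comp_zero]
  rfl

lemma preR_closed {g : KMap X' X k} (hg : g.RLin) (hc : g.Closed) :
    (preR Y g hg).Closed := by
  rw [KMap.Closed, D_preR]
  refine KMap.ext fun i j h f => ofR_injective ?_
  rw [ofR_preR, hc, zero_comp, smul_zero]
  rfl

end HomRElements

section TensorMaps

open KMap

variable {A A' A'' B C C' C'' : DGA K}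

lemma kmap_tensor_ext {A₁ B₁ : DGA K} {M : DGBimod A B} {N : DGBimod B C} {L : DGBimod A₁ B₁}
    {f g : KMap (tensor M N) L k}
    (h : ∀ (i j p q : ℤ) (hij : i + k = j) (hpq : p + q = i) (x : M.X p) (y : N.X q),
      f.app hij (tm M N hpq x y) = g.app hij (tm M N hpq x y)) : f = g :=
  KMap.ext fun i j hij t => LinearMap.congr_fun (tm_ext fun p q hpq x y => h i j p q hij hpq x y) t

variable {M : DGBimod A B} {M' : DGBimod A' B} {M'' : DGBimod A'' B}
  {N : DGBimod B C} {N' : DGBimod B C'} {N'' : DGBimod B C''}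

variable (N) in
/-- The family of bilinear maps defining `tmapL`. -/
noncomputable def tmapLAux (f : KMap M M' k) (h : i + k = j) (p q : ℤ)
    (hpq : p + q = i) : M.X p →ₗ[K] N.X q →ₗ[K] (tensor M' N).X j :=
  (tm M' N (by omega : p + k + q = j)).comp (f.app rfl)

lemma tmapLAux_apply (f : KMap M M' k) {i j p q p' : ℤ} (h : i + k = j) (hpq : p + q = i)
    (hp : p + k = p') (hj : p' + q = j) (x : M.X p) (y : N.X q) :
    tmapLAux N f h p q hpq x y = tm M' N hj (f.app hp x) y := by
  subst hp
  rfl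

lemma tmapLAux_balanced (f : KMap M M' k) (hf : f.RLin) (h : i + k = j) :
    ∀ (p q l pl lq : ℤ) (h₁ : p + l = pl) (h₂ : pl + q = i) (h₃ : l + q = lq) (h₄ : p + lq = i)
      (x : M.X p) (b : B.X l) (y : N.X q),
      tmapLAux N f h pl q h₂ (M.rsmul h₁ x b) y = tmapLAux N f h p lq h₄ x (N.lsmul h₃ b y) :=
  fun p q l pl lq h₁ h₂ h₃ h₄ x b y => by
    rw [tmapLAux_apply f h h₂ rfl (by omega), tmapLAux_apply f h h₄ rfl (by omega),
      hf p _ l pl _ rfl rfl h₁ (by omega), tm_rsmul _ _ h₃]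

variable (N) in
/-- The graded map `f ⊗ N`, `x ⊗ y ↦ f x ⊗ y`. -/
noncomputable def tmapL (f : KMap M M' k) (hf : f.RLin) :
    KMap (tensor M N) (tensor M' N) k :=
  KMap.mk fun _ _ h => tmLift (tmapLAux N f h) (tmapLAux_balanced f hf h)

lemma tmapL_tm (f : KMap M M' k) (hf : f.RLin) {i j p q p' : ℤ} (h : i + k = j)
    (hpq : p + q = i) (hp : p + k = p') (hj : p' + q = j) (x : M.X p) (y : N.X q) :
    (tmapL N f hf).app h (tm M N hpq x y) = tm M' N hj (f.app hp x) y := by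
  rw [tmapL, mk_app, tmLift_tm (tmapLAux N f h) (tmapLAux_balanced f hf h) hpq x y,
    tmapLAux_apply f h hpq hp hj]

variable (M) in
/-- The family of bilinear maps defining `tmapR`. -/
noncomputable def tmapRAux (g : KMap N N' k) (h : i + k = j) (p q : ℤ)
    (hpq : p + q = i) : M.X p →ₗ[K] N.X q →ₗ[K] (tensor M N').X j :=
  sgn (k * p) • (tm M N' (by omega : p + (q + k) = j)).compl₂ (g.app rfl)

lemma tmapRAux_apply (g : KMap N N' k) {i j p q q' : ℤ} (h : i + k = j) (hpq : p + q = i)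
    (hq : q + k = q') (hj : p + q' = j) (x : M.X p) (y : N.X q) :
    tmapRAux M g h p q hpq x y = sgn (k * p) • tm M N' hj x (g.app hq y) := by
  subst hq
  rfl

lemma tmapRAux_balanced (g : KMap N N' k) (hg : g.LLin) (h : i + k = j) :
    ∀ (p q l pl lq : ℤ) (h₁ : p + l = pl) (h₂ : pl + q = i) (h₃ : l + q = lq) (h₄ : p + lq = i)
      (x : M.X p) (b : B.X l) (y : N.X q),
      tmapRAux M g h pl q h₂ (M.rsmul h₁ x b) y = tmapRAux M g h p lq h₄ x (N.lsmul h₃ b y) :=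
  fun p q l pl lq h₁ h₂ h₃ h₄ x b y => by
    rw [tmapRAux_apply g h h₂ rfl (by omega), tmapRAux_apply g h h₄ rfl (by omega),
      hg q _ l lq _ rfl rfl h₃ (by omega : l + (q + k) = lq + k), map_zsmul, smul_smul,
      ← sgn_add, tm_rsmul h₁ _ (by omega : l + (q + k) = lq + k) (by omega)]
    congr 1
    exact sgn_congr 0 (by rw [← h₁]; ring)

variable (M) in
/-- The graded map `M ⊗ g`, `x ⊗ y ↦ (-1)^{|g||x|} x ⊗ g y`. -/
noncomputable def tmapR (g : KMap N N' k) (hg : g.LLin) :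
    KMap (tensor M N) (tensor M N') k :=
  KMap.mk fun _ _ h => tmLift (tmapRAux M g h) (tmapRAux_balanced g hg h)

lemma tmapR_tm (g : KMap N N' k) (hg : g.LLin) {i j p q q' : ℤ} (h : i + k = j)
    (hpq : p + q = i) (hq : q + k = q') (hj : p + q' = j) (x : M.X p) (y : N.X q) :
    (tmapR M g hg).app h (tm M N hpq x y) = sgn (k * p) • tm M N' hj x (g.app hq y) := by
  rw [tmapR, mk_app, tmLift_tm (tmapRAux M g h) (tmapRAux_balanced g hg h) hpq x y,
    tmapRAux_apply g h hpq hq hj]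

lemma tmapL_comp {f : KMap M M' k} (hf : f.RLin) {g : KMap M' M'' l} (hg : g.RLin)
    (h : k + l = n) : (tmapL N f hf).comp (tmapL N g hg) h = tmapL N (f.comp g h) (hf.comp hg h) :=
  kmap_tensor_ext fun i j p q hij hpq x y => by
    rw [comp_app _ _ _ _ rfl (by omega), tmapL_tm f hf _ hpq rfl (by omega),
      tmapL_tm g hg _ _ (by omega : p + k + l = p + n) (by omega), tmapL_tm _ _ _ hpq rfl (by omega),
      comp_app _ _ _ _ rfl (by omega)]

lemma tmapR_comp {f : KMap N N' k} (hf : f.LLin) {g : KMap N' N'' l} (hg : g.LLin)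
    (h : k + l = n) : (tmapR M f hf).comp (tmapR M g hg) h = tmapR M (f.comp g h) (hf.comp hg h) :=
  kmap_tensor_ext fun i j p q hij hpq x y => by
    rw [comp_app _ _ _ _ rfl (by omega), tmapR_tm f hf _ hpq rfl (by omega), map_zsmul,
      tmapR_tm g hg _ _ (by omega : q + k + l = q + n) (by omega),
      tmapR_tm _ _ _ hpq rfl (by omega), comp_app _ _ _ _ rfl (by omega), smul_smul, ← sgn_add]
    congr 1
    exact sgn_congr 0 (by rw [← h]; ring)

lemma tmapL_one (h : (one M).RLin) : tmapL N (one M) h = one (tensor M N) :=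
  kmap_tensor_ext fun i j p q hij hpq x y => by
    obtain rfl : j = i := by omega
    rw [tmapL_tm _ _ _ hpq (add_zero p) hpq, one_app, one_app]

lemma tmapR_one (h : (one N).LLin) : tmapR M (one N) h = one (tensor M N) :=
  kmap_tensor_ext fun i j p q hij hpq x y => by
    obtain rfl : j = i := by omega
    rw [tmapR_tm _ _ _ hpq (add_zero q) hpq, one_app, one_app, zero_mul, sgn_zero, one_smul]

lemma D_tmapL (hk : k' + 1 = k) {f : KMap M M' k} (hf : f.RLin) :
    (tmapL N f hf).D hk = tmapL N (f.D hk) (hf.D hk) := kmap_tensor_ext fun i j p q hij hpq x y => by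
  rw [D_app hk _ hij (sub_add_cancel i 1) rfl (by omega) (by omega),
    tmapL_tm f hf _ hpq (by omega : p + k = p + k' + 1) (by omega),
    d_tm hpq _ (sub_add_cancel p 1) (sub_add_cancel q 1) (by omega) (by omega), map_add, map_zsmul,
    tmapL_tm f hf _ _ (by omega : p - 1 + k = p + k') (by omega),
    tmapL_tm f hf _ _ (by omega : p + k = p + k' + 1) (by omega), tmapL_tm _ _ _ hpq rfl (by omega),
    d_tm _ _ rfl (sub_add_cancel q 1) (by omega) (by omega),
    D_app hk f _ (sub_add_cancel p 1) rfl (by omega) (by omega), map_sub, map_zsmul,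
    LinearMap.sub_apply, LinearMap.smul_apply, smul_add, smul_smul, ← sgn_add,
    show sgn (p + k' + 1) = sgn (k + p) from sgn_congr 0 (by rw [← hk]; ring)]
  abel

lemma D_tmapR (hk : k' + 1 = k) {g : KMap N N' k} (hg : g.LLin) :
    (tmapR M g hg).D hk = tmapR M (g.D hk) (hg.D hk) := kmap_tensor_ext fun i j p q hij hpq x y => by
  rw [D_app hk _ hij (sub_add_cancel i 1) rfl (by omega) (by omega),
    tmapR_tm g hg _ hpq (by omega : q + k = q + k' + 1) (by omega),
    d_tm hpq _ (sub_add_cancel p 1) (sub_add_cancel q 1) (by omega) (by omega), map_add, map_zsmul,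
    map_zsmul,
    tmapR_tm g hg _ _ (by omega : q + k = q + k' + 1) (by omega),
    tmapR_tm g hg _ _ (by omega : q - 1 + k = q + k') (by omega), tmapR_tm _ _ _ hpq rfl (by omega),
    d_tm _ _ (sub_add_cancel p 1) rfl (by omega) (by omega),
    D_app hk g _ (sub_add_cancel q 1) rfl (by omega) (by omega), map_sub, map_zsmul]
  have e₁ : sgn k * sgn (k * (p - 1)) = sgn (k * p) := by
    rw [← sgn_add]; exact sgn_congr 0 (by ring)
  have e₂ : sgn (k * p) * sgn p = sgn (k' * p) := by
    rw [← sgn_add]; exact sgn_congr p (by rw [← hk]; ring)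
  have e₃ : sgn k * (sgn p * sgn (k * p)) = sgn (k' * p) * sgn k := by rw [← e₂]; ring
  simp only [smul_add, smul_sub, smul_smul, e₁, e₂, e₃]
  abel

lemma tmapL_zero {f : KMap M M' k} (hf : f.RLin) (h : f = 0) : tmapL N f hf = 0 := by
  subst h
  exact kmap_tensor_ext fun i j p q hij hpq x y => by
    rw [tmapL_tm _ _ _ hpq rfl (by omega), zero_app, map_zero, LinearMap.zero_apply, zero_app]

lemma tmapR_zero {g : KMap N N' k} (hg : g.LLin) (h : g = 0) : tmapR M g hg = 0 := by
  subst h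
  exact kmap_tensor_ext fun i j p q hij hpq x y => by
    rw [tmapR_tm _ _ _ hpq rfl (by omega), zero_app, map_zero, smul_zero, zero_app]

lemma tmapL_add {f g : KMap M M' k} (hf : f.RLin) (hg : g.RLin) :
    tmapL N (f + g) (hf.add hg) = tmapL N f hf + tmapL N g hg :=
  kmap_tensor_ext fun i j p q hij hpq x y => by
    rw [add_app, tmapL_tm _ _ _ hpq rfl (by omega), tmapL_tm _ _ _ hpq rfl (by omega),
      tmapL_tm _ _ _ hpq rfl (by omega), add_app, map_add, LinearMap.add_apply]

lemma tmapL_closed {f : KMap M M' k} (hf : f.RLin) (hc : f.Closed) :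
    (tmapL N f hf).Closed := by
  rw [KMap.Closed, D_tmapL]
  exact tmapL_zero _ hc

lemma tmapR_closed {g : KMap N N' k} (hg : g.LLin) (hc : g.Closed) :
    (tmapR M g hg).Closed := by
  rw [KMap.Closed, D_tmapR]
  exact tmapR_zero _ hc

lemma tmapL_lLin {M' : DGBimod A B} {f : KMap M M' k} (hf : f.RLin) (hl : f.LLin) :
    (tmapL N f hf).LLin := fun i j l i' j' h h' hl₁ hl' a t => by
  induction t using tm_induction with
  | hz => simp only [map_zero, smul_zero]
  | h0 p q hpq x y =>
    rw [lsmul_tm hl₁ hpq rfl (by omega), tmapL_tm f hf _ _ rfl (by omega),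
      tmapL_tm f hf _ hpq rfl (by omega), lsmul_tm hl' _ (by omega : l + (p + k) = l + p + k)
      (by omega), hl p _ l _ _ rfl rfl rfl (by omega), map_zsmul, LinearMap.smul_apply]
  | hadd s t hs ht => simp only [map_add, smul_add, hs, ht]

lemma tmapL_rLin {f : KMap M M' k} (hf : f.RLin) : (tmapL N f hf).RLin :=
  fun i j l i' j' h h' hl hl' t c => by
  induction t using tm_induction with
  | hz => simp only [map_zero, LinearMap.zero_apply]
  | h0 p q hpq x y =>
    rw [rsmul_tm hl hpq rfl (by omega), tmapL_tm f hf _ _ rfl (by omega),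
      tmapL_tm f hf _ hpq rfl (by omega), rsmul_tm hl' _ rfl (by omega)]
  | hadd s t hs ht => simp only [map_add, LinearMap.add_apply, hs, ht]

lemma tmapR_lLin {g : KMap N N' k} (hg : g.LLin) : (tmapR M g hg).LLin :=
  fun i j l i' j' h h' hl hl' a t => by
  induction t using tm_induction with
  | hz => simp only [map_zero, smul_zero]
  | h0 p q hpq x y =>
    rw [lsmul_tm hl hpq rfl (by omega), tmapR_tm g hg _ _ rfl (by omega),
      tmapR_tm g hg _ hpq rfl (by omega), map_zsmul, lsmul_tm hl' _ rfl (by omega), smul_smul,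
      ← sgn_add]
    congr 1
    exact sgn_congr 0 (by ring)
  | hadd s t hs ht => simp only [map_add, smul_add, hs, ht]

lemma tmapR_rLin {N' : DGBimod B C} {g : KMap N N' k} (hg : g.LLin) (hr : g.RLin) :
    (tmapR M g hg).RLin := fun i j l i' j' h h' hl hl' t c => by
  induction t using tm_induction with
  | hz => simp only [map_zero, LinearMap.zero_apply]
  | h0 p q hpq x y =>
    rw [rsmul_tm hl hpq rfl (by omega), tmapR_tm g hg _ _ rfl (by omega),
      tmapR_tm g hg _ hpq rfl (by omega), map_zsmul, LinearMap.smul_apply,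
      rsmul_tm hl' _ (by omega : q + k + l = q + l + k) (by omega),
      hr q _ l _ _ rfl rfl rfl (by omega)]
  | hadd s t hs ht => simp only [map_add, LinearMap.add_apply, hs, ht]

lemma ofHom_tensorMap_id {M' : DGBimod A B} (f : M ⟶ M') :
    ofHom (tensorMap f (𝟙 N)) = tmapL N (ofHom f) (ofHom_bLin f).2 :=
  kmap_tensor_ext fun i j p q hij hpq x y => by
    obtain rfl : j = i := by omega
    rw [tmapL_tm _ _ _ hpq (add_zero p) hpq, ofHom_app, tensorMap_tm, ofHom_app]
    rfl

lemma ofHom_id_tensorMap {N' : DGBimod B C} (g : N ⟶ N') :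
    ofHom (tensorMap (𝟙 M) g) = tmapR M (ofHom g) (ofHom_bLin g).1 :=
  kmap_tensor_ext fun i j p q hij hpq x y => by
    obtain rfl : j = i := by omega
    rw [tmapR_tm _ _ _ hpq (add_zero q) hpq, ofHom_app, tensorMap_tm, ofHom_app, zero_mul, sgn_zero,
      one_smul]
    rfl

lemma tmapL_tmapR {f : KMap M M' k} (hf : f.RLin) {g : KMap N N' l} (hg : g.LLin)
    (h : k + l = n) (h' : l + k = n) : (tmapL N f hf).comp (tmapR M' g hg) h =
      sgn (k * l) • (tmapR M g hg).comp (tmapL N' f hf) h' :=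
  kmap_tensor_ext fun i j p q hij hpq x y => by
    rw [zsmul_app, comp_app _ _ _ _ rfl (by omega), comp_app _ _ _ _ rfl (by omega),
      tmapL_tm f hf _ hpq rfl (by omega), tmapR_tm g hg _ hpq rfl (by omega),
      tmapR_tm g hg _ _ rfl (by omega), map_zsmul, tmapL_tm f hf _ _ rfl (by omega), smul_smul,
      ← sgn_add]
    congr 1
    exact sgn_congr 0 (by ring)

end TensorMaps

section Restriction

lemma KMap.one_lLin {A B : DGA K} (M : DGBimod A B) : (KMap.one M).LLin :=
  fun i j l i' j' h h' hl hl' a x => by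
    obtain rfl : i = j := by omega
    obtain rfl : i' = j' := by omega
    rw [KMap.one_app, KMap.one_app, zero_mul, sgn_zero, one_smul]

lemma KMap.one_rLin {A B : DGA K} (M : DGBimod A B) : (KMap.one M).RLin :=
  fun i j l i' j' h h' hl hl' x c => by
    obtain rfl : i = j := by omega
    obtain rfl : i' = j' := by omega
    rw [KMap.one_app, KMap.one_app]

variable {A B : DGA K} (M : DGBimod A B)

/-- The identity map from `M` to its underlying right DG module. -/
noncomputable def intoRight : KMap M M.right 0 := KMap.mk fun _ _ h => (KMap.one M).app h

/-- The identity map to `M` from its underlying right DG module. -/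
noncomputable def fromRight : KMap M.right M 0 := KMap.mk fun _ _ h => (KMap.one M).app h

/-- The identity map from `M` to its underlying left DG module. -/
noncomputable def intoLeft : KMap M M.left 0 := KMap.mk fun _ _ h => (KMap.one M).app h

/-- The identity map to `M` from its underlying left DG module. -/
noncomputable def fromLeft : KMap M.left M 0 := KMap.mk fun _ _ h => (KMap.one M).app h

variable {M}

lemma fromRight_app (x : M.X i) : (fromRight M).app (add_zero i) x = x :=
  KMap.one_app _ x

lemma fromLeft_app (x : M.X i) : (fromLeft M).app (add_zero i) x = x :=
  KMap.one_app _ x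

lemma intoRight_closed : (intoRight M).Closed := KMap.one_closed (M := M)

lemma fromRight_closed : (fromRight M).Closed := KMap.one_closed (M := M)

lemma intoLeft_closed : (intoLeft M).Closed := KMap.one_closed (M := M)

lemma fromLeft_closed : (fromLeft M).Closed := KMap.one_closed (M := M)

lemma intoRight_rLin : (intoRight M).RLin :=
  fun i j l i' j' h h' hl hl' x c => KMap.one_rLin M i j l i' j' h h' hl hl' x c

lemma fromRight_rLin : (fromRight M).RLin :=
  fun i j l i' j' h h' hl hl' x c => KMap.one_rLin M i j l i' j' h h' hl hl' x c

lemma intoLeft_lLin : (intoLeft M).LLin :=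
  fun i j l i' j' h h' hl hl' a x => KMap.one_lLin M i j l i' j' h h' hl hl' a x

lemma fromLeft_lLin : (fromLeft M).LLin :=
  fun i j l i' j' h h' hl hl' a x => KMap.one_lLin M i j l i' j' h h' hl hl' a x

lemma intoRight_comp_fromRight : (intoRight M).comp (fromRight M) (add_zero 0) = KMap.one M :=
  KMap.one_comp (KMap.one M) (add_zero 0)

lemma fromRight_comp_intoRight : (fromRight M).comp (intoRight M) (add_zero 0) = KMap.one M.right :=
  KMap.one_comp (KMap.one M) (add_zero 0)

lemma intoLeft_comp_fromLeft : (intoLeft M).comp (fromLeft M) (add_zero 0) = KMap.one M :=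
  KMap.one_comp (KMap.one M) (add_zero 0)

lemma fromLeft_comp_intoLeft : (fromLeft M).comp (intoLeft M) (add_zero 0) = KMap.one M.left :=
  KMap.one_comp (KMap.one M) (add_zero 0)

lemma intoRight_qis : (intoRight M).Qis := one_qis (M := M)

lemma fromRight_qis : (fromRight M).Qis := one_qis (M := M)

lemma intoLeft_qis : (intoLeft M).Qis := one_qis (M := M)

lemma fromLeft_qis : (fromLeft M).Qis := one_qis (M := M)

end Restriction

section Ground

open KMap

variable {A B : DGA K}

lemma ground_eq_smul_one (u : (ground K).X 0) : u = u.1 • (ground K).one :=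
  Subtype.ext (mul_one u.1).symm

lemma lsmul_smul_one (M : DGBimod A B) (c : K) (h : 0 + i = j) (x : M.X i) :
    M.lsmul h (c • A.one) x = c • M.lsmul h A.one x := by
  rw [map_smul, LinearMap.smul_apply]

lemma rsmul_smul_one (M : DGBimod A B) (c : K) (h : i + 0 = j) (x : M.X i) :
    M.rsmul h x (c • B.one) = c • M.rsmul h x B.one := by
  rw [map_smul]

/-- Graded maps between complexes are linear over the ground ring. -/
lemma KMap.lLin_ground {M : DGBimod (ground K) A} {N : DGBimod (ground K) B}
    (f : KMap M N k) : f.LLin := fun i j l i' j' h h' hl hl' a x => by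
  by_cases h0 : l = 0
  · subst h0
    obtain rfl : i = i' := by omega
    obtain rfl : j = j' := by omega
    rw [ground_eq_smul_one a, lsmul_smul_one, lsmul_smul_one, M.one_lsmul, N.one_lsmul, map_smul,
      mul_zero, sgn_zero, one_smul]
  · rw [ground_eq_zero h0 a]
    simp only [map_zero, LinearMap.zero_apply, smul_zero]

lemma KMap.rLin_ground {M : DGBimod A (ground K)} {N : DGBimod B (ground K)}
    (f : KMap M N k) : f.RLin := fun i j l i' j' h h' hl hl' x a => by
  by_cases h0 : l = 0
  · subst h0
    obtain rfl : i = i' := by omega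
    obtain rfl : j = j' := by omega
    rw [ground_eq_smul_one a, rsmul_smul_one, rsmul_smul_one, M.rsmul_one, N.rsmul_one, map_smul]
  · rw [ground_eq_zero h0 a]
    simp only [map_zero]

lemma KMap.LLin.bLin {M N : DGMod A} {f : KMap M N k} (hf : f.LLin) : f.BLin :=
  ⟨hf, f.rLin_ground⟩

lemma KMap.RLin.bLin {M N : DGModOp A} {f : KMap M N k} (hf : f.RLin) : f.BLin :=
  ⟨f.lLin_ground, hf⟩

end Ground

section Characters

variable (K) in
/-- Characters of `K`, an injective cogenerator, as a complex concentrated in degree `0`. -/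
def charDeg (i : ℤ) : Submodule K (CharacterModule K) where
  carrier := {x | i ≠ 0 → x = 0}
  add_mem' {x y} hx hy h := by rw [hx h, hy h, add_zero]
  zero_mem' _ := rfl
  smul_mem' c x hx h := by rw [hx h, smul_zero]

variable (K) in
/-- The injective cogenerator `Hom(K, ℚ/ℤ)` as a DG module concentrated in degree `0`. -/
def chars : DGBimod (ground K) (ground K) where
  X i := charDeg K i
  d _ := 0
  lsmul {i j k} h := LinearMap.mk₂ K
    (fun a x => ⟨a.1 • x.1, fun hk => by
      by_cases hi : i = 0
      · rw [x.2 (by omega), smul_zero]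
      · rw [a.2 hi, zero_smul]⟩)
    (fun a a' x => Subtype.ext (add_smul _ _ _))
    (fun c a x => Subtype.ext (mul_smul _ _ _))
    (fun a x x' => Subtype.ext (smul_add _ _ _))
    (fun c a x => Subtype.ext (smul_comm _ _ _))
  rsmul {i j k} h := LinearMap.mk₂ K
    (fun x a => ⟨a.1 • x.1, fun hk => by
      by_cases hi : i = 0
      · rw [a.2 (by omega), zero_smul]
      · rw [x.2 hi, smul_zero]⟩)
    (fun x x' a => Subtype.ext (smul_add _ _ _))
    (fun c x a => Subtype.ext (smul_comm _ _ _))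
    (fun x a a' => Subtype.ext (add_smul _ _ _))
    (fun c x a => Subtype.ext (mul_smul _ _ _))
  d_d _ _ _ := rfl
  one_lsmul _ x := Subtype.ext (one_smul _ _)
  rsmul_one _ x := Subtype.ext (one_smul _ _)
  mul_lsmul _ _ _ _ a b x := Subtype.ext (mul_smul _ _ _)
  rsmul_mul _ _ _ _ x a b := Subtype.ext
    ((mul_smul _ _ _).symm.trans (congrArg (· • x.1) (mul_comm _ _)))
  lsmul_rsmul _ _ _ _ _ _ _ := Subtype.ext (smul_comm _ _ _)
  lleibniz {_ _ _ _ _ _} _ _ _ _ _ _ _ x := by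
    simp only [LinearMap.zero_apply, map_zero, smul_zero]
    exact Subtype.ext (by change (0 : CharacterModule K) = (0 : K) • x.1 + 0; simp)
  rleibniz {i _ _ _ _ _} _ _ _ _ _ _ x _ := by
    simp only [LinearMap.zero_apply, map_zero, zero_add]
    exact Subtype.ext (by change (0 : CharacterModule K) = sgn i • (0 : K) • x.1; simp)

/-- The character underlying an element of `chars K`. -/
def charVal (j : ℤ) : (chars K).X j →ₗ[K] CharacterModule K := (charDeg K j).subtype

/-- A character as an element of degree `0` of `chars K`. -/
def ofChar (hj : j = 0) : CharacterModule K →ₗ[K] (chars K).X j :=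
  LinearMap.codRestrict (charDeg K j) LinearMap.id fun _ h => absurd hj h

lemma chars_ext {x y : (chars K).X 0} (h : charVal 0 x = charVal 0 y) : x = y := Subtype.ext h

lemma chars_eq_zero (hj : j ≠ 0) (x : (chars K).X j) : x = 0 := Subtype.ext (x.2 hj)

lemma exists_character_extension {U V : Type u} [AddCommGroup U] [Module K U] [AddCommGroup V]
    [Module K V] (j : U →ₗ[K] V) (φ : U →ₗ[K] CharacterModule K)
    (h : ∀ x, j x = 0 → φ x = 0) : ∃ ψ : V →ₗ[K] CharacterModule K, ∀ x, ψ (j x) = φ x := by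
  have hI : Module.Injective K (CharacterModule K) :=
    Module.Flat.iff_characterModule_injective.1 inferInstance
  have hk : LinearMap.ker j ≤ LinearMap.ker φ := h
  obtain ⟨ψ, hψ⟩ := hI.out ((LinearMap.ker j).liftQ j le_rfl)
    (LinearMap.ker_eq_bot.1 (Submodule.ker_liftQ_eq_bot _ _ _ le_rfl))
    ((LinearMap.ker j).liftQ φ hk)
  exact ⟨ψ, fun x => hψ (Submodule.Quotient.mk x)⟩

lemma exists_character_separating {V : Type u} [AddCommGroup V] [Module K V] (W : Submodule K V)
    {v : V} (hv : v ∉ W) :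
    ∃ ψ : V →ₗ[K] CharacterModule K, (∀ w ∈ W, ψ w = 0) ∧ ψ v ≠ 0 := by
  obtain ⟨c, hc⟩ := CharacterModule.exists_character_apply_ne_zero_of_ne_zero
    (a := (Submodule.Quotient.mk v : V ⧸ W)) (by rwa [Ne, Submodule.Quotient.mk_eq_zero])
  let χ : V ⧸ W →ₗ[K] CharacterModule K :=
    { toFun := fun w => AddMonoidHom.comp c (LinearMap.toSpanSingleton K _ w).toAddMonoidHom
      map_add' := fun w w' => DFunLike.ext _ _ fun r =>
        (congrArg c (smul_add r w w')).trans (map_add c _ _)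
      map_smul' := fun a w => DFunLike.ext _ _ fun r =>
        congrArg c ((smul_smul r a w).trans (by rw [mul_comm]; rfl)) }
  refine ⟨χ.comp W.mkQ, fun w hw => ?_, fun h => hc ?_⟩
  · rw [LinearMap.comp_apply, Submodule.mkQ_apply, (Submodule.Quotient.mk_eq_zero _).2 hw, map_zero]
  · have := DFunLike.congr_fun h 1
    exact (congrArg c (one_smul K _)).symm.trans this

open KMap

variable {A B A' B' : DGA K} {X : DGBimod A B} {Y : DGBimod A' B'}

/-- The graded map to `chars K` given by a functional on one component. -/
def charMap (hmn : m + n = 0) (φ : X.X m →ₗ[K] CharacterModule K) :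
    KMap X (chars K) n :=
  KMap.mk fun i j h =>
    if hi : m = i then hi ▸ ((ofChar (by omega : j = 0)).comp φ) else 0

lemma charMap_app (hmn : m + n = 0) (φ : X.X m →ₗ[K] CharacterModule K)
    (x : X.X m) : charVal 0 ((charMap hmn φ).app hmn x) = φ x := by
  simp only [charMap, mk_app, dite_true]
  rfl

lemma charMap_ext {f g : KMap X (chars K) n}
    (h : ∀ (m : ℤ) (hmn : m + n = 0) (x : X.X m), f.app hmn x = g.app hmn x) : f = g :=
  KMap.ext fun i j hij x => by
    by_cases hj : j = 0
    · subst hj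
      exact h i hij x
    · rw [chars_eq_zero hj (f.app hij x), chars_eq_zero hj (g.app hij x)]

lemma D_chars_app (hn : n' + 1 = n) (f : KMap X (chars K) n) {i j i' : ℤ}
    (h : i + n' = j) (hi : i' + 1 = i) (h' : i' + n = j) (x : X.X i) :
    (f.D hn).app h x = -(sgn n • f.app h' (X.d hi x)) := by
  rw [D_app hn f h hi rfl (by omega) h']
  exact zero_sub _

lemma closed_chars_iff (hmn : m + n = 0) {f : KMap X (chars K) n} :
    f.Closed ↔ ∀ x ∈ bdry X m, f.app hmn x = 0 := by
  rw [closed_iff (sub_add_cancel n 1)]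
  constructor
  · rintro h _ ⟨w, rfl⟩
    have h1 := congrArg (fun g => g.app (by omega : m + 1 + (n - 1) = 0) w) h
    have h2 : sgn n • f.app hmn (X.d rfl w) = 0 := by
      rw [← neg_eq_zero, ← D_chars_app (sub_add_cancel n 1) f (by omega) rfl hmn]
      exact h1
    simpa [smul_smul, sgn_mul_self] using congrArg (sgn n • ·) h2
  · intro h
    refine charMap_ext fun i hi x => ?_
    rw [D_chars_app _ f hi (by omega : m + 1 = i) hmn, h _ (d_mem_bdry _ _), smul_zero, neg_zero,
      zero_app]

lemma exact_chars_iff (hmn : m + n = 0) (hn : n + 1 = n') {f : KMap X (chars K) n} :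
    (∃ w : KMap X (chars K) n', w.D hn = f) ↔ ∀ x ∈ cyc X m, f.app hmn x = 0 := by
  constructor
  · rintro ⟨w, rfl⟩ x hx
    rw [D_chars_app hn w hmn (sub_add_cancel m 1) (by omega), (mem_cyc _).1 hx, map_zero, smul_zero,
      neg_zero]
  · intro h
    obtain ⟨ψ, hψ⟩ := exists_character_extension (X.d (sub_add_cancel m 1))
      ((charVal 0).comp (f.app hmn)) fun x hx => by
        rw [LinearMap.comp_apply, h x ((mem_cyc _).2 hx), map_zero]
    have e : m - 1 + n' = 0 := by omega
    refine ⟨-(sgn n' • charMap e ψ), charMap_ext fun i hi x => chars_ext ?_⟩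
    obtain rfl : i = m := by omega
    rw [D_chars_app hn _ hi (sub_add_cancel i 1) e, neg_app, zsmul_app, smul_neg, smul_smul,
      sgn_mul_self, one_smul, neg_neg, charMap_app, hψ]
    rfl

/-- The map induced on the complexes of graded maps to `chars K` is a quasi-isomorphism. -/
def KMap.DualQis (f : KMap X Y 0) : Prop :=
  ∀ (n n' : ℤ) (hn : n + 1 = n'),
    (∀ g : KMap Y (chars K) n, g.Closed →
      (∃ w : KMap X (chars K) n', w.D hn = f.comp g (zero_add n)) →
      ∃ v : KMap Y (chars K) n', v.D hn = g) ∧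
    (∀ g : KMap X (chars K) n, g.Closed → ∃ g' : KMap Y (chars K) n, g'.Closed ∧
      ∃ w : KMap X (chars K) n', w.D hn = g - f.comp g' (zero_add n))

lemma KMap.Qis.dualQis {f : KMap X Y 0} (h : f.Qis) : f.DualQis := by
  intro n n' hn
  have hmn : -n + n = 0 := neg_add_cancel n
  obtain ⟨h₁, h₂⟩ := h (-n) (-n) (add_zero _)
  constructor
  · intro g hg hw
    rw [exact_chars_iff hmn] at hw ⊢
    intro y hy
    obtain ⟨x, hx, hxy⟩ := h₂ y hy
    have e := (closed_chars_iff hmn).1 hg _ hxy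
    rw [map_sub, sub_eq_zero] at e
    rw [e, ← hw x hx, comp_app _ _ _ hmn (add_zero _) hmn]
  · intro g hg
    obtain ⟨ψ, hψ⟩ := exists_character_extension
      ((bdry Y (-n)).mkQ.comp ((f.app (add_zero (-n))).comp (cyc X (-n)).subtype))
      ((charVal 0).comp ((g.app hmn).comp (cyc X (-n)).subtype)) (by
        rintro ⟨x, hx⟩ hb
        have hb' : f.app (add_zero (-n)) x ∈ bdry Y (-n) := (Submodule.Quotient.mk_eq_zero _).1 hb
        exact (congrArg (charVal 0) ((closed_chars_iff hmn).1 hg x (h₁ x hx hb'))).trans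
          (map_zero _))
    refine ⟨charMap hmn (ψ.comp (bdry Y (-n)).mkQ), (closed_chars_iff hmn).2 fun y hy =>
      chars_ext ?_, (exact_chars_iff hmn hn).2 fun x hx => ?_⟩
    · rw [charMap_app, LinearMap.comp_apply, Submodule.mkQ_apply,
        (Submodule.Quotient.mk_eq_zero _).2 hy, map_zero, map_zero]
    · rw [sub_app, comp_app _ _ _ hmn (add_zero _) hmn, sub_eq_zero]
      exact chars_ext (((charMap_app hmn _ _).trans (hψ ⟨x, hx⟩)).symm)

lemma KMap.DualQis.qis {f : KMap X Y 0} (h : f.DualQis) : f.Qis := by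
  intro m j hmj
  obtain rfl : j = m := by omega
  have hmn : j + -j = 0 := add_neg_cancel j
  obtain ⟨h₁, h₂⟩ := h (-j) (-j + 1) rfl
  have key : ∀ {X : DGBimod A B} {ψ : X.X j →ₗ[K] CharacterModule K} {x : X.X j},
      (charMap hmn ψ).app hmn x = 0 ↔ ψ x = 0 := fun {X ψ x} => by
    rw [← charMap_app hmn ψ x]
    exact ⟨fun h => by rw [h, map_zero], fun h => chars_ext (by rw [h, map_zero])⟩
  have key' : ∀ {X : DGBimod A' B'} {ψ : X.X j →ₗ[K] CharacterModule K} {x : X.X j},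
      (charMap hmn ψ).app hmn x = 0 ↔ ψ x = 0 := fun {X ψ x} => by
    rw [← charMap_app hmn ψ x]
    exact ⟨fun h => by rw [h, map_zero], fun h => chars_ext (by rw [h, map_zero])⟩
  constructor
  · intro x hx hb
    by_contra hx'
    obtain ⟨ψ, hψ, hψx⟩ := exists_character_separating _ hx'
    obtain ⟨g', hg', hw⟩ := h₂ (charMap hmn ψ) ((closed_chars_iff hmn).2 fun y hy =>
      key.2 (hψ y hy))
    have e := (exact_chars_iff hmn rfl).1 hw x hx
    rw [sub_app, sub_eq_zero, comp_app _ _ _ hmn hmj hmn, (closed_chars_iff hmn).1 hg' _ hb] at e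
    exact hψx (key.1 e)
  · intro y hy
    by_contra hc
    obtain ⟨ψ, hψ, hψy⟩ := exists_character_separating
      ((cyc X j).map (f.app hmj) ⊔ bdry Y j) (v := y) fun hy' => hc <| by
        obtain ⟨_, ⟨x, hx, rfl⟩, b, hb, e⟩ := Submodule.mem_sup.1 hy'
        exact ⟨x, hx, by rw [← e, add_sub_cancel_left]; exact hb⟩
    refine hψy (key'.1 ((exact_chars_iff hmn rfl).1 (h₁ (charMap hmn ψ)
      ((closed_chars_iff hmn).2 fun z hz => key'.2 (hψ z (Submodule.mem_sup_right hz)))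
      ((exact_chars_iff hmn rfl).2 fun x hx => ?_)) y hy))
    rw [comp_app _ _ _ hmn hmj hmn]
    exact key'.2 (hψ _ (Submodule.mem_sup_left ⟨x, hx, rfl⟩))

end Characters

section Underlying

open KMap

variable {A A' B B' : DGA K}

namespace KMap

section Left

variable {M : DGBimod A B} {N : DGBimod A B'} {k : ℤ}

/-- A graded map as a map of the underlying left modules. -/
def asLeft (f : KMap M N k) : KMap M.left N.left k := KMap.mk fun _ _ h => f.app h

/-- A graded map of the underlying left modules as a graded map. -/
def ofLeft (f : KMap M.left N.left k) : KMap M N k := KMap.mk fun _ _ h => f.app h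

lemma ofLeft_asLeft (f : KMap M N k) : f.asLeft.ofLeft = f := rfl

lemma D_ofLeft (hk : k' + 1 = k) (f : KMap M.left N.left k) :
    f.ofLeft.D hk = (f.D hk).ofLeft := rfl

lemma D_asLeft (hk : k' + 1 = k) (f : KMap M N k) :
    f.asLeft.D hk = (f.D hk).asLeft := rfl

lemma Closed.asLeft {f : KMap M N k} (hf : f.Closed) : f.asLeft.Closed :=
  congrArg KMap.asLeft (show f.D (sub_add_cancel k 1) = 0 from hf)

lemma Closed.ofLeft {f : KMap M.left N.left k} (hf : f.Closed) : f.ofLeft.Closed :=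
  congrArg KMap.ofLeft (show f.D (sub_add_cancel k 1) = 0 from hf)

lemma LLin.asLeft {f : KMap M N k} (hf : f.LLin) : f.asLeft.BLin :=
  LLin.bLin fun i j l i' j' h h' hl hl' a x => hf i j l i' j' h h' hl hl' a x

lemma LLin.ofLeft {f : KMap M.left N.left k} (hf : f.LLin) : f.ofLeft.LLin :=
  fun i j l i' j' h h' hl hl' a x => hf i j l i' j' h h' hl hl' a x

lemma Qis.asLeft {f : KMap M N k} (hf : f.Qis) : f.asLeft.Qis := hf

lemma asLeft_comp {B₁ : DGA K} {L : DGBimod A B₁} (f : KMap M N k) (g : KMap N L l)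
    (h : k + l = n) : (f.comp g h).asLeft = f.asLeft.comp g.asLeft h := rfl

/-- A closed left linear map as a morphism of the underlying left modules. -/
def leftHom (f : KMap M N 0) (hf : f.Closed) (hl : f.LLin) : M.left ⟶ N.left :=
  f.asLeft.toHom hf.asLeft hl.asLeft

lemma ofHom_leftHom (f : KMap M N 0) (hf : f.Closed) (hl : f.LLin) :
    ofHom (f.leftHom hf hl) = f.asLeft := ofHom_toHom _ _ _

lemma Qis.leftHom {f : KMap M N 0} (h : f.Qis) (hf : f.Closed) (hl : f.LLin) :
    quasiIso _ _ (f.leftHom hf hl) := by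
  rw [← qis_ofHom_iff, ofHom_leftHom]
  exact h.asLeft

end Left

section Right

variable {M : DGBimod A B} {N : DGBimod A' B} {k : ℤ}

/-- A graded map as a map of the underlying right modules. -/
def asRight (f : KMap M N k) : KMap M.right N.right k := KMap.mk fun _ _ h => f.app h

/-- A graded map of the underlying right modules as a graded map. -/
def ofRight (f : KMap M.right N.right k) : KMap M N k := KMap.mk fun _ _ h => f.app h

lemma ofRight_asRight (f : KMap M N k) : f.asRight.ofRight = f := rfl

lemma D_ofRight (hk : k' + 1 = k) (f : KMap M.right N.right k) :
    f.ofRight.D hk = (f.D hk).ofRight := rfl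

lemma D_asRight (hk : k' + 1 = k) (f : KMap M N k) :
    f.asRight.D hk = (f.D hk).asRight := rfl

lemma Closed.asRight {f : KMap M N k} (hf : f.Closed) : f.asRight.Closed :=
  congrArg KMap.asRight (show f.D (sub_add_cancel k 1) = 0 from hf)

lemma Closed.ofRight {f : KMap M.right N.right k} (hf : f.Closed) : f.ofRight.Closed :=
  congrArg KMap.ofRight (show f.D (sub_add_cancel k 1) = 0 from hf)

lemma RLin.asRight {f : KMap M N k} (hf : f.RLin) : f.asRight.BLin :=
  RLin.bLin fun i j l i' j' h h' hl hl' a x => hf i j l i' j' h h' hl hl' a x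

lemma RLin.ofRight {f : KMap M.right N.right k} (hf : f.RLin) : f.ofRight.RLin :=
  fun i j l i' j' h h' hl hl' a x => hf i j l i' j' h h' hl hl' a x

lemma Qis.asRight {f : KMap M N k} (hf : f.Qis) : f.asRight.Qis := hf

lemma asRight_comp {A₁ : DGA K} {L : DGBimod A₁ B} (f : KMap M N k) (g : KMap N L l)
    (h : k + l = n) : (f.comp g h).asRight = f.asRight.comp g.asRight h := rfl

/-- A closed right linear map as a morphism of the underlying right modules. -/
def rightHom (f : KMap M N 0) (hf : f.Closed) (hr : f.RLin) : M.right ⟶ N.right :=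
  f.asRight.toHom hf.asRight hr.asRight

lemma ofHom_rightHom (f : KMap M N 0) (hf : f.Closed) (hr : f.RLin) :
    ofHom (f.rightHom hf hr) = f.asRight := ofHom_toHom _ _ _

lemma Qis.rightHom {f : KMap M N 0} (h : f.Qis) (hf : f.Closed) (hr : f.RLin) :
    quasiIso _ _ (f.rightHom hf hr) := by
  rw [← qis_ofHom_iff, ofHom_rightHom]
  exact h.asRight

end Right

end KMap

lemma HProj.left {P : DGMod A} (hP : P.HProj) : P.left.HProj := by
  intro N hN k k' hk g hg hgb
  obtain ⟨h, hh, e⟩ := hP N hN k k' hk ((intoLeft P).comp g (zero_add k))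
    (intoLeft_closed.comp hg _) (intoLeft_lLin.comp hgb.1 _).bLin
  refine ⟨(fromLeft P).comp h (zero_add k'), (fromLeft_lLin.comp hh.1 _).bLin, ?_⟩
  rw [fromLeft_closed.D_comp_left h _ hk hk (zero_add k), e,
    ← comp_assoc _ _ _ (add_zero 0) (zero_add k), fromLeft_comp_intoLeft, one_comp]

lemma HProj.right {P : DGModOp A} (hP : P.HProj) : P.right.HProj := by
  intro N hN k k' hk g hg hgb
  obtain ⟨h, hh, e⟩ := hP N hN k k' hk ((intoRight P).comp g (zero_add k))
    (intoRight_closed.comp hg _) (intoRight_rLin.comp hgb.2 _).bLin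
  refine ⟨(fromRight P).comp h (zero_add k'), (fromRight_rLin.comp hh.2 _).bLin, ?_⟩
  rw [fromRight_closed.D_comp_left h _ hk hk (zero_add k), e,
    ← comp_assoc _ _ _ (add_zero 0) (zero_add k), fromRight_comp_intoRight, one_comp]

variable {C D D' : DGA K}

/-- `Hom(F, -)` preserves quasi-isomorphisms when `F` is homotopically projective as a left
module. -/
lemma postL_qis {F : DGBimod A B} (hF : F.left.HProj) {Y : DGBimod A C} {Y' : DGBimod A D}
    {f : KMap Y Y' 0} (hl : f.LLin) (hc : f.Closed) (hf : f.Qis) : (postL F f hl).Qis := by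
  have hq := hf.leftHom hc hl
  intro i j hij
  obtain rfl : i = j := by omega
  constructor
  · intro φ hφ hb
    rw [mem_cyc_homL] at hφ
    rw [mem_bdry_homL rfl, ofL_postL] at hb
    obtain ⟨w, hw, e⟩ := hb
    obtain ⟨v, hv, ev⟩ := hF.exists_of_comp hq rfl (ofL φ).asLeft hφ.asLeft (ofL_lLin φ).asLeft
      w.asLeft hw.asLeft (by rw [ofHom_leftHom, D_asLeft, e, asLeft_comp])
    exact (mem_bdry_homL rfl).2 ⟨v.ofLeft, hv.1.ofLeft, by rw [D_ofLeft, ev, ofLeft_asLeft]⟩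
  · intro ψ hψ
    rw [mem_cyc_homL] at hψ
    obtain ⟨g, hg, hgb, h, hh, e⟩ := hF.exists_lift hq rfl (ofL ψ).asLeft hψ.asLeft
      (ofL_lLin ψ).asLeft
    refine ⟨toL g.ofLeft hgb.1.ofLeft, mem_cyc_homL.2 hg.ofLeft,
      (mem_bdry_homL rfl).2 ⟨h.ofLeft, hh.1.ofLeft, ?_⟩⟩
    rw [D_ofLeft, e, ofL_sub, ofL_postL, ofHom_leftHom]
    rfl

/-- `Hom(P, -)` preserves quasi-isomorphisms when `P` is homotopically projective as a right
module. -/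
lemma postR_qis {P : DGBimod B A} (hP : P.right.HProj) {Y : DGBimod C A} {Y' : DGBimod D A}
    {f : KMap Y Y' 0} (hr : f.RLin) (hc : f.Closed) (hf : f.Qis) : (postR P f hr).Qis := by
  have hq := hf.rightHom hc hr
  intro i j hij
  obtain rfl : i = j := by omega
  constructor
  · intro φ hφ hb
    rw [mem_cyc_homR] at hφ
    rw [mem_bdry_homR rfl, ofR_postR] at hb
    obtain ⟨w, hw, e⟩ := hb
    obtain ⟨v, hv, ev⟩ := hP.exists_of_comp hq rfl (ofR φ).asRight hφ.asRight (ofR_rLin φ).asRight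
      w.asRight hw.asRight (by rw [ofHom_rightHom, D_asRight, e, asRight_comp])
    exact (mem_bdry_homR rfl).2 ⟨v.ofRight, hv.2.ofRight, by rw [D_ofRight, ev, ofRight_asRight]⟩
  · intro ψ hψ
    rw [mem_cyc_homR] at hψ
    obtain ⟨g, hg, hgb, h, hh, e⟩ := hP.exists_lift hq rfl (ofR ψ).asRight hψ.asRight
      (ofR_rLin ψ).asRight
    refine ⟨toR g.ofRight hgb.2.ofRight, mem_cyc_homR.2 hg.ofRight,
      (mem_bdry_homR rfl).2 ⟨h.ofRight, hh.2.ofRight, ?_⟩⟩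
    rw [D_ofRight, e, ofR_sub, ofR_postR, ofHom_rightHom]
    rfl

lemma ofHom_homLMap (X : DGBimod A B) {Y Y' : DGBimod A C} (g : Y ⟶ Y') :
    ofHom (homLMap X g) = postL X (ofHom g) (ofHom_bLin g).1 := KMap.ext fun i j h f => by
  obtain rfl : i = j := by omega
  refine ofL_injective ?_
  rw [ofL_postL, ofHom_app, ofL_homLMap]

lemma ofHom_homRMap (X : DGBimod B A) {Y Y' : DGBimod C A} (g : Y ⟶ Y') :
    ofHom (homRMap X g) = postR X (ofHom g) (ofHom_bLin g).2 := KMap.ext fun i j h f => by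
  obtain rfl : i = j := by omega
  refine evR_ext fun p q h' x => ?_
  rw [ofHom_app, ← ofR_app, ← ofR_app, ofR_postR, comp_app _ _ _ h' h' (add_zero q)]
  rfl

lemma ofHom_homLPre {X X' : DGBimod A B} (Y : DGBimod A C) (g : X ⟶ X') :
    ofHom (homLPre Y g) = preL Y (ofHom g) (ofHom_bLin g).1 := KMap.ext fun i j h f => by
  obtain rfl : i = j := by omega
  refine ofL_injective ?_
  rw [ofL_preL, ofHom_app, ofL_homLPre, zero_mul, sgn_zero, one_smul]

lemma acyclic_zeroBimod (A B : DGA K) : (zeroBimod A B).Acyclic := fun _ _ _ => ⟨0, rfl⟩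

lemma HProj.kProj {P : DGMod A} (hP : P.HProj) : P.KProj := fun N N' f hf => by
  rw [← qis_ofHom_iff, ofHom_homLMap]
  exact postL_qis hP.left _ (ofHom_closed f) ((qis_ofHom_iff f).2 hf)

lemma HProj.kProjOp {P : DGModOp A} (hP : P.HProj) : P.KProjOp := fun N N' f hf => by
  rw [← qis_ofHom_iff, ofHom_homRMap]
  exact postR_qis hP.right _ (ofHom_closed f) ((qis_ofHom_iff f).2 hf)

lemma KProj.hProj {P : DGMod A} (hP : P.KProj) : P.HProj := by
  intro N hN k k' hk g hg hgb
  have h := hP _ _ (zeroHom N (zeroBimod A (ground K))) (hN.quasiIso (acyclic_zeroBimod _ _) _)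
  rw [← qis_ofHom_iff] at h
  obtain ⟨w, hw, e⟩ := (mem_bdry_homL hk).1 ((h k k (add_zero k)).1 (toL g hgb.1)
    (mem_cyc_homL.2 hg) (by
      rw [show (ofHom (homLMap P (zeroHom N (zeroBimod A (ground K))))).app (add_zero k)
        (toL g hgb.1) = 0 from rfl]
      exact Submodule.zero_mem _))
  exact ⟨w, hw.bLin, e⟩

lemma KProjOp.hProj {P : DGModOp A} (hP : P.KProjOp) : P.HProj := by
  intro N hN k k' hk g hg hgb
  have h := hP _ _ (zeroHom N (zeroBimod (ground K) A)) (hN.quasiIso (acyclic_zeroBimod _ _) _)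
  rw [← qis_ofHom_iff] at h
  obtain ⟨w, hw, e⟩ := (mem_bdry_homR hk).1 ((h k k (add_zero k)).1 (toR g hgb.2)
    (mem_cyc_homR.2 hg) (by
      rw [show (ofHom (homRMap P (zeroHom N (zeroBimod (ground K) A)))).app (add_zero k)
        (toR g hgb.2) = 0 from rfl]
      exact Submodule.zero_mem _))
  exact ⟨w, hw.bLin, e⟩

end Underlying

section DualCriterion

open KMap

variable {B B' : DGA K}

lemma preL_chars_qis_iff {X : DGBimod (ground K) B} {X' : DGBimod (ground K) B'} {f : KMap X' X 0}
    (hl : f.LLin) : (preL (chars K) f hl).Qis ↔ f.DualQis := by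
  have key : ∀ {n : ℤ} (h : n + 0 = n) (φ : (homL X (chars K)).X n),
      ofL ((preL (chars K) f hl).app h φ) = f.comp (ofL φ) (zero_add n) := fun h φ => by
    rw [ofL_preL, zero_mul, sgn_zero, one_smul]
  constructor
  · intro h n n' hn
    obtain ⟨h₁, h₂⟩ := h n n (add_zero n)
    constructor
    · rintro g hg ⟨w, e⟩
      obtain ⟨v, -, e'⟩ := (mem_bdry_homL hn).1 (h₁ (toL g g.lLin_ground) (mem_cyc_homL.2 hg)
        ((mem_bdry_homL hn).2 ⟨w, w.lLin_ground, by rw [e, key, ofL_toL]⟩))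
      exact ⟨v, e'⟩
    · intro g hg
      obtain ⟨x, hx, hb⟩ := h₂ (toL g g.lLin_ground) (mem_cyc_homL.2 hg)
      obtain ⟨w, -, e⟩ := (mem_bdry_homL hn).1 hb
      exact ⟨ofL x, mem_cyc_homL.1 hx, w, by rw [e, ofL_sub, key, ofL_toL]⟩
  · intro h n m hnm
    obtain rfl : n = m := by omega
    obtain ⟨h₁, h₂⟩ := h n _ rfl
    constructor
    · intro x hx hb
      obtain ⟨w, -, e⟩ := (mem_bdry_homL rfl).1 hb
      obtain ⟨v, e'⟩ := h₁ (ofL x) (mem_cyc_homL.1 hx) ⟨w, by rw [e, key]⟩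
      exact (mem_bdry_homL rfl).2 ⟨v, v.lLin_ground, e'⟩
    · intro y hy
      obtain ⟨g, hg, w, e⟩ := h₂ (ofL y) (mem_cyc_homL.1 hy)
      exact ⟨toL g g.lLin_ground, mem_cyc_homL.2 hg, (mem_bdry_homL rfl).2
        ⟨w, w.lLin_ground, by rw [e, ofL_sub, key, ofL_toL]⟩⟩

lemma preR_chars_qis_iff {X : DGBimod B (ground K)} {X' : DGBimod B' (ground K)} {f : KMap X' X 0}
    (hr : f.RLin) : (preR (chars K) f hr).Qis ↔ f.DualQis := by
  have key : ∀ {n : ℤ} (h : n + 0 = n) (φ : (homR X (chars K)).X n),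
      ofR ((preR (chars K) f hr).app h φ) = f.comp (ofR φ) (zero_add n) := fun h φ => by
    rw [ofR_preR, zero_mul, sgn_zero, one_smul]
  constructor
  · intro h n n' hn
    obtain ⟨h₁, h₂⟩ := h n n (add_zero n)
    constructor
    · rintro g hg ⟨w, e⟩
      obtain ⟨v, -, e'⟩ := (mem_bdry_homR hn).1 (h₁ (toR g g.rLin_ground) (mem_cyc_homR.2 hg)
        ((mem_bdry_homR hn).2 ⟨w, w.rLin_ground, by rw [e, key, ofR_toR]⟩))
      exact ⟨v, e'⟩
    · intro g hg
      obtain ⟨x, hx, hb⟩ := h₂ (toR g g.rLin_ground) (mem_cyc_homR.2 hg)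
      obtain ⟨w, -, e⟩ := (mem_bdry_homR hn).1 hb
      exact ⟨ofR x, mem_cyc_homR.1 hx, w, by rw [e, ofR_sub, key, ofR_toR]⟩
  · intro h n m hnm
    obtain rfl : n = m := by omega
    obtain ⟨h₁, h₂⟩ := h n _ rfl
    constructor
    · intro x hx hb
      obtain ⟨w, -, e⟩ := (mem_bdry_homR rfl).1 hb
      obtain ⟨v, e'⟩ := h₁ (ofR x) (mem_cyc_homR.1 hx) ⟨w, by rw [e, key]⟩
      exact (mem_bdry_homR rfl).2 ⟨v, v.rLin_ground, e'⟩
    · intro y hy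
      obtain ⟨g, hg, w, e⟩ := h₂ (ofR y) (mem_cyc_homR.1 hy)
      exact ⟨toR g g.rLin_ground, mem_cyc_homR.2 hg, (mem_bdry_homR rfl).2
        ⟨w, w.rLin_ground, by rw [e, ofR_sub, key, ofR_toR]⟩⟩

end DualCriterion

section Adjunction

open KMap

variable {A B C D : DGA K}

lemma evL_postL {X : DGBimod A B} {Y : DGBimod A C} {Y' : DGBimod A D} {g : KMap Y Y' k}
    (hg : g.LLin) {i j p q r : ℤ} (h : i + k = j) (hp : p + j = q) (hr : p + i = r) (hq : r + k = q)
    (f : (homL X Y).X i) (x : X.X p) :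
    evL hp ((postL X g hg).app h f) x = g.app hq (evL hr f x) := by
  rw [← ofL_app, ofL_postL, comp_app _ _ _ _ hr hq, ofL_app]

lemma evL_preL {B' : DGA K} {X : DGBimod A B} {X' : DGBimod A B'} {Y : DGBimod A C} {g : KMap X' X 0}
    (hg : g.LLin) {i p q : ℤ} (h : i + 0 = i) (hp : p + i = q) (f : (homL X Y).X i) (x : X'.X p) :
    evL hp ((preL Y g hg).app h f) x = evL hp f (g.app (add_zero p) x) := by
  rw [← ofL_app, ofL_preL, zsmul_app, zero_mul, sgn_zero, one_smul,
    comp_app _ _ _ _ (add_zero p) hp, ofL_app]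

lemma postL_lLin {X : DGBimod A B} {Y : DGBimod A C} {Y' : DGBimod A D} {g : KMap Y Y' k}
    (hg : g.LLin) : (postL X g hg).LLin := fun i j l i' j' h h' hl hl' b f =>
  evL_ext fun p q hpq x => by
    rw [map_zsmul, LinearMap.smul_apply, evL_lsmul hl' b _ hpq rfl (by omega), ← ofL_app,
      ← ofL_app, ofL_postL, ofL_postL, comp_app _ _ _ _ rfl (by omega),
      comp_app _ _ _ _ (by omega : p + l + i = p + i') (by omega), ofL_app,
      evL_lsmul hl b f rfl rfl (by omega), map_zsmul, smul_smul, ← sgn_add, ofL_app]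
    congr 1
    exact sgn_congr (-(k * l)) (by rw [← h]; ring)

/-- The adjunction morphism `Hom_A(N ⊗_B F, Y) → Hom_B(F, Hom_A(N, Y))`. -/
noncomputable def curryL (N : DGBimod A B) {C : DGA K} (F : DGBimod B C) (Y : DGBimod A D) :
    KMap (homL (tensor N F) Y) (homL F (homL N Y)) 0 :=
  KMap.mk fun i j h =>
    { toFun := fun f => toL ((ofHom (coev N F)).comp (postL N (ofL f) (ofL_lLin f)) (by omega))
        ((ofHom_bLin _).1.comp (postL_lLin _) _)
      map_add' := fun f f' => evL_ext fun p q hpq z => evL_ext fun r s hrs x => rfl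
      map_smul' := fun c f => evL_ext fun p q hpq z => evL_ext fun r s hrs x => rfl }

variable {N : DGBimod A B} {F : DGBimod B C} {Y : DGBimod A D}

lemma evL_coev (h : j + i = n) (y : F.X i) (x : N.X j) :
    evL h ((coev N F).f i y) x = sgn (j * i) • tm N F h x y := rfl

lemma ofL_curryL (h : i + 0 = j) (f : (homL (tensor N F) Y).X i) :
    ofL ((curryL N F Y).app h f) =
      (ofHom (coev N F)).comp (postL N (ofL f) (ofL_lLin f)) (by omega) := rfl

lemma evL_curryL {i j p q r s t : ℤ} (h : i + 0 = j) (hp : p + j = q) (hr : r + q = s)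
    (ht : r + p = t) (hs : t + i = s) (f : (homL (tensor N F) Y).X i) (z : F.X p) (x : N.X r) :
    evL hr (evL hp ((curryL N F Y).app h f) z) x = sgn (r * p) • evL hs f (tm N F ht x z) := by
  rw [← ofL_app, ← ofL_app, ofL_curryL, comp_app _ _ _ _ (add_zero p) (by omega), ofL_postL,
    comp_app _ _ _ _ ht hs, ofHom_app, ofL_app, ofL_app, evL_coev, map_zsmul]

lemma postL_congr {X : DGBimod A B} {Y' : DGBimod A C} {g g' : KMap Y Y' k} (hg : g.LLin)
    (e : g = g') : postL X g hg = postL X g' (e ▸ hg) := by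
  subst e; rfl

lemma postR_congr {X : DGBimod B A} {Y : DGBimod C A} {Y' : DGBimod D A} {g g' : KMap Y Y' k}
    (hg : g.RLin) (e : g = g') : postR X g hg = postR X g' (e ▸ hg) := by
  subst e; rfl

lemma curryL_closed : (curryL N F Y).Closed := closed_of fun i j i' j' h hi hj h' f => by
  obtain rfl : i = j := by omega
  obtain rfl : i' = j' := by omega
  refine ofL_injective ?_
  rw [ofL_d, sgn_zero, one_smul, ofL_curryL, ofL_curryL,
    (ofHom_closed _).D_comp_left _ _ hj hi (zero_add i'), D_postL, postL_congr _ (ofL_d hi f)]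

/-- The bilinear maps `(x, z) ↦ (-1)^{|x||z|} h z x`. -/
noncomputable def uncurryAux (h : (homL F (homL N Y)).X n) (hij : i + n = j)
    (p q : ℤ) (hpq : p + q = i) : N.X p →ₗ[K] F.X q →ₗ[K] Y.X j :=
  sgn (p * q) • ((evL (X := N) (Y := Y) (by omega : p + (q + n) = j)).comp (evL rfl h)).flip

lemma uncurryAux_apply (h : (homL F (homL N Y)).X n) {i j p q r : ℤ} (hij : i + n = j)
    (hpq : p + q = i) (hr : q + n = r) (hj : p + r = j) (x : N.X p) (z : F.X q) :
    uncurryAux h hij p q hpq x z = sgn (p * q) • evL hj (evL hr h z) x := by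
  subst hr; rfl

lemma uncurryAux_balanced (h : (homL F (homL N Y)).X n) (hij : i + n = j) :
    Balanced (uncurryAux h hij) := fun p q l pl lq h₁ h₂ h₃ h₄ x b z => by
  rw [uncurryAux_apply h hij h₂ rfl (by omega), uncurryAux_apply h hij h₄ rfl (by omega),
    evL_x_lsmul h rfl h₃ rfl (by omega : l + (q + n) = lq + n), map_zsmul, LinearMap.smul_apply,
    evL_lsmul _ b _ _ h₁ (by omega), smul_smul, smul_smul, ← sgn_add, ← sgn_add]
  congr 1
  exact sgn_congr (-(l * p) - n * l) (by rw [← h₁, ← h₃]; ring)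

/-- The graded map `N ⊗_B F → Y` corresponding to an element of `Hom_B(F, Hom_A(N, Y))`. -/
noncomputable def uncurryMap (h : (homL F (homL N Y)).X n) : KMap (tensor N F) Y n :=
  KMap.mk fun _ _ hij => tmLift (uncurryAux h hij) (uncurryAux_balanced h hij)

lemma uncurryMap_tm (h : (homL F (homL N Y)).X n) {i j p q r : ℤ} (hij : i + n = j)
    (hpq : p + q = i) (hr : q + n = r) (hj : p + r = j) (x : N.X p) (z : F.X q) :
    (uncurryMap h).app hij (tm N F hpq x z) = sgn (p * q) • evL hj (evL hr h z) x := by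
  rw [uncurryMap, mk_app, tmLift_tm (uncurryAux h hij) (uncurryAux_balanced h hij) hpq x z,
    uncurryAux_apply h hij hpq hr hj]

lemma uncurryMap_lLin (h : (homL F (homL N Y)).X n) : (uncurryMap h).LLin :=
  fun i j l i' j' h₀ h' hl hl' a t => by
  induction t using tm_induction with
  | hz => simp only [map_zero, smul_zero]
  | h0 p q hpq x z =>
    rw [lsmul_tm hl hpq rfl (by omega), uncurryMap_tm h h' _ rfl (by omega),
      uncurryMap_tm h h₀ hpq rfl (by omega),
      evL_x_lsmul _ _ rfl (by omega : p + (q + n) = j) hl', map_zsmul, smul_smul, smul_smul,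
      ← sgn_add, ← sgn_add]
    congr 1
    exact sgn_congr (l * q) (by ring)
  | hadd s t hs ht => simp only [map_add, smul_add, hs, ht]

lemma curryL_bijective (h : i + 0 = j) : Function.Bijective ((curryL N F Y).app h) := by
  obtain rfl : i = j := by omega
  constructor
  · intro f f' e
    refine ofL_injective (kmap_tensor_ext fun r s p q hrs hpq x z => ?_)
    have := congrArg (fun g => sgn (p * q) • evL (by omega : p + (q + i) = s) (evL rfl g z) x) e
    beta_reduce at this
    rwa [evL_curryL h rfl _ hpq hrs, evL_curryL h rfl _ hpq hrs, smul_smul, smul_smul,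
      sgn_mul_self, one_smul, one_smul] at this
  · intro g
    refine ⟨toL (uncurryMap g) (uncurryMap_lLin g), evL_ext fun p q hpq z =>
      evL_ext fun r s hrs x => ?_⟩
    rw [evL_curryL h hpq hrs rfl (by omega), evL_toL, uncurryMap_tm g _ rfl hpq hrs, smul_smul,
      sgn_mul_self, one_smul]

lemma curryL_qis : (curryL N F Y).Qis := qis_of_bijective curryL_closed fun _ _ => curryL_bijective

lemma preL_lLin {B' : DGA K} {X : DGBimod A B} {X' : DGBimod A B} {g : KMap X' X k}
    {Y : DGBimod A B'} (hg : g.LLin) (hr : g.RLin) : (preL Y g hg).LLin :=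
  fun i j l i' j' h h' hl hl' b f => evL_ext fun p q hpq x => by
    rw [map_zsmul, LinearMap.smul_apply, evL_lsmul hl' b _ hpq rfl (by omega), ← ofL_app,
      ← ofL_app, ofL_preL, ofL_preL, zsmul_app, zsmul_app,
      comp_app _ _ _ _ rfl (by omega), comp_app _ _ _ _ rfl (by omega), ofL_app,
      evL_lsmul hl b f _ (by omega : p + k + l = p + l + k) (by omega),
      hr p _ l _ _ rfl (by omega) rfl (by omega), smul_smul, smul_smul, smul_smul, ← sgn_add,
      ← sgn_add, ← sgn_add, ofL_app]
    congr 1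
    exact sgn_congr 0 (by rw [← h, ← hl]; ring)

lemma curryL_naturality {N' : DGBimod A B} {f : KMap N N' 0} (hl : f.LLin) (hr : f.RLin) :
    (preL Y (tmapL F f hr) (tmapL_lLin hr hl)).comp (curryL N F Y) (add_zero 0) =
      (curryL N' F Y).comp (postL F (preL Y f hl) (preL_lLin hl hr)) (add_zero 0) :=
  KMap.ext fun i j h g => evL_ext fun p q hpq z => evL_ext fun r s hrs x => by
    obtain rfl : i = j := by omega
    rw [comp_app _ _ _ _ h h, comp_app _ _ _ _ h h, evL_curryL h hpq hrs rfl (by omega),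
      evL_preL, tmapL_tm f hr _ _ (add_zero r) rfl, evL_postL _ h hpq hpq (add_zero q), evL_preL,
      evL_curryL h hpq hrs rfl (by omega)]

end Adjunction

section AdjunctionRight

open KMap

variable {A B C D : DGA K}

lemma evR_postR {X : DGBimod B A} {Y : DGBimod C A} {Y' : DGBimod D A} {g : KMap Y Y' k}
    (hg : g.RLin) {i j p q r : ℤ} (h : i + k = j) (hp : p + j = q) (hr : p + i = r) (hq : r + k = q)
    (f : (homR X Y).X i) (x : X.X p) :
    evR hp ((postR X g hg).app h f) x = g.app hq (evR hr f x) := by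
  rw [← ofR_app, ofR_postR, comp_app _ _ _ _ hr hq, ofR_app]

lemma evR_preR {B' : DGA K} {X : DGBimod B A} {X' : DGBimod B' A} {Y : DGBimod C A} {g : KMap X' X 0}
    (hg : g.RLin) {i p q : ℤ} (h : i + 0 = i) (hp : p + i = q) (f : (homR X Y).X i) (x : X'.X p) :
    evR hp ((preR Y g hg).app h f) x = evR hp f (g.app (add_zero p) x) := by
  rw [← ofR_app, ofR_preR, zsmul_app, zero_mul, sgn_zero, one_smul,
    comp_app _ _ _ _ (add_zero p) hp, ofR_app]

lemma postR_rLin {X : DGBimod B A} {Y : DGBimod C A} {Y' : DGBimod D A} {g : KMap Y Y' k}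
    (hg : g.RLin) : (postR X g hg).RLin := fun i j l i' j' h h' hl hl' f b =>
  evR_ext fun p q hpq x => by
    rw [evR_rsmul hl' _ b hpq rfl (by omega), ← ofR_app, ← ofR_app, ofR_postR, ofR_postR,
      comp_app _ _ _ _ rfl (by omega), comp_app _ _ _ _ (by omega : l + p + i = p + i') (by omega),
      ofR_app, evR_rsmul hl f b rfl rfl (by omega), ofR_app]

lemma preR_rLin {B' : DGA K} {X : DGBimod B A} {X' : DGBimod B A} {Y : DGBimod B' A}
    {g : KMap X' X k} (hg : g.RLin) (hl : g.LLin) : (preR Y g hg).RLin :=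
  fun i j l i' j' h h' hlr hlr' f b => evR_ext fun p q hpq x => by
    rw [evR_rsmul hlr' _ b hpq rfl (by omega), ← ofR_app,
      ← ofR_app, ofR_preR, ofR_preR, zsmul_app, zsmul_app,
      comp_app _ _ _ _ rfl (by omega), comp_app _ _ _ _ rfl (by omega), ofR_app,
      evR_rsmul hlr f b _ (by omega : l + (p + k) = l + p + k) (by omega),
      hl p _ l _ _ rfl (by omega) rfl (by omega), map_zsmul, smul_smul, ← sgn_add, ofR_app]
    congr 1
    exact sgn_congr 0 (by rw [← hlr]; ring)

/-- The map `N → Hom_{Cᵒᵖ}(E, N ⊗ E)` sending `x` to `y ↦ x ⊗ y`. -/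
noncomputable def insertR (E : DGBimod A B) (N : DGBimod B C) : KMap E (homR N (tensor E N)) 0 :=
  KMap.mk fun i j h =>
    { toFun := fun x => homRMk (fun p q hpq => tm E N (by omega : i + p = q) x)
        (fun p q l p' q' h₁ h₂ hl hl' y c => (rsmul_tm hl' _ hl _ x y c).symm)
      map_add' := fun x x' => evR_ext fun p q hpq y => by simp [evR_mk]
      map_smul' := fun c x => evR_ext fun p q hpq y => by simp [evR_mk] }

variable {E : DGBimod A B} {N : DGBimod B C} {Y : DGBimod D C}

lemma evR_insertR {i j p q : ℤ} (h : i + 0 = j) (hpq : p + j = q) (h' : i + p = q) (x : E.X i)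
    (y : N.X p) : evR hpq ((insertR E N).app h x) y = tm E N h' x y := rfl

lemma insertR_closed : (insertR E N).Closed := closed_of fun i j i' j' h hi hj h' x => by
  obtain rfl : i = j := by omega
  obtain rfl : i' = j' := by omega
  refine evR_ext fun p q hpq y => ?_
  rw [sgn_zero, one_smul, evR_insertR _ _ (by omega), evR_d hi _ hpq (sub_add_cancel p 1) rfl
    (by omega) (by omega), evR_insertR _ _ (by omega), evR_insertR _ _ (by omega),
    d_tm _ _ hi (sub_add_cancel p 1) (by omega) (by omega), add_sub_cancel_right]

lemma insertR_rLin : (insertR E N).RLin := fun i j l i' j' h h' hl hl' x b => by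
  refine evR_ext fun p q hpq y => ?_
  rw [evR_rsmul hl' _ b hpq rfl (by omega), evR_insertR _ _ (by omega),
    evR_insertR _ _ (by omega : i + (l + p) = q), tm_rsmul hl _ rfl]

variable (E N Y) in
/-- The adjunction morphism `Hom_{Cᵒᵖ}(E ⊗_B N, Y) → Hom_{Bᵒᵖ}(E, Hom_{Cᵒᵖ}(N, Y))`. -/
noncomputable def curryR : KMap (homR (tensor E N) Y) (homR E (homR N Y)) 0 :=
  KMap.mk fun i j h =>
    { toFun := fun f => toR ((insertR E N).comp (postR N (ofR f) (ofR_rLin f)) (by omega))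
        (insertR_rLin.comp (postR_rLin _) _)
      map_add' := fun f f' => evR_ext fun p q hpq z => evR_ext fun r s hrs x => rfl
      map_smul' := fun c f => evR_ext fun p q hpq z => evR_ext fun r s hrs x => rfl }

lemma ofR_curryR (h : i + 0 = j) (f : (homR (tensor E N) Y).X i) :
    ofR ((curryR E N Y).app h f) =
      (insertR E N).comp (postR N (ofR f) (ofR_rLin f)) (by omega) := rfl

lemma evR_curryR {i j p q r s t : ℤ} (h : i + 0 = j) (hp : p + j = q) (hr : r + q = s)
    (ht : p + r = t) (hs : t + i = s) (f : (homR (tensor E N) Y).X i) (x : E.X p) (y : N.X r) :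
    evR hr (evR hp ((curryR E N Y).app h f) x) y = evR hs f (tm E N ht x y) := by
  rw [← ofR_app, ← ofR_app, ofR_curryR, comp_app _ _ _ _ (add_zero p) (by omega), ofR_postR,
    comp_app _ _ _ _ (by omega : r + p = t) hs, ofR_app, ofR_app, evR_insertR]

lemma curryR_closed : (curryR E N Y).Closed := closed_of fun i j i' j' h hi hj h' f => by
  obtain rfl : i = j := by omega
  obtain rfl : i' = j' := by omega
  refine ofR_injective ?_
  rw [ofR_d, sgn_zero, one_smul, ofR_curryR, ofR_curryR,
    insertR_closed.D_comp_left _ _ hj hi (zero_add i'), D_postR, postR_congr _ (ofR_d hi f)]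

/-- The bilinear maps `(x, y) ↦ h x y`. -/
noncomputable def uncurryRAux (h : (homR E (homR N Y)).X n) (hij : i + n = j)
    (p q : ℤ) (hpq : p + q = i) : E.X p →ₗ[K] N.X q →ₗ[K] Y.X j :=
  (evR (X := N) (Y := Y) (by omega : q + (p + n) = j)).comp (evR rfl h)

lemma uncurryRAux_apply (h : (homR E (homR N Y)).X n) {i j p q r : ℤ} (hij : i + n = j)
    (hpq : p + q = i) (hr : p + n = r) (hj : q + r = j) (x : E.X p) (y : N.X q) :
    uncurryRAux h hij p q hpq x y = evR hj (evR hr h x) y := by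
  subst hr; rfl

lemma uncurryRAux_balanced (h : (homR E (homR N Y)).X n) (hij : i + n = j) :
    Balanced (uncurryRAux h hij) := fun p q l pl lq h₁ h₂ h₃ h₄ x b y => by
  rw [uncurryRAux_apply h hij h₂ rfl (by omega), uncurryRAux_apply h hij h₄ rfl (by omega),
    evR_x_rsmul h rfl h₁ rfl (by omega : p + n + l = pl + n), evR_rsmul _ _ b _ h₃ (by omega)]

/-- The graded map `E ⊗_B N → Y` corresponding to an element of `Hom_{Bᵒᵖ}(E, Hom_{Cᵒᵖ}(N, Y))`. -/
noncomputable def uncurryRMap (h : (homR E (homR N Y)).X n) : KMap (tensor E N) Y n :=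
  KMap.mk fun _ _ hij => tmLift (uncurryRAux h hij) (uncurryRAux_balanced h hij)

lemma uncurryRMap_tm (h : (homR E (homR N Y)).X n) {i j p q r : ℤ} (hij : i + n = j)
    (hpq : p + q = i) (hr : p + n = r) (hj : q + r = j) (x : E.X p) (y : N.X q) :
    (uncurryRMap h).app hij (tm E N hpq x y) = evR hj (evR hr h x) y := by
  rw [uncurryRMap, mk_app, tmLift_tm (uncurryRAux h hij) (uncurryRAux_balanced h hij) hpq x y,
    uncurryRAux_apply h hij hpq hr hj]

lemma uncurryRMap_rLin (h : (homR E (homR N Y)).X n) : (uncurryRMap h).RLin :=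
  fun i j l i' j' h₀ h' hl hl' t c => by
  induction t using tm_induction with
  | hz => simp only [map_zero, LinearMap.zero_apply]
  | h0 p q hpq x y =>
    rw [rsmul_tm hl hpq rfl (by omega), uncurryRMap_tm h h' _ rfl (by omega),
      uncurryRMap_tm h h₀ hpq rfl (by omega), evR_x_rsmul _ _ rfl (by omega : q + (p + n) = j) hl']
  | hadd s t hs ht => simp only [map_add, LinearMap.add_apply, hs, ht]

lemma curryR_bijective (h : i + 0 = j) : Function.Bijective ((curryR E N Y).app h) := by
  obtain rfl : i = j := by omega
  constructor
  · intro f f' e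
    refine ofR_injective (kmap_tensor_ext fun r s p q hrs hpq x z => ?_)
    have := congrArg (fun g => evR (by omega : q + (p + i) = s) (evR rfl g x) z) e
    beta_reduce at this
    rwa [evR_curryR h rfl _ hpq hrs, evR_curryR h rfl _ hpq hrs] at this
  · intro g
    refine ⟨toR (uncurryRMap g) (uncurryRMap_rLin g), evR_ext fun p q hpq z =>
      evR_ext fun r s hrs x => ?_⟩
    rw [evR_curryR h hpq hrs rfl (by omega), evR_toR, uncurryRMap_tm g _ rfl hpq hrs]

lemma curryR_qis : (curryR E N Y).Qis := qis_of_bijective curryR_closed fun _ _ => curryR_bijective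

lemma curryR_naturality {N' : DGBimod B C} {f : KMap N N' 0} (hl : f.LLin) (hr : f.RLin) :
    (preR Y (tmapR E f hl) (tmapR_rLin hl hr)).comp (curryR E N Y) (add_zero 0) =
      (curryR E N' Y).comp (postR E (preR Y f hr) (preR_rLin hr hl)) (add_zero 0) :=
  KMap.ext fun i j h g => evR_ext fun p q hpq z => evR_ext fun r s hrs x => by
    obtain rfl : i = j := by omega
    rw [comp_app _ _ _ _ h h, comp_app _ _ _ _ h h, evR_curryR h hpq hrs rfl (by omega),
      evR_preR, tmapR_tm f hl _ _ (add_zero r) rfl, zero_mul, sgn_zero, one_smul,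
      evR_postR _ h hpq hpq (add_zero q), evR_preR, evR_curryR h hpq hrs rfl (by omega)]

end AdjunctionRight

section Flatness

open KMap

variable {A A' B C C' : DGA K}

lemma tmapL_congr {M : DGBimod A B} {M' : DGBimod A' B} {N : DGBimod B C}
    {f f' : KMap M M' k} (hf : f.RLin) (e : f = f') : tmapL N f hf = tmapL N f' (e ▸ hf) := by
  subst e; rfl

lemma tmapR_congr {M : DGBimod A B} {N : DGBimod B C} {N' : DGBimod B C'}
    {f f' : KMap N N' k} (hf : f.LLin) (e : f = f') : tmapR M f hf = tmapR M f' (e ▸ hf) := by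
  subst e; rfl

/-- A morphism with a two-sided graded inverse stays a quasi-isomorphism after tensoring. -/
lemma tmapL_qis_of_inverse {M : DGBimod A B} {M' : DGBimod A' B} (N : DGBimod B C)
    {f : KMap M M' 0} {g : KMap M' M 0} (hf : f.RLin) (hg : g.RLin) (hgc : g.Closed)
    (h : f.comp g (add_zero 0) = one M) (h' : g.comp f (add_zero 0) = one M') :
    (tmapL N f hf).Qis := by
  refine qis_of_comp_qis (g := tmapL N g hg) (h := add_zero 0) (h' := add_zero 0) ?_ ?_
    (tmapL_closed hg hgc)
  · rw [tmapL_comp, tmapL_congr _ h, tmapL_one]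
    exact one_qis
  · rw [tmapL_comp, tmapL_congr _ h', tmapL_one]
    exact one_qis

lemma tmapR_qis_of_inverse (M : DGBimod A B) {N : DGBimod B C} {N' : DGBimod B C'}
    {f : KMap N N' 0} {g : KMap N' N 0} (hf : f.LLin) (hg : g.LLin) (hgc : g.Closed)
    (h : f.comp g (add_zero 0) = one N) (h' : g.comp f (add_zero 0) = one N') :
    (tmapR M f hf).Qis := by
  refine qis_of_comp_qis (g := tmapR M g hg) (h := add_zero 0) (h' := add_zero 0) ?_ ?_
    (tmapR_closed hg hgc)
  · rw [tmapR_comp, tmapR_congr _ h, tmapR_one]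
    exact one_qis
  · rw [tmapR_comp, tmapR_congr _ h', tmapR_one]
    exact one_qis

/-- The identification of the tensor product of the underlying one-sided modules. -/
noncomputable def tensorUnderlying (M : DGBimod A B) (N : DGBimod B C) :
    KMap (tensor M.right N.left) (tensor M N) 0 :=
  (tmapL N.left (fromRight M) fromRight_rLin).comp (tmapR M (fromLeft N) fromLeft_lLin) (add_zero 0)

lemma tensorUnderlying_closed (M : DGBimod A B) (N : DGBimod B C) :
    (tensorUnderlying M N).Closed :=
  (tmapL_closed _ fromRight_closed).comp (tmapR_closed _ fromLeft_closed) _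

lemma tensorUnderlying_qis (M : DGBimod A B) (N : DGBimod B C) : (tensorUnderlying M N).Qis :=
  (tmapL_qis_of_inverse _ fromRight_rLin intoRight_rLin intoRight_closed fromRight_comp_intoRight
    intoRight_comp_fromRight).comp (tmapR_qis_of_inverse _ fromLeft_lLin intoLeft_lLin
    intoLeft_closed fromLeft_comp_intoLeft intoLeft_comp_fromLeft)
    (tmapL_closed _ fromRight_closed) (tmapR_closed _ fromLeft_closed) _

lemma tensorUnderlying_tm (M : DGBimod A B) (N : DGBimod B C) {p q i : ℤ} (h : p + q = i)
    (h' : i + 0 = i) (x : M.X p) (y : N.X q) :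
    (tensorUnderlying M N).app h' (tm M.right N.left h x y) = tm M N h x y := by
  have key : ∀ (x : M.right.X p) (y : N.left.X q), (tensorUnderlying M N).app h'
      (tm M.right N.left h x y) =
      tm M N h ((fromRight M).app (add_zero p) x) ((fromLeft N).app (add_zero q) y) := fun x y => by
    rw [tensorUnderlying, comp_app _ _ _ h' h' h', tmapL_tm _ _ _ _ (add_zero p) h,
      tmapR_tm _ _ _ _ (add_zero q) h, zero_mul, sgn_zero, one_smul]
  exact (key x y).trans
    (congrArg₂ (fun a b => tm M N h a b) (fromRight_app x) (fromLeft_app y))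

lemma KMap.RLin.asRight_rLin {M : DGBimod A B} {M' : DGBimod A' B} {f : KMap M M' k}
    (hf : f.RLin) : f.asRight.RLin := hf.asRight.2

lemma KMap.LLin.asLeft_lLin {N : DGBimod B C} {N' : DGBimod B C'} {f : KMap N N' k}
    (hf : f.LLin) : f.asLeft.LLin := hf.asLeft.1

lemma tmapL_asRight_comp {M : DGBimod A B} {M' : DGBimod A' B} (N : DGBimod B C) {f : KMap M M' 0}
    (hf : f.RLin) :
    (tmapL N.left f.asRight hf.asRight_rLin).comp (tensorUnderlying M' N) (add_zero 0) =
      (tensorUnderlying M N).comp (tmapL N f hf) (add_zero 0) :=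
  kmap_tensor_ext fun i j p q hij hpq x y => by
    obtain rfl : i = j := by omega
    rw [comp_app _ _ _ hij hij hij, comp_app _ _ _ hij hij hij, tmapL_tm _ _ _ _ (add_zero p) hpq]
    exact (tensorUnderlying_tm M' N hpq hij (f.app (add_zero p) x) y).trans
      ((tmapL_tm f hf hij hpq (add_zero p) hpq x y).symm.trans
        (congrArg ((tmapL N f hf).app hij) (tensorUnderlying_tm M N hpq hij x y)).symm)

lemma tmapR_asLeft_comp (M : DGBimod A B) {N : DGBimod B C} {N' : DGBimod B C'} {f : KMap N N' 0}
    (hf : f.LLin) :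
    (tmapR M.right f.asLeft hf.asLeft_lLin).comp (tensorUnderlying M N') (add_zero 0) =
      (tensorUnderlying M N).comp (tmapR M f hf) (add_zero 0) :=
  kmap_tensor_ext fun i j p q hij hpq x y => by
    obtain rfl : i = j := by omega
    rw [comp_app _ _ _ hij hij hij, comp_app _ _ _ hij hij hij, tmapR_tm _ _ _ _ (add_zero q) hpq,
      map_zsmul]
    exact (congrArg (sgn (0 * p) • ·) (tensorUnderlying_tm M N' hpq hij x
      (f.app (add_zero q) y))).trans ((tmapR_tm f hf hij hpq (add_zero q) hpq x y).symm.trans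
        (congrArg ((tmapR M f hf).app hij) (tensorUnderlying_tm M N hpq hij x y)).symm)

lemma KFlat.tmapL_qis {N : DGBimod B C} (hN : N.left.KFlat) {M : DGBimod A B} {M' : DGBimod A' B}
    {f : KMap M M' 0} (hf : f.RLin) (hc : f.Closed) (hq : f.Qis) : (tmapL N f hf).Qis := by
  have h := hN _ _ _ (hq.rightHom hc hf)
  rw [← qis_ofHom_iff, ofHom_tensorMap_id, tmapL_congr _ (ofHom_rightHom f hc hf)] at h
  refine (tensorUnderlying_qis M N).of_comp_left (h := add_zero 0) ?_ (tensorUnderlying_closed M N)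
    (tmapL_closed _ hc)
  rw [← tmapL_asRight_comp]
  exact h.comp (tensorUnderlying_qis _ _) (tmapL_closed _ hc.asRight) (tensorUnderlying_closed _ _) _

lemma KFlatOp.tmapR_qis {M : DGBimod A B} (hM : M.right.KFlatOp) {N : DGBimod B C}
    {N' : DGBimod B C'} {f : KMap N N' 0} (hf : f.LLin) (hc : f.Closed) (hq : f.Qis) :
    (tmapR M f hf).Qis := by
  have h := hM _ _ _ (hq.leftHom hc hf)
  rw [← qis_ofHom_iff, ofHom_id_tensorMap, tmapR_congr _ (ofHom_leftHom f hc hf)] at h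
  refine (tensorUnderlying_qis M N).of_comp_left (h := add_zero 0) ?_ (tensorUnderlying_closed M N)
    (tmapR_closed _ hc)
  rw [← tmapR_asLeft_comp]
  exact h.comp (tensorUnderlying_qis _ _) (tmapR_closed _ hc.asLeft) (tensorUnderlying_closed _ _) _

lemma HProj.kFlat {F : DGMod A} (hF : F.HProj) : F.KFlat := fun N N' f hf => by
  rw [← qis_ofHom_iff, ofHom_tensorMap_id] at *
  have h₁ := (preL_chars_qis_iff (ofHom_bLin f).1).2 (Qis.dualQis hf)
  have h₂ := postL_qis hF.left (preL_lLin (Y := chars K) (ofHom_bLin f).1 (ofHom_bLin f).2)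
    (preL_closed _ (ofHom_closed f)) h₁
  refine DualQis.qis ((preL_chars_qis_iff (tmapL_lLin (ofHom_bLin f).2 (ofHom_bLin f).1)).1 ?_)
  refine curryL_qis.of_comp_right (h := add_zero 0) ?_
    (preL_closed _ (tmapL_closed _ (ofHom_closed f))) curryL_closed
  rw [curryL_naturality]
  exact curryL_qis.comp h₂ curryL_closed (postL_closed _ (preL_closed _ (ofHom_closed f))) _

lemma HProj.kFlatOp {E : DGModOp A} (hE : E.HProj) : E.KFlatOp := fun N N' f hf => by
  rw [← qis_ofHom_iff, ofHom_id_tensorMap] at *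
  have h₁ := (preR_chars_qis_iff (ofHom_bLin f).2).2 (Qis.dualQis hf)
  have h₂ := postR_qis hE.right (preR_rLin (Y := chars K) (ofHom_bLin f).2 (ofHom_bLin f).1)
    (preR_closed _ (ofHom_closed f)) h₁
  refine DualQis.qis ((preR_chars_qis_iff (tmapR_rLin (ofHom_bLin f).1 (ofHom_bLin f).2)).1 ?_)
  refine curryR_qis.of_comp_right (h := add_zero 0) ?_
    (preR_closed _ (tmapR_closed _ (ofHom_closed f))) curryR_closed
  rw [curryR_naturality]
  exact curryR_qis.comp h₂ curryR_closed (postR_closed _ (preR_closed _ (ofHom_closed f))) _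

lemma KFlat.left {F : DGMod A} (hF : F.KFlat) : F.left.KFlat := fun N N' f hf => by
  have h := hF N N' f hf
  rw [← qis_ofHom_iff, ofHom_tensorMap_id] at h ⊢
  have e := tmapL_tmapR (ofHom_bLin f).2 (fromLeft_lLin (M := F)) (add_zero 0) (add_zero 0)
  rw [zero_mul, sgn_zero, one_smul] at e
  have hq : ∀ N : DGModOp A, (tmapR N (fromLeft F) fromLeft_lLin).Qis := fun N =>
    tmapR_qis_of_inverse _ fromLeft_lLin intoLeft_lLin
      intoLeft_closed fromLeft_comp_intoLeft intoLeft_comp_fromLeft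
  refine (hq N').of_comp_right (h := add_zero 0) ?_ (tmapL_closed _ (ofHom_closed f))
    (tmapR_closed _ fromLeft_closed)
  rw [e]
  exact (hq N).comp h (tmapR_closed _ fromLeft_closed) (tmapL_closed _ (ofHom_closed f)) _

lemma KFlatOp.right {E : DGModOp A} (hE : E.KFlatOp) : E.right.KFlatOp := fun N N' f hf => by
  have h := hE N N' f hf
  rw [← qis_ofHom_iff, ofHom_id_tensorMap] at h ⊢
  have e := tmapL_tmapR (fromRight_rLin (M := E)) (ofHom_bLin f).1 (add_zero 0) (add_zero 0)
  rw [zero_mul, sgn_zero, one_smul] at e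
  have hq : ∀ N : DGMod A, (tmapL N (fromRight E) fromRight_rLin).Qis := fun N =>
    tmapL_qis_of_inverse _ fromRight_rLin intoRight_rLin
      intoRight_closed fromRight_comp_intoRight intoRight_comp_fromRight
  refine (hq N').of_comp_right (h := add_zero 0) ?_ (tmapR_closed _ (ofHom_closed f))
    (tmapL_closed _ fromRight_closed)
  rw [← e]
  exact (hq N).comp h (tmapL_closed _ fromRight_closed) (tmapR_closed _ (ofHom_closed f)) _

lemma exists_hProj_resolution (N : DGBimod A B) :
    ∃ (P : DGBimod A B) (π : P ⟶ N), P.HProj ∧ quasiIso A B π := by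
  obtain ⟨P, π, hP, hπ⟩ := exists_cof N
  exact ⟨P, π, hP.hProj, hπ.1⟩

/-- A quasi-isomorphism between K-flat modules stays one after tensoring. -/
lemma KFlat.tmapR_qis {F : DGBimod B C} {F' : DGBimod B C'} (hF : F.left.KFlat)
    (hF' : F'.left.KFlat) {f : KMap F F' 0} (hl : f.LLin) (hc : f.Closed) (hq : f.Qis)
    (N : DGBimod A B) : (tmapR N f hl).Qis := by
  obtain ⟨E, p, hE, hp⟩ := exists_hProj_resolution N.right
  have hp' := (qis_ofHom_iff p).2 hp
  let q := (ofHom p).comp (fromRight N) (add_zero 0)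
  have hqq : q.Qis := hp'.comp fromRight_qis (ofHom_closed p) fromRight_closed _
  have hqc : q.Closed := (ofHom_closed p).comp fromRight_closed _
  have hqr : q.RLin := (ofHom_bLin p).2.comp fromRight_rLin _
  have e := tmapL_tmapR hqr hl (add_zero 0) (add_zero 0)
  rw [zero_mul, sgn_zero, one_smul] at e
  refine (KFlat.tmapL_qis hF hqr hqc hqq).of_comp_left (h := add_zero 0) ?_ (tmapL_closed _ hqc)
    (tmapR_closed _ hc)
  rw [e]
  exact (KFlatOp.tmapR_qis hE.kFlatOp.right hl hc hq).comp (KFlat.tmapL_qis hF' hqr hqc hqq)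
    (tmapR_closed _ hc) (tmapL_closed _ hqc) _

end Flatness

section ConeData

open KMap

variable {A B A₁ B₁ A₂ B₂ : DGA K}

/-- The maps exhibiting `C` as the mapping cone of `f`. -/
structure ConeData {A B A₁ B₁ A₂ B₂ : DGA K} (M : DGBimod A B) (N : DGBimod A₁ B₁)
    (C : DGBimod A₂ B₂) where
  f : KMap M N 0
  inl : KMap N C 0
  inr : KMap M C 1
  fst : KMap C N 0
  snd : KMap C M (-1)
  f_closed : f.Closed
  inl_closed : inl.Closed
  snd_closed : snd.Closed
  D_inr : inr.D (zero_add 1) = f.comp inl (add_zero 0)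
  D_fst : fst.D (neg_add_cancel 1) = -snd.comp f (add_zero (-1))
  inl_fst : inl.comp fst (add_zero 0) = one N
  inr_snd : inr.comp snd (add_neg_cancel 1) = one M
  inl_snd : inl.comp snd (zero_add (-1)) = 0
  fst_inl : fst.comp inl (add_zero 0) + snd.comp inr (neg_add_cancel 1) = one C

namespace ConeData

variable {M : DGBimod A B} {N : DGBimod A₁ B₁} {C : DGBimod A₂ B₂} (c : ConeData M N C)

lemma d_inr (h : j + 1 = i) (hk : i + 1 = k) (m : M.X i) :
    C.d hk (c.inr.app hk m) = c.inl.app (add_zero i) (c.f.app (add_zero i) m) -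
      c.inr.app h (M.d h m) := by
  have := congrArg (fun g => g.app (add_zero i) m) c.D_inr
  beta_reduce at this
  rw [D_app _ _ _ h hk hk h, comp_app _ _ _ _ (add_zero i) (add_zero i), sgn_one, neg_one_smul,
    sub_neg_eq_add] at this
  rw [← this, add_sub_cancel_right]

lemma d_fst (h : j + 1 = i) (h' : i + -1 = j) (x : C.X i) :
    N.d h (c.fst.app (add_zero i) x) = c.fst.app (add_zero j) (C.d h x) -
      c.f.app (add_zero j) (c.snd.app h' x) := by
  have := congrArg (fun g => g.app h' x) c.D_fst
  beta_reduce at this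
  rw [D_app _ _ _ h h (add_zero i) (add_zero j), neg_app, comp_app _ _ _ _ h' (add_zero j), sgn_zero,
    one_smul] at this
  rw [sub_eq_iff_eq_add.1 this]
  abel

lemma fst_inl_app (x : N.X i) :
    c.fst.app (add_zero i) (c.inl.app (add_zero i) x) = x := by
  rw [← comp_app _ _ (add_zero 0) (add_zero i), c.inl_fst, one_app]

lemma snd_inr_app (h : i + 1 = k) (h' : k + -1 = i) (x : M.X i) :
    c.snd.app h' (c.inr.app h x) = x := by
  rw [← comp_app _ _ (add_neg_cancel 1) (add_zero i), c.inr_snd, one_app]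

lemma snd_inl_app (h : i + -1 = k) (x : N.X i) :
    c.snd.app h (c.inl.app (add_zero i) x) = 0 := by
  rw [← comp_app _ _ (zero_add (-1)) h, c.inl_snd, zero_app]

lemma decomp (h₁ : i + -1 = j) (h₂ : j + 1 = i) (x : C.X i) :
    c.inl.app (add_zero i) (c.fst.app (add_zero i) x) + c.inr.app h₂ (c.snd.app h₁ x) = x := by
  have := congrArg (fun g => g.app (add_zero i) x) c.fst_inl
  beta_reduce at this
  rwa [add_app, comp_app _ _ _ _ (add_zero i) (add_zero i), comp_app _ _ _ _ h₁ h₂, one_app] at this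

lemma inl_f_mem_bdry {m : M.X i} (hm : m ∈ cyc M i) :
    c.inl.app (add_zero i) (c.f.app (add_zero i) m) ∈ bdry C i := by
  have := c.d_inr (sub_add_cancel i 1) rfl m
  rw [(mem_cyc (sub_add_cancel i 1)).1 hm, map_zero, sub_zero] at this
  rw [← this]
  exact d_mem_bdry _ _

variable {A' B' A₁' B₁' A₂' B₂' : DGA K} {M' : DGBimod A' B'} {N' : DGBimod A₁' B₁'}
  {C' : DGBimod A₂' B₂'} (c' : ConeData M' N' C') {m : KMap M M' 0} {n : KMap N N' 0}
  {p : KMap C C' 0}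

/-- The five lemma for mapping cones. -/
lemma qis (hpc : p.Closed)
    (hf : ∀ i (x : M.X i), n.app (add_zero i) (c.f.app (add_zero i) x) =
      c'.f.app (add_zero i) (m.app (add_zero i) x))
    (hl : ∀ i (x : N.X i), p.app (add_zero i) (c.inl.app (add_zero i) x) =
      c'.inl.app (add_zero i) (n.app (add_zero i) x))
    (hr : ∀ i j (h : i + 1 = j) (x : M.X i), p.app (add_zero j) (c.inr.app h x) =
      c'.inr.app h (m.app (add_zero i) x))
    (hs : ∀ i j (h : i + -1 = j) (x : C.X i), m.app (add_zero j) (c.snd.app h x) =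
      c'.snd.app h (p.app (add_zero i) x))
    (hm : m.Qis) (hn : n.Qis) : p.Qis := by
  intro i j hij
  obtain rfl : i = j := by omega
  have h₁ : i - 1 + 1 = i := sub_add_cancel i 1
  have h₂ : i + -1 = i - 1 := rfl
  obtain ⟨m₁, m₂⟩ := hm (i - 1) (i - 1) (add_zero _)
  obtain ⟨n₁, n₂⟩ := hn i i (add_zero _)
  obtain ⟨-, m₃⟩ := hm i i (add_zero _)
  constructor
  · intro x hx hb
    obtain ⟨u, hu⟩ := (mem_bdry h₁).1 (m₁ (c.snd.app h₂ x) (c.snd_closed.map_cyc _ hx) (by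
      rw [hs]; exact c'.snd_closed.map_bdry _ hb))
    set y := c.fst.app (add_zero i) x + c.f.app (add_zero i) u with hy
    have e : c.inl.app (add_zero i) y = x + C.d rfl (c.inr.app rfl u) := by
      rw [c.d_inr h₁ rfl, hu, hy, map_add, eq_sub_of_add_eq (c.decomp h₂ h₁ x)]
      abel
    have hyc : y ∈ cyc N i := by
      rw [mem_cyc h₁]
      have := c.inl_closed.d_app (add_zero i) h₁ h₁ (add_zero _) y
      rw [e, map_add, (mem_cyc h₁).1 hx, zero_add, C.d_d, sgn_zero, one_smul] at this
      rw [← c.fst_inl_app (N.d h₁ y), ← this, map_zero]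
    have hb' : c'.inl.app (add_zero i) (n.app (add_zero i) y) ∈ bdry C' i := by
      rw [← hl, e, map_add]
      exact add_mem hb (hpc.map_bdry _ (d_mem_bdry _ _))
    obtain ⟨g, hg⟩ := (mem_bdry (rfl : i + 1 = i + 1)).1 hb'
    have hi : i + 1 + -1 = i := add_neg_cancel_right i 1
    have hw : c'.snd.app hi g ∈ cyc M' i := by
      rw [mem_cyc h₁, c'.snd_closed.d_app hi rfl h₁ h₂, hg, c'.snd_inl_app, smul_zero]
    have e₂ := c'.d_fst rfl hi g
    rw [hg, c'.fst_inl_app] at e₂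
    obtain ⟨v, hv, hvb⟩ := m₃ _ hw
    have hb₂ : n.app (add_zero i) (y - c.f.app (add_zero i) v) ∈ bdry N' i := by
      have h3 := add_mem (c'.f_closed.map_bdry (add_zero i) hvb) (d_mem_bdry rfl
        (c'.fst.app (add_zero (i + 1)) g))
      rw [e₂, map_sub] at h3
      rw [map_sub, hf]
      convert h3 using 1
      abel
    have hb₃ := c.inl_closed.map_bdry (add_zero i)
      (n₁ _ (sub_mem hyc (c.f_closed.map_cyc _ hv)) hb₂)
    rw [map_sub, e] at hb₃
    have := sub_mem (add_mem hb₃ (c.inl_f_mem_bdry hv)) (d_mem_bdry rfl (c.inr.app rfl u))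
    convert this using 1
    abel
  · intro γ hγ
    obtain ⟨u, hu, hb⟩ := m₂ (c'.snd.app h₂ γ) (c'.snd_closed.map_cyc _ hγ)
    obtain ⟨t, ht⟩ := (mem_bdry h₁).1 hb
    obtain ⟨n₃, -⟩ := hn (i - 1) (i - 1) (add_zero _)
    have e₁ := c'.d_fst h₁ h₂ γ
    rw [(mem_cyc h₁).1 hγ, map_zero, zero_sub] at e₁
    obtain ⟨s, hs'⟩ := (mem_bdry h₁).1 (n₃ (c.f.app (add_zero _) u) (c.f_closed.map_cyc _ hu) (by
      rw [hf]
      have h3 := add_mem (neg_mem (c'.f_closed.map_bdry (add_zero _) hb)) (neg_mem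
        (d_mem_bdry h₁ (c'.fst.app (add_zero i) γ)))
      rw [e₁, map_sub] at h3
      convert h3 using 1
      abel))
    have hd : ∀ (z : C.X i), z = c.inr.app h₁ u - c.inl.app (add_zero i) s → z ∈ cyc C i := by
      rintro z rfl
      rw [mem_cyc h₁, map_sub, c.d_inr (sub_add_cancel (i - 1) 1) h₁, (mem_cyc _).1 hu, map_zero,
        c.inl_closed.d_app (add_zero i) h₁ h₁ (add_zero _), hs', sgn_zero, one_smul, sub_zero,
        sub_self]
    have hz := hd _ rfl
    set z := c.inr.app h₁ u - c.inl.app (add_zero i) s with hzdef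
    set γ₁ := γ - p.app (add_zero i) z + C'.d rfl (c'.inr.app rfl t) with hγ₁
    have hγ₁c : γ₁ ∈ cyc C' i := add_mem (sub_mem hγ (hpc.map_cyc _ hz)) (d_mem_cyc _ _)
    have hγ₁s : c'.snd.app h₂ γ₁ = 0 := by
      rw [hγ₁, c'.d_inr h₁ rfl, hzdef, map_sub, hr, hl, map_add, map_sub, map_sub, map_sub,
        c'.snd_inr_app, c'.snd_inl_app, c'.snd_inl_app, c'.snd_inr_app, ht]
      abel
    have e₃ := c'.decomp h₂ h₁ γ₁
    rw [hγ₁s, map_zero, add_zero] at e₃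
    have e₄ := c'.d_fst h₁ h₂ γ₁
    rw [(mem_cyc h₁).1 hγ₁c, hγ₁s, map_zero, map_zero, sub_zero] at e₄
    obtain ⟨y, hy, hyb⟩ := n₂ _ ((mem_cyc h₁).2 e₄)
    refine ⟨z + c.inl.app (add_zero i) y, add_mem hz (c.inl_closed.map_cyc _ hy), ?_⟩
    have h5 := sub_mem (c'.inl_closed.map_bdry (add_zero i) hyb) (d_mem_bdry rfl
      (c'.inr.app rfl t))
    rw [map_sub, e₃, ← hl] at h5
    rw [map_add]
    convert h5 using 1
    rw [hγ₁]
    abel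

end ConeData

end ConeData

section DGFunctors

open KMap

variable {S A B A' B' : DGA K}

lemma KMap.RLin.neg {M : DGBimod A S} {N : DGBimod B S} {f : KMap M N k} (hf : f.RLin) :
    (-f).RLin := fun i j l i' j' h h' hl hl' x b => by
  rw [neg_app, neg_app, hf i j l i' j' h h' hl hl', map_neg, LinearMap.neg_apply]

/-- A DG functor from DG right `S`-modules. -/
structure DGFun (S A B : DGA K) where
  obj : DGModOp S → DGBimod A B
  map {Y Y' : DGModOp S} {k : ℤ} (f : KMap Y Y' k) (hf : f.RLin) : KMap (obj Y) (obj Y') k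
  map_one (Y : DGModOp S) : map (one Y) (one_rLin Y) = one (obj Y)
  map_comp {Y Y' Y'' : DGModOp S} {k l n : ℤ} {f : KMap Y Y' k} (hf : f.RLin) {g : KMap Y' Y'' l}
    (hg : g.RLin) (h : k + l = n) : (map f hf).comp (map g hg) h = map (f.comp g h) (hf.comp hg h)
  map_add {Y Y' : DGModOp S} {k : ℤ} {f g : KMap Y Y' k} (hf : f.RLin) (hg : g.RLin) :
    map (f + g) (hf.add hg) = map f hf + map g hg
  D_map {Y Y' : DGModOp S} {k k' : ℤ} (hk : k' + 1 = k) {f : KMap Y Y' k} (hf : f.RLin) :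
    (map f hf).D hk = map (f.D hk) (hf.D hk)

namespace DGFun

variable (F : DGFun S A B) {Y Y' : DGModOp S}

lemma map_congr {f f' : KMap Y Y' k} (hf : f.RLin) (e : f = f') :
    F.map f hf = F.map f' (e ▸ hf) := by
  subst e; rfl

lemma map_zero {f : KMap Y Y' k} (hf : f.RLin) (h : f = 0) : F.map f hf = 0 := by
  subst h
  have := F.map_add hf hf
  rw [F.map_congr (hf.add hf) (add_zero 0)] at this
  simpa using this

lemma map_neg {f g : KMap Y Y' k} (hf : f.RLin) (hg : g.RLin) (h : f = -g) :
    F.map f hf = -F.map g hg := by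
  rw [eq_neg_iff_add_eq_zero, ← F.map_add]
  exact F.map_zero _ (by rw [h, neg_add_cancel])

lemma map_closed {f : KMap Y Y' k} (hf : f.RLin) (hc : f.Closed) : (F.map f hf).Closed := by
  rw [KMap.Closed, D_map]
  exact F.map_zero _ hc

/-- A DG functor sends mapping cones to mapping cones. -/
def coneData (f : Y ⟶ Y') : ConeData (F.obj Y) (F.obj Y') (F.obj (cone f)) where
  f := F.map (ofHom f) (ofHom_bLin f).2
  inl := F.map (coneInl f) (coneInl_bLin f).2
  inr := F.map (coneInr f) (coneInr_bLin f).2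
  fst := F.map (coneFst f) (coneFst_bLin f).2
  snd := F.map (coneSnd f) (coneSnd_bLin f).2
  f_closed := F.map_closed _ (ofHom_closed f)
  inl_closed := F.map_closed _ (coneInl_closed f)
  snd_closed := F.map_closed _ (coneSnd_closed f)
  D_inr := by rw [D_map, map_comp, F.map_congr _ (D_coneInr f)]
  D_fst := by rw [D_map, map_comp, F.map_neg _ _ (D_coneFst f _)]
  inl_fst := by rw [map_comp, F.map_congr _ (coneInl_comp_coneFst f), map_one]
  inr_snd := by rw [map_comp, F.map_congr _ (coneInr_comp_coneSnd f), map_one]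
  inl_snd := by rw [map_comp, F.map_zero _ (coneInl_comp_coneSnd f _)]
  fst_inl := by
    rw [map_comp, map_comp, ← map_add, F.map_congr _ (coneFst_comp_coneInl_add f), map_one]

end DGFun

/-- A natural transformation of DG functors. -/
structure DGNat (F : DGFun S A B) (G : DGFun S A' B') where
  app (Y : DGModOp S) : KMap (F.obj Y) (G.obj Y) 0
  closed (Y : DGModOp S) : (app Y).Closed
  naturality {Y Y' : DGModOp S} {k : ℤ} {f : KMap Y Y' k} (hf : f.RLin) :
    (F.map f hf).comp (app Y') (add_zero k) = (app Y).comp (G.map f hf) (zero_add k)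

namespace DGNat

variable {F : DGFun S A B} {G : DGFun S A' B'} (τ : DGNat F G) {Y Y' : DGModOp S}

lemma naturality_app {f : KMap Y Y' k} (hf : f.RLin) (h : i + k = j)
    (x : (F.obj Y).X i) : (τ.app Y').app (add_zero j) ((F.map f hf).app h x) =
      (G.map f hf).app h ((τ.app Y).app (add_zero i) x) := by
  rw [← comp_app _ _ (add_zero k) h, τ.naturality, comp_app _ _ _ _ (add_zero i) h]

lemma qis_cone {f : Y ⟶ Y'} (h : (τ.app Y).Qis) (h' : (τ.app Y').Qis) : (τ.app (cone f)).Qis :=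
  (F.coneData f).qis (G.coneData f) (τ.closed _)
    (fun _ _ => τ.naturality_app _ _ _) (fun _ _ => τ.naturality_app _ _ _)
    (fun _ _ _ _ => τ.naturality_app _ _ _) (fun _ _ _ _ => τ.naturality_app _ _ _) h h'

lemma qis_shift (n : ℤ) (h : (τ.app Y).Qis) : (τ.app (Y.shift n)).Qis := by
  have key : ∀ {A B : DGA K} (F : DGFun S A B),
      (F.map (toShift Y n) (toShift_bLin Y n).2).Qis := fun F => by
    refine qis_of_comp_qis (g := F.map (ofShift Y n (add_neg_cancel n)) (ofShift_bLin Y n _).2)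
      (h := add_neg_cancel n) (h' := neg_add_cancel n) ?_ ?_ (F.map_closed _ (ofShift_closed _ _ _))
    · rw [F.map_comp, F.map_congr _ (toShift_comp_ofShift Y n _), F.map_one]
      exact one_qis
    · rw [F.map_comp, F.map_congr _ (ofShift_comp_toShift Y n _), F.map_one]
      exact one_qis
  refine (key F).of_comp_left (h := add_zero n) ?_ (F.map_closed _ (toShift_closed Y n))
    (τ.closed _)
  rw [τ.naturality]
  exact h.comp (key G) (τ.closed _) (G.map_closed _ (toShift_closed Y n)) _

/-- A homotopy retract of a module at which a transformation is a quasi-isomorphism. -/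
lemma qis_retract (i : Y ⟶ Y') (r : Y' ⟶ Y) (hir : Homotopic (i ≫ r) (𝟙 Y)) (h : (τ.app Y').Qis) :
    (τ.app Y).Qis := by
  obtain ⟨s, hs, e⟩ := hir
  have key : ∀ {A B : DGA K} (F : DGFun S A B) {j : ℤ} {x : (F.obj Y).X j}, x ∈ cyc _ j →
      (F.map (ofHom r) (ofHom_bLin r).2).app (add_zero j)
        ((F.map (ofHom i) (ofHom_bLin i).2).app (add_zero j) x) - x ∈ bdry (F.obj Y) j := by
    intro A B F j x hx
    have e' : (F.map s hs.2).D (zero_add 1) = (F.map (ofHom i) (ofHom_bLin i).2).comp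
        (F.map (ofHom r) (ofHom_bLin r).2) (add_zero 0) + -one (F.obj Y) := by
      rw [F.D_map, F.map_comp, ← F.map_one, ← F.map_neg (RLin.neg (one_rLin Y)) (one_rLin Y) rfl,
        ← F.map_add]
      exact F.map_congr _ (by rw [e, ofHom_comp, sub_eq_add_neg]; rfl)
    have := congrArg (fun g => g.app (add_zero j) x) e'
    beta_reduce at this
    rw [D_app _ _ _ (sub_add_cancel j 1) rfl rfl (sub_add_cancel j 1), (mem_cyc _).1 hx,
      LinearMap.map_zero, smul_zero, sub_zero, add_app, neg_app, one_app,
      comp_app _ _ _ _ (add_zero j) (add_zero j), ← sub_eq_add_neg] at this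
    rw [← this]
    exact d_mem_bdry _ _
  intro j k hjk
  obtain rfl : j = k := by omega
  obtain ⟨h₁, h₂⟩ := h j j (add_zero j)
  constructor
  · intro x hx hb
    have h3 := (F.map_closed (ofHom_bLin r).2 (ofHom_closed r)).map_bdry (add_zero j)
      (h₁ _ ((F.map_closed (ofHom_bLin i).2 (ofHom_closed i)).map_cyc (add_zero j) hx) (by
        rw [τ.naturality_app]
        exact (G.map_closed _ (ofHom_closed i)).map_bdry _ hb))
    simpa using sub_mem h3 (key F hx)
  · intro y hy
    obtain ⟨x, hx, hb⟩ := h₂ _ ((G.map_closed (ofHom_bLin i).2 (ofHom_closed i)).map_cyc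
      (add_zero j) hy)
    refine ⟨_, (F.map_closed (ofHom_bLin r).2 (ofHom_closed r)).map_cyc (add_zero j) hx, ?_⟩
    rw [τ.naturality_app]
    have h3 := (G.map_closed (ofHom_bLin r).2 (ofHom_closed r)).map_bdry (add_zero j) hb
    rw [LinearMap.map_sub] at h3
    simpa using sub_mem h3 (key G hy)

lemma qis_sum (h : (τ.app Y).Qis) (h' : (τ.app Y').Qis) : (τ.app (sum Y Y')).Qis := by
  have key : ∀ {A B : DGA K} (F : DGFun S A B) {j : ℤ} (x : (F.obj (sum Y Y')).X j),
      (F.map (ofHom (sumInl Y Y')) (ofHom_bLin _).2).app (add_zero j)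
        ((F.map (ofHom (sumFst Y Y')) (ofHom_bLin _).2).app (add_zero j) x) +
      (F.map (ofHom (sumInr Y Y')) (ofHom_bLin _).2).app (add_zero j)
        ((F.map (ofHom (sumSnd Y Y')) (ofHom_bLin _).2).app (add_zero j) x) = x := by
    intro A B F j x
    rw [← comp_app _ _ (add_zero 0) (add_zero j), ← comp_app _ _ (add_zero 0) (add_zero j),
      ← add_app, F.map_comp, F.map_comp, ← F.map_add, F.map_congr (f' := one (sum Y Y')),
      F.map_one, one_app]
    refine KMap.ext fun i j h x => ?_
    obtain rfl : i = j := by omega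
    rw [add_app, comp_app _ _ _ _ (add_zero i) (add_zero i),
      comp_app _ _ _ _ (add_zero i) (add_zero i), one_app]
    exact Prod.ext (add_zero x.1) (zero_add x.2)
  intro j k hjk
  obtain rfl : j = k := by omega
  obtain ⟨h₁, h₂⟩ := h j j (add_zero j)
  obtain ⟨h₁', h₂'⟩ := h' j j (add_zero j)
  have hc : ∀ {A B : DGA K} (F : DGFun S A B) {Y Y' : DGModOp S} (f : Y ⟶ Y'),
    (F.map (ofHom f) (ofHom_bLin f).2).Closed := fun F _ _ f => F.map_closed _ (ofHom_closed f)
  constructor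
  · intro x hx hb
    rw [← key F x]
    refine add_mem ((hc F _).map_bdry _ (h₁ _ ((hc F _).map_cyc _ hx) ?_))
      ((hc F _).map_bdry _ (h₁' _ ((hc F _).map_cyc _ hx) ?_))
    · rw [τ.naturality_app]
      exact (hc G _).map_bdry _ hb
    · rw [τ.naturality_app]
      exact (hc G _).map_bdry _ hb
  · intro y hy
    obtain ⟨x, hx, hb⟩ := h₂ _ ((hc G (sumFst Y Y')).map_cyc (add_zero j) hy)
    obtain ⟨x', hx', hb'⟩ := h₂' _ ((hc G (sumSnd Y Y')).map_cyc (add_zero j) hy)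
    refine ⟨_, add_mem ((hc F (sumInl Y Y')).map_cyc (add_zero j) hx)
      ((hc F (sumInr Y Y')).map_cyc (add_zero j) hx'), ?_⟩
    have h3 := add_mem ((hc G (sumInl Y Y')).map_bdry (add_zero j) hb)
      ((hc G (sumInr Y Y')).map_bdry (add_zero j) hb')
    rw [LinearMap.map_sub, LinearMap.map_sub, sub_add_sub_comm, key G y] at h3
    rwa [LinearMap.map_add, τ.naturality_app, τ.naturality_app]

end DGNat

end DGFunctors

section FinitelyBuilt

variable {A B : DGA K}

/-- Induction principle for modules that are finitely built from `G`. -/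
lemma FinitelyBuilt.induction {G : DGBimod A B} {Good : DGBimod A B → Prop}
    (hQ : ∀ {Y Y' : DGBimod A B} (f : Y ⟶ Y'), quasiIso A B f → (Good Y ↔ Good Y'))
    (base : Good G) (hshift : ∀ n Y, Good Y → Good (Y.shift n))
    (hcone : ∀ {Y Y' : DGBimod A B} (f : Y ⟶ Y'), Good Y → Good Y' → Good (DGBimod.cone f))
    (hsum : ∀ Y Y', Good Y → Good Y' → Good (sum Y Y'))
    (hret : ∀ {Y Y' : DGBimod A B} (i : Y ⟶ Y') (r : Y' ⟶ Y), Homotopic (i ≫ r) (𝟙 Y) →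
      Good Y' → Good Y)
    {X : Derived A B} (h : FinitelyBuilt G X) : ∀ Y, Nonempty (Q.obj Y ≅ X) → Good Y := by
  have invQ : ∀ {Y Y' : DGBimod A B}, (Q.obj Y ≅ Q.obj Y') → Good Y → Good Y' := by
    intro Y Y' e hY
    obtain ⟨P, p, hP, hp⟩ := exists_hProj_resolution Y
    have : IsIso (Q.map p) := (isIso_Q_map_iff p).2 hp
    obtain ⟨f, hf⟩ := hP.exists_Q_map_eq (Q.map p ≫ e.hom)
    have hf' : IsIso (Q.map f) := by rw [hf]; infer_instance
    exact (hQ f ((isIso_Q_map_iff f).1 hf')).1 ((hQ p hp).2 hY)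
  have retract : ∀ {Y Y' : DGBimod A B}, Retract (Q.obj Y) (Q.obj Y') → Good Y' → Good Y := by
    intro Y Y' r hY
    obtain ⟨P, p, hP, hp⟩ := exists_hProj_resolution Y
    obtain ⟨P', p', hP', hp'⟩ := exists_hProj_resolution Y'
    have : IsIso (Q.map p) := (isIso_Q_map_iff p).2 hp
    have : IsIso (Q.map p') := (isIso_Q_map_iff p').2 hp'
    obtain ⟨f, hf⟩ := hP.exists_Q_map_eq (Q.map p ≫ r.i ≫ inv (Q.map p'))
    obtain ⟨g, hg⟩ := hP'.exists_Q_map_eq (Q.map p' ≫ r.r ≫ inv (Q.map p))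
    refine (hQ p hp).1 (hret f g (hP.homotopic_of_Q_map_eq ?_) ((hQ p' hp').2 hY))
    rw [Functor.map_comp, hf, hg, CategoryTheory.Functor.map_id]
    simp
  have obj : ∀ X : Derived A B, ∃ Y : DGBimod A B, Nonempty (Q.obj Y ≅ X) := fun X =>
    ⟨_, ⟨(Q : DGBimod A B ⥤ Derived A B).objObjPreimageIso X⟩⟩
  induction h with
  | base => exact fun Y ⟨e⟩ => invQ e.symm base
  | iso e _ ih => exact fun Y ⟨e'⟩ => ih Y ⟨e' ≪≫ e.symm⟩
  | shift n M _ ih => exact fun Y ⟨e⟩ => invQ e.symm (hshift n M (ih M ⟨Iso.refl _⟩))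
  | cone f _ _ ih ih' =>
    exact fun Y ⟨e⟩ => invQ e.symm (hcone f (ih _ ⟨Iso.refl _⟩) (ih' _ ⟨Iso.refl _⟩))
  | @summand X X' r _ ih =>
    rintro Y ⟨e⟩
    obtain ⟨Y', ⟨e'⟩⟩ := obj X'
    exact retract ⟨e.hom ≫ r.i ≫ e'.inv, e'.hom ≫ r.r ≫ e.inv, by simp⟩ (ih Y' ⟨e'⟩)
  | @emptyCoprod X h =>
    rintro Y ⟨e⟩
    exact retract ⟨e.hom ≫ h.to _, Q.map (zeroHom G Y), by
      rw [← cancel_epi e.inv]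
      exact h.hom_ext _ _⟩ base
  | @coprod X X' c h _ _ ih ih' =>
    rintro Y ⟨e⟩
    obtain ⟨Y₁, ⟨e₁⟩⟩ := obj X
    obtain ⟨Y₂, ⟨e₂⟩⟩ := obj X'
    obtain ⟨P₁, p₁, hP₁, hp₁⟩ := exists_hProj_resolution Y₁
    obtain ⟨P₂, p₂, hP₂, hp₂⟩ := exists_hProj_resolution Y₂
    have : IsIso (Q.map p₁) := (isIso_Q_map_iff p₁).2 hp₁
    have : IsIso (Q.map p₂) := (isIso_Q_map_iff p₂).2 hp₂
    let l : X ⟶ c.pt := c.inl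
    let r : X' ⟶ c.pt := c.inr
    obtain ⟨f, hf⟩ := hP₁.exists_Q_map_eq (Q.map p₁ ≫ e₁.hom ≫ l ≫ e.inv)
    obtain ⟨g, hg⟩ := hP₂.exists_Q_map_eq (Q.map p₂ ≫ e₂.hom ≫ r ≫ e.inv)
    obtain ⟨d, hl, hr⟩ : ∃ d : c.pt ⟶ Q.obj (sum P₁ P₂),
        l ≫ d = e₁.inv ≫ inv (Q.map p₁) ≫ Q.map (sumInl P₁ P₂) ∧
        r ≫ d = e₂.inv ≫ inv (Q.map p₂) ≫ Q.map (sumInr P₁ P₂) :=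
      ⟨Limits.BinaryCofan.IsColimit.desc h _ _, Limits.BinaryCofan.IsColimit.inl_desc h _ _,
        Limits.BinaryCofan.IsColimit.inr_desc h _ _⟩
    have hd : d ≫ Q.map (sumDesc f g) = e.inv := by
      refine Limits.BinaryCofan.IsColimit.hom_ext h ?_ ?_
      · change l ≫ d ≫ Q.map (sumDesc f g) = l ≫ e.inv
        rw [← Category.assoc, hl, Category.assoc, Category.assoc,
          ← Functor.map_comp, sumInl_desc, hf]
        simp
      · change r ≫ d ≫ Q.map (sumDesc f g) = r ≫ e.inv
        rw [← Category.assoc, hr, Category.assoc, Category.assoc,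
          ← Functor.map_comp, sumInr_desc, hg]
        simp
    exact retract (Y' := sum P₁ P₂) ⟨e.hom ≫ d, Q.map (sumDesc f g), by
      rw [Category.assoc, hd, e.hom_inv_id]⟩
      (hsum _ _ ((hQ p₁ hp₁).2 (ih _ ⟨e₁⟩)) ((hQ p₂ hp₂).2 (ih' _ ⟨e₂⟩)))

end FinitelyBuilt

section Unitor

open KMap

variable {A B C : DGA K}

/-- The pairing given by the left action. -/
def actionPairing (F : DGBimod A B) : Pairing (regular A) F F where
  φ _ _ _ h := F.lsmul h
  bal _ _ _ _ _ _ h₁ h₂ h₃ h₄ a b x := F.mul_lsmul h₁ h₂ h₃ h₄ a b x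
  leibniz _ _ _ _ _ _ h hn hi hj hl hr a x := F.lleibniz h hi hj hn hl hr a x
  map_lsmul _ _ _ _ _ _ h hpq hip hk a b x := F.mul_lsmul hip hk hpq h a b x
  map_rsmul _ _ _ _ _ _ h hpq hqj hk a x b := (F.lsmul_rsmul hpq h hqj hk a x b).symm

/-- The left unitor `A ⊗_A F → F`. -/
noncomputable def unitor (F : DGBimod A B) : tensor (regular A) F ⟶ F := (actionPairing F).desc

lemma unitor_tm {F : DGBimod A B} (h : i + j = n) (a : (regular A).X i) (x : F.X j) :
    (unitor F).f n (tm (regular A) F h a x) = F.lsmul h a x := (actionPairing F).desc_tm h a x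

/-- The inverse `y ↦ 1 ⊗ y` of the left unitor. -/
noncomputable def unitorInv (F : DGBimod A B) : KMap F (tensor (regular A) F) 0 :=
  KMap.mk fun i j h => tm (regular A) F (by omega : 0 + i = j) A.one

lemma unitorInv_app {F : DGBimod A B} (h : i + 0 = j) (h' : 0 + i = j) (y : F.X i) :
    (unitorInv F).app h y = tm (regular A) F h' A.one y := rfl

lemma unitorInv_closed {F : DGBimod A B} : (unitorInv F).Closed :=
  closed_of fun i j i' j' h hi hj h' y => by
    obtain rfl : i = j := by omega
    have key : ∀ a : (regular A).X 0, (regular A).d (neg_add_cancel 1) a = 0 →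
        (tensor (regular A) F).d hj (tm (regular A) F (zero_add i) a y) =
          tm (regular A) F (by omega : 0 + i' = j') a (F.d hi y) := fun a ha => by
      rw [d_tm _ hj (neg_add_cancel 1) hi (by omega) (by omega), ha, map_zero,
        LinearMap.zero_apply, zero_add, sgn_zero, one_smul]
    rw [sgn_zero, one_smul]
    exact key A.one (d_one _)

lemma unitorInv_comp {F : DGBimod A B} :
    (unitorInv F).comp (ofHom (unitor F)) (add_zero 0) = one F := KMap.ext fun i j h y => by
  obtain rfl : i = j := by omega
  rw [comp_app _ _ _ h h h, ofHom_app, one_app]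
  exact (unitor_tm (zero_add i) A.one y).trans (F.one_lsmul _ y)

lemma unitor_comp {F : DGBimod A B} :
    (ofHom (unitor F)).comp (unitorInv F) (add_zero 0) = one (tensor (regular A) F) :=
  kmap_tensor_ext fun i j p q h hpq a y => by
    obtain rfl : i = j := by omega
    rw [comp_app _ _ _ h h h, ofHom_app, unitor_tm, one_app]
    refine (unitorInv_app h (zero_add i) _).trans ?_
    have := tm_rsmul (M := regular A) (N := F) (zero_add p) hpq hpq (zero_add i) A.one a y
    rw [← this]
    exact congrArg (fun a => tm (regular A) F hpq a y) (A.one_mul _ a)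

lemma unitorInv_qis {F : DGBimod A B} : (unitorInv F).Qis :=
  qis_of_comp_qis (g := ofHom (unitor F)) (h := add_zero 0) (h' := add_zero 0)
    (by rw [unitorInv_comp]; exact one_qis) (by rw [unitor_comp]; exact one_qis) (ofHom_closed _)

lemma unitor_quasiIso (F : DGBimod A B) : quasiIso _ _ (unitor F) := by
  rw [← qis_ofHom_iff]
  exact qis_of_comp_qis (g := unitorInv F) (h := add_zero 0) (h' := add_zero 0)
    (by rw [unitor_comp]; exact one_qis) (by rw [unitorInv_comp]; exact one_qis) unitorInv_closed

end Unitor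

section DualBasis

open KMap

variable {A B C D S : DGA K}

/-- The map `(y, z) ↦ (x ↦ y (z x))`. -/
def rankOneAux (P : DGBimod A S) (Y : DGBimod D S) {p q n : ℤ} (h : p + q = n) (y : Y.X p)
    (z : (dual P).X q) : KMap P Y n :=
  KMap.mk fun i j hij => (Y.rsmul (by omega : p + (i + q) = j) y).comp (evD (rfl : i + q = i + q) z)

lemma rankOneAux_app {P : DGBimod A S} {Y : DGBimod D S} {p q n i j r : ℤ} (h : p + q = n)
    (y : Y.X p) (z : (dual P).X q) (hij : i + n = j) (hr : i + q = r) (hj : p + r = j) (x : P.X i) :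
    (rankOneAux P Y h y z).app hij x = Y.rsmul hj y (evD hr z x) := by
  subst hr; rfl

lemma rankOneAux_rLin {P : DGBimod A S} {Y : DGBimod D S} {p q n : ℤ} (h : p + q = n)
    (y : Y.X p) (z : (dual P).X q) : (rankOneAux P Y h y z).RLin :=
  fun i j l i' j' h₁ h₂ hl hl' x b => by
    rw [rankOneAux_app h y z h₂ (by omega : i' + q = i + q + l) (by omega),
      rankOneAux_app h y z h₁ rfl (by omega), evD_x_rsmul z _ hl rfl rfl, Y.rsmul_mul]

/-- The bilinear maps `(y, z) ↦ (x ↦ y (z x))`. -/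
def rankOne (P : DGBimod A S) (Y : DGBimod D S) {p q n : ℤ} (h : p + q = n) :
    Y.X p →ₗ[K] (dual P).X q →ₗ[K] (homR P Y).X n :=
  LinearMap.mk₂ K (fun y z => toR (rankOneAux P Y h y z) (rankOneAux_rLin h y z))
    (fun y y' z => evR_ext fun i j hij x => by
      simp only [evR_toR, map_add, LinearMap.add_apply]
      rw [rankOneAux_app _ _ _ _ rfl (by omega), rankOneAux_app _ _ _ _ rfl (by omega),
        rankOneAux_app _ _ _ _ rfl (by omega), map_add, LinearMap.add_apply])
    (fun c y z => evR_ext fun i j hij x => by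
      simp only [evR_toR, map_smul, LinearMap.smul_apply]
      rw [rankOneAux_app _ _ _ _ rfl (by omega), rankOneAux_app _ _ _ _ rfl (by omega), map_smul,
        LinearMap.smul_apply])
    (fun y z z' => evR_ext fun i j hij x => by
      simp only [evR_toR, map_add, LinearMap.add_apply]
      rw [rankOneAux_app _ _ _ _ rfl (by omega), rankOneAux_app _ _ _ _ rfl (by omega),
        rankOneAux_app _ _ _ _ rfl (by omega), map_add, LinearMap.add_apply, map_add])
    (fun c y z => evR_ext fun i j hij x => by
      simp only [evR_toR, map_smul, LinearMap.smul_apply]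
      rw [rankOneAux_app _ _ _ _ rfl (by omega), rankOneAux_app _ _ _ _ rfl (by omega), map_smul,
        LinearMap.smul_apply, map_smul])

lemma evR_rankOne {P : DGBimod A S} {Y : DGBimod D S} {p q n i j r : ℤ} (h : p + q = n)
    (y : Y.X p) (z : (dual P).X q) (hij : i + n = j) (hr : i + q = r) (hj : p + r = j) (x : P.X i) :
    evR hij (rankOne P Y h y z) x = Y.rsmul hj y (evD hr z x) :=
  rankOneAux_app h y z hij hr hj x

/-- The pairing `(y, z) ↦ (x ↦ y (z x))`. -/
def rankOnePairing (P : DGBimod A S) (Y : DGBimod D S) : Pairing Y (dual P) (homR P Y) where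
  φ n i j h := rankOne P Y h
  bal n i j l il lj h₁ h₂ h₃ h₄ y b z := evR_ext fun r s hrs x => by
    rw [evR_rankOne _ _ _ _ rfl (by omega), evR_rankOne _ _ _ _ (by omega : r + lj = l + (r + j))
      (by omega), evD_lsmul h₃ b z _ rfl rfl, Y.rsmul_mul]
  leibniz i j n i' j' n' h hn hi hj hl hr y z := evR_ext fun r s hrs x => by
    rw [evR_d hn _ hrs (sub_add_cancel r 1) rfl (by omega) (by omega), map_add,
      LinearMap.add_apply, map_zsmul, LinearMap.smul_apply, evR_rankOne _ _ _ _ rfl (by omega),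
      evR_rankOne _ _ _ _ (by omega : r - 1 + j = r + j') (by omega : i + (r + j') = s),
      evR_rankOne hl _ _ hrs rfl (by omega : i' + (r + j) = s),
      evR_rankOne hr _ _ hrs rfl (by omega : i + (r + j') = s),
      Y.rleibniz (by omega : i + (r + j) = s + 1) hi (by omega : r + j' + 1 = r + j) rfl
        (by omega : i' + (r + j) = s) (by omega : i + (r + j') = s),
      evD_d hj z rfl (sub_add_cancel r 1) (by omega : r + j' + 1 = r + j) rfl (by omega), map_sub, map_zsmul,
      smul_sub, smul_smul, ← sgn_add, show sgn n = sgn (i + j) by rw [h]]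
    exact add_sub_assoc _ _ _
  map_lsmul i j k p q ip h hpq hip hk a y z := evR_ext fun r s hrs x => by
    rw [evR_rankOne _ _ _ _ rfl (by omega), evR_lsmul h a _ hrs rfl (by omega),
      evR_rankOne _ _ _ _ rfl (by omega), Y.lsmul_rsmul]
  map_rsmul i j k p q qj h hpq hqj hk y z a := evR_ext fun r s hrs x => by
    rw [evR_rankOne _ _ _ _ rfl (by omega), evR_rsmul h _ a hrs rfl (by omega),
      evR_rankOne _ _ _ _ (by omega : j + r + q = r + qj) (by omega), evD_rsmul hqj z a _ rfl]

/-- The morphism `Y ⊗_S Hom_{Sᵒᵖ}(P, S) → Hom_{Sᵒᵖ}(P, Y)`. -/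
noncomputable def rankOneHom (P : DGBimod A S) (Y : DGBimod D S) : tensor Y (dual P) ⟶ homR P Y :=
  (rankOnePairing P Y).desc

lemma evR_rankOneHom {P : DGBimod A S} {Y : DGBimod D S} {p q n i j r : ℤ} (h : p + q = n)
    (y : Y.X p) (z : (dual P).X q) (hij : i + n = j) (hr : i + q = r) (hj : p + r = j) (x : P.X i) :
    evR hij ((rankOneHom P Y).f n (tm Y (dual P) h y z)) x = Y.rsmul hj y (evD hr z x) := by
  rw [rankOneHom, Pairing.desc_tm]
  exact evR_rankOne h y z hij hr hj x

lemma rankOneHom_naturality {D' : DGA K} {P : DGBimod A S} {Y : DGBimod D S} {Y' : DGBimod D' S} {f : KMap Y Y' k} (hf : f.RLin) :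
    (tmapL (dual P) f hf).comp (ofHom (rankOneHom P Y')) (add_zero k) =
      (ofHom (rankOneHom P Y)).comp (postR P f hf) (zero_add k) :=
  kmap_tensor_ext fun i j p q hij hpq y z => evR_ext fun r s hrs x => by
    rw [comp_app _ _ _ hij hij (add_zero j), comp_app _ _ _ hij (add_zero i) hij,
      tmapL_tm f hf hij hpq rfl (by omega), ofHom_app, evR_rankOneHom _ _ _ _ rfl (by omega),
      evR_postR hf hij hrs rfl (by omega), ofHom_app, evR_rankOneHom _ _ _ _ rfl (by omega),
      hf p (p + k) _ _ _ rfl _ _ (by omega)]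

/-- The DG functor `- ⊗_S W`. -/
noncomputable def tensorDGFun (W : DGBimod S C) : DGFun S (ground K) C where
  obj Y := tensor Y W
  map f hf := tmapL W f hf
  map_one _ := tmapL_one _
  map_comp {_ _ _ _ _ _ _} hf {_} hg h := tmapL_comp hf hg h
  map_add {_ _ _ _ _} hf hg := tmapL_add hf hg
  D_map hk _ hf := D_tmapL hk hf

/-- The DG functor `Hom_{Sᵒᵖ}(P, -)`. -/
def homRDGFun (P : DGBimod A S) : DGFun S (ground K) A where
  obj Y := homR P Y
  map f hf := postR P f hf
  map_one Y := KMap.ext fun i j h f => by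
    obtain rfl : i = j := by omega
    refine ofR_injective ?_
    rw [ofR_postR, comp_one, one_app]
  map_comp {_ _ _ _ _ _ _} hf {_} hg h := KMap.ext fun i j hij f => ofR_injective <| by
    rw [comp_app _ _ _ hij rfl (by omega), ofR_postR, ofR_postR, ofR_postR,
      comp_assoc _ _ _ _ _ h hij]
  map_add {_ _ _ _ _} hf hg := KMap.ext fun i j hij f => ofR_injective <| by
    rw [add_app, ofR_add, ofR_postR, ofR_postR, ofR_postR, comp_add]
  D_map hk _ hf := D_postR hk _ hf

lemma rankOneMap_naturality {P : DGBimod A S} {W : DGBimod S C} (w : KMap W (dual P) 0)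
    (hw : w.LLin) {D' : DGA K} {Y : DGBimod D S} {Y' : DGBimod D' S} {f : KMap Y Y' k}
    (hf : f.RLin) :
    (tmapL W f hf).comp ((tmapR Y' w hw).comp (ofHom (rankOneHom P Y')) (add_zero 0)) (add_zero k) =
      ((tmapR Y w hw).comp (ofHom (rankOneHom P Y)) (add_zero 0)).comp (postR P f hf)
        (zero_add k) := by
  have e := tmapL_tmapR hf hw (add_zero k) (zero_add k)
  rw [mul_zero, sgn_zero, one_smul] at e
  rw [← comp_assoc _ _ _ (add_zero k) (add_zero k), e, comp_assoc _ _ _ _ _ (add_zero k)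
    (zero_add k), rankOneHom_naturality, comp_assoc _ _ _ _ _ (zero_add k) (zero_add k)]

lemma unitorInv_rankOne {P : DGBimod A S} {W : DGBimod S C} (w : KMap W (dual P) 0)
    (hw : w.LLin) :
    (unitorInv W).comp ((tmapR (regular S) w hw).comp (ofHom (rankOneHom P (regular S)))
      (add_zero 0)) (add_zero 0) = w := by
  refine KMap.ext fun i j h x => evR_ext fun r s hrs y => ?_
  obtain rfl : i = j := by omega
  have key : ∀ a : (regular S).X 0, evR hrs (((tmapR (regular S) w hw).comp
      (ofHom (rankOneHom P (regular S))) (add_zero 0)).app h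
        (tm (regular S) W (zero_add i) a x)) y =
      (regular S).rsmul (zero_add s) a (evD hrs (w.app h x) y) := fun a => by
    rw [comp_app _ _ _ h h h, tmapR_tm w hw _ _ h (zero_add i), mul_zero, sgn_zero, one_smul,
      ofHom_app, evR_rankOneHom (zero_add i) _ _ hrs hrs (zero_add s)]
  rw [comp_app _ _ _ h h h, unitorInv_app h (zero_add i)]
  exact (key S.one).trans (S.one_mul _ _)

/-- The transformation `- ⊗_S W → Hom_{Sᵒᵖ}(P, -)` given by a map from `W` to the dual of `P`. -/
noncomputable def rankOneNat (P : DGBimod A S) {W : DGBimod S C} (w : KMap W (dual P) 0)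
    (hw : w.LLin) (hc : w.Closed) : DGNat (tensorDGFun W) (homRDGFun P) where
  app Y := (tmapR Y w hw).comp (ofHom (rankOneHom P Y)) (add_zero 0)
  closed _ := (tmapR_closed hw hc).comp (ofHom_closed _) _
  naturality {_ _ _ _} hf := rankOneMap_naturality w hw hf

/-- A DG bimodule that is finitely built and K-projective over `Sᵒᵖ` has a dual basis up to
homotopy. -/
theorem exists_dualBasis (P : DGBimod A S) (hP : P.right.KProjOp)
    (hfb : FinitelyBuilt (regular S).right (Q.obj P.right)) :
    ∃ c ∈ cyc (tensor P (dual P)) 0, ∃ h : KMap P P 1, h.RLin ∧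
      h.D (zero_add 1) = ofR ((rankOneHom P P).f 0 c) - one P := by
  have hP' := hP.hProj
  obtain ⟨W, π, hW, hπ⟩ := exists_hProj_resolution (dual P).left
  let w : KMap W (dual P) 0 := (ofHom π).comp (fromLeft (dual P)) (add_zero 0)
  have hw : w.LLin := (ofHom_bLin π).1.comp fromLeft_lLin _
  have hwc : w.Closed := (ofHom_closed π).comp fromLeft_closed _
  have hwq : w.Qis := ((qis_ofHom_iff π).2 hπ).comp fromLeft_qis (ofHom_closed π) fromLeft_closed _
  let τ := rankOneNat P w hw hwc
  have hgood : (τ.app P.right).Qis := by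
    refine FinitelyBuilt.induction (Good := fun Y => (τ.app Y).Qis) ?_ ?_ (fun n Y' => τ.qis_shift n (Y := Y'))
      (fun f => τ.qis_cone) (fun Y Y' => τ.qis_sum) (fun i r => τ.qis_retract i r) hfb _
      ⟨Iso.refl _⟩
    · intro Y Y' f hf
      have hf' := (qis_ofHom_iff f).2 hf
      have h₁ : ((tensorDGFun W).map (ofHom f) (ofHom_bLin f).2).Qis :=
        KFlat.tmapL_qis hW.kFlat.left (ofHom_bLin f).2 (ofHom_closed f) hf'
      have h₂ : ((homRDGFun P).map (ofHom f) (ofHom_bLin f).2).Qis :=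
        postR_qis hP' (ofHom_bLin f).2 (ofHom_closed f) hf'
      have c₁ := (tensorDGFun W).map_closed (ofHom_bLin f).2 (ofHom_closed f)
      have c₂ := (homRDGFun P).map_closed (ofHom_bLin f).2 (ofHom_closed f)
      constructor
      · intro h
        refine h₁.of_comp_left (h := add_zero 0) ?_ c₁ (τ.closed _)
        rw [τ.naturality]
        exact h.comp h₂ (τ.closed _) c₂ _
      · intro h
        refine h₂.of_comp_right (h := add_zero 0) ?_ (τ.closed _) c₂
        rw [← τ.naturality]
        exact h₁.comp h c₁ (τ.closed _) _
    · have h₁ : ((unitorInv W).comp (tmapL W (intoRight (regular S)) intoRight_rLin)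
          (add_zero 0)).Qis := unitorInv_qis.comp (tmapL_qis_of_inverse W intoRight_rLin
            fromRight_rLin fromRight_closed intoRight_comp_fromRight fromRight_comp_intoRight)
            unitorInv_closed (tmapL_closed _ intoRight_closed) _
      refine h₁.of_comp_left (h := add_zero 0) ?_ (unitorInv_closed.comp
        (tmapL_closed _ intoRight_closed) _) (τ.closed _)
      have e : ((unitorInv W).comp (tmapL W (intoRight (regular S)) intoRight_rLin)
          (add_zero 0)).comp ((tmapR (regular S).right w hw).comp
            (ofHom (rankOneHom P (regular S).right)) (add_zero 0)) (add_zero 0) =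
          w.comp (postR P (intoRight (regular S)) intoRight_rLin) (add_zero 0) := by
        rw [comp_assoc _ _ _ _ _ (add_zero 0) (add_zero 0), rankOneMap_naturality,
          ← comp_assoc _ _ _ (add_zero 0) (add_zero 0), unitorInv_rankOne]
      refine (congrArg Qis e).mpr ?_
      exact hwq.comp (postR_qis hP' _ intoRight_closed intoRight_qis) hwc
        (postR_closed _ intoRight_closed) _
  obtain ⟨c', hc', hb⟩ := (hgood 0 0 (add_zero 0)).2 (toR (intoRight P) intoRight_rLin)
    (mem_cyc_homR.2 intoRight_closed)
  obtain ⟨v, hv, e⟩ := (mem_bdry_homR (zero_add 1)).1 hb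
  refine ⟨(tmapL (dual P) (fromRight P) fromRight_rLin).app (add_zero 0)
    ((tmapR P.right w hw).app (add_zero 0) c'),
    (tmapL_closed _ fromRight_closed).map_cyc _ ((tmapR_closed hw hwc).map_cyc _ hc'),
    -v.comp (fromRight P) (add_zero 1), RLin.neg (hv.comp fromRight_rLin _), ?_⟩
  have e₂ : ofR ((rankOneHom P P).f 0 ((tmapL (dual P) (fromRight P) fromRight_rLin).app (add_zero 0)
      ((tmapR P.right w hw).app (add_zero 0) c'))) =
      (ofR ((τ.app P.right).app (add_zero 0) c')).comp (fromRight P) (add_zero 0) := by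
    have := congrArg (fun g => g.app (add_zero 0) ((tmapR P.right w hw).app (add_zero 0) c'))
      (rankOneHom_naturality (P := P) (fromRight_rLin (M := P)))
    beta_reduce at this
    rw [comp_app _ _ _ (add_zero 0) (add_zero 0) (add_zero 0),
      comp_app _ _ _ (add_zero 0) (add_zero 0) (add_zero 0), ofHom_app, ofHom_app] at this
    rw [this, ofR_postR]
    refine congrArg (fun t => (ofR t).comp (fromRight P) (add_zero 0)) ?_
    exact (comp_app (tmapR P.right w hw) (ofHom (rankOneHom P P.right)) (add_zero 0) (add_zero 0) (add_zero 0)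
      (add_zero 0) c').symm
  have e' : v.D (zero_add 1) = intoRight P - ofR (Y := P.right)
      ((τ.app P.right).app (add_zero 0) c') := by
    refine e.trans ((ofR_sub _ _).trans ?_)
    rw [ofR_toR]
  rw [e₂, D_neg, fromRight_closed.D_comp_right _ _ (zero_add 1) (zero_add 1) (add_zero 0), e',
    sub_comp, intoRight_comp_fromRight, sgn_zero, one_smul]
  exact neg_sub _ _

end DualBasis

section DualTensor

open KMap

variable {A B C D S : DGA K}

lemma preR_lLin {A' : DGA K} {X : DGBimod A S} {X' : DGBimod A' S} {Y : DGBimod D S}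
    {g : KMap X' X k} (hg : g.RLin) : (preR Y g hg).LLin :=
  fun i j l i' j' h h' hl hl' b f => evR_ext fun p q hpq x => by
    rw [map_zsmul, LinearMap.smul_apply, evR_lsmul hl' b _ hpq rfl (by omega), ← ofR_app,
      ← ofR_app, ofR_preR, ofR_preR, zsmul_app, zsmul_app,
      comp_app _ _ _ _ rfl (by omega), comp_app _ _ _ _ rfl (by omega), ofR_app,
      evR_lsmul hl b f _ (by omega : p + k + i = p + j) (by omega), ofR_app, map_zsmul, smul_smul,
      ← sgn_add, show sgn (k * i') = sgn (k * l + k * i) by rw [← hl, mul_add]]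

lemma preR_add {A' : DGA K} {X : DGBimod A S} {X' : DGBimod A' S} {Y : DGBimod D S}
    {f g : KMap X' X k} (hf : f.RLin) (hg : g.RLin) :
    preR Y (f + g) (hf.add hg) = preR Y f hf + preR Y g hg :=
  KMap.ext fun i j h φ => ofR_injective <| by
    rw [add_app, ofR_add, ofR_preR, ofR_preR, ofR_preR, add_comp, smul_add]

lemma preR_one (X : DGBimod A S) (Y : DGBimod D S) :
    preR Y (one X) (one_rLin X) = one (homR X Y) :=
  KMap.ext fun i j h φ => ofR_injective <| by
    obtain rfl : i = j := by omega
    rw [ofR_preR, one_comp, one_app, zero_mul, sgn_zero, one_smul]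

lemma preR_congr {A' : DGA K} {X : DGBimod A S} {X' : DGBimod A' S} {Y : DGBimod D S}
    {f f' : KMap X' X k} (hf : f.RLin) (e : f = f') : preR Y f hf = preR Y f' (e ▸ hf) := by
  subst e; rfl

lemma preL_add {B' : DGA K} {X : DGBimod A B} {X' : DGBimod A B'} {Y : DGBimod A C}
    {f g : KMap X' X k} (hf : f.LLin) (hg : g.LLin) :
    preL Y (f + g) (hf.add hg) = preL Y f hf + preL Y g hg :=
  KMap.ext fun i j h φ => ofL_injective <| by
    rw [add_app, ofL_add, ofL_preL, ofL_preL, ofL_preL, add_comp, smul_add]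

lemma preL_one (X : DGBimod A B) (Y : DGBimod A C) :
    preL Y (one X) (one_lLin X) = one (homL X Y) :=
  KMap.ext fun i j h φ => ofL_injective <| by
    obtain rfl : i = j := by omega
    rw [ofL_preL, one_comp, one_app, zero_mul, sgn_zero, one_smul]

lemma preL_congr {B' : DGA K} {X : DGBimod A B} {X' : DGBimod A B'} {Y : DGBimod A C}
    {f f' : KMap X' X k} (hf : f.LLin) (e : f = f') : preL Y f hf = preL Y f' (e ▸ hf) := by
  subst e; rfl

lemma tmapL_qis_of_homotopy {P : DGBimod A S} (N : DGBimod S C) {f : KMap P P 0} (hf : f.RLin)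
    {h : KMap P P 1} (hh : h.RLin) (e : h.D (zero_add 1) = f - one P) : (tmapL N f hf).Qis := by
  refine Qis.of_homotopy (f := one _) one_qis (zero_add 1) (-tmapL N h hh) ?_
  have e' : f = one P + h.D (zero_add 1) := by rw [e]; abel
  rw [tmapL_congr hf e', tmapL_add (one_rLin P) (hh.D _), tmapL_one, D_neg, D_tmapL]
  abel

lemma preL_preR_qis_of_homotopy {P : DGBimod A S} (Y : DGBimod D S) (N : DGBimod D C)
    {f : KMap P P 0} (hf : f.RLin)
    {h : KMap P P 1} (hh : h.RLin) (e : h.D (zero_add 1) = f - one P) :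
    (preL N (preR Y f hf) (preR_lLin hf)).Qis := by
  refine Qis.of_homotopy (f := one _) one_qis (zero_add 1) (-preL N (preR Y h hh) (preR_lLin hh)) ?_
  have e' : f = one P + h.D (zero_add 1) := by rw [e]; abel
  have e₁ : preR Y f hf = one _ + preR Y (h.D (zero_add 1)) (hh.D _) := by
    rw [preR_congr hf e', preR_add (one_rLin P) (hh.D _), preR_one]
  rw [preL_congr _ e₁, preL_add (one_lLin _) (preR_lLin _), preL_one, D_neg, D_preL,
    preL_congr _ (D_preR _ _ _)]
  abel

/-- The map `P ⊗_S N → Hom_S(P^∨, N)` of degree `0`. -/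
noncomputable def tensorToHom (P : DGBimod A S) (N : DGBimod S C) :
    KMap (tensor P N) (homL (dual P) N) 0 :=
  (ofHom (coev (dual P) (tensor P N))).comp (ofHom (homLMap (dual P) (evalTensor P N))) (add_zero 0)

lemma evL_tensorToHom_apply {P : DGBimod A S} {N : DGBimod S C} (h : i + 0 = i)
    (hjk : j + i = k) (t : (tensor P N).X i) (z : (dual P).X j) :
    evL hjk ((tensorToHom P N).app h t) z =
      sgn (j * i) • (evalTensor P N).f k (tm (dual P) (tensor P N) hjk z t) := by
  rw [tensorToHom, comp_app _ _ _ h h h, ofHom_app, ofHom_app, ← ofL_app, ofL_homLMap,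
    comp_app _ _ _ hjk hjk (add_zero k), ofHom_app, ofL_app, evL_coev, map_zsmul]

lemma evL_tensorToHom_tm {P : DGBimod A S} {N : DGBimod S C} {i j k p q r : ℤ} (h : i + 0 = i)
    (hjk : j + i = k) (hpq : p + q = i) (hr : p + j = r) (hk : r + q = k)
    (x : P.X p) (y : N.X q) (z : (dual P).X j) :
    evL hjk ((tensorToHom P N).app h (tm P N hpq x y)) z =
      sgn (j * i) • N.lsmul hk (evD hr z x) y := by
  rw [evL_tensorToHom_apply]
  congr 1
  refine (Pairing.desc_tm (evalTensorPairing P N) hjk z (tm P N hpq x y)).trans ?_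
  refine Eq.trans ?_ (evalTensorAux_apply P N hjk hpq hr hk x y z)
  exact tmLift_tm (evalTensorAux P N hjk) (evalTensorAux_balanced P N hjk) hpq x y ▸ rfl

lemma tensorToHom_closed (P : DGBimod A S) (N : DGBimod S C) : (tensorToHom P N).Closed :=
  (ofHom_closed _).comp (ofHom_closed _) _

/-- The map `Hom_S(P^∨, N) → P ⊗_S N` given by evaluation at an element of `P ⊗_S P^∨`. -/
noncomputable def homToTensor {P : DGBimod A S} (N : DGBimod S C) (c : (tensor P (dual P)).X 0) :
    KMap (homL (dual P) N) (tensor P N) 0 :=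
  KMap.mk fun i j h =>
    { toFun := fun φ => (tmapR P (ofL φ) (ofL_lLin φ)).app (by omega : 0 + i = j) c
      map_add' := fun φ φ' => by
        induction c using tm_induction with
        | h0 p q hpq x z =>
          rw [tmapR_tm _ _ _ hpq rfl (by omega), tmapR_tm _ _ _ hpq rfl (by omega),
            tmapR_tm _ _ _ hpq rfl (by omega), ofL_app, ofL_app, ofL_app, map_add,
            LinearMap.add_apply, map_add, smul_add]
        | hz => simp only [map_zero, add_zero]
        | hadd s t hs ht => rw [map_add, map_add, map_add, hs, ht]; abel
      map_smul' := fun a φ => by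
        induction c using tm_induction with
        | h0 p q hpq x z =>
          rw [tmapR_tm _ _ _ hpq rfl (by omega), tmapR_tm _ _ _ hpq rfl (by omega), ofL_app,
            ofL_app, map_smul, LinearMap.smul_apply, map_smul, smul_comm, RingHom.id_apply]
        | hz => simp only [map_zero, smul_zero]
        | hadd s t hs ht => rw [map_add, map_add, hs, ht, smul_add] }

lemma homToTensor_app {P : DGBimod A S} {N : DGBimod S C} (c : (tensor P (dual P)).X 0)
    (h : i + 0 = j) (h' : 0 + i = j) (φ : (homL (dual P) N).X i) :
    (homToTensor N c).app h φ = (tmapR P (ofL φ) (ofL_lLin φ)).app h' c := rfl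

lemma homToTensor_closed {P : DGBimod A S} (N : DGBimod S C) {c : (tensor P (dual P)).X 0}
    (hc : c ∈ cyc (tensor P (dual P)) 0) : (homToTensor N c).Closed :=
  closed_of fun i j i' j' h hi hj h' φ => by
    have e := congrArg (fun f => f.app (by omega : 0 + i' = j') c)
      (D_tmapR (M := P) hi (ofL_lLin φ))
    beta_reduce at e
    rw [D_app hi _ _ (sub_add_cancel 0 1) hj (by omega) (by omega),
      (mem_cyc (sub_add_cancel 0 1)).1 hc, map_zero, smul_zero, sub_zero] at e
    rw [sgn_zero, one_smul, homToTensor_app c h (by omega), e,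
      homToTensor_app c h' (by omega), tmapR_congr _ (ofL_d hi φ).symm]

lemma homToTensor_tm {P : DGBimod A S} {N : DGBimod S C} {p q : ℤ} (hpq : p + q = 0) (x : P.X p)
    (z : (dual P).X q) {i j r : ℤ} (h : i + 0 = j) (hr : q + i = r) (hj : p + r = j)
    (φ : (homL (dual P) N).X i) :
    (homToTensor N (tm P (dual P) hpq x z)).app h φ = sgn (i * p) • tm P N hj x (evL hr φ z) := by
  rw [homToTensor_app _ h (by omega), tmapR_tm _ _ _ hpq hr hj, ofL_app]

lemma tensorToHom_comp_homToTensor {P : DGBimod A S} (N : DGBimod S C)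
    (c : (tensor P (dual P)).X 0) :
    (tensorToHom P N).comp (homToTensor N c) (add_zero 0) =
      tmapL N (ofR ((rankOneHom P P).f 0 c)) (ofR_rLin _) :=
  kmap_tensor_ext fun i j p q hij hpq x y => by
    obtain rfl : i = j := by omega
    rw [comp_app _ _ _ hij hij hij, tmapL_tm _ _ _ hpq (add_zero p) hpq]
    induction c using tm_induction with
    | h0 a b hab u z =>
      rw [homToTensor_tm hab u z hij (rfl : b + i = b + i) (by omega),
        evL_tensorToHom_tm hij rfl hpq (rfl : p + b = p + b) (by omega), ofR_app,
        evR_rankOneHom hab u z (add_zero p) rfl (by omega), map_zsmul, smul_smul, ← sgn_add,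
        show sgn (i * a + b * i) = sgn 0 from
          sgn_congr 0 (by rw [eq_neg_of_add_eq_zero_right hab]; ring), sgn_zero, one_smul,
        tm_rsmul _ _ _ _]
    | hz =>
      rw [map_zero, ofR_zero, zero_app, map_zero, LinearMap.zero_apply, homToTensor_app _ hij
        (by omega), map_zero]
    | hadd s t hs ht =>
      rw [map_add, ofR_add, add_app, map_add, LinearMap.add_apply, ← hs, ← ht,
        homToTensor_app _ hij (by omega), homToTensor_app _ hij (by omega),
        homToTensor_app _ hij (by omega), map_add]

lemma homToTensor_comp_tensorToHom {P : DGBimod A S} (N : DGBimod S C)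
    (c : (tensor P (dual P)).X 0) :
    (homToTensor N c).comp (tensorToHom P N) (add_zero 0) =
      preL N (preR (regular S) (ofR ((rankOneHom P P).f 0 c)) (ofR_rLin _)) (preR_lLin _) :=
  KMap.ext fun i j hij φ => evL_ext fun r s hrs w => by
    obtain rfl : i = j := by omega
    rw [comp_app _ _ _ hij hij hij, evL_preL _ hij hrs]
    induction c using tm_induction with
    | h0 a b hab u z =>
      rw [homToTensor_tm hab u z hij (rfl : b + i = b + i) (by omega), map_zsmul, map_zsmul,
        LinearMap.smul_apply, evL_tensorToHom_tm hij hrs _ (rfl : a + r = a + r) (by omega),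
        smul_smul, ← sgn_add]
      have e : (preR (regular S) (ofR ((rankOneHom P P).f 0 (tm P (dual P) hab u z))) (ofR_rLin _)).app
          (add_zero r) w = (dual P).lsmul (by omega : a + r + b = r) (evD rfl w u) z :=
        evR_ext fun m n hmn y => by
          rw [evR_preR _ (add_zero r) hmn, ofR_app, evR_rankOneHom hab u z (add_zero m) rfl (by omega)]
          refine (evD_x_rsmul w _ _ rfl (by omega : a + r + (m + b) = n) _ _).trans ?_
          refine (evD_lsmul _ _ _ _ rfl _ _).symm
      rw [e, evL_x_lsmul φ _ _ rfl (by omega : a + r + (b + i) = s)]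
      congr 1
      exact sgn_congr 0 (by ring)
    | hz =>
      have e : (preR (regular S) (ofR ((rankOneHom P P).f 0 (0 : (tensor P (dual P)).X 0)))
          (ofR_rLin _)).app (add_zero r) w = 0 := by
        refine evR_ext fun m n hmn y => ?_
        rw [evR_preR _ (add_zero r) hmn, map_zero, ofR_zero, zero_app, map_zero, map_zero,
          LinearMap.zero_apply]
      rw [e, map_zero, homToTensor_app _ hij (by omega), map_zero, map_zero, map_zero,
        LinearMap.zero_apply]
    | hadd t t' ht ht' =>
      have e : (preR (regular S) (ofR ((rankOneHom P P).f 0 (t + t')))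
          (ofR_rLin _)).app (add_zero r) w =
          (preR (regular S) (ofR ((rankOneHom P P).f 0 t)) (ofR_rLin _)).app (add_zero r) w +
          (preR (regular S) (ofR ((rankOneHom P P).f 0 t')) (ofR_rLin _)).app (add_zero r) w := by
        refine evR_ext fun m n hmn y => ?_
        rw [map_add (evR hmn), LinearMap.add_apply, evR_preR _ (add_zero r) hmn,
          evR_preR _ (add_zero r) hmn, evR_preR _ (add_zero r) hmn, map_add, ofR_add, add_app,
          map_add]
      rw [e, map_add (evL hrs φ), ← ht, ← ht', homToTensor_app _ hij (by omega),
        homToTensor_app _ hij (by omega), homToTensor_app _ hij (by omega), map_add, map_add,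
        map_add, LinearMap.add_apply]

/-- For a finitely built K-projective `P`, the map `P ⊗_S N → Hom_S(P^∨, N)` is a
quasi-isomorphism. -/
theorem tensorToHom_qis (P : DGBimod A S) (hP : P.right.KProjOp)
    (hfb : FinitelyBuilt (regular S).right (Q.obj P.right)) (N : DGBimod S C) :
    (tensorToHom P N).Qis := by
  obtain ⟨c, hc, h, hh, e⟩ := exists_dualBasis P hP hfb
  refine qis_of_comp_qis (g := homToTensor N c) (h := add_zero 0) (h' := add_zero 0) ?_ ?_
    (homToTensor_closed N hc)
  · rw [tensorToHom_comp_homToTensor]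
    exact tmapL_qis_of_homotopy N _ hh e
  · rw [homToTensor_comp_tensorToHom]
    exact preL_preR_qis_of_homotopy _ N _ hh e

end DualTensor

section SubProd

variable (E R : DGA K) (U : ∀ n, Submodule K (E.X n × R.X n))
  (hd : ∀ {i j : ℤ} (h : j + 1 = i) (x : E.X i × R.X i), x ∈ U i → (E.d h x.1, R.d h x.2) ∈ U j)
  (h1 : (E.one, R.one) ∈ U 0)
  (hm : ∀ {i j k : ℤ} (h : i + j = k) (x : E.X i × R.X i) (y : E.X j × R.X j), x ∈ U i → y ∈ U j →
    (E.mul h x.1 y.1, R.mul h x.2 y.2) ∈ U k)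

/-- A sub-DGA of a product of two DGAs. -/
def subProd : DGA K where
  X n := U n
  d h := ((E.d h).prodMap (R.d h)).restrict (hd h)
  mul h := LinearMap.mk₂ K
    (fun x y => ⟨(E.mul h x.1.1 y.1.1, R.mul h x.1.2 y.1.2), hm h _ _ x.2 y.2⟩)
    (fun x x' y => Subtype.ext (Prod.ext (by simp) (by simp)))
    (fun c x y => Subtype.ext (Prod.ext (by simp) (by simp)))
    (fun x y y' => Subtype.ext (Prod.ext (by simp) (by simp)))
    (fun c x y => Subtype.ext (Prod.ext (by simp) (by simp)))
  one := ⟨_, h1⟩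
  d_d h h' _ := Subtype.ext (Prod.ext (E.d_d h h' _) (R.d_d h h' _))
  one_mul h _ := Subtype.ext (Prod.ext (E.one_mul h _) (R.one_mul h _))
  mul_one h _ := Subtype.ext (Prod.ext (E.mul_one h _) (R.mul_one h _))
  mul_assoc h₁ h₂ h₃ h₄ _ _ _ := Subtype.ext
    (Prod.ext (E.mul_assoc h₁ h₂ h₃ h₄ _ _ _) (R.mul_assoc h₁ h₂ h₃ h₄ _ _ _))
  leibniz h hi hj hk hl hr _ _ := Subtype.ext
    (Prod.ext (E.leibniz h hi hj hk hl hr _ _) (R.leibniz h hi hj hk hl hr _ _))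

/-- The first projection of a sub-DGA of a product. -/
def subProdFst : DGA.Hom (subProd E R U hd h1 hm) E where
  f n := (LinearMap.fst K _ _).comp (U n).subtype
  comm _ _ := rfl
  map_one := rfl
  map_mul _ _ _ := rfl

/-- The second projection of a sub-DGA of a product. -/
def subProdSnd : DGA.Hom (subProd E R U hd h1 hm) R where
  f n := (LinearMap.snd K _ _).comp (U n).subtype
  comm _ _ := rfl
  map_one := rfl
  map_mul _ _ _ := rfl

end SubProd

open KMap

variable {A B S R : DGA K}

section EndDGA

variable (P : DGBimod A S)

/-- The composition of graded endomorphisms of a DG right module. -/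
def endMul (h : i + j = k) :
    (homR P P).X i →ₗ[K] (homR P P).X j →ₗ[K] (homR P P).X k :=
  LinearMap.mk₂ K
    (fun e e' => toR ((ofR e').comp (ofR e) (by omega)) ((ofR_rLin e').comp (ofR_rLin e) _))
    (fun e e' f => ofR_injective (by simp only [ofR_add, ofR_toR, comp_add]))
    (fun c e f => evR_ext fun p q hpq x => by
      rw [map_smul, LinearMap.smul_apply, evR_toR, evR_toR,
        comp_app _ _ _ hpq rfl (by omega), comp_app _ _ _ hpq rfl (by omega), ofR_app, ofR_app,
        ofR_app, map_smul, LinearMap.smul_apply])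
    (fun e f f' => ofR_injective (by simp only [ofR_add, ofR_toR, add_comp]))
    (fun c e f => evR_ext fun p q hpq x => by
      rw [map_smul, LinearMap.smul_apply, evR_toR, evR_toR,
        comp_app _ _ _ hpq rfl (by omega), comp_app _ _ _ hpq rfl (by omega), ofR_app, ofR_app,
        ofR_app, ofR_app, map_smul, LinearMap.smul_apply, map_smul])

variable {P} in
lemma ofR_endMul (h : i + j = k) (e : (homR P P).X i) (e' : (homR P P).X j) :
    ofR (endMul P h e e') = (ofR e').comp (ofR e) (by omega) := rfl

/-- The endomorphism DGA of a DG right module. -/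
def endR : DGA K where
  X n := (homR P P).X n
  d h := (homR P P).d h
  mul h := endMul P h
  one := toR (one P) (one_rLin P)
  d_d h h' e := (homR P P).d_d h h' e
  one_mul h e := ofR_injective (by rw [ofR_endMul, ofR_toR, comp_one])
  mul_one h e := ofR_injective (by rw [ofR_endMul, ofR_toR, one_comp])
  mul_assoc {_ _ _ ij _ n} h₁ h₂ h₃ h₄ a b c := ofR_injective (by
    rw [ofR_endMul, ofR_endMul, ofR_endMul, ofR_endMul,
      comp_assoc (ofR c) (ofR b) (ofR a) (by omega) (by omega) (by omega : _ = ij) (by omega)])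
  leibniz {i j k i' j' k'} h hi hj hk hl hr a b := ofR_injective <| by
    rw [ofR_add, ofR_zsmul, ofR_d, ofR_endMul, ofR_endMul, ofR_endMul,
      D_comp _ _ _ hk hj hi (by omega) (by omega), ofR_d, ofR_d]

/-- The action of graded endomorphisms on a DG right module. -/
def endAct (h : i + j = k) : (homR P P).X i →ₗ[K] P.X j →ₗ[K] P.X k :=
  evR (by omega)

/-- A DG right module is a DG bimodule over its endomorphism DGA. -/
def endBimod : DGBimod (endR P) S where
  X := P.X
  grp := P.grp
  mod := P.mod
  d h := P.d h
  lsmul h := endAct P h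
  rsmul h := P.rsmul h
  d_d h h' x := P.d_d h h' x
  one_lsmul h x := (one_app (add_zero _) x :)
  rsmul_one h x := P.rsmul_one h x
  mul_lsmul {_ _ k _ jk n} h₁ h₂ h₃ h₄ a b x :=
    comp_app (ofR (X := P) (Y := P) b) (ofR (X := P) (Y := P) a) (by omega)
      (by omega : k + _ = n) (by omega : k + _ = jk) (by omega) x
  rsmul_mul h₁ h₂ h₃ h₄ a b x := P.rsmul_mul h₁ h₂ h₃ h₄ a b x
  lsmul_rsmul h₁ h₂ h₃ h₄ a x b :=
    (ofR_rLin (X := P) (Y := P) a _ _ _ _ _ (by omega) (by omega) h₃ h₂ x b).symm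
  lleibniz h hi hj hk hl hr a x :=
    sub_eq_iff_eq_add.1 (evR_d (X := P) (Y := P) hi a (by omega) hj hk (by omega) (by omega) x).symm
  rleibniz h hi hj hk hl hr a b := P.rleibniz h hi hj hk hl hr a b

end EndDGA

/-- The left action of an element as a graded map. -/
def leftMul (M : DGBimod R S) (r : R.X n) : KMap M M n :=
  KMap.mk fun _ _ h => M.lsmul (by omega) r

lemma leftMul_app {M : DGBimod R S} (r : R.X n) (h : i + n = j) (h' : n + i = j)
    (x : M.X i) : (leftMul M r).app h x = M.lsmul h' r x := rfl

lemma leftMul_rLin {M : DGBimod R S} (r : R.X n) : (leftMul M r).RLin :=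
  fun i j l i' j' h h' hl hl' x b => by
    rw [leftMul_app r h (by omega), leftMul_app r h' (by omega), M.lsmul_rsmul]

lemma D_leftMul {M : DGBimod R S} (h : n' + 1 = n) (r : R.X n) :
    (leftMul M r).D h = leftMul M (R.d h r) := KMap.ext fun i j hij x => by
  rw [D_app h _ hij (sub_add_cancel i 1) rfl (by omega) (by omega),
    leftMul_app r _ (by omega), leftMul_app r _ (by omega), leftMul_app _ hij (by omega),
    M.lleibniz _ h (sub_add_cancel i 1) rfl (by omega : n' + i = j) (by omega), add_sub_cancel_right]

lemma leftMul_add {M : DGBimod R S} (r r' : R.X n) :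
    leftMul M (r + r') = leftMul M r + leftMul M r' := KMap.ext fun i j h x => by
  rw [add_app, leftMul_app _ h (by omega), leftMul_app _ h (by omega), leftMul_app _ h (by omega),
    map_add, LinearMap.add_apply]

lemma leftMul_mul {M : DGBimod R S} (h : m + n = k) (r : R.X m) (r' : R.X n) :
    leftMul M (R.mul h r r') = (leftMul M r').comp (leftMul M r) (by omega) :=
  KMap.ext fun i j hij x => by
    rw [comp_app _ _ _ hij rfl (by omega), leftMul_app _ hij (by omega),
      leftMul_app _ _ (by omega), leftMul_app _ _ (by omega), M.mul_lsmul _ _ _ _]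

lemma leftMul_one {M : DGBimod R S} : leftMul M R.one = one M := KMap.ext fun i j h x => by
  obtain rfl : i = j := by omega
  exact M.one_lsmul _ x

section Semifree

variable {M : DGBimod R S} {P : DGModOp S} {π : P ⟶ M.right}

/-- Closed maps out of a cofibrant module lift strictly along trivial fibrations. -/
lemma Cof.exists_closed_lift (hP : P.Cof) (hπ : TrivFib π) (g : KMap P M n) (hg : g.Closed)
    (hr : g.RLin) : ∃ e : KMap P P n, e.Closed ∧ e.RLin ∧
      e.comp ((ofHom π).comp (fromRight M) (add_zero 0)) (add_zero n) = g := by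
  obtain ⟨e, he, hb, h, hh, eq⟩ := hP.hProj.exists_lift hπ.1 rfl (g.comp (intoRight M) (add_zero n))
    (hg.comp intoRight_closed _) (hr.comp intoRight_rLin _).bLin
  obtain ⟨h', hh', eq'⟩ := hP.exists_graded_lift π hπ.2 h hh
  refine ⟨e + h'.D rfl, he.add ?_, hb.2.add (hh'.2.D _), ?_⟩
  · rw [closed_iff (sub_add_cancel n 1)]
    exact D_D _ _ _
  · have e₁ : (h'.D rfl).comp (ofHom π) (add_zero n) = h.D rfl := by
      rw [← eq', (ofHom_closed π).D_comp_right _ _ _ rfl (add_zero n), sgn_zero, one_smul]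
    have e₂ : (g.comp (intoRight M) (add_zero n)).comp (fromRight M) (add_zero n) = g := by
      rw [comp_assoc _ _ _ _ _ (add_zero 0) (add_zero n), intoRight_comp_fromRight, comp_one]
    rw [← comp_assoc _ _ _ (add_zero n) (add_zero n), add_comp, e₁, eq, add_sub_cancel, e₂]

/-- Compatibility of a graded endomorphism `e` of `P` and an element of `R` with `q : P → M`. -/
def Compatible (q : KMap P M 0) (e : (homR P P).X n) (r : R.X n) : Prop :=
  (ofR e).comp q (add_zero n) = q.comp (leftMul M r) (zero_add n)

namespace Compatible

variable {q : KMap P M 0} {n : ℤ} {e e' : (homR P P).X n} {r r' : R.X n}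

lemma add (h : Compatible q e r) (h' : Compatible q e' r') : Compatible q (e + e') (r + r') := by
  rw [Compatible, ofR_add, add_comp, leftMul_add, comp_add, h, h']

lemma app_iff : Compatible q e r ↔ ∀ (i j : ℤ) (h : i + n = j) (h' : n + i = j) (x : P.X i),
    q.app (add_zero j) (evR h e x) = M.lsmul h' r (q.app (add_zero i) x) := by
  constructor
  · intro H i j h h' x
    have := congrArg (fun f => f.app h x) H
    beta_reduce at this
    rwa [comp_app _ _ _ h h (add_zero j), comp_app _ _ _ h (add_zero i) h,
      leftMul_app _ h h'] at this
  · intro H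
    refine KMap.ext fun i j h x => ?_
    rw [comp_app _ _ _ h h (add_zero j), comp_app _ _ _ h (add_zero i) h,
      leftMul_app _ h (by omega)]
    exact H _ _ _ _ _

lemma zero : Compatible q (0 : (homR P P).X n) 0 := app_iff.2 fun i j h h' x => by
  simp only [map_zero, LinearMap.zero_apply]

lemma smul (c : K) (H : Compatible q e r) : Compatible q (c • e) (c • r) :=
  app_iff.2 fun i j h h' x => by
    rw [map_smul, map_smul, LinearMap.smul_apply, LinearMap.smul_apply, map_smul,
      app_iff.1 H i j h h' x]

lemma d (hq : q.Closed) (hn : n' + 1 = n) (H : Compatible q e r) :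
    Compatible q ((homR P P).d hn e) (R.d hn r) := by
  have := congrArg (fun f => f.D hn) H
  beta_reduce at this
  rwa [hq.D_comp_right _ _ hn hn (add_zero n'), hq.D_comp_left _ _ hn hn (zero_add n'),
    sgn_zero, one_smul, D_leftMul, ← ofR_d] at this

lemma one : Compatible q (toR (KMap.one P) (one_rLin P)) R.one := by
  rw [Compatible, leftMul_one, comp_one, ofR_toR, one_comp]

lemma mul {f : (homR P P).X m} {s : R.X m} (h : n + m = k) (H : Compatible q e r)
    (H' : Compatible q f s) : Compatible q (endMul P h e f) (R.mul h r s) := by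
  rw [Compatible, leftMul_mul, ofR_endMul, comp_assoc _ _ _ _ _ (add_zero n) (by omega), H,
    ← comp_assoc _ _ _ (add_zero m) (by omega), H',
    comp_assoc _ _ _ _ _ (by omega : m + n = k) (by omega)]

end Compatible

/-- The pairs of an endomorphism of `P` and an element of `R` that are compatible with `q`. -/
def compatibleSubmodule (q : KMap P M 0) (n : ℤ) : Submodule K ((endR P).X n × R.X n) where
  carrier := {x | Compatible q x.1 x.2}
  add_mem' hx hy := hx.add hy
  zero_mem' := Compatible.zero
  smul_mem' c _ hx := hx.smul c

variable {q : KMap P M 0} (hq : q.Closed)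

/-- The DGA of endomorphisms of `P` lying over the left action of `R`. -/
def liftDGA : DGA K :=
  subProd (endR P) R (compatibleSubmodule q) (fun h _ hx => hx.d hq h) Compatible.one
    (fun h _ _ hx hy => hx.mul h hy)

/-- The projection to `R`. -/
def liftDGASnd : DGA.Hom (liftDGA hq) R := subProdSnd (endR P) R (compatibleSubmodule q)
  (fun h _ hx => hx.d hq h) Compatible.one (fun h _ _ hx hy => hx.mul h hy)

/-- The projection to the endomorphism DGA. -/
def liftDGAFst : DGA.Hom (liftDGA hq) (endR P) := subProdFst (endR P) R (compatibleSubmodule q)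
  (fun h _ hx => hx.d hq h) Compatible.one (fun h _ _ hx hy => hx.mul h hy)

/-- `P` as a DG bimodule over `liftDGA hq`. -/
def liftBimod : DGBimod (liftDGA hq) S := (endBimod P).restrict (liftDGAFst hq) (DGA.Hom.id S)

/-- The morphism of DG bimodules given by `q`. -/
def liftBimodHom (hr : q.RLin) :
    liftBimod hq ⟶ M.restrict (liftDGASnd hq) (DGA.Hom.id S) where
  f i := q.app (add_zero i)
  comm {i j} h x := by
    have := hq.d_app (add_zero i) h h (add_zero j) x
    rw [sgn_zero, one_smul] at this
    exact this.symm
  map_lsmul {i j k} h a x :=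
    Compatible.app_iff.1 (show Compatible q a.1.1 a.1.2 from a.2) j k (by omega : j + i = k) h x
  map_rsmul h x b := hr _ _ _ _ _ _ _ h h x b

lemma liftBimodHom_quasiIso (hr : q.RLin) (hqis : q.Qis) :
    quasiIso _ _ (liftBimodHom hq hr) := (qis_ofHom_iff (liftBimodHom hq hr)).1
    (show (ofHom (liftBimodHom hq hr)).Qis from fun i j h => by
      obtain rfl : i = j := by omega
      exact hqis i i h)

lemma liftBimod_kProjOp (hP : P.HProj) : (liftBimod hq).right.KProjOp := by
  let f : KMap (liftBimod hq).right P 0 := KMap.mk fun i j h => (KMap.one P).app h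
  let g : KMap P (liftBimod hq).right 0 := KMap.mk fun i j h => (KMap.one P).app h
  have hf : f.Closed := one_closed (M := P)
  have hg : g.Closed := one_closed (M := P)
  have hfr : f.RLin := one_rLin P
  have hgr : g.RLin := one_rLin P
  refine (hP.of_retract (f.toHom hf hfr.bLin) (g.toHom hg hgr.bLin) ?_).kProjOp
  refine ⟨0, BLin.zero, ?_⟩
  rw [D_zero, ofHom_comp, ofHom_toHom, ofHom_toHom, ofHom_id, eq_comm, sub_eq_zero]
  exact one_comp (one P) (add_zero 0)

lemma exists_of_cyc_liftDGA {e : (homR P P).X n} {r : R.X n} (hP : P.Cof) (hπ : TrivFib π)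
    (he : e ∈ cyc (homR P P) n) (hn : n + 1 = n') (s : R.X n') (hs : R.d hn s = r)
    (H : Compatible ((ofHom π).comp (fromRight M) (add_zero 0)) e r) :
    ∃ f, Compatible ((ofHom π).comp (fromRight M) (add_zero 0)) f s ∧ (homR P P).d hn f = e := by
  have hq : ((ofHom π).comp (fromRight M) (add_zero 0)).Closed :=
    (ofHom_closed π).comp fromRight_closed _
  have hr : ((ofHom π).comp (fromRight M) (add_zero 0)).RLin :=
    (ofHom_bLin π).2.comp fromRight_rLin _
  set q := (ofHom π).comp (fromRight M) (add_zero 0) with hq'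
  have eq : q.comp (intoRight M) (add_zero 0) = ofHom π := by
    rw [hq', comp_assoc _ _ _ _ _ (add_zero 0) (add_zero 0), fromRight_comp_intoRight, comp_one]
  rw [mem_cyc_homR] at he
  obtain ⟨h, hh, eh⟩ := hP.hProj.exists_of_comp hπ.1 hn (ofR e) he (ofR_rLin e).bLin
    ((q.comp (leftMul M s) (zero_add n')).comp (intoRight M) (add_zero n'))
    ((hr.comp (leftMul_rLin _) _).comp intoRight_rLin _).bLin (by
      rw [intoRight_closed.D_comp_right _ _ hn hn (add_zero n), hq.D_comp_left _ _ hn hn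
        (zero_add n), D_leftMul, hs, ← H, sgn_zero, one_smul, comp_assoc _ _ _ _ _ (add_zero 0)
        (add_zero n), eq])
  obtain ⟨g, hg, hgr, eg⟩ := hP.exists_closed_lift hπ
    (q.comp (leftMul M s) (zero_add n') - h.comp q (add_zero n')) (by
      rw [closed_iff hn, D_sub, hq.D_comp_right _ _ hn hn (add_zero n), hq.D_comp_left _ _ hn hn
        (zero_add n), D_leftMul, hs, eh, sgn_zero, one_smul, H, sub_self])
    ((hr.comp (leftMul_rLin _) _).sub (hh.2.comp hr _))
  refine ⟨toR (h + g) (hh.2.add hgr), ?_, ofR_injective ?_⟩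
  · rw [Compatible, ofR_toR, add_comp, eg, add_sub_cancel]
  · rw [ofR_d, ofR_toR, D_add, eh, (closed_iff hn g).1 hg, add_zero]

lemma liftDGASnd_quasiIso (hP : P.Cof) (hπ : TrivFib π)
    (hq : ((ofHom π).comp (fromRight M) (add_zero 0)).Closed) : (liftDGASnd hq).QuasiIso := by
  have hr : ((ofHom π).comp (fromRight M) (add_zero 0)).RLin :=
    (ofHom_bLin π).2.comp fromRight_rLin _
  intro i j k h h'
  constructor
  · rintro ⟨⟨e, r⟩, H⟩ hx ⟨s, hs⟩
    have he : (homR P P).d h' e = 0 := congrArg (fun t => t.1.1) hx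
    obtain ⟨f, hf, ef⟩ := exists_of_cyc_liftDGA hP hπ ((mem_cyc h').2 he) h s hs H
    exact ⟨⟨(f, s), hf⟩, Subtype.ext (Prod.ext ef hs)⟩
  · intro r hr'
    obtain ⟨e, he, her, eq⟩ := hP.exists_closed_lift hπ (((ofHom π).comp (fromRight M)
      (add_zero 0)).comp (leftMul M r) (zero_add j)) (by
        rw [closed_iff h', hq.D_comp_left _ _ h' h' (zero_add k), D_leftMul, hr']
        exact KMap.ext fun a b hab x => by
          rw [comp_app _ _ _ hab (add_zero a) hab, leftMul_app _ _ (by omega), map_zero]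
          rfl) (hr.comp (leftMul_rLin _) _)
    refine ⟨⟨(toR e her, r), eq⟩, Subtype.ext (Prod.ext ?_ hr'), 0, ?_⟩
    · exact (mem_cyc (M := homR P P) h').1 (mem_cyc_homR.2 he)
    · rw [map_zero]
      exact (sub_self r).symm

end Semifree

theorem nonempty_bimodRes (M : DGBimod R S) : Nonempty (BimodRes M) := by
  obtain ⟨P, π, hP, hπ⟩ := exists_cof M.right
  have hq : ((ofHom π).comp (fromRight M) (add_zero 0)).Closed :=
    (ofHom_closed π).comp fromRight_closed _
  exact ⟨{ R' := liftDGA hq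
           ρ := liftDGASnd hq
           hρ := liftDGASnd_quasiIso hP hπ hq
           P := liftBimod hq
           π := liftBimodHom hq ((ofHom_bLin π).2.comp fromRight_rLin _)
           qis := liftBimodHom_quasiIso hq _ (((qis_ofHom_iff π).2 hπ.1).comp fromRight_qis
             (ofHom_closed π) fromRight_closed _)
           proj := liftBimod_kProjOp hq hP.hProj }⟩

open KMap

section Regular

variable {A B S C : DGA K}

/-- The left linear map out of the regular bimodule determined by the image of `1`. -/
def fromOneL (N : DGBimod S C) (w : N.X k) : KMap (regular S) N k :=
  KMap.mk fun i _ h => sgn (k * i) • (N.lsmul h).flip w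

lemma fromOneL_app {N : DGBimod S C} (w : N.X k) (h : i + k = j)
    (s : (regular S).X i) : (fromOneL N w).app h s = sgn (k * i) • N.lsmul h s w := rfl

lemma fromOneL_lLin {N : DGBimod S C} (w : N.X k) : (fromOneL N w).LLin :=
  fun i j l i' j' h h' hl hl' a s => by
    rw [fromOneL_app, fromOneL_app, map_zsmul, smul_smul, ← sgn_add, ← mul_add, hl]
    exact congrArg _ (N.mul_lsmul hl h' h hl' a s w)

lemma D_fromOneL {N : DGBimod S C} (hk : k' + 1 = k) (w : N.X k) :
    (fromOneL N w).D hk = fromOneL N (N.d hk w) := KMap.ext fun i j h s => by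
  have key : N.d rfl (N.lsmul (by omega : i + k = j + 1) s w) =
      N.lsmul (by omega : i - 1 + k = j) ((regular S).d (sub_add_cancel i 1) s) w +
        sgn i • N.lsmul h s (N.d hk w) := N.lleibniz _ _ _ _ _ _ s w
  rw [D_app hk _ h (sub_add_cancel i 1) rfl (by omega) (by omega), fromOneL_app, fromOneL_app,
    fromOneL_app, map_zsmul, key, smul_add, smul_smul, smul_smul, ← sgn_add, ← sgn_add,
    show sgn (k + k * (i - 1)) = sgn (k * i) from sgn_congr 0 (by ring),
    show sgn (k * i + i) = sgn (k' * i) from sgn_congr i (by rw [← hk]; ring), add_sub_cancel_left]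

lemma LLin.eq_fromOneL {N : DGBimod S C} {g : KMap (regular S) N k} (hg : g.LLin) :
    g = fromOneL N (g.app (zero_add k) S.one) := KMap.ext fun i j h s => by
  have := hg 0 k i i j (zero_add k) h (add_zero i) h s S.one
  rw [fromOneL_app, ← this]
  exact congrArg (g.app h) (S.mul_one (add_zero i) s).symm

/-- The right linear map out of the regular bimodule determined by the image of `1`. -/
def fromOneR (N : DGBimod C S) (w : N.X k) : KMap (regular S) N k :=
  KMap.mk fun _ _ h => N.rsmul (by omega) w

lemma fromOneR_app {N : DGBimod C S} (w : N.X k) (h : i + k = j) (h' : k + i = j)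
    (s : (regular S).X i) : (fromOneR N w).app h s = N.rsmul h' w s := rfl

lemma fromOneR_rLin {N : DGBimod C S} (w : N.X k) : (fromOneR N w).RLin :=
  fun i j l i' j' h h' hl hl' s a => by
    rw [fromOneR_app w h (by omega), fromOneR_app w h' (by omega)]
    exact (N.rsmul_mul (by omega : k + i = j) hl' hl (by omega) w s a).symm

lemma D_fromOneR {N : DGBimod C S} (hk : k' + 1 = k) (w : N.X k) :
    (fromOneR N w).D hk = fromOneR N (N.d hk w) := KMap.ext fun i j h s => by
  have key : N.d rfl (N.rsmul (by omega : k + i = j + 1) w s) =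
      N.rsmul (by omega : k' + i = j) (N.d hk w) s +
        sgn k • N.rsmul (by omega : k + (i - 1) = j) w ((regular S).d (sub_add_cancel i 1) s) :=
    N.rleibniz _ _ _ _ _ _ w s
  rw [D_app hk _ h (sub_add_cancel i 1) rfl (by omega) (by omega), fromOneR_app _ _ (by omega),
    fromOneR_app _ _ (by omega), fromOneR_app _ _ (by omega), key, add_sub_cancel_right]

lemma RLin.eq_fromOneR {N : DGBimod C S} {g : KMap (regular S) N k} (hg : g.RLin) :
    g = fromOneR N (g.app (zero_add k) S.one) := KMap.ext fun i j h s => by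
  have := hg 0 k i i j (zero_add k) h (zero_add i) (by omega) S.one s
  rw [fromOneR_app _ h (by omega), ← this]
  exact congrArg (g.app h) (S.one_mul (zero_add i) s).symm

lemma closed_app_one_mem_cyc {N : DGBimod C B} {g : KMap (regular S) N k}
    (hg : g.Closed) : g.app (zero_add k) S.one ∈ cyc N k :=
  hg.map_cyc _ ((mem_cyc (neg_add_cancel 1)).2 (d_one _))

lemma hProj_regular_left (S : DGA K) : (regular S).left.HProj := by
  intro N hN k k' hk g hg hgb
  have hg' := (intoLeft_closed (M := regular S)).comp hg (zero_add k)
  have hl := (intoLeft_lLin (M := regular S)).comp hgb.1 (zero_add k)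
  obtain ⟨w, hw⟩ := (mem_bdry hk).1 (hN _ (closed_app_one_mem_cyc hg'))
  refine ⟨(fromLeft (regular S)).comp (fromOneL N w) (zero_add k'),
    (fromLeft_lLin.comp (fromOneL_lLin w) _).bLin, ?_⟩
  rw [fromLeft_closed.D_comp_left _ _ hk hk (zero_add k), D_fromOneL, hw, ← LLin.eq_fromOneL hl,
    ← comp_assoc _ _ _ (add_zero 0) (zero_add k), fromLeft_comp_intoLeft, one_comp]

lemma hProj_regular_right (S : DGA K) : (regular S).right.HProj := by
  intro N hN k k' hk g hg hgb
  have hg' := (intoRight_closed (M := regular S)).comp hg (zero_add k)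
  have hl := (intoRight_rLin (M := regular S)).comp hgb.2 (zero_add k)
  obtain ⟨w, hw⟩ := (mem_bdry hk).1 (hN _ (closed_app_one_mem_cyc hg'))
  refine ⟨(fromRight (regular S)).comp (fromOneR N w) (zero_add k'),
    (fromRight_rLin.comp (fromOneR_rLin w) _).bLin, ?_⟩
  rw [fromRight_closed.D_comp_left _ _ hk hk (zero_add k), D_fromOneR, hw, ← RLin.eq_fromOneR hl,
    ← comp_assoc _ _ _ (add_zero 0) (zero_add k), fromRight_comp_intoRight, one_comp]

/-- The inverse `x ↦ x ⊗ 1` of the right unitor. -/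
noncomputable def rightUnitorInv (M : DGBimod A S) : KMap M (tensor M (regular S)) 0 :=
  KMap.mk fun _ _ h => (tm M (regular S) h).flip S.one

lemma rightUnitorInv_app {M : DGBimod A S} (h : i + 0 = j) (x : M.X i) :
    (rightUnitorInv M).app h x = tm M (regular S) h x S.one := rfl

lemma rightUnitorInv_closed {M : DGBimod A S} : (rightUnitorInv M).Closed :=
  closed_of fun i j i' j' h hi hj h' x => by
    have key : ∀ a : (regular S).X 0, (regular S).d (neg_add_cancel 1) a = 0 →
        (tensor M (regular S)).d hj (tm M (regular S) h x a) =
          tm M (regular S) h' (M.d hi x) a := fun a ha => by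
      rw [d_tm _ hj hi (neg_add_cancel 1) h' (by omega), ha, map_zero, smul_zero, add_zero]
    rw [sgn_zero, one_smul]
    exact key S.one (d_one _)

lemma rightUnitorInv_lLin {M : DGBimod A S} : (rightUnitorInv M).LLin :=
  fun i j l i' j' h h' hl hl' a x => by
    rw [zero_mul, sgn_zero, one_smul]
    exact (lsmul_tm (M := M) (N := regular S) hl' h hl h' a x S.one).symm

/-- The pairing given by the right action. -/
def rightActionPairing (M : DGBimod A S) : Pairing M (regular S) M where
  φ _ _ _ h := M.rsmul h
  bal _ _ _ _ _ _ h₁ h₂ h₃ h₄ x a b := M.rsmul_mul h₁ h₂ h₃ h₄ x a b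
  leibniz _ _ _ _ _ _ h hn hi hj hl hr x a := M.rleibniz h hi hj hn hl hr x a
  map_lsmul _ _ _ _ _ _ h hpq hip hk a x b := M.lsmul_rsmul hip hk hpq h a x b
  map_rsmul _ _ _ _ _ _ h hpq hqj hk x a b := (M.rsmul_mul hpq h hqj hk x a b).symm

/-- The right unitor `M ⊗_S S → M`. -/
noncomputable def rightUnitor (M : DGBimod A S) : tensor M (regular S) ⟶ M :=
  (rightActionPairing M).desc

lemma rightUnitor_tm {M : DGBimod A S} (h : i + j = n) (x : M.X i)
    (s : (regular S).X j) : (rightUnitor M).f n (tm M (regular S) h x s) = M.rsmul h x s :=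
  (rightActionPairing M).desc_tm h x s

lemma rightUnitorInv_comp {M : DGBimod A S} :
    (rightUnitorInv M).comp (ofHom (rightUnitor M)) (add_zero 0) = one M :=
  KMap.ext fun i j h x => by
    obtain rfl : i = j := by omega
    rw [comp_app _ _ _ h h h, ofHom_app, one_app]
    exact (rightUnitor_tm (add_zero i) x S.one).trans (M.rsmul_one _ x)

lemma rightUnitor_comp {M : DGBimod A S} :
    (ofHom (rightUnitor M)).comp (rightUnitorInv M) (add_zero 0) = one _ :=
  kmap_tensor_ext fun i j p q h hpq x s => by
    obtain rfl : i = j := by omega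
    rw [comp_app _ _ _ h h h, ofHom_app, rightUnitor_tm, one_app]
    refine (rightUnitorInv_app h _).trans ?_
    have := tm_rsmul (M := M) (N := regular S) hpq h (add_zero q) hpq x s S.one
    refine this.trans ?_
    exact congrArg (fun a => tm M (regular S) hpq x a) (S.mul_one _ s)

lemma rightUnitorInv_qis {M : DGBimod A S} : (rightUnitorInv M).Qis :=
  qis_of_comp_qis (g := ofHom (rightUnitor M)) (h := add_zero 0) (h' := add_zero 0)
    (by rw [rightUnitorInv_comp]; exact one_qis) (by rw [rightUnitor_comp]; exact one_qis)
    (ofHom_closed _)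

end Regular

section Assoc

variable {A B C D : DGA K} (M : DGBimod A B) (N : DGBimod B C) (P : DGBimod C D)

/-- The bilinear maps `(y, z) ↦ (x ⊗ y) ⊗ z`. -/
noncomputable def assocInvAux {p j n : ℤ} (h : p + j = n) (x : M.X p) (q r : ℤ) (hqr : q + r = j) :
    N.X q →ₗ[K] P.X r →ₗ[K] (tensor (tensor M N) P).X n :=
  (tm (tensor M N) P (by omega : p + q + r = n)).comp (tm M N rfl x)

variable {M N P} in
lemma assocInvAux_apply {p j n q r s : ℤ} (h : p + j = n) (x : M.X p) (hqr : q + r = j)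
    (hs : p + q = s) (hn : s + r = n) (y : N.X q) (z : P.X r) :
    assocInvAux M N P h x q r hqr y z = tm (tensor M N) P hn (tm M N hs x y) z := by
  subst hs; rfl

lemma assocInvAux_balanced {p j n : ℤ} (h : p + j = n) (x : M.X p) :
    Balanced (assocInvAux M N P h x) := by
  intro q r l ql lr h₁ h₂ h₃ h₄ y c z
  rw [assocInvAux_apply h x h₂ rfl (by omega), assocInvAux_apply h x h₄ rfl (by omega),
    ← tm_rsmul (by omega : p + q + l = p + ql) _ h₃ _, rsmul_tm _ rfl h₁ rfl]

/-- The bilinear maps `(x, y ⊗ z) ↦ (x ⊗ y) ⊗ z`. -/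
noncomputable def assocInvMap (n p j : ℤ) (h : p + j = n) :
    M.X p →ₗ[K] (tensor N P).X j →ₗ[K] (tensor (tensor M N) P).X n where
  toFun x := tmLift (assocInvAux M N P h x) (assocInvAux_balanced M N P h x)
  map_add' x x' := tm_ext fun q r hqr y z => by
    rw [LinearMap.add_apply, tmLift_tm, tmLift_tm, tmLift_tm, assocInvAux_apply h _ hqr rfl
      (by omega), assocInvAux_apply h _ hqr rfl (by omega), assocInvAux_apply h _ hqr rfl
      (by omega), map_add, LinearMap.add_apply, map_add, LinearMap.add_apply]
  map_smul' c x := tm_ext fun q r hqr y z => by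
    rw [LinearMap.smul_apply, tmLift_tm, tmLift_tm, assocInvAux_apply h _ hqr rfl
      (by omega), assocInvAux_apply h _ hqr rfl (by omega), map_smul, LinearMap.smul_apply,
      map_smul, LinearMap.smul_apply, RingHom.id_apply]

variable {M N P} in
lemma assocInvMap_tm {n p j q r s : ℤ} (h : p + j = n) (hqr : q + r = j) (hs : p + q = s)
    (hn : s + r = n) (x : M.X p) (y : N.X q) (z : P.X r) :
    assocInvMap M N P n p j h x (tm N P hqr y z) = tm (tensor M N) P hn (tm M N hs x y) z := by
  rw [← assocInvAux_apply h x hqr hs hn y z]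
  exact tmLift_tm (assocInvAux M N P h x) (assocInvAux_balanced M N P h x) hqr y z

lemma assocInvMap_balanced (n : ℤ) : Balanced (assocInvMap M N P n) := by
  intro p j l pl lj h₁ h₂ h₃ h₄ x b t
  induction t using tm_induction with
  | h0 q r hqr y z =>
    rw [assocInvMap_tm h₂ hqr rfl (by omega), lsmul_tm h₃ hqr rfl (by omega),
      assocInvMap_tm h₄ _ (by omega : p + (l + q) = pl + q) (by omega),
      tm_rsmul h₁ rfl rfl (by omega)]
  | hz => simp only [map_zero]
  | hadd s t hs ht => simp only [map_add, hs, ht]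

/-- The inverse of the associativity morphism. -/
noncomputable def assocInv : KMap (tensor M (tensor N P)) (tensor (tensor M N) P) 0 :=
  KMap.mk fun _ j h => tmLift (fun p q hpq => assocInvMap M N P j p q (by omega)) (by
    obtain rfl : _ = j := (add_zero _).symm.trans h
    exact assocInvMap_balanced M N P _)

variable {M N P}

lemma assocInv_tm {i j p q r s t : ℤ} (h : i + 0 = j) (hpq : p + q = i) (hrs : r + s = q)
    (ht : p + r = t) (hj : t + s = j) (x : M.X p) (y : N.X r) (z : P.X s) :
    (assocInv M N P).app h (tm M (tensor N P) hpq x (tm N P hrs y z)) =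
      tm (tensor M N) P hj (tm M N ht x y) z := by
  obtain rfl : i = j := by omega
  rw [← assocInvMap_tm hpq hrs ht hj x y z]
  exact tmLift_tm (assocInvMap M N P i) (assocInvMap_balanced M N P i) hpq x (tm N P hrs y z)

lemma assocHom_tm {i j n p q r : ℤ} (h : i + j = n) (hpq : p + q = i) (hr : q + j = r)
    (hn : p + r = n) (x : M.X p) (y : N.X q) (z : P.X j) :
    (assocHom M N P).f n (tm (tensor M N) P h (tm M N hpq x y) z) =
      tm M (tensor N P) hn x (tm N P hr y z) := by
  rw [← assocAux_apply M N P h hpq hr hn x y z]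
  refine (Pairing.desc_tm (assocPairing M N P) h (tm M N hpq x y) z).trans ?_
  exact congrArg (fun f => f z)
    (tmLift_tm (assocAux M N P h) (assocAux_balanced M N P h) hpq x y)

lemma assocHom_comp_assocInv : (ofHom (assocHom M N P)).comp (assocInv M N P) (add_zero 0) =
    one (tensor (tensor M N) P) := kmap_tensor_ext fun i j p q h hpq t z => by
  obtain rfl : i = j := by omega
  induction t using tm_induction with
  | h0 r s hrs x y =>
    rw [comp_app _ _ _ h h h, ofHom_app, assocHom_tm hpq hrs rfl (by omega),
      assocInv_tm h _ rfl hrs hpq, one_app]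
  | hz => simp only [map_zero, LinearMap.zero_apply]
  | hadd s t hs ht => simp only [map_add, LinearMap.add_apply, hs, ht]

lemma assocInv_comp_assocHom : (assocInv M N P).comp (ofHom (assocHom M N P)) (add_zero 0) =
    one (tensor M (tensor N P)) := kmap_tensor_ext fun i j p q h hpq x t => by
  obtain rfl : i = j := by omega
  induction t using tm_induction with
  | h0 r s hrs y z =>
    rw [comp_app _ _ _ h h h, assocInv_tm h hpq hrs rfl (by omega), ofHom_app,
      assocHom_tm _ rfl hrs hpq, one_app]
  | hz => simp only [map_zero]
  | hadd s t hs ht => simp only [map_add, hs, ht]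

lemma assocHom_qis : (ofHom (assocHom M N P)).Qis :=
  qis_of_bijective (ofHom_closed _) fun i j h => by
    obtain rfl : i = j := by omega
    refine Function.bijective_iff_has_inverse.2 ⟨(assocInv M N P).app h, fun t => ?_, fun t => ?_⟩
    · rw [← comp_app _ _ (add_zero 0) h h h, assocHom_comp_assocInv, one_app]
    · rw [← comp_app _ _ (add_zero 0) h h h, assocInv_comp_assocHom, one_app]

end Assoc

open KMap

section Evaluation

variable {A B C D S : DGA K}

lemma quasiIso_comp_isIso_iff {X Y W : DGBimod A B} (f : X ⟶ Y) {V : Derived A B}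
    (g : Y ⟶ W) (e : Q.obj W ≅ V) :
    IsIso (Q.map f ≫ Q.map g ≫ e.hom) ↔ quasiIso A B (f ≫ g) := by
  rw [← isIso_Q_map_iff, ← Category.assoc, isIso_comp_right_iff, Functor.map_comp]

/-- The map `Z ⊗ H → F` given by a map `H → P ⊗ F`, where `Z` is the dual of `P`. -/
noncomputable def evalAlong (P : DGBimod A S) (F : DGBimod S C) {H : DGBimod A D}
    (p : KMap H (tensor P F) 0) (hp : p.LLin) : KMap (tensor (dual P) H) F 0 :=
  (tmapR (dual P) p hp).comp (ofHom (evalTensor P F)) (add_zero 0)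

lemma evalAlong_closed {P : DGBimod A S} {F : DGBimod S C} {H : DGBimod A D}
    {p : KMap H (tensor P F) 0} (hp : p.LLin) (hc : p.Closed) : (evalAlong P F p hp).Closed :=
  (tmapR_closed hp hc).comp (ofHom_closed _) _

lemma evalAlong_lLin {P : DGBimod A S} {F : DGBimod S C} {H : DGBimod A D}
    {p : KMap H (tensor P F) 0} (hp : p.LLin) : (evalAlong P F p hp).LLin :=
  (tmapR_lLin hp).comp (ofHom_bLin _).1 _

/-- The derived tensor product may be computed by a resolution of either factor. -/
lemma tmapR_comp_qis_iff {Z : DGBimod S A} {G : DGBimod B A} {γ : KMap G Z 0} (hγ : γ.RLin)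
    (hγc : γ.Closed) (hγq : γ.Qis) (hG : G.right.KFlatOp) {Y : DGBimod A C} {H : DGBimod A D}
    (hH : H.left.KFlat) {p : KMap H Y 0} (hp : p.LLin) (hpc : p.Closed) (hpq : p.Qis)
    {B' C' : DGA K} {W : DGBimod B' C'} {ev : KMap (tensor Z Y) W 0} (hev : ev.Closed) :
    ((tmapR Z p hp).comp ev (add_zero 0)).Qis ↔ ((tmapL Y γ hγ).comp ev (add_zero 0)).Qis := by
  have h₁ : (tmapL H γ hγ).Qis := KFlat.tmapL_qis hH hγ hγc hγq
  have h₂ : (tmapR G p hp).Qis := KFlatOp.tmapR_qis hG hp hpc hpq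
  have e := tmapL_tmapR hγ hp (add_zero 0) (add_zero 0)
  rw [zero_mul, sgn_zero, one_smul] at e
  have e' : (tmapL H γ hγ).comp ((tmapR Z p hp).comp ev (add_zero 0)) (add_zero 0) =
      (tmapR G p hp).comp ((tmapL Y γ hγ).comp ev (add_zero 0)) (add_zero 0) := by
    rw [← comp_assoc _ _ _ (add_zero 0) (add_zero 0), e, comp_assoc _ _ _ _ _ (add_zero 0)
      (add_zero 0)]
  have c₁ := tmapL_closed (N := H) hγ hγc
  have c₂ := tmapR_closed (M := G) hp hpc
  have c₃ := (tmapR_closed (M := Z) hp hpc).comp hev (add_zero 0)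
  have c₄ := (tmapL_closed (N := Y) hγ hγc).comp hev (add_zero 0)
  constructor
  · intro h
    have := h₁.comp h c₁ c₃ (add_zero 0)
    rw [e'] at this
    exact h₂.of_comp_left this c₂ c₄
  · intro h
    have := h₂.comp h c₂ c₄ (add_zero 0)
    rw [← e'] at this
    exact h₁.of_comp_left this c₁ c₃

lemma evalTensor_tm {P : DGBimod A S} {F : DGBimod S C} {i j n p q r : ℤ} (h : i + j = n)
    (hpq : p + q = j) (hr : p + i = r) (hn : r + q = n) (z : (dual P).X i) (x : P.X p) (y : F.X q) :
    (evalTensor P F).f n (tm (dual P) (tensor P F) h z (tm P F hpq x y)) =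
      F.lsmul hn (evD hr z x) y := by
  rw [← evalTensorAux_apply P F h hpq hr hn x y z]
  refine (Pairing.desc_tm (evalTensorPairing P F) h z (tm P F hpq x y)).trans ?_
  exact congrArg (fun f => f z)
    (tmLift_tm (evalTensorAux P F h) (evalTensorAux_balanced P F h) hpq x y)

lemma evalHom_tm {P : DGBimod A S} (h : i + j = n) (h' : j + i = n)
    (z : (dual P).X i) (x : P.X j) :
    (evalPairing P).desc.f n (tm (dual P) P h z x) = evD h' z x := (evalPairing P).desc_tm h z x

section FixedResolution

variable {P : DGBimod A S} {G : DGBimod B A} {γ : KMap G (dual P) 0} (hγ : γ.RLin)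

lemma tmapL_evalTensor (F : DGBimod S C) :
    (ofHom (assocHom G P F)).comp ((tmapL (tensor P F) γ hγ).comp (ofHom (evalTensor P F))
      (add_zero 0)) (add_zero 0) =
    (tmapL F ((tmapL P γ hγ).comp (ofHom (evalPairing P).desc) (add_zero 0))
      ((tmapL_rLin hγ).comp (ofHom_bLin _).2 _)).comp (ofHom (unitor F)) (add_zero 0) :=
  kmap_tensor_ext fun i j p q h hpq t y => by
    obtain rfl : i = j := by omega
    induction t using tm_induction with
    | h0 r s hrs g x =>
      rw [comp_app _ _ _ h h h, comp_app _ _ _ h h h, comp_app _ _ _ h h h, ofHom_app, ofHom_app,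
        ofHom_app, assocHom_tm hpq hrs rfl (by omega), tmapL_tm γ hγ h _ (add_zero r) (by omega),
        evalTensor_tm _ rfl (by omega : s + r = p) hpq, tmapL_tm _ _ h hpq (add_zero p) hpq,
        comp_app _ _ _ (add_zero p) (add_zero p) (add_zero p),
        tmapL_tm γ hγ _ hrs (add_zero r) hrs, ofHom_app, evalHom_tm hrs (by omega)]
      exact (unitor_tm hpq _ y).symm
    | hz => simp only [map_zero, LinearMap.zero_apply]
    | hadd s t hs ht => simp only [map_add, LinearMap.add_apply, hs, ht]

lemma tmapL_evalTensor_qis (hγc : γ.Closed) {F : DGBimod S C} (hF : F.left.KFlat)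
    (h : ((tmapL P γ hγ).comp (ofHom (evalPairing P).desc) (add_zero 0)).Qis) :
    ((tmapL (tensor P F) γ hγ).comp (ofHom (evalTensor P F)) (add_zero 0)).Qis := by
  have hc : ((tmapL P γ hγ).comp (ofHom (evalPairing P).desc) (add_zero 0)).Closed :=
    (tmapL_closed hγ hγc).comp (ofHom_closed _) _
  refine (assocHom_qis (M := G) (N := P) (P := F)).of_comp_left (h := add_zero 0) ?_
    (ofHom_closed _) ((tmapL_closed hγ hγc).comp (ofHom_closed _) _)
  rw [tmapL_evalTensor]
  exact (KFlat.tmapL_qis hF _ hc h).comp ((qis_ofHom_iff _).2 (unitor_quasiIso F))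
    (tmapL_closed _ hc) (ofHom_closed _) _

/-- The map `x ↦ x ⊗ 1` from `P` to `P ⊗_S S`. -/
noncomputable def toTensorRegular (P : DGBimod A S) : KMap P (tensor P (regular S).left) 0 :=
  (rightUnitorInv P).comp (tmapR P (intoLeft (regular S)) intoLeft_lLin) (add_zero 0)

lemma toTensorRegular_lLin (P : DGBimod A S) : (toTensorRegular P).LLin :=
  rightUnitorInv_lLin.comp (tmapR_lLin _) _

lemma toTensorRegular_closed (P : DGBimod A S) : (toTensorRegular P).Closed :=
  rightUnitorInv_closed.comp (tmapR_closed _ intoLeft_closed) _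

lemma toTensorRegular_qis (P : DGBimod A S) : (toTensorRegular P).Qis :=
  rightUnitorInv_qis.comp (tmapR_qis_of_inverse _ intoLeft_lLin fromLeft_lLin fromLeft_closed
    intoLeft_comp_fromLeft fromLeft_comp_intoLeft) rightUnitorInv_closed
    (tmapR_closed _ intoLeft_closed) _

lemma toTensorRegular_app (h : i + 0 = j) (x : P.X i) :
    (toTensorRegular P).app h x = tm P (regular S).left h x S.one := by
  obtain rfl : i = j := by omega
  have key : ∀ s : (regular S).X 0, (tmapR P (intoLeft (regular S)) intoLeft_lLin).app h
      (tm P (regular S) h x s) = tm P (regular S).left h x s := fun s => by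
    rw [tmapR_tm _ _ h h (add_zero 0) h, zero_mul, sgn_zero, one_smul]
    rfl
  rw [toTensorRegular, comp_app _ _ _ h h h, rightUnitorInv_app]
  exact key S.one

lemma tmapR_toTensorRegular :
    (tmapR (dual P) (toTensorRegular P) (toTensorRegular_lLin P)).comp
      (ofHom (evalTensor P (regular S).left)) (add_zero 0) =
      (ofHom (evalPairing P).desc).comp (intoLeft (regular S)) (add_zero 0) :=
  kmap_tensor_ext fun i j p q h hpq z x => by
    obtain rfl : i = j := by omega
    have key : ∀ s : (regular S).left.X 0,
        (evalTensor P (regular S).left).f i (tm (dual P) (tensor P (regular S).left) hpq z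
          (tm P (regular S).left (add_zero q) x s)) =
        (regular S).left.lsmul h (evD (by omega : q + p = i) z x) s := fun s =>
      evalTensor_tm hpq (add_zero q) _ _ z x s
    rw [comp_app _ _ _ h h h, comp_app _ _ _ h h h, ofHom_app, ofHom_app,
      tmapR_tm _ _ h hpq (add_zero q) hpq, zero_mul, sgn_zero, one_smul, toTensorRegular_app,
      evalHom_tm hpq (by omega)]
    exact (key S.one).trans (S.mul_one _ _)

lemma evalPairing_qis_of (hγc : γ.Closed) (hG : G.right.KFlatOp)
    (h : ((tmapL (tensor P (regular S).left) γ hγ).comp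
      (ofHom (evalTensor P (regular S).left)) (add_zero 0)).Qis) :
    ((tmapL P γ hγ).comp (ofHom (evalPairing P).desc) (add_zero 0)).Qis := by
  have hj : (tmapR G (toTensorRegular P) (toTensorRegular_lLin P)).Qis :=
    KFlatOp.tmapR_qis hG _ (toTensorRegular_closed P) (toTensorRegular_qis P)
  have hjc : (tmapR G (toTensorRegular P) (toTensorRegular_lLin P)).Closed :=
    tmapR_closed _ (toTensorRegular_closed P)
  have e := tmapL_tmapR hγ (toTensorRegular_lLin P) (add_zero 0) (add_zero 0)
  rw [zero_mul, sgn_zero, one_smul] at e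
  refine (intoLeft_qis (M := regular S)).of_comp_right (h := add_zero 0) ?_
    ((tmapL_closed hγ hγc).comp (ofHom_closed _) _) intoLeft_closed
  rw [comp_assoc _ _ _ _ _ (add_zero 0) (add_zero 0), ← tmapR_toTensorRegular,
    ← comp_assoc _ _ _ (add_zero 0) (add_zero 0), e, comp_assoc _ _ _ _ _ (add_zero 0) (add_zero 0)]
  exact hj.comp h hjc ((tmapL_closed hγ hγc).comp (ofHom_closed _) _) _

end FixedResolution

lemma exists_flat_resolution_right (Z : DGBimod S A) : ∃ (G : DGModOp A) (γ : KMap G Z 0),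
    γ.RLin ∧ γ.Closed ∧ γ.Qis ∧ G.HProj := by
  obtain ⟨G, π, hG, hπ⟩ := exists_hProj_resolution Z.right
  exact ⟨G, (ofHom π).comp (fromRight Z) (add_zero 0), (ofHom_bLin π).2.comp fromRight_rLin _,
    (ofHom_closed π).comp fromRight_closed _, ((qis_ofHom_iff π).2 hπ).comp fromRight_qis
      (ofHom_closed π) fromRight_closed _, hG⟩

variable {R : DGA K} {M : DGBimod R S} (T : BimodRes M)

lemma evalIsIso_iff {G : DGModOp T.R'} {γ : KMap G T.Z 0} (hγ : γ.RLin) (hγc : γ.Closed)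
    (hγq : γ.Qis) (hG : G.HProj) : EvalIsIso T ↔
      ((tmapL T.P γ hγ).comp (ofHom (evalPairing T.P).desc) (add_zero 0)).Qis := by
  have key : ∀ F : KFlatRes T.P.left,
      IsIso (Q.map (tensorMap (𝟙 T.Z) F.π) ≫ Q.map (evalLeft T.P)) ↔
      ((tmapL T.P γ hγ).comp (ofHom (evalPairing T.P).desc) (add_zero 0)).Qis := fun F => by
    rw [← Functor.map_comp, isIso_Q_map_iff, ← qis_ofHom_iff]
    have hp : ((ofHom F.π).comp (fromLeft T.P) (add_zero 0)).LLin :=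
      (ofHom_bLin F.π).1.comp fromLeft_lLin _
    have hpc : ((ofHom F.π).comp (fromLeft T.P) (add_zero 0)).Closed :=
      (ofHom_closed F.π).comp fromLeft_closed _
    rw [← tmapR_comp_qis_iff hγ hγc hγq hG.kFlatOp.right F.flat.left hp hpc
      (((qis_ofHom_iff _).2 F.qis).comp fromLeft_qis (ofHom_closed _) fromLeft_closed _)
      (ofHom_closed _)]
    have e : ofHom (tensorMap (𝟙 T.Z) F.π ≫ evalLeft T.P) =
        ((tmapR T.Z ((ofHom F.π).comp (fromLeft T.P) (add_zero 0)) hp).comp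
          (ofHom (evalPairing T.P).desc) (add_zero 0)).comp (intoLeft (regular S)) (add_zero 0) := by
      refine kmap_tensor_ext fun i j p q h hpq z x => ?_
      obtain rfl : i = j := by omega
      rw [ofHom_app, comp_f, tensorMap_tm, comp_app _ _ _ h h h, comp_app _ _ _ h h h,
        tmapR_tm _ _ h hpq (add_zero q) hpq, ofHom_app, comp_app _ _ _ (add_zero q) (add_zero q)
        (add_zero q), ofHom_app, zero_mul, sgn_zero, one_smul]
      rfl
    rw [e]
    have c : ((tmapR T.Z ((ofHom F.π).comp (fromLeft T.P) (add_zero 0)) hp).comp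
      (ofHom (evalPairing T.P).desc) (add_zero 0)).Closed :=
      (tmapR_closed hp hpc).comp (ofHom_closed _) _
    exact ⟨fun h => intoLeft_qis.of_comp_right h c intoLeft_closed,
      fun h => h.comp intoLeft_qis c intoLeft_closed _⟩
  constructor
  · intro h
    obtain ⟨F, π, hF, hπ⟩ := exists_hProj_resolution T.P.left
    exact (key ⟨F, hF.kFlat, π, hπ⟩).1 (h _)
  · exact fun h F => (key F).2 h

lemma evalTensor_isIso_iff {G : DGModOp T.R'} {γ : KMap G T.Z 0} (hγ : γ.RLin) (hγc : γ.Closed)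
    (hγq : γ.Qis) (hG : G.HProj) {N : DGMod S} (F : KFlatRes N) (H : KFlatRes (tensor T.P F.obj)) :
    IsIso (Q.map (tensorMap (𝟙 T.Z) H.π) ≫ Q.map (evalTensor T.P F.obj) ≫ F.iso.hom) ↔
      ((tmapL (tensor T.P F.obj) γ hγ).comp (ofHom (evalTensor T.P F.obj)) (add_zero 0)).Qis := by
  rw [quasiIso_comp_isIso_iff, ← qis_ofHom_iff, ofHom_comp, ofHom_id_tensorMap]
  exact tmapR_comp_qis_iff hγ hγc hγq hG.kFlatOp.right H.flat.left _ (ofHom_closed _)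
    ((qis_ofHom_iff _).2 H.qis) (ofHom_closed _)

theorem evalIsIso_iff_evalTensorIsIso : EvalIsIso T ↔ EvalTensorIsIso T := by
  obtain ⟨G, γ, hγ, hγc, hγq, hG⟩ := exists_flat_resolution_right T.Z
  rw [evalIsIso_iff T hγ hγc hγq hG]
  constructor
  · intro h N F H
    rw [evalTensor_isIso_iff T hγ hγc hγq hG]
    exact tmapL_evalTensor_qis hγ hγc F.flat.left h
  · intro h
    obtain ⟨H, π, hH, hπ⟩ := exists_hProj_resolution (tensor T.P (regular S).left)
    have := h (regular S).left ⟨_, (hProj_regular_left S).kFlat, 𝟙 _, quasiIso_id _⟩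
      ⟨H, hH.kFlat, π, hπ⟩
    rw [evalTensor_isIso_iff T hγ hγc hγq hG] at this
    exact evalPairing_qis_of hγ hγc hG.kFlatOp.right this

lemma tensorEval_isIso_iff {N : DGModOp S} (E : KFlatResOp N) {N' : DGMod S} (F : KFlatRes N')
    (H : KFlatRes (tensor T.P F.obj)) :
    IsIso (Q.map (tensorMap (𝟙 (tensor E.obj T.Z)) H.π) ≫
      Q.map (assocHom E.obj T.Z (tensor T.P F.obj)) ≫
      Q.map (tensorMap (𝟙 E.obj) (evalTensor T.P F.obj))) ↔
    (tmapR E.obj (evalAlong T.P F.obj (ofHom H.π) (ofHom_bLin _).1) (evalAlong_lLin _)).Qis := by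
  rw [← Functor.map_comp, ← Functor.map_comp, isIso_Q_map_iff,
    ← qis_ofHom_iff]
  have e : ofHom (tensorMap (𝟙 (tensor E.obj T.Z)) H.π ≫ assocHom E.obj T.Z (tensor T.P F.obj) ≫
      tensorMap (𝟙 E.obj) (evalTensor T.P F.obj)) =
      (ofHom (assocHom E.obj T.Z H.obj)).comp
        (tmapR E.obj (evalAlong T.P F.obj (ofHom H.π) (ofHom_bLin _).1) (evalAlong_lLin _))
        (add_zero 0) := by
    refine kmap_tensor_ext fun i j p q h hpq t y => ?_
    obtain rfl : i = j := by omega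
    rw [ofHom_app, comp_f, comp_f, tensorMap_tm, comp_app _ _ _ h h h, ofHom_app, id_f]
    induction t using tm_induction with
    | h0 r s hrs x z =>
      rw [assocHom_tm hpq hrs rfl (by omega), tensorMap_tm,
        assocHom_tm hpq hrs rfl (by omega), tmapR_tm _ _ h _ (add_zero _) (by omega), zero_mul,
        sgn_zero, one_smul, evalAlong, comp_app _ _ _ (add_zero _) (add_zero _) (add_zero _),
        tmapR_tm _ _ _ rfl (add_zero q) rfl, zero_mul, sgn_zero, one_smul, ofHom_app, ofHom_app]
      rfl
    | hz => simp only [map_zero, LinearMap.zero_apply]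
    | hadd s t hs ht => simp only [map_add, LinearMap.add_apply, hs, ht]
  rw [e]
  have c : (tmapR E.obj (evalAlong T.P F.obj (ofHom H.π) (ofHom_bLin _).1)
      (evalAlong_lLin _)).Closed := tmapR_closed _ (evalAlong_closed _ (ofHom_closed _))
  exact ⟨fun h => assocHom_qis.of_comp_left h (ofHom_closed _) c,
    fun h => assocHom_qis.comp h (ofHom_closed _) c _⟩

lemma unitorInv_naturality {F : DGBimod S C} {F' : DGBimod S D} {f : KMap F F' 0} (hf : f.LLin) :
    (unitorInv F).comp (tmapR (regular S) f hf) (add_zero 0) =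
      f.comp (unitorInv F') (add_zero 0) := KMap.ext fun i j h y => by
  obtain rfl : i = j := by omega
  have key : ∀ s : (regular S).X 0, (tmapR (regular S) f hf).app h
      (tm (regular S) F (zero_add i) s y) = tm (regular S) F' (zero_add i) s (f.app h y) :=
    fun s => by rw [tmapR_tm _ _ h _ (add_zero i) (zero_add i), zero_mul, sgn_zero, one_smul]
  rw [comp_app _ _ _ h h h, comp_app _ _ _ h h h]
  exact key S.one

lemma qis_of_tmapR_regular_right {F : DGBimod S C} {F' : DGBimod S D} {f : KMap F F' 0}
    (hf : f.LLin) (hc : f.Closed) (h : (tmapR (regular S).right f hf).Qis) : f.Qis := by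
  have hi : ∀ {E : DGA K} (F : DGBimod S E),
      (tmapL F (intoRight (regular S)) intoRight_rLin).Qis := fun F =>
    tmapL_qis_of_inverse F intoRight_rLin fromRight_rLin fromRight_closed
      intoRight_comp_fromRight fromRight_comp_intoRight
  have hic : ∀ {E : DGA K} (F : DGBimod S E),
      (tmapL F (intoRight (regular S)) intoRight_rLin).Closed := fun F =>
    tmapL_closed _ intoRight_closed
  have e := tmapL_tmapR (intoRight_rLin (M := regular S)) hf (add_zero 0) (add_zero 0)
  rw [zero_mul, sgn_zero, one_smul] at e
  have h₁ := (hi F).comp h (hic F) (tmapR_closed hf hc) (add_zero 0)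
  rw [e] at h₁
  have h₂ := unitorInv_qis.comp ((hi F').of_comp_right h₁ (tmapR_closed hf hc) (hic F'))
    unitorInv_closed (tmapR_closed hf hc) (add_zero 0)
  rw [unitorInv_naturality] at h₂
  exact unitorInv_qis.of_comp_right h₂ hc unitorInv_closed

theorem evalTensorIsIso_iff_tensorEvalTensorIsIso :
    EvalTensorIsIso T ↔ TensorEvalTensorIsIso T := by
  have key : ∀ {N : DGMod S} (F : KFlatRes N) (H : KFlatRes (tensor T.P F.obj)),
      IsIso (Q.map (tensorMap (𝟙 T.Z) H.π) ≫ Q.map (evalTensor T.P F.obj) ≫ F.iso.hom) ↔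
      (evalAlong T.P F.obj (ofHom H.π) (ofHom_bLin _).1).Qis := fun F H => by
    rw [quasiIso_comp_isIso_iff, ← qis_ofHom_iff, ofHom_comp, ofHom_id_tensorMap]
    rfl
  constructor
  · intro h N N' E F H
    rw [tensorEval_isIso_iff]
    exact KFlatOp.tmapR_qis E.flat.right _ (evalAlong_closed _ (ofHom_closed _))
      ((key F H).1 (h N' F H))
  · intro h N F H
    have := h (regular S).right N ⟨_, (hProj_regular_right S).kFlatOp, 𝟙 _, quasiIso_id _⟩ F H
    rw [tensorEval_isIso_iff] at this
    exact (key F H).2 (qis_of_tmapR_regular_right _ (evalAlong_closed _ (ofHom_closed _)) this)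

end Evaluation

open KMap

lemma KMap.LLin.neg {A B C : DGA K} {M : DGBimod A B} {N : DGBimod A C} {f : KMap M N k}
    (hf : f.LLin) : (-f).LLin := fun i j l i' j' h h' hl hl' a x => by
  rw [neg_app, neg_app, hf i j l i' j' h h' hl hl', map_neg, smul_neg]

section HomFunctoriality

variable {A B C D E : DGA K}

lemma preL_comp {X : DGBimod A B} {X' : DGBimod A C} {X'' : DGBimod A D} {Y : DGBimod A E}
    {f : KMap X X' 0} (hf : f.LLin) {g : KMap X' X'' 0} (hg : g.LLin) :
    (preL Y g hg).comp (preL Y f hf) (add_zero 0) = preL Y (f.comp g (add_zero 0)) (hf.comp hg _) :=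
  KMap.ext fun i j h φ => ofL_injective <| by
    obtain rfl : i = j := by omega
    rw [comp_app _ _ _ h h h, ofL_preL, ofL_preL, ofL_preL, zero_mul, sgn_zero, one_smul, one_smul,
      one_smul, comp_assoc]

lemma postL_preL {X : DGBimod A B} {X' : DGBimod A C} {Y : DGBimod A D} {Y' : DGBimod A E}
    {f : KMap X X' 0} (hf : f.LLin) {g : KMap Y Y' 0} (hg : g.LLin) :
    (postL X' g hg).comp (preL Y' f hf) (add_zero 0) =
      (preL Y f hf).comp (postL X g hg) (add_zero 0) :=
  KMap.ext fun i j h φ => ofL_injective <| by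
    obtain rfl : i = j := by omega
    rw [comp_app _ _ _ h h h, comp_app _ _ _ h h h, ofL_preL, ofL_postL, ofL_postL, ofL_preL,
      zero_mul, sgn_zero, one_smul, one_smul, comp_assoc]

lemma preL_qis_of_inverse {X : DGBimod A B} {X' : DGBimod A C} (Y : DGBimod A D)
    {f : KMap X X' 0} {g : KMap X' X 0} (hf : f.LLin) (hfc : f.Closed) (hg : g.LLin)
    (h : f.comp g (add_zero 0) = one X) (h' : g.comp f (add_zero 0) = one X') :
    (preL Y g hg).Qis := by
  refine qis_of_comp_qis (g := preL Y f hf) (h := add_zero 0) (h' := add_zero 0) ?_ ?_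
    (preL_closed hf hfc)
  · rw [preL_comp, preL_congr _ h, preL_one]; exact one_qis
  · rw [preL_comp, preL_congr _ h', preL_one]; exact one_qis

lemma preL_qis_of_homotopy {X : DGBimod A B} {X' : DGBimod A C} {Y : DGBimod A D}
    {f f' : KMap X X' 0} (hf : f.LLin) (hf' : f'.LLin) {h : KMap X X' 1} (hh : h.LLin)
    (e : h.D (zero_add 1) = f - f') (hq : (preL Y f hf).Qis) : (preL Y f' hf').Qis := by
  refine hq.of_homotopy (zero_add 1) (preL Y h hh) ?_
  have e' : f = f' + h.D (zero_add 1) := by rw [e]; abel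
  rw [D_preL, preL_congr hf e', preL_add hf' (hh.D _)]
  abel

lemma preL_qis_of_hProj {X X' : DGMod A} (hX : X.HProj) (hX' : X'.HProj) (Y : DGBimod A D)
    {f : KMap X X' 0} (hl : f.LLin) (hc : f.Closed) (hq : f.Qis) : (preL Y f hl).Qis := by
  have hq' : quasiIso _ _ (f.toHom hc hl.bLin) := by
    rw [← qis_ofHom_iff, ofHom_toHom]; exact hq
  obtain ⟨g, ⟨s, hs, es⟩, t, ht, et⟩ := hX.exists_homotopy_inverse hX' hq'
  rw [ofHom_comp, ofHom_toHom, ofHom_id] at es et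
  refine qis_of_comp_qis (g := preL Y (ofHom g) (ofHom_bLin g).1) (h := add_zero 0)
    (h' := add_zero 0) ?_ ?_ (preL_closed _ (ofHom_closed g))
  · rw [preL_comp]
    refine preL_qis_of_homotopy (f := one _) (one_lLin _) _ (h := -s) (LLin.neg hs.1) ?_ ?_
    · rw [D_neg, es, neg_sub]
    · rw [preL_one]; exact one_qis
  · rw [preL_comp]
    refine preL_qis_of_homotopy (f := one _) (one_lLin _) _ (h := -t) (LLin.neg ht.1) ?_ ?_
    · rw [D_neg, et, neg_sub]
    · rw [preL_one]; exact one_qis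

lemma curryL_postL {N : DGBimod A B} {F : DGBimod B C} {Y : DGBimod A D} {Y' : DGBimod A E}
    {g : KMap Y Y' 0} (hg : g.LLin) :
    (postL (tensor N F) g hg).comp (curryL N F Y') (add_zero 0) =
      (curryL N F Y).comp (postL F (postL N g hg) (postL_lLin hg)) (add_zero 0) :=
  KMap.ext fun i j h f => evL_ext fun p q hpq z => evL_ext fun r s hrs x => by
    obtain rfl : i = j := by omega
    rw [comp_app _ _ _ _ h h, comp_app _ _ _ _ h h, evL_curryL h hpq hrs rfl (by omega),
      evL_postL hg h _ (by omega : r + p + i = s) (add_zero s), evL_postL _ h hpq hpq (add_zero q),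
      evL_postL hg _ hrs hrs (add_zero s), evL_curryL h hpq hrs rfl (by omega), map_zsmul]

lemma curryL_preL {N : DGBimod A B} {F : DGBimod B C} {F' : DGBimod B D} {Y : DGBimod A E}
    {f : KMap F F' 0} (hf : f.LLin) :
    (preL Y (tmapR N f hf) (tmapR_lLin hf)).comp (curryL N F Y) (add_zero 0) =
      (curryL N F' Y).comp (preL (homL N Y) f hf) (add_zero 0) :=
  KMap.ext fun i j h g => evL_ext fun p q hpq z => evL_ext fun r s hrs x => by
    obtain rfl : i = j := by omega
    rw [comp_app _ _ _ _ h h, comp_app _ _ _ _ h h, evL_curryL h hpq hrs rfl (by omega),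
      evL_preL, tmapR_tm f hf _ _ (add_zero p) rfl, zero_mul, sgn_zero, one_smul,
      evL_preL hf h hpq, evL_curryL h hpq hrs rfl (by omega)]

end HomFunctoriality

section Restriction

variable {A A' B B' C D : DGA K}

/-- The identity map from a DG bimodule to a restriction of scalars of it. -/
def toRestrict (φ : DGA.Hom A' A) (ψ : DGA.Hom B' B) (M : DGBimod A B) :
    KMap M (M.restrict φ ψ) 0 := KMap.mk fun _ _ h => (KMap.one M).app h

/-- The identity map to a DG bimodule from a restriction of scalars of it. -/
def fromRestrict (φ : DGA.Hom A' A) (ψ : DGA.Hom B' B) (M : DGBimod A B) :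
    KMap (M.restrict φ ψ) M 0 := KMap.mk fun _ _ h => (KMap.one M).app h

variable {φ : DGA.Hom A' A} {ψ : DGA.Hom B' B} {M : DGBimod A B}

lemma toRestrict_closed : (toRestrict φ ψ M).Closed := one_closed (M := M)

lemma fromRestrict_closed : (fromRestrict φ ψ M).Closed := one_closed (M := M)

lemma toRestrict_comp_fromRestrict :
    (toRestrict φ ψ M).comp (fromRestrict φ ψ M) (add_zero 0) = one M := one_comp (one M) (zero_add 0)

lemma fromRestrict_comp_toRestrict :
    (fromRestrict φ ψ M).comp (toRestrict φ ψ M) (add_zero 0) = one (M.restrict φ ψ) :=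
  one_comp (one M) (zero_add 0)

lemma toRestrict_lLin : (toRestrict (DGA.Hom.id A) ψ M).LLin := one_lLin M

lemma fromRestrict_lLin : (fromRestrict (DGA.Hom.id A) ψ M).LLin := one_lLin M

lemma toRestrict_rLin : (toRestrict φ (DGA.Hom.id B) M).RLin := one_rLin M

lemma fromRestrict_rLin : (fromRestrict φ (DGA.Hom.id B) M).RLin := one_rLin M

lemma toRestrict_qis : (toRestrict φ ψ M).Qis := one_qis (M := M)

lemma fromRestrict_qis : (fromRestrict φ ψ M).Qis := one_qis (M := M)

lemma hProj_restrict_regular_left (ψ : DGA.Hom B' A) :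
    ((regular A).restrict (DGA.Hom.id A) ψ).left.HProj := by
  refine (hProj_regular_left A).of_retract
    ((((fromLeft _).comp (fromRestrict _ _ _) (add_zero 0)).comp (intoLeft (regular A))
      (add_zero 0)).toHom ((fromLeft_closed.comp fromRestrict_closed _).comp intoLeft_closed _)
      ((fromLeft_lLin.comp fromRestrict_lLin _).comp intoLeft_lLin _).bLin)
    ((((fromLeft (regular A)).comp (toRestrict (DGA.Hom.id A) ψ _) (add_zero 0)).comp (intoLeft _)
      (add_zero 0)).toHom ((fromLeft_closed.comp toRestrict_closed _).comp intoLeft_closed _)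
      ((fromLeft_lLin.comp toRestrict_lLin _).comp intoLeft_lLin _).bLin) ⟨0, BLin.zero, ?_⟩
  rw [D_zero, ofHom_comp, ofHom_toHom, ofHom_toHom, ofHom_id, eq_comm, sub_eq_zero]
  exact KMap.ext fun i j h x => by
    obtain rfl : i = j := by omega
    rw [comp_app _ _ _ h h h, comp_app _ _ _ h h h, comp_app _ _ _ h h h, comp_app _ _ _ h h h,
      comp_app _ _ _ h h h]
    rfl

lemma tmapR_regular_qis {F : DGBimod A C} {F' : DGBimod A D} {f : KMap F F' 0} (hf : f.LLin)
    (hc : f.Closed) (hq : f.Qis) : (tmapR (regular A) f hf).Qis := by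
  refine unitorInv_qis.of_comp_left (h := add_zero 0) ?_ unitorInv_closed (tmapR_closed hf hc)
  rw [unitorInv_naturality]
  exact hq.comp unitorInv_qis hc unitorInv_closed _

lemma tmapR_restrict_regular_qis (φ : DGA.Hom A' A) {F : DGBimod A C} {F' : DGBimod A D}
    {f : KMap F F' 0} (hf : f.LLin) (hc : f.Closed) (hq : f.Qis) :
    (tmapR ((regular A).restrict φ (DGA.Hom.id A)) f hf).Qis := by
  have hi : ∀ {E : DGA K} (F : DGBimod A E),
      (tmapL F (fromRestrict φ (DGA.Hom.id A) (regular A)) fromRestrict_rLin).Qis := fun F =>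
    tmapL_qis_of_inverse F fromRestrict_rLin toRestrict_rLin toRestrict_closed
      fromRestrict_comp_toRestrict toRestrict_comp_fromRestrict
  have hic : ∀ {E : DGA K} (F : DGBimod A E),
      (tmapL F (fromRestrict φ (DGA.Hom.id A) (regular A)) fromRestrict_rLin).Closed := fun F =>
    tmapL_closed _ fromRestrict_closed
  have e := tmapL_tmapR (fromRestrict_rLin (φ := φ) (M := regular A)) hf (add_zero 0) (add_zero 0)
  rw [zero_mul, sgn_zero, one_smul] at e
  have h₁ := (hi F).comp (tmapR_regular_qis hf hc hq) (hic F) (tmapR_closed hf hc) (add_zero 0)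
  rw [e] at h₁
  exact (hi F').of_comp_right h₁ (tmapR_closed hf hc) (hic F')

/-- The identification of a module with the maps out of the regular bimodule. -/
def fromOneMap (Y : DGBimod A C) : KMap Y (homL (regular A) Y) 0 :=
  KMap.mk fun i j h =>
    { toFun := fun y => toL (fromOneL Y (Y.castX (h ▸ (add_zero i).symm) y)) (fromOneL_lLin _)
      map_add' := fun y y' => evL_ext fun r s hrs x => by
        rw [map_add, map_add, LinearMap.add_apply, evL_toL, evL_toL, evL_toL, fromOneL_app,
          fromOneL_app, fromOneL_app, map_add, smul_add]
      map_smul' := fun c y => evL_ext fun r s hrs x => by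
        rw [map_smul, map_smul, LinearMap.smul_apply, evL_toL, evL_toL, fromOneL_app,
          fromOneL_app, map_smul, smul_comm, RingHom.id_apply] }

lemma ofL_fromOneMap {Y : DGBimod A C} (h : i + 0 = i) (y : Y.X i) :
    ofL ((fromOneMap Y).app h y) = fromOneL Y y := rfl

lemma fromOneMap_closed {Y : DGBimod A C} : (fromOneMap Y).Closed :=
  closed_of fun i j i' j' h hi hj h' y => by
    obtain rfl : i = j := by omega
    obtain rfl : i' = j' := by omega
    refine ofL_injective ?_
    rw [ofL_d, sgn_zero, one_smul, ofL_fromOneMap, ofL_fromOneMap, D_fromOneL]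

lemma fromOneMap_qis {Y : DGBimod A C} : (fromOneMap Y).Qis :=
  qis_of_bijective fromOneMap_closed fun i j h => by
    obtain rfl : i = j := by omega
    constructor
    · intro y y' e
      have key : ∀ (y : Y.X i) (a : (regular A).X 0),
          (ofL ((fromOneMap Y).app h y)).app (zero_add i) a = Y.lsmul (zero_add i) a y :=
        fun y a => by rw [ofL_fromOneMap, fromOneL_app, mul_zero, sgn_zero, one_smul]
      have := congrArg (fun f => (ofL f).app (zero_add i) A.one) e
      exact (Y.one_lsmul _ y).symm.trans ((key y A.one).symm.trans
        (this.trans ((key y' A.one).trans (Y.one_lsmul _ y'))))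
    · intro f
      refine ⟨(ofL f).app (zero_add i) A.one, ofL_injective ?_⟩
      rw [ofL_fromOneMap]
      exact (LLin.eq_fromOneL (ofL_lLin f)).symm

end Restriction

section Adjoints

variable {A B C D : DGA K}

/-- Tensoring with a DG bimodule whose Hom functor preserves quasi-isomorphisms preserves
K-projectivity. -/
lemma HProj.tensor {N : DGBimod A B} {F : DGMod B} (hF : F.HProj)
    (hN : ∀ (Y Y' : DGMod A) (f : KMap Y Y' 0) (hl : f.LLin), f.Closed → f.Qis →
      (postL N f hl).Qis) : HProj (DGBimod.tensor N F) := by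
  refine KProj.hProj fun Y Y' f hf => ?_
  rw [← qis_ofHom_iff, ofHom_homLMap]
  have hq := (qis_ofHom_iff f).2 hf
  refine curryL_qis.of_comp_right (h := add_zero 0) ?_ (postL_closed _ (ofHom_closed f))
    curryL_closed
  rw [curryL_postL]
  exact curryL_qis.comp (postL_qis hF.left _ (postL_closed _ (ofHom_closed f))
    (hN _ _ _ (ofHom_bLin f).1 (ofHom_closed f) hq)) curryL_closed
    (postL_closed _ (postL_closed _ (ofHom_closed f))) _

lemma KInj.preL_qis {J : DGMod A} (hJ : J.KInj) {X : DGBimod A B} {X' : DGBimod A C}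
    {f : KMap X X' 0} (hl : f.LLin) (hc : f.Closed) (hq : f.Qis) : (preL J f hl).Qis := by
  have h := hJ _ _ _ (hq.leftHom hc hl)
  rw [← qis_ofHom_iff, ofHom_homLPre, preL_congr _ (ofHom_leftHom f hc hl)] at h
  have hi : ∀ {E : DGA K} (X : DGBimod A E), (preL J (intoLeft X) intoLeft_lLin).Qis := fun X =>
    preL_qis_of_inverse J fromLeft_lLin fromLeft_closed intoLeft_lLin fromLeft_comp_intoLeft
      intoLeft_comp_fromLeft
  have hic : ∀ {E : DGA K} (X : DGBimod A E), (preL J (intoLeft X) intoLeft_lLin).Closed :=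
    fun X => preL_closed _ intoLeft_closed
  refine (hi X').of_comp_left (h := add_zero 0) ?_ (hic X') (preL_closed hl hc)
  have e : f.comp (intoLeft X') (add_zero 0) = (intoLeft X).comp f.asLeft (add_zero 0) :=
    KMap.ext fun i j h x => by
      obtain rfl : i = j := by omega
      rw [comp_app _ _ _ h h h, comp_app _ _ _ h h h]
      rfl
  rw [preL_comp, preL_congr _ e, ← preL_comp intoLeft_lLin hl.asLeft.1]
  exact h.comp (hi X) (preL_closed _ hc.asLeft) (hic X) _

/-- Coinduction along a flat DG bimodule preserves K-injectivity. -/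
lemma KInj.homL {N : DGBimod A B} {J : DGMod A} (hJ : J.KInj)
    (hN : ∀ (Y Y' : DGMod B) (f : KMap Y Y' 0) (hl : f.LLin), f.Closed → f.Qis →
      (tmapR N f hl).Qis) : KInj (DGBimod.homL N J) := fun Y Y' f hf => by
  rw [← qis_ofHom_iff, ofHom_homLPre]
  have hq := (qis_ofHom_iff f).2 hf
  refine curryL_qis.of_comp_left (h := add_zero 0) ?_ curryL_closed
    (preL_closed _ (ofHom_closed f))
  rw [← curryL_preL]
  exact (hJ.preL_qis (tmapR_lLin _) (tmapR_closed _ (ofHom_closed f))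
    (hN _ _ _ (ofHom_bLin f).1 (ofHom_closed f) hq)).comp curryL_qis
    (preL_closed _ (tmapR_closed _ (ofHom_closed f))) curryL_closed _

lemma kInj_chars : (chars K).KInj := fun N N' f hf => by
  rw [← qis_ofHom_iff, ofHom_homLPre, preL_chars_qis_iff]
  exact ((qis_ofHom_iff f).2 hf).dualQis

lemma KInj.exists_extension {J : DGMod A} (hJ : J.KInj) {X : DGBimod A B} {X' : DGBimod A C}
    {f : KMap X X' 0} (hl : f.LLin) (hc : f.Closed) (hq : f.Qis) {g : KMap X J 0} (hgl : g.LLin)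
    (hgc : g.Closed) : ∃ v : KMap X' J 0, v.LLin ∧ v.Closed ∧ ∃ s : KMap X J 1, s.LLin ∧
      s.D (zero_add 1) = g - f.comp v (add_zero 0) := by
  obtain ⟨v, hv, hb⟩ := (hJ.preL_qis hl hc hq 0 0 (add_zero 0)).2 (toL g hgl)
    (mem_cyc_homL.2 hgc)
  obtain ⟨s, hs, e⟩ := (mem_bdry_homL (zero_add 1)).1 hb
  refine ⟨ofL v, ofL_lLin v, mem_cyc_homL.1 hv, s, hs, ?_⟩
  rw [e, ofL_sub, ofL_toL, ofL_preL, zero_mul, sgn_zero, one_smul]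

end Adjoints

open KMap

section RestrictMap

variable {R' R C D E : DGA K} (ρ : DGA.Hom R' R)

/-- A graded map as a map between the restrictions of scalars. -/
def KMap.restrictMap {Y : DGBimod R C} {Y' : DGBimod R D} (f : KMap Y Y' k) :
    KMap (Y.restrict ρ (DGA.Hom.id C)) (Y'.restrict ρ (DGA.Hom.id D)) k :=
  KMap.mk fun _ _ h => f.app h

variable {ρ} {Y : DGBimod R C} {Y' : DGBimod R D} {Y'' : DGBimod R E}

lemma restrictMap_lLin {f : KMap Y Y' k} (hf : f.LLin) : (f.restrictMap ρ).LLin :=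
  fun i j l i' j' h h' hl hl' a x => hf i j l i' j' h h' hl hl' (ρ.f l a) x

lemma restrictMap_closed {f : KMap Y Y' k} (hf : f.Closed) : (f.restrictMap ρ).Closed :=
  congrArg (KMap.restrictMap ρ) (show f.D (sub_add_cancel k 1) = 0 from hf)

lemma qis_of_restrictMap {f : KMap Y Y' k} (hf : (f.restrictMap ρ).Qis) : f.Qis := hf

variable (ρ Y Y') in
/-- Restriction of scalars on Hom complexes. -/
def resHom : KMap (homL Y Y') (homL (Y.restrict ρ (DGA.Hom.id C)) (Y'.restrict ρ (DGA.Hom.id D))) 0 :=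
  KMap.mk fun i j h =>
    { toFun := fun f => homLMk (fun p q hpq => (ofL f).app (by omega : p + i = q))
        (fun p q l p' q' h₁ h₂ hl hl' a x => by
          have e : sgn (i * l) = sgn (j * l) := by rw [show i = j by omega]
          rw [← e]
          exact evL_x_lsmul f _ hl _ hl' (ρ.f l a) x)
      map_add' := fun f f' => evL_ext fun p q hpq x => by
        rw [map_add, LinearMap.add_apply]
        exact LinearMap.congr_fun (map_add (evL (by omega : p + i = q)) f f') x
      map_smul' := fun c f => evL_ext fun p q hpq x => by
        rw [map_smul, LinearMap.smul_apply]
        exact LinearMap.congr_fun (map_smul (evL (by omega : p + i = q)) c f) x }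

lemma ofL_resHom (h : i + 0 = i) (f : (homL Y Y').X i) :
    ofL ((resHom ρ Y Y').app h f) = (ofL f).restrictMap ρ := rfl

lemma resHom_closed : (resHom ρ Y Y').Closed :=
  closed_of fun i j i' j' h hi hj h' f => by
    obtain rfl : i = j := by omega
    obtain rfl : i' = j' := by omega
    refine ofL_injective ?_
    rw [ofL_d, sgn_zero, one_smul, ofL_resHom, ofL_resHom, ofL_d]
    rfl

lemma resHom_preL {f : KMap Y Y' 0} (hf : f.LLin) :
    (preL Y'' f hf).comp (resHom ρ Y Y'') (add_zero 0) =
      (resHom ρ Y' Y'').comp (preL _ (f.restrictMap ρ) (restrictMap_lLin hf)) (add_zero 0) :=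
  KMap.ext fun i j h φ => ofL_injective <| by
    obtain rfl : i = j := by omega
    rw [comp_app _ _ _ h h h, comp_app _ _ _ h h h, ofL_preL, ofL_resHom, ofL_resHom, ofL_preL,
      zero_mul, sgn_zero, one_smul, one_smul]
    rfl

end RestrictMap

section Extension

variable {R' R C D E : DGA K} (ρ : DGA.Hom R' R)

/-- A morphism of DGAs as a morphism of DG bimodules. -/
def DGA.Hom.toBimodHom : regular R' ⟶ (regular R).restrict ρ ρ where
  f := ρ.f
  comm h a := ρ.comm h a
  map_lsmul h a b := ρ.map_mul h a b
  map_rsmul h a b := ρ.map_mul h a b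

/-- The DG bimodule inducing extension of scalars. -/
abbrev extBimod : DGBimod R R' := (regular R).restrict (DGA.Hom.id R) ρ

/-- The DG bimodule inducing coextension of scalars. -/
abbrev coextBimod : DGBimod R' R := (regular R).restrict ρ (DGA.Hom.id R)

/-- A morphism of DGAs as a right linear map. -/
def toExtBimod : KMap (regular R') (extBimod ρ) 0 :=
  KMap.mk fun _ _ h => (ofHom (DGA.Hom.toBimodHom ρ)).app h

/-- A morphism of DGAs as a left linear map. -/
def toCoextBimod : KMap (regular R') (coextBimod ρ) 0 :=
  KMap.mk fun _ _ h => (ofHom (DGA.Hom.toBimodHom ρ)).app h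

variable {ρ}

lemma toExtBimod_rLin : (toExtBimod ρ).RLin :=
  fun i j l i' j' h h' hl hl' a x =>
    (ofHom_bLin (DGA.Hom.toBimodHom ρ)).2 i j l i' j' h h' hl hl' a x

lemma toCoextBimod_lLin : (toCoextBimod ρ).LLin :=
  fun i j l i' j' h h' hl hl' a x =>
    (ofHom_bLin (DGA.Hom.toBimodHom ρ)).1 i j l i' j' h h' hl hl' a x

lemma toExtBimod_closed : (toExtBimod ρ).Closed := ofHom_closed (DGA.Hom.toBimodHom ρ)

lemma toCoextBimod_closed : (toCoextBimod ρ).Closed := ofHom_closed (DGA.Hom.toBimodHom ρ)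

lemma qis_toBimodHom (hρ : ρ.QuasiIso) : (ofHom (DGA.Hom.toBimodHom ρ)).Qis :=
  (qis_ofHom_iff (DGA.Hom.toBimodHom ρ)).2 hρ

lemma toExtBimod_qis (hρ : ρ.QuasiIso) : (toExtBimod ρ).Qis := qis_toBimodHom hρ

lemma toCoextBimod_qis (hρ : ρ.QuasiIso) : (toCoextBimod ρ).Qis := qis_toBimodHom hρ

variable (ρ)

/-- The action of `R` on the restriction of scalars of a DG bimodule. -/
def extPairing (Y : DGBimod R C) : Pairing (extBimod ρ) (Y.restrict ρ (DGA.Hom.id C)) Y where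
  φ _ _ _ h := Y.lsmul h
  bal _ _ _ l _ _ h₁ h₂ h₃ h₄ a b x := Y.mul_lsmul h₁ h₂ h₃ h₄ a (ρ.f l b) x
  leibniz _ _ _ _ _ _ h hn hi hj hl hr a x := Y.lleibniz h hi hj hn hl hr a x
  map_lsmul _ _ _ _ _ _ h hpq hip hk a b x := Y.mul_lsmul hip hk hpq h a b x
  map_rsmul _ _ _ _ _ _ h hpq hqj hk a x b := (Y.lsmul_rsmul hpq h hqj hk a x b).symm

/-- The counit of the extension of scalars. -/
noncomputable def extCounit (Y : DGBimod R C) :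
    tensor (extBimod ρ) (Y.restrict ρ (DGA.Hom.id C)) ⟶ Y := (extPairing ρ Y).desc

lemma extCounit_tm (Y : DGBimod R C) (h : i + j = n) (a : (extBimod ρ).X i)
    (y : (Y.restrict ρ (DGA.Hom.id C)).X j) :
    (extCounit ρ Y).f n (tm (extBimod ρ) (Y.restrict ρ (DGA.Hom.id C)) h a y) = Y.lsmul h a y :=
  (extPairing ρ Y).desc_tm h a y

/-- The unit of the extension of scalars. -/
noncomputable def extUnit (H : DGBimod R' C) :
    KMap H ((tensor (extBimod ρ) H).restrict ρ (DGA.Hom.id C)) 0 :=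
  ((unitorInv H).comp (tmapL H (toExtBimod ρ) toExtBimod_rLin) (add_zero 0)).comp
    (toRestrict ρ (DGA.Hom.id C) _) (add_zero 0)

variable {ρ}

lemma extUnit_app (H : DGBimod R' C) (h : i + 0 = j) (h' : 0 + i = j) (x : H.X i) :
    (extUnit ρ H).app h x = tm (extBimod ρ) H h' R.one x := by
  obtain rfl : i = j := by omega
  have key : ∀ (s : (regular R').X 0) (a : (extBimod ρ).X 0), (toExtBimod ρ).app (add_zero 0) s = a →
      (tmapL H (toExtBimod ρ) toExtBimod_rLin).app h (tm (regular R') H h' s x) =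
        tm (extBimod ρ) H h' a x := by
    rintro s _ rfl
    rw [tmapL_tm _ _ h h' (add_zero 0) h']
  refine Eq.trans ?_ (key R'.one R.one ρ.map_one)
  rw [extUnit, comp_app _ _ _ h h h, comp_app _ _ _ h h h]
  rfl

lemma extUnit_closed (H : DGBimod R' C) : (extUnit ρ H).Closed :=
  (unitorInv_closed.comp (tmapL_closed _ toExtBimod_closed) _).comp toRestrict_closed _

lemma extUnit_lLin (H : DGBimod R' C) : (extUnit ρ H).LLin := by
  intro i j l i' j' h h' hl hl' a x
  obtain rfl : i = j := by omega
  obtain rfl : i' = j' := by omega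
  rw [extUnit_app H h (zero_add i), extUnit_app H h' (zero_add i'), zero_mul, sgn_zero, one_smul]
  have key : ∀ (o : (extBimod ρ).X 0), (extBimod ρ).rsmul (zero_add l) o a = (ρ.f l a : R.X l) →
      (regular R).lsmul (add_zero l) (ρ.f l a) o = (ρ.f l a : R.X l) →
      tm (extBimod ρ) H (zero_add i') o (H.lsmul hl a x) =
        (tensor (extBimod ρ) H).lsmul hl (ρ.f l a) (tm (extBimod ρ) H (zero_add i) o x) := by
    intro o h₁ h₂
    rw [lsmul_tm hl _ (add_zero l) (by omega), ← tm_rsmul (zero_add l) (by omega) hl _ o a x, h₁]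
    exact congrArg (fun t => tm (extBimod ρ) H (by omega) t x) h₂.symm
  exact key R.one (R.one_mul _ _) (R.mul_one _ _)

lemma extUnit_qis {H : DGBimod R' C} (hH : H.left.KFlat) (hρ : ρ.QuasiIso) : (extUnit ρ H).Qis :=
  (unitorInv_qis.comp (hH.tmapL_qis _ toExtBimod_closed (toExtBimod_qis hρ)) unitorInv_closed
    (tmapL_closed _ toExtBimod_closed) _).comp toRestrict_qis
    (unitorInv_closed.comp (tmapL_closed _ toExtBimod_closed) _) toRestrict_closed _

/-- The `R`-linear map out of the extension of scalars given by a map into a restriction of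
scalars. -/
noncomputable def extLift {H : DGBimod R' C} {Y : DGBimod R D}
    (q : KMap H (Y.restrict ρ (DGA.Hom.id D)) k) (hq : q.LLin) : KMap (tensor (extBimod ρ) H) Y k :=
  (tmapR (extBimod ρ) q hq).comp (ofHom (extCounit ρ Y)) (add_zero k)

lemma extLift_lLin {H : DGBimod R' C} {Y : DGBimod R D}
    {q : KMap H (Y.restrict ρ (DGA.Hom.id D)) k} (hq : q.LLin) : (extLift q hq).LLin :=
  (tmapR_lLin hq).comp (ofHom_bLin _).1 _

lemma extLift_closed {H : DGBimod R' C} {Y : DGBimod R D}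
    {q : KMap H (Y.restrict ρ (DGA.Hom.id D)) k} (hq : q.LLin) (hc : q.Closed) :
    (extLift q hq).Closed := (tmapR_closed hq hc).comp (ofHom_closed _) _

lemma extUnit_comp_extLift {H : DGBimod R' C} {Y : DGBimod R D}
    {q : KMap H (Y.restrict ρ (DGA.Hom.id D)) k} (hq : q.LLin) :
    (extUnit ρ H).comp ((extLift q hq).restrictMap ρ) (zero_add k) = q :=
  KMap.ext fun i j h x => by
    have key : ∀ o : (extBimod ρ).X 0, (extLift q hq).app h (tm (extBimod ρ) H (zero_add i) o x) =
        Y.lsmul (zero_add j) o (q.app h x) := fun o => by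
      rw [extLift, comp_app _ _ _ h h (add_zero j), tmapR_tm q hq h _ h (zero_add j), mul_zero,
        sgn_zero, one_smul, ofHom_app, extCounit_tm]
    rw [comp_app _ _ _ h (add_zero i) h, extUnit_app H _ (zero_add i)]
    exact (key R.one).trans (Y.one_lsmul _ _)

lemma extLift_qis {H : DGBimod R' C} {Y : DGBimod R D} (hH : H.left.KFlat)
    (hρ : ρ.QuasiIso) {q : KMap H (Y.restrict ρ (DGA.Hom.id D)) k} (hq : q.LLin) (hc : q.Closed)
    (hqq : q.Qis) : (extLift q hq).Qis := by
  refine qis_of_restrictMap (ρ := ρ) ((extUnit_qis hH hρ).of_comp_left (h := zero_add k) ?_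
    (extUnit_closed H) (restrictMap_closed (extLift_closed hq hc)))
  rw [extUnit_comp_extLift]
  exact hqq

/-- The adjunction isomorphism between extension and restriction of scalars. -/
noncomputable def extAdj (ρ : DGA.Hom R' R) (H : DGBimod R' C) (Y : DGBimod R D) :
    KMap (homL (tensor (extBimod ρ) H) Y) (homL H (Y.restrict ρ (DGA.Hom.id D))) 0 :=
  (resHom ρ (tensor (extBimod ρ) H) Y).comp (preL _ (extUnit ρ H) (extUnit_lLin H)) (add_zero 0)

lemma extAdj_closed (H : DGBimod R' C) (Y : DGBimod R D) : (extAdj ρ H Y).Closed :=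
  resHom_closed.comp (preL_closed _ (extUnit_closed H)) _

lemma ofL_extAdj {H : DGBimod R' C} {Y : DGBimod R D} (h : i + 0 = i)
    (f : (homL (tensor (extBimod ρ) H) Y).X i) : ofL ((extAdj ρ H Y).app h f) =
      (extUnit ρ H).comp ((ofL f).restrictMap ρ) (zero_add i) := by
  rw [extAdj, comp_app _ _ _ h h h, ofL_preL, zero_mul, sgn_zero, one_smul, ofL_resHom]

lemma extAdj_qis {H : DGBimod R' C} {Y : DGBimod R D} : (extAdj ρ H Y).Qis :=
  qis_of_bijective (extAdj_closed H Y) fun i j h => by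
    obtain rfl : i = j := by omega
    constructor
    · intro f f' e
      have e' := congrArg ofL e
      rw [ofL_extAdj, ofL_extAdj] at e'
      refine ofL_injective (kmap_tensor_ext fun m n p q hmn hpq a x => ?_)
      have key : ∀ (g : KMap (tensor (extBimod ρ) H) Y i), g.LLin →
          g.app hmn (tm (extBimod ρ) H hpq a x) = sgn (i * p) • Y.lsmul (by omega) a
            (((extUnit ρ H).comp (g.restrictMap ρ) (zero_add i)).app (rfl : q + i = q + i) x) := by
        intro g hg
        rw [comp_app _ _ _ rfl (add_zero q) rfl, extUnit_app H _ (zero_add q)]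
        refine Eq.trans ?_ (hg q (q + i) p m n rfl hmn hpq (by omega) a
          (tm (extBimod ρ) H (zero_add q) R.one x))
        have key' : ∀ (b : R.X p) (o : (extBimod ρ).X 0), (tensor (extBimod ρ) H).lsmul hpq b
            (tm (extBimod ρ) H (zero_add q) o x) =
              tm (extBimod ρ) H hpq ((extBimod ρ).lsmul (add_zero p) b o) x :=
          fun b o => lsmul_tm hpq (zero_add q) (add_zero p) hpq b o x
        refine congrArg (g.app hmn) (Eq.trans ?_ (key' a R.one).symm)
        exact congrArg (fun t => tm (extBimod ρ) H hpq t x) (R.mul_one _ a).symm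
      rw [key _ (ofL_lLin f), key _ (ofL_lLin f'), e']
    · intro g
      refine ⟨toL (extLift (ofL g) (ofL_lLin g)) (extLift_lLin _), ofL_injective ?_⟩
      rw [ofL_extAdj, ofL_toL, extUnit_comp_extLift]

lemma preL_extLift_comp_extAdj {H : DGBimod R' C} {Y : DGBimod R D} {W : DGBimod R E}
    {q : KMap H (Y.restrict ρ (DGA.Hom.id D)) 0} (hq : q.LLin) :
    (preL W (extLift q hq) (extLift_lLin hq)).comp (extAdj ρ H W) (add_zero 0) =
      (resHom ρ Y W).comp (preL _ q hq) (add_zero 0) := by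
  rw [extAdj, ← comp_assoc _ _ _ (add_zero 0) (add_zero 0), resHom_preL,
    comp_assoc _ _ _ _ _ (add_zero 0) (add_zero 0), preL_comp,
    preL_congr _ (extUnit_comp_extLift hq)]

end Extension

open KMap

lemma ofL_tensorHom {A B C D : DGA K} {M : DGBimod A B} {F : DGBimod B C} {F' : DGBimod B D}
    (f : (homL F F').X n) :
    ofL ((tensorHom M F F').f n f) = tmapR M (ofL f) (ofL_lLin f) := rfl

lemma tensorToHom_naturality {A S C D : DGA K} {P : DGBimod A S} {N : DGBimod S C}
    {N' : DGBimod S D} {f : KMap N N' 0} (hf : f.LLin) :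
    (tmapR P f hf).comp (tensorToHom P N') (add_zero 0) =
      (tensorToHom P N).comp (postL (dual P) f hf) (add_zero 0) :=
  kmap_tensor_ext fun i j p q h hpq x y => evL_ext fun r s hrs z => by
    obtain rfl : i = j := by omega
    rw [comp_app _ _ _ h h h, comp_app _ _ _ h h h, tmapR_tm f hf h hpq (add_zero q) hpq, zero_mul,
      sgn_zero, one_smul, evL_tensorToHom_tm h hrs hpq rfl (by omega),
      evL_postL hf h hrs hrs (add_zero s), evL_tensorToHom_tm h hrs hpq rfl (by omega), map_zsmul,
      hf q q (p + r) s s (add_zero q) (add_zero s) (by omega) (by omega), zero_mul, sgn_zero,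
      one_smul]

lemma tensorToHom_lLin {A S C : DGA K} {P : DGBimod A S} {N : DGBimod S C} :
    (tensorToHom P N).LLin := (ofHom_bLin _).1.comp (ofHom_bLin _).1 _

namespace BimodRes

variable {R S C D : DGA K} {M : DGBimod R S} (T : BimodRes M)

/-- The resolution as a map to the original DG bimodule. -/
def toBimod : KMap T.P M 0 :=
  (ofHom T.π).comp (fromRestrict T.ρ (DGA.Hom.id S) M) (add_zero 0)

lemma toBimod_rLin : T.toBimod.RLin := (ofHom_bLin _).2.comp fromRestrict_rLin _

lemma toBimod_closed : T.toBimod.Closed := (ofHom_closed _).comp fromRestrict_closed _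

lemma toBimod_qis : T.toBimod.Qis :=
  ((qis_ofHom_iff T.π).2 T.qis).comp fromRestrict_qis (ofHom_closed _) fromRestrict_closed _

lemma toBimod_lsmul (hl : l + i = j) (a : T.R'.X l) (x : T.P.X i) :
    T.toBimod.app (add_zero j) (T.P.lsmul hl a x) =
      M.lsmul hl (T.ρ.f l a) (T.toBimod.app (add_zero i) x) := by
  have := (ofHom_bLin T.π).1 i i l j j (add_zero i) (add_zero j) hl hl a x
  rw [zero_mul, sgn_zero, one_smul] at this
  rw [toBimod, comp_app _ _ _ (add_zero j) (add_zero j) (add_zero j),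
    comp_app _ _ _ (add_zero i) (add_zero i) (add_zero i)]
  exact this

/-- The map `P ⊗ F → M ⊗ F` induced by the resolution. -/
noncomputable def tensorComparison (F : DGBimod S C) :
    KMap (tensor T.P F) ((tensor M F).restrict T.ρ (DGA.Hom.id C)) 0 :=
  (tmapL F T.toBimod T.toBimod_rLin).comp (toRestrict T.ρ (DGA.Hom.id C) (tensor M F)) (add_zero 0)

lemma tensorComparison_tm {F : DGBimod S C} {i p q : ℤ} (h : i + 0 = i) (hpq : p + q = i)
    (x : T.P.X p) (y : F.X q) : (T.tensorComparison F).app h (tm T.P F hpq x y) =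
      tm M F hpq (T.toBimod.app (add_zero p) x) y := by
  rw [tensorComparison, comp_app _ _ _ h h h, tmapL_tm _ _ h hpq (add_zero p) hpq]
  rfl

lemma tensorComparison_closed (F : DGBimod S C) : (T.tensorComparison F).Closed :=
  (tmapL_closed _ T.toBimod_closed).comp toRestrict_closed _

lemma tensorComparison_lLin (F : DGBimod S C) : (T.tensorComparison F).LLin := by
  intro i j l i' j' h h' hl hl' a t
  obtain rfl : i = j := by omega
  obtain rfl : i' = j' := by omega
  rw [zero_mul, sgn_zero, one_smul]
  induction t using tm_induction with
  | h0 p q hpq x y =>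
    rw [lsmul_tm hl hpq rfl (by omega), tensorComparison_tm, tensorComparison_tm, toBimod_lsmul]
    exact (lsmul_tm hl hpq rfl (by omega) (T.ρ.f l a) _ _).symm
  | hz => simp only [map_zero]
  | hadd s t hs ht => simp only [map_add, hs, ht]

lemma tensorComparison_qis {F : DGBimod S C} (hF : F.left.KFlat) : (T.tensorComparison F).Qis :=
  (hF.tmapL_qis _ T.toBimod_closed T.toBimod_qis).comp toRestrict_qis
    (tmapL_closed _ T.toBimod_closed) toRestrict_closed _

lemma tensorHom_tensorComparison (F : DGBimod S C) (F' : DGBimod S D) :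
    ((ofHom (tensorHom M F F')).comp (resHom T.ρ (tensor M F) (tensor M F')) (add_zero 0)).comp
      (preL _ (T.tensorComparison F) (T.tensorComparison_lLin F)) (add_zero 0) =
    (ofHom (tensorHom T.P F F')).comp
      (postL _ (T.tensorComparison F') (T.tensorComparison_lLin F')) (add_zero 0) :=
  KMap.ext fun n n' h f => ofL_injective <| kmap_tensor_ext fun i j p q hij hpq x y => by
    obtain rfl : n = n' := by omega
    rw [comp_app _ _ _ h h h, comp_app _ _ _ h h h, comp_app _ _ _ h h h, ofL_preL, zero_mul,
      sgn_zero, one_smul, ofL_resHom, ofL_postL, ofHom_app, ofHom_app, ofL_tensorHom, ofL_tensorHom,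
      comp_app _ _ _ hij (add_zero i) hij, comp_app _ _ _ hij hij (add_zero j), tensorComparison_tm,
      tmapR_tm _ _ hij hpq rfl (by omega), map_zsmul, tensorComparison_tm]
    exact tmapR_tm (ofL f) (ofL_lLin f) hij hpq rfl (by omega) _ _

/-- The map `R ⊗_{R'} H → M ⊗ F` induced by a map `H → P ⊗ F`. -/
noncomputable def extMap {F : DGBimod S C} {H : DGBimod T.R' D} {p : KMap H (tensor T.P F) 0}
    (hp : p.LLin) : KMap (tensor (extBimod T.ρ) H) (tensor M F) 0 :=
  extLift (p.comp (T.tensorComparison F) (add_zero 0)) (hp.comp (T.tensorComparison_lLin F) _)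

lemma extMap_lLin {F : DGBimod S C} {H : DGBimod T.R' D} {p : KMap H (tensor T.P F) 0}
    (hp : p.LLin) : (T.extMap hp).LLin := extLift_lLin _

lemma extMap_closed {F : DGBimod S C} {H : DGBimod T.R' D} {p : KMap H (tensor T.P F) 0}
    (hp : p.LLin) (hc : p.Closed) : (T.extMap hp).Closed :=
  extLift_closed _ (hc.comp (T.tensorComparison_closed F) _)

lemma extMap_qis {F : DGBimod S C} (hF : F.left.KFlat) {H : DGBimod T.R' D} (hH : H.left.KFlat)
    {p : KMap H (tensor T.P F) 0} (hp : p.LLin) (hc : p.Closed) (hq : p.Qis) :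
    (T.extMap hp).Qis :=
  extLift_qis hH T.hρ _ (hc.comp (T.tensorComparison_closed F) _)
    (hq.comp (T.tensorComparison_qis hF) hc (T.tensorComparison_closed F) _)

lemma hProj_extension {H : DGMod T.R'} (hH : H.HProj) :
    HProj (tensor (extBimod T.ρ) H) :=
  hH.tensor fun _ _ _ hl hc hq => postL_qis (hProj_restrict_regular_left T.ρ) hl hc hq

lemma hProj_dual_tensor (hfb : FinitelyBuilt (regular S).right (Q.obj T.P.right)) {H : DGMod T.R'}
    (hH : H.HProj) : HProj (tensor T.Z H) :=
  hH.tensor fun Y Y' f hl hc hq => by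
    refine (tensorToHom_qis T.P T.proj hfb Y).of_comp_left (h := add_zero 0) ?_
      (tensorToHom_closed _ _) (postL_closed hl hc)
    rw [← tensorToHom_naturality]
    exact (KFlatOp.tmapR_qis (KProjOp.hProj T.proj).kFlatOp hl hc hq).comp
      (tensorToHom_qis T.P T.proj hfb Y') (tmapR_closed hl hc) (tensorToHom_closed _ _) _

lemma tensorHom_extMap_comp_extAdj {F : DGBimod S C} {F' : DGBimod S D} {H : DGMod T.R'}
    {p : KMap H (tensor T.P F) 0} (hp : p.LLin) :
    ((ofHom (tensorHom M F F')).comp (preL _ (T.extMap hp) (T.extMap_lLin hp)) (add_zero 0)).comp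
      (extAdj T.ρ H (tensor M F')) (add_zero 0) =
    ((ofHom (tensorHom T.P F F')).comp (preL _ p hp) (add_zero 0)).comp
      (postL H (T.tensorComparison F') (T.tensorComparison_lLin F')) (add_zero 0) := by
  have e := preL_extLift_comp_extAdj (W := tensor M F')
    (hp.comp (T.tensorComparison_lLin F) (add_zero 0))
  refine (comp_assoc _ _ _ _ (add_zero 0) (add_zero 0) (add_zero 0)).trans
    ((congrArg (fun g => (ofHom (tensorHom M F F')).comp g (add_zero 0)) e).trans ?_)
  rw [← preL_comp hp (T.tensorComparison_lLin F),
    ← comp_assoc _ _ _ (add_zero 0) (add_zero 0), ← comp_assoc _ _ _ (add_zero 0) (add_zero 0),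
    tensorHom_tensorComparison, comp_assoc _ _ _ (add_zero 0) (add_zero 0) (add_zero 0) (add_zero 0),
    postL_preL, ← comp_assoc _ _ _ (add_zero 0) (add_zero 0)]

lemma tensorHom_comp_tensorToHom {F : DGBimod S C} {F' : DGBimod S D} {H : DGMod T.R'}
    {p : KMap H (tensor T.P F) 0} (hp : p.LLin) (hν : (tensorToHom T.P F').LLin) :
    ((ofHom (tensorHom T.P F F')).comp (preL _ p hp) (add_zero 0)).comp
      (postL H (tensorToHom T.P F') hν) (add_zero 0) =
    (preL F' (evalAlong T.P F p hp) (evalAlong_lLin hp)).comp (curryL T.Z H F') (add_zero 0) :=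
  KMap.ext fun n n' h f => evL_ext fun r s hrs x => evL_ext fun i j hij z => by
    obtain rfl : n = n' := by omega
    rw [comp_app _ _ _ h h h, comp_app _ _ _ h h h, comp_app _ _ _ h h h,
      evL_curryL h hrs hij rfl (by omega), evL_postL hν h hrs hrs (add_zero s),
      evL_preL hp h hrs, evL_preL _ h, ofHom_app, ← ofL_app _ hrs, ofL_tensorHom, evalAlong, comp_app _ _ _ (add_zero _) (add_zero _) (add_zero _),
      tmapR_tm p hp (add_zero _) rfl (add_zero r) rfl, zero_mul, sgn_zero, one_smul, ofHom_app]
    induction p.app (add_zero r) x using tm_induction with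
    | h0 a b hab x y =>
      rw [tmapR_tm (ofL f) (ofL_lLin f) hrs hab rfl (by omega), map_zsmul, map_zsmul,
        LinearMap.smul_apply, evL_tensorToHom_tm (add_zero s) hij _ rfl (by omega),
        evalTensor_tm rfl hab rfl (by omega), ← ofL_app f (by omega : i + r + n = j),
        ofL_lLin f b (b + n) (a + i) _ _ rfl _ (by omega) (by omega), smul_smul, smul_smul,
        ← sgn_add, ← sgn_add]
      refine congrArg (· • _) (sgn_congr 0 ?_)
      rw [← hrs]; ring
    | hz => simp only [map_zero, LinearMap.zero_apply, smul_zero]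
    | hadd s t hs ht => simp only [map_add, LinearMap.add_apply, smul_add, hs, ht]

lemma finitelyBuilt (hM : FinitelyBuilt (regular S).right (Q.obj M.right)) :
    FinitelyBuilt (regular S).right (Q.obj T.P.right) :=
  hM.iso (Localization.isoOfHom Q (quasiIso _ _) _
    (T.toBimod_qis.rightHom T.toBimod_closed T.toBimod_rLin)).symm

theorem tensorHom_extMap_qis_iff (hM : FinitelyBuilt (regular S).right (Q.obj M.right))
    {F : DGBimod S C} {F' : DGBimod S D} (hF' : F'.left.KFlat) {H : DGMod T.R'} (hH : H.HProj)
    {p : KMap H (tensor T.P F) 0} (hp : p.LLin) (hc : p.Closed) :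
    ((ofHom (tensorHom M F F')).comp (preL _ (T.extMap hp) (T.extMap_lLin hp)) (add_zero 0)).Qis ↔
      (preL F' (evalAlong T.P F p hp) (evalAlong_lLin hp)).Qis := by
  set b := (ofHom (tensorHom M F F')).comp (preL _ (T.extMap hp) (T.extMap_lLin hp)) (add_zero 0)
  set δ := (ofHom (tensorHom T.P F F')).comp (preL _ p hp) (add_zero 0)
  have hδ : δ.Closed := (ofHom_closed _).comp (preL_closed _ hc) _
  have hκ : (postL H (T.tensorComparison F') (T.tensorComparison_lLin F')).Qis :=
    postL_qis hH.left _ (T.tensorComparison_closed F') (T.tensorComparison_qis hF')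
  have hν : (postL H (tensorToHom T.P F') tensorToHom_lLin).Qis :=
    postL_qis hH.left _ (tensorToHom_closed _ _) (tensorToHom_qis T.P T.proj (T.finitelyBuilt hM) F')
  have hκc := postL_closed (X := H) (T.tensorComparison_lLin F') (T.tensorComparison_closed F')
  have hνc := postL_closed (X := H) (tensorToHom_lLin (P := T.P) (N := F')) (tensorToHom_closed _ _)
  have hb : b.Closed := (ofHom_closed _).comp (preL_closed _ (T.extMap_closed hp hc)) _
  have hε : (preL F' (evalAlong T.P F p hp) (evalAlong_lLin hp)).Closed :=
    preL_closed _ (evalAlong_closed hp hc)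
  have e₁ := T.tensorHom_extMap_comp_extAdj (F' := F') hp
  have e₂ := T.tensorHom_comp_tensorToHom (F' := F') hp tensorToHom_lLin
  calc b.Qis ↔ (b.comp (extAdj T.ρ H (tensor M F')) (add_zero 0)).Qis :=
        ⟨fun h => h.comp extAdj_qis hb (extAdj_closed _ _) _,
          fun h => extAdj_qis.of_comp_right h hb (extAdj_closed _ _)⟩
    _ ↔ δ.Qis := by
        rw [e₁]
        exact ⟨fun h => hκ.of_comp_right h hδ hκc, fun h => h.comp hκ hδ hκc _⟩
    _ ↔ (δ.comp (postL H (tensorToHom T.P F') tensorToHom_lLin) (add_zero 0)).Qis :=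
        ⟨fun h => h.comp hν hδ hνc _, fun h => hν.of_comp_right h hδ hνc⟩
    _ ↔ _ := by
        rw [e₂]
        exact ⟨fun h => curryL_qis.of_comp_right h hε curryL_closed,
          fun h => h.comp curryL_qis hε curryL_closed _⟩

end BimodRes

open KMap

section Coevaluation

variable {R S C C' D E : DGA K} {M : DGBimod R S}

lemma tensorHom_postL_qis_iff {F : DGBimod S C} {F' : DGBimod S D} {W : DGMod R} (hW : W.HProj)
    {ξ : KMap W (tensor M F) 0} (hξ : ξ.LLin) (hξc : ξ.Closed) (hξq : ξ.Qis) {J : DGMod R}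
    (hJ : J.KInj) {ι : KMap (tensor M F') J 0} (hι : ι.LLin) (hιc : ι.Closed) (hιq : ι.Qis) :
    ((ofHom (tensorHom M F F')).comp (postL _ ι hι) (add_zero 0)).Qis ↔
      ((ofHom (tensorHom M F F')).comp (preL _ ξ hξ) (add_zero 0)).Qis := by
  have h₁ : (preL J ξ hξ).Qis := hJ.preL_qis hξ hξc hξq
  have h₂ : (postL W ι hι).Qis := postL_qis hW.left hι hιc hιq
  have c₁ : (preL J ξ hξ).Closed := preL_closed _ hξc
  have c₂ : (postL W ι hι).Closed := postL_closed _ hιc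
  have c₃ : ((ofHom (tensorHom M F F')).comp (postL _ ι hι) (add_zero 0)).Closed :=
    (ofHom_closed _).comp (postL_closed _ hιc) _
  have c₄ : ((ofHom (tensorHom M F F')).comp (preL _ ξ hξ) (add_zero 0)).Closed :=
    (ofHom_closed _).comp (preL_closed _ hξc) _
  have e : ((ofHom (tensorHom M F F')).comp (postL _ ι hι) (add_zero 0)).comp (preL J ξ hξ)
      (add_zero 0) = ((ofHom (tensorHom M F F')).comp (preL _ ξ hξ) (add_zero 0)).comp
        (postL W ι hι) (add_zero 0) := by
    rw [comp_assoc _ _ _ _ _ (add_zero 0) (add_zero 0), postL_preL,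
      ← comp_assoc _ _ _ (add_zero 0) (add_zero 0)]
  constructor
  · intro h
    have := h.comp h₁ c₃ c₁ (add_zero 0)
    rw [e] at this
    exact h₂.of_comp_right this c₄ c₂
  · intro h
    have := h.comp h₂ c₄ c₂ (add_zero 0)
    rw [← e] at this
    exact h₁.of_comp_right this c₃ c₁

lemma coev_eq_tensorHom (F : DGBimod S C) : ofHom (coev M F) =
    (((fromOneMap F).comp (preL F (fromLeft (regular S)) fromLeft_lLin) (add_zero 0)).comp
      (ofHom (tensorHom M (regular S).left F)) (add_zero 0)).comp
      (preL _ (toTensorRegular M) (toTensorRegular_lLin M)) (add_zero 0) :=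
  KMap.ext fun i j h y => evL_ext fun p q hpq x => by
    obtain rfl : i = j := by omega
    have key : ∀ (g : (homL (regular S).left F).X i) (s : (regular S).left.X 0) (z : F.X i),
        evL (zero_add i) g s = z →
        evL hpq ((tensorHom M (regular S).left F).f i g) (tm M (regular S).left (add_zero p) x s) =
          sgn (p * i) • tm M F hpq x z := by
      rintro g s _ rfl
      rw [← ofL_app, ofL_tensorHom, tmapR_tm _ _ hpq (add_zero p) (zero_add i) hpq x s, mul_comm]
      rfl
    have hone : ∀ s : (regular S).X 0, (fromOneL F y).app (zero_add i) s =
        F.lsmul (zero_add i) s y := fun s => by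
      rw [fromOneL_app, mul_zero, sgn_zero, one_smul]
    rw [comp_app _ _ _ h h h, comp_app _ _ _ h h h, comp_app _ _ _ h h h, evL_preL _ h,
      toTensorRegular_app, ofHom_app, ofHom_app, evL_coev]
    exact (key _ S.one y ((evL_preL _ h (zero_add i) _ _).trans
      ((hone S.one).trans (F.one_lsmul _ y)))).symm

lemma coev_postL_qis_iff {F : DGBimod S C} {J : DGMod R} (hJ : J.KInj)
    {ι : KMap (tensor M F) J 0} (hι : ι.LLin) (hιc : ι.Closed) :
    ((ofHom (coev M F)).comp (postL M ι hι) (add_zero 0)).Qis ↔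
      ((ofHom (tensorHom M (regular S).left F)).comp (postL _ ι hι) (add_zero 0)).Qis := by
  set θ := (ofHom (tensorHom M (regular S).left F)).comp (postL _ ι hι) (add_zero 0) with hθ
  set a := (fromOneMap F).comp (preL F (fromLeft (regular S)) fromLeft_lLin) (add_zero 0) with ha
  have haq : a.Qis := fromOneMap_qis.comp (preL_qis_of_inverse F intoLeft_lLin intoLeft_closed
    fromLeft_lLin intoLeft_comp_fromLeft fromLeft_comp_intoLeft) fromOneMap_closed
    (preL_closed _ fromLeft_closed) _
  have hac : a.Closed := fromOneMap_closed.comp (preL_closed _ fromLeft_closed) _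
  have hθc : θ.Closed := (ofHom_closed _).comp (postL_closed _ hιc) _
  have hτ : (preL J (toTensorRegular M) (toTensorRegular_lLin M)).Qis :=
    hJ.preL_qis _ (toTensorRegular_closed M) (toTensorRegular_qis M)
  have hτc : (preL J (toTensorRegular M) (toTensorRegular_lLin M)).Closed :=
    preL_closed _ (toTensorRegular_closed M)
  have e : (ofHom (coev M F)).comp (postL M ι hι) (add_zero 0) = (a.comp θ (add_zero 0)).comp
      (preL J (toTensorRegular M) (toTensorRegular_lLin M)) (add_zero 0) := by
    rw [coev_eq_tensorHom, comp_assoc _ _ _ _ (add_zero 0) (add_zero 0) (add_zero 0), ← postL_preL,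
      ← comp_assoc _ _ _ (add_zero 0) (add_zero 0) (add_zero 0),
      comp_assoc a _ _ _ _ (add_zero 0) (add_zero 0)]
  rw [e]
  exact ⟨fun h => haq.of_comp_left (hτ.of_comp_right h (hac.comp hθc _) hτc) hac hθc,
    fun h => (haq.comp h hac hθc _).comp hτ (hac.comp hθc _) hτc _⟩

lemma coevIsIso_iff : CoevIsIso M ↔ ∀ (F : DGMod S) (_ : F.KFlat) (J : DGMod R) (_ : J.KInj)
    (ι : tensor M F ⟶ J), quasiIso _ _ ι →
    ((ofHom (tensorHom M (regular S).left F)).comp (postL _ (ofHom ι) (ofHom_bLin ι).1)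
      (add_zero 0)).Qis := by
  have key : ∀ {N : DGMod S} (F : KFlatRes N) (J : KInjRes (tensor M F.obj)),
      IsIso (F.iso.inv ≫ Q.map (coev M F.obj) ≫ Q.map (homLMap M J.ι)) ↔
      ((ofHom (tensorHom M (regular S).left F.obj)).comp (postL _ (ofHom J.ι) (ofHom_bLin J.ι).1)
        (add_zero 0)).Qis := fun F J => by
    rw [← coev_postL_qis_iff J.inj _ (ofHom_closed _), ← ofHom_homLMap, ← ofHom_comp,
      qis_ofHom_iff, ← isIso_Q_map_iff, Functor.map_comp]
    exact ⟨fun h => IsIso.of_isIso_comp_left F.iso.inv _, fun h => inferInstance⟩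
  exact ⟨fun h F hF J hJ ι hι => (key ⟨F, hF, 𝟙 _, quasiIso_id _⟩ ⟨J, hJ, ι, hι⟩).1 (h F _ _),
    fun h N F J => (key F J).2 (h F.obj F.flat J.obj J.inj J.ι J.qis)⟩

lemma tensorHomIsIso_iff : TensorHomIsIso M ↔ ∀ (F F' : DGMod S) (_ : F.KProj) (_ : F'.KFlat)
    (J : DGMod R) (_ : J.KInj) (ι : tensor M F' ⟶ J), quasiIso _ _ ι →
    ((ofHom (tensorHom M F F')).comp (postL _ (ofHom ι) (ofHom_bLin ι).1) (add_zero 0)).Qis := by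
  have key : ∀ (F F' : DGMod S) (J : DGMod R) (ι : tensor M F' ⟶ J),
      IsIso (Q.map (tensorHom M F F') ≫ Q.map (homLMap (tensor M F) ι)) ↔
      ((ofHom (tensorHom M F F')).comp (postL _ (ofHom ι) (ofHom_bLin ι).1)
        (add_zero 0)).Qis := fun F F' J ι => by
    rw [← ofHom_homLMap, ← ofHom_comp, qis_ofHom_iff, ← isIso_Q_map_iff,
      Functor.map_comp]
  exact ⟨fun h F F' hF hF' J hJ ι hι => (key F F' J ι).1 (h F F' ⟨F, hF, 𝟙 _, quasiIso_id _⟩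
      ⟨F', hF', 𝟙 _, quasiIso_id _⟩ ⟨J, hJ, ι, hι⟩),
    fun h N N' F F' J => (key _ _ _ _).2 (h _ _ F.proj F'.flat _ J.inj J.ι J.qis)⟩

theorem CoevIsIso.of_tensorHomIsIso (h : TensorHomIsIso M) : CoevIsIso M :=
  coevIsIso_iff.2 fun F hF J hJ ι hι =>
    tensorHomIsIso_iff.1 h _ F (hProj_regular_left S).kProj hF J hJ ι hι

end Coevaluation

section Coextension

variable {R' R S C D E : DGA K} (ρ : DGA.Hom R' R)

/-- The action of `R` on a DG bimodule, as a pairing of DG `R'`-modules. -/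
def coextPairing (Y : DGBimod R C) : Pairing (coextBimod ρ) Y (Y.restrict ρ (DGA.Hom.id C)) where
  φ _ _ _ h := Y.lsmul h
  bal _ _ _ _ _ _ h₁ h₂ h₃ h₄ a b x := Y.mul_lsmul h₁ h₂ h₃ h₄ a b x
  leibniz _ _ _ _ _ _ h hn hi hj hl hr a x := Y.lleibniz h hi hj hn hl hr a x
  map_lsmul i _ _ _ _ _ h hpq hip hk a b x := Y.mul_lsmul hip hk hpq h (ρ.f i a) b x
  map_rsmul _ _ _ _ _ _ h hpq hqj hk a x b := (Y.lsmul_rsmul hpq h hqj hk a x b).symm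

/-- The `R`-linear map into a coextension of scalars given by a map out of a restriction of
scalars. -/
noncomputable def coextLift {Y : DGBimod R C} {J : DGBimod R' D}
    (v : KMap (Y.restrict ρ (DGA.Hom.id C)) J 0) (hv : v.LLin) : KMap Y (homL (coextBimod ρ) J) 0 :=
  (ofHom (coev (coextBimod ρ) Y)).comp
    (postL _ ((ofHom (coextPairing ρ Y).desc).comp v (add_zero 0)) ((ofHom_bLin _).1.comp hv _))
    (add_zero 0)

variable {ρ} {Y : DGBimod R C} {J : DGBimod R' D} {v : KMap (Y.restrict ρ (DGA.Hom.id C)) J 0}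

lemma coextLift_lLin (hv : v.LLin) : (coextLift ρ v hv).LLin :=
  (ofHom_bLin _).1.comp (postL_lLin _) _

lemma coextLift_closed (hv : v.LLin) (hc : v.Closed) : (coextLift ρ v hv).Closed :=
  (ofHom_closed _).comp (postL_closed _ ((ofHom_closed _).comp hc _)) _

lemma coextLift_comp_preL (hv : v.LLin) :
    (coextLift ρ v hv).comp (preL J (toCoextBimod ρ) toCoextBimod_lLin) (add_zero 0) =
      ((toRestrict ρ (DGA.Hom.id C) Y).comp v (add_zero 0)).comp (fromOneMap J) (add_zero 0) :=
  KMap.ext fun i j h y => evL_ext fun p q hpq r => by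
    obtain rfl : i = j := by omega
    have key : ∀ a : (coextBimod ρ).X p, (coextPairing ρ Y).desc.f q (tm (coextBimod ρ) Y hpq a y) =
        Y.lsmul hpq a y := fun a => (coextPairing ρ Y).desc_tm hpq a y
    have hl := hv i i p q q (add_zero i) (add_zero q) hpq hpq r y
    rw [zero_mul, sgn_zero, one_smul] at hl
    rw [comp_app _ _ _ h h h, comp_app _ _ _ h h h, evL_preL _ h, coextLift, comp_app _ _ _ h h h,
      evL_postL _ h hpq hpq (add_zero q), ofHom_app, evL_coev, map_zsmul,
      comp_app _ _ _ (add_zero q) (add_zero q) (add_zero q), ofHom_app, key, ← ofL_app,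
      ofL_fromOneMap, fromOneL_app, comp_app _ _ _ h h h, mul_comm]
    exact congrArg _ hl

lemma coextLift_qis (hρ : ρ.QuasiIso) {Y : DGBimod R C} {J : DGMod R'} (hJ : J.KInj)
    {v : KMap (Y.restrict ρ (DGA.Hom.id C)) J 0} (hv : v.LLin) (hc : v.Closed) (hq : v.Qis) :
    (coextLift ρ v hv).Qis := by
  refine (hJ.preL_qis toCoextBimod_lLin toCoextBimod_closed (toCoextBimod_qis hρ)).of_comp_right
    (h := add_zero 0) ?_ (coextLift_closed hv hc) (preL_closed _ toCoextBimod_closed)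
  rw [coextLift_comp_preL]
  exact (toRestrict_qis.comp hq toRestrict_closed hc _).comp fromOneMap_qis
    (toRestrict_closed.comp hc _) fromOneMap_closed _

lemma kInj_coextension (ρ : DGA.Hom R' R) {J : DGMod R'} (hJ : J.KInj) :
    KInj (homL (coextBimod ρ) J) :=
  hJ.homL fun _ _ _ hl hc hq => tmapR_restrict_regular_qis ρ hl hc hq

end Coextension

section CharacterModule

variable {R S A C : DGA K}

lemma resHom_lLin {R' R C D : DGA K} {ρ : DGA.Hom R' R} {Y : DGBimod R C} {Y' : DGBimod R D} :
    (resHom ρ Y Y').LLin := fun i j l i' j' h h' hl hl' a f => by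
  obtain rfl : i = j := by omega
  obtain rfl : i' = j' := by omega
  rw [zero_mul, sgn_zero, one_smul]
  refine evL_ext fun p q hpq x => ?_
  rw [evL_lsmul hl a _ hpq rfl (by omega)]
  exact evL_lsmul hl a f hpq rfl (by omega) x

variable (S) in
/-- The character module of `S`. -/
abbrev charModule : DGMod S := homL (regular S).right (chars K)

variable (S) in
/-- Evaluation of a character at `1`. -/
def evalOne : KMap ((charModule S).restrict S.unit (DGA.Hom.id (ground K))) (chars K) 0 :=
  KMap.mk fun i j h =>
    { toFun := fun f => evL (by omega : 0 + i = j) f S.one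
      map_add' := fun f f' => LinearMap.congr_fun (map_add (evL (X := (regular S).right) (Y := chars K) (by omega : 0 + i = j)) f f') S.one
      map_smul' := fun c f => LinearMap.congr_fun (map_smul (evL (X := (regular S).right) (Y := chars K) (by omega : 0 + i = j)) c f) S.one }

lemma evalOne_closed : (evalOne S).Closed :=
  closed_of fun i j i' j' h hi hj h' f => by
    obtain rfl : i = j := by omega
    obtain rfl : i' = j' := by omega
    have key : ∀ (g : (charModule S).X i) (o : (regular S).right.X 0),
        (regular S).right.d (neg_add_cancel 1) o = 0 →
        evL (zero_add i') ((charModule S).d hi g) o = (chars K).d hj (evL (zero_add i) g o) :=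
      fun g o ho => by
        rw [evL_d hi g _ (neg_add_cancel 1) hj (zero_add i) (by omega), ho, map_zero, smul_zero,
          sub_zero]
    rw [sgn_zero, one_smul]
    exact (key f S.one (d_one _)).symm

lemma evalOne_lLin : (evalOne S).LLin := KMap.lLin_ground _

/-- The map sending an `S`-linear map to the character module to its composition with the evaluation
at `1`. -/
noncomputable def toChars (Z : DGBimod S A) :
    KMap (homL Z (charModule S)) (homL Z.right (chars K)) 0 :=
  (resHom S.unit Z (charModule S)).comp (postL Z.right (evalOne S) evalOne_lLin) (add_zero 0)

lemma toChars_closed (Z : DGBimod S A) : (toChars Z).Closed :=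
  resHom_closed.comp (postL_closed _ evalOne_closed) _

lemma toChars_lLin (Z : DGBimod S A) : (toChars Z).LLin :=
  resHom_lLin.comp (postL_lLin _) _

/-- The map `z ↦ 1 ⊗ z`. -/
noncomputable def oneTensor (Z : DGBimod S A) : KMap Z.right (tensor (regular S).right Z) 0 :=
  ((fromRight Z).comp (unitorInv Z) (add_zero 0)).comp
    (tmapL Z (intoRight (regular S)) intoRight_rLin) (add_zero 0)

lemma oneTensor_closed (Z : DGBimod S A) : (oneTensor Z).Closed :=
  (fromRight_closed.comp unitorInv_closed _).comp (tmapL_closed _ intoRight_closed) _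

lemma oneTensor_lLin (Z : DGBimod S A) : (oneTensor Z).LLin := KMap.lLin_ground _

lemma oneTensor_qis (Z : DGBimod S A) : (oneTensor Z).Qis :=
  (fromRight_qis.comp unitorInv_qis fromRight_closed unitorInv_closed _).comp
    (tmapL_qis_of_inverse Z intoRight_rLin fromRight_rLin fromRight_closed
      intoRight_comp_fromRight fromRight_comp_intoRight)
    (fromRight_closed.comp unitorInv_closed _) (tmapL_closed _ intoRight_closed) _

lemma oneTensor_app {Z : DGBimod S A} (h : i + 0 = i) (z : Z.right.X i) :
    (oneTensor Z).app h z = tm (regular S).right Z (zero_add i) S.one z := by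
  have key : ∀ s : (regular S).X 0, (tmapL Z (intoRight (regular S)) intoRight_rLin).app h
      (tm (regular S) Z (zero_add i) s z) = tm (regular S).right Z (zero_add i) s z := fun s =>
    tmapL_tm _ _ h (zero_add i) (add_zero 0) (zero_add i) s z
  rw [oneTensor, comp_app _ _ _ h h h, comp_app _ _ _ h h h]
  exact key S.one

lemma curryL_comp_toChars (Z : DGBimod S A) :
    (curryL (regular S).right Z (chars K)).comp (toChars Z) (add_zero 0) =
      preL (chars K) (oneTensor Z) (oneTensor_lLin Z) :=
  KMap.ext fun i j h f => evL_ext fun p q hpq z => by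
    obtain rfl : i = j := by omega
    have key : ∀ (z : Z.X p) (o : (regular S).right.X 0), evL (zero_add q)
        (evL hpq ((curryL (regular S).right Z (chars K)).app h f) z) o =
        evL hpq f (tm (regular S).right Z (zero_add p) o z) := fun z o => by
      rw [evL_curryL h hpq (zero_add q) (zero_add p) hpq, zero_mul, sgn_zero, one_smul]
    rw [comp_app _ _ _ h h h, evL_preL _ h, toChars, comp_app _ _ _ h h h,
      evL_postL _ h hpq hpq (add_zero q)]
    exact (key z S.one).trans (congrArg (evL hpq f) (oneTensor_app (add_zero p) z).symm)

lemma toChars_qis (Z : DGBimod S A) : (toChars Z).Qis := by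
  refine curryL_qis.of_comp_left (h := add_zero 0) ?_ curryL_closed (toChars_closed Z)
  rw [curryL_comp_toChars]
  exact kInj_chars.preL_qis _ (oneTensor_closed Z) (oneTensor_qis Z)

end CharacterModule

section Evaluation

variable {R S : DGA K} {M : DGBimod R S}

/-- A K-injective resolution of `M ⊗ F'` when `F'` resolves the character module of `S`. -/
lemma BimodRes.exists_kInj_resolution (T : BimodRes M)
    (hM : FinitelyBuilt (regular S).right (Q.obj M.right))
    {F' : DGMod S} (hF' : F'.HProj) {γ : KMap F' (charModule S) 0} (hγ : γ.LLin)
    (hγc : γ.Closed) (hγq : γ.Qis) :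
    ∃ (J : DGMod R) (_ : J.KInj) (ι : tensor M F' ⟶ J), quasiIso _ _ ι := by
  obtain ⟨G, π, hG, hπ⟩ := exists_hProj_resolution T.Z.right
  have hπl : (ofHom π).LLin := (ofHom_bLin π).1
  have hπ' := (qis_ofHom_iff π).2 hπ
  have hJ' : KInj (homL G (chars K)) := kInj_chars.homL fun _ _ _ hl hc hq =>
    KFlatOp.tmapR_qis hG.kFlatOp.right hl hc hq
  have c₁ : (tmapR T.P γ hγ).Closed := tmapR_closed hγ hγc
  have c₂ := c₁.comp (tensorToHom_closed T.P (charModule S)) (add_zero 0)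
  have c₃ := c₂.comp (toChars_closed T.Z) (add_zero 0)
  have c₄ : (preL (chars K) (ofHom π) hπl).Closed := preL_closed _ (ofHom_closed π)
  have q₁ : (tmapR T.P γ hγ).Qis := KFlatOp.tmapR_qis T.proj.hProj.kFlatOp hγ hγc hγq
  have q₂ := (q₁.comp (tensorToHom_qis T.P T.proj (T.finitelyBuilt hM) (charModule S)) c₁
    (tensorToHom_closed _ _) (add_zero 0)).comp (toChars_qis T.Z) c₂ (toChars_closed T.Z) (add_zero 0)
  have q₃ := q₂.comp (kInj_chars.preL_qis hπl (ofHom_closed π) hπ') c₃ c₄ (add_zero 0)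
  have hl := ((((tmapR_lLin (M := T.P) hγ).comp tensorToHom_lLin (add_zero 0)).comp
    (toChars_lLin T.Z) (add_zero 0)).comp (preL_lLin hπl (ofHom_bLin π).2) (add_zero 0))
  have hF := hF'.left.kFlat
  obtain ⟨v, hv, hvc, s, -, es⟩ := hJ'.exists_extension (T.tensorComparison_lLin F')
    (T.tensorComparison_closed F') (T.tensorComparison_qis hF) hl (c₃.comp c₄ _)
  have hvq : v.Qis := (T.tensorComparison_qis hF).of_comp_left (q₃.of_homotopy (zero_add 1) s es)
    (T.tensorComparison_closed F') hvc
  refine ⟨_, kInj_coextension T.ρ hJ', (coextLift T.ρ v hv).toHom (coextLift_closed hv hvc)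
    (coextLift_lLin hv).bLin, ?_⟩
  rw [← qis_ofHom_iff, ofHom_toHom]
  exact coextLift_qis T.hρ hJ' hv hvc hvq

theorem evalIsIso_of_coevIsIso (T : BimodRes M)
    (hM : FinitelyBuilt (regular S).right (Q.obj M.right))
    (h : CoevIsIso M) : EvalIsIso T := by
  obtain ⟨F', γ₀, hF', hγ₀⟩ := exists_hProj_resolution (charModule S)
  have hγ := (ofHom_bLin γ₀).1
  have hγc := ofHom_closed γ₀
  have hγq := (qis_ofHom_iff γ₀).2 hγ₀
  obtain ⟨J, hJ, ι, hι⟩ := T.exists_kInj_resolution hM hF' hγ hγc hγq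
  have hθ := coevIsIso_iff.1 h F' hF'.kFlat J hJ ι hι
  have hS := hProj_regular_left S
  obtain ⟨H, p₀, hH, hp₀⟩ := exists_hProj_resolution (tensor T.P (regular S).left)
  have hp := (ofHom_bLin p₀).1
  have hpc := ofHom_closed p₀
  have hpq := (qis_ofHom_iff p₀).2 hp₀
  rw [tensorHom_postL_qis_iff (T.hProj_extension hH) (T.extMap_lLin hp) (T.extMap_closed hp hpc)
    (T.extMap_qis hS.left.kFlat hH.left.kFlat hp hpc hpq) hJ _ (ofHom_closed ι)
    ((qis_ofHom_iff ι).2 hι), T.tensorHom_extMap_qis_iff hM hF'.left.kFlat hH hp hpc] at hθ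
  have hZ := T.hProj_dual_tensor (T.finitelyBuilt hM) hH
  set ε := evalAlong T.P (regular S).left (ofHom p₀) hp
  have hε : ε.LLin := evalAlong_lLin hp
  have hεc : ε.Closed := evalAlong_closed hp hpc
  have h₁ : (preL (charModule S) ε hε).Qis := by
    refine (postL_qis hS.left hγ hγc hγq).of_comp_left (h := add_zero 0) ?_ (postL_closed hγ hγc)
      (preL_closed hε hεc)
    rw [postL_preL]
    exact hθ.comp (postL_qis hZ.left hγ hγc hγq) (preL_closed hε hεc) (postL_closed hγ hγc) _
  have h₂ : (preL (chars K) (tmapR (regular S).right ε hε) (tmapR_lLin hε)).Qis := by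
    refine curryL_qis.of_comp_right (h := add_zero 0) ?_ (preL_closed _ (tmapR_closed hε hεc))
      curryL_closed
    rw [curryL_preL]
    exact curryL_qis.comp h₁ curryL_closed (preL_closed hε hεc) _
  have h₃ : ε.Qis := qis_of_tmapR_regular_right hε hεc ((preL_chars_qis_iff _).1 h₂).qis
  obtain ⟨G, δ, hδ, hδc, hδq, hG⟩ := exists_flat_resolution_right T.Z
  rw [evalIsIso_iff T hδ hδc hδq hG]
  refine evalPairing_qis_of hδ hδc hG.kFlatOp.right ?_
  rw [← tmapR_comp_qis_iff hδ hδc hδq hG.kFlatOp.right hH.left.kFlat hp hpc hpq (ofHom_closed _)]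
  exact h₃

end Evaluation

open KMap

section LeftDerived

universe v w

variable {A B : DGA K} {E : Type w} [Category.{v} E] (T : DGBimod A B ⥤ E)

/-- The action of a functor on a morphism of the derived category out of a homotopically projective
bimodule. -/
noncomputable def derivedMap {P N : DGBimod A B} (hP : P.HProj)
    (φ : (Q : DGBimod A B ⥤ Derived A B).obj P ⟶ Q.obj N) : T.obj P ⟶ T.obj N :=
  T.map (hP.exists_Q_map_eq φ).choose

variable {T} (hT : ∀ ⦃M N : DGBimod A B⦄ (f g : M ⟶ N), Homotopic f g → T.map f = T.map g)

include hT in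
lemma derivedMap_Q_map {P N : DGBimod A B} (hP : P.HProj) (f : P ⟶ N) :
    derivedMap T hP (Q.map f) = T.map f :=
  hT _ _ (hP.homotopic_of_Q_map_eq (hP.exists_Q_map_eq (Q.map f)).choose_spec)

include hT in
lemma derivedMap_comp_map {P N N' : DGBimod A B} (hP : P.HProj)
    (φ : (Q : DGBimod A B ⥤ Derived A B).obj P ⟶ Q.obj N) (f : N ⟶ N') :
    derivedMap T hP (φ ≫ Q.map f) = derivedMap T hP φ ≫ T.map f := by
  obtain ⟨g, rfl⟩ := hP.exists_Q_map_eq φ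
  rw [← Functor.map_comp, derivedMap_Q_map hT, derivedMap_Q_map hT,
    Functor.map_comp]

include hT in
lemma derivedMap_comp {P P' N : DGBimod A B} (hP : P.HProj) (hP' : P'.HProj)
    (φ : (Q : DGBimod A B ⥤ Derived A B).obj P ⟶ Q.obj P')
    (ψ : (Q : DGBimod A B ⥤ Derived A B).obj P' ⟶ Q.obj N) :
    derivedMap T hP (φ ≫ ψ) = derivedMap T hP φ ≫ derivedMap T hP' ψ := by
  obtain ⟨g, rfl⟩ := hP'.exists_Q_map_eq ψ
  rw [derivedMap_comp_map hT, derivedMap_Q_map hT]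

include hT in
lemma derivedMap_id {P : DGBimod A B} (hP : P.HProj) :
    derivedMap T hP (𝟙 (Q.obj P)) = 𝟙 (T.obj P) := by
  rw [← CategoryTheory.Functor.map_id, derivedMap_Q_map hT, CategoryTheory.Functor.map_id]

lemma exists_hProj_iso (X : Derived A B) :
    ∃ P : DGBimod A B, P.HProj ∧ Nonempty ((Q : DGBimod A B ⥤ Derived A B).obj P ≅ X) := by
  have := Localization.essSurj (Q : DGBimod A B ⥤ Derived A B) (quasiIso A B)
  obtain ⟨P, π, hP, hπ⟩ :=
    exists_hProj_resolution ((Q : DGBimod A B ⥤ Derived A B).objPreimage X)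
  exact ⟨P, hP, ⟨Localization.isoOfHom Q (quasiIso A B) π hπ ≪≫
    (Q : DGBimod A B ⥤ Derived A B).objObjPreimageIso X⟩⟩

/-- A homotopically projective resolution of an object of the derived category. -/
noncomputable def resObj (X : Derived A B) : DGBimod A B := (exists_hProj_iso X).choose

lemma hProj_resObj (X : Derived A B) : (resObj X).HProj := (exists_hProj_iso X).choose_spec.1

/-- The isomorphism between an object of the derived category and its resolution. -/
noncomputable def resIso (X : Derived A B) :
    (Q : DGBimod A B ⥤ Derived A B).obj (resObj X) ≅ X := (exists_hProj_iso X).choose_spec.2.some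

/-- The left derived functor of a functor which identifies homotopic morphisms. -/
noncomputable def leftDerived : Derived A B ⥤ E where
  obj X := T.obj (resObj X)
  map {X Y} φ := derivedMap T (hProj_resObj X) ((resIso X).hom ≫ φ ≫ (resIso Y).inv)
  map_id X := by rw [Category.id_comp, Iso.hom_inv_id, derivedMap_id hT]
  map_comp {X Y Z} φ ψ := by
    rw [← derivedMap_comp hT _ (hProj_resObj Y)]
    simp only [Category.assoc, Iso.inv_hom_id_assoc]

/-- The counit of the left derived functor. -/
noncomputable def leftDerivedCounit : (Q : DGBimod A B ⥤ Derived A B) ⋙ leftDerived hT ⟶ T where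
  app N := derivedMap T (hProj_resObj (Q.obj N)) (resIso (Q.obj N)).hom
  naturality {N N'} f := by
    refine (derivedMap_comp hT (hProj_resObj (Q.obj N)) (hProj_resObj (Q.obj N')) _ _).symm.trans ?_
    have e : ((resIso (Q.obj N)).hom ≫ Q.map f ≫ (resIso (Q.obj N')).inv) ≫
        (resIso (Q.obj N')).hom = (resIso (Q.obj N)).hom ≫ Q.map f := by
      simp only [Category.assoc, Iso.inv_hom_id, Category.comp_id]
    exact (congrArg (derivedMap T _) e).trans (derivedMap_comp_map hT (hProj_resObj _) _ f)

lemma leftDerived_map_resIso (X : Derived A B) : (leftDerived hT).map (resIso X).hom =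
    (leftDerivedCounit hT).app (resObj X) := by
  have e : (resIso (Q.obj (resObj X))).hom ≫ (resIso X).hom ≫ (resIso X).inv =
      (resIso (Q.obj (resObj X))).hom := by rw [Iso.hom_inv_id, Category.comp_id]
  exact congrArg (derivedMap T (hProj_resObj _)) e

/-- The universal property of the left derived functor. -/
noncomputable def leftDerivedLift {G : Derived A B ⥤ E} (β : Q ⋙ G ⟶ T) : G ⟶ leftDerived hT where
  app X := G.map (resIso X).inv ≫ β.app (resObj X)
  naturality {X Y} φ := by
    obtain ⟨g, hg⟩ := (hProj_resObj X).exists_Q_map_eq ((resIso X).hom ≫ φ ≫ (resIso Y).inv)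
    have e : T.map g = (leftDerived hT).map φ := by
      rw [← derivedMap_Q_map hT (hProj_resObj X) g, hg]; rfl
    have n := β.naturality g
    have e' : G.map φ ≫ G.map (resIso Y).inv = G.map (resIso X).inv ≫ G.map (Q.map g) := by
      rw [hg, ← Functor.map_comp, ← Functor.map_comp,
        Iso.inv_hom_id_assoc]
    have key : (G.map φ ≫ G.map (resIso Y).inv) ≫ β.app (resObj Y) =
        G.map (resIso X).inv ≫ β.app (resObj X) ≫ T.map g := by
      rw [e', ← n, Category.assoc]; rfl
    exact (Category.assoc _ _ _).symm.trans (key.trans ((Category.assoc _ _ _).symm.trans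
      (congrArg (fun t => (G.map (resIso X).inv ≫ β.app (resObj X)) ≫ t) e)))

lemma leftDerivedLift_fac {G : Derived A B ⥤ E} (β : Q ⋙ G ⟶ T) :
    Functor.whiskerLeft Q (leftDerivedLift hT β) ≫ leftDerivedCounit hT = β := by
  ext N
  obtain ⟨g, hg⟩ := (hProj_resObj (Q.obj N)).exists_Q_map_eq (resIso (Q.obj N)).hom
  have e : (leftDerivedCounit hT).app N = T.map g := by
    rw [← derivedMap_Q_map hT (hProj_resObj _) g, hg]; rfl
  have n := β.naturality g
  rw [Functor.comp_map, hg] at n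
  have key : (G.map (resIso (Q.obj N)).inv ≫ β.app (resObj (Q.obj N))) ≫ T.map g = β.app N := by
    rw [Category.assoc, ← n, ← Category.assoc, ← Functor.map_comp, Iso.inv_hom_id,
      CategoryTheory.Functor.map_id]
    exact Category.id_comp _
  exact (congrArg (fun t => (G.map (resIso (Q.obj N)).inv ≫ β.app (resObj (Q.obj N))) ≫ t) e).trans
    key

lemma eq_leftDerivedLift {G : Derived A B ⥤ E} {β : Q ⋙ G ⟶ T} {γ : G ⟶ leftDerived hT}
    (h : Functor.whiskerLeft Q γ ≫ leftDerivedCounit hT = β) : γ = leftDerivedLift hT β := by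
  ext X
  have e : γ.app (Q.obj (resObj X)) ≫ (leftDerivedCounit hT).app (resObj X) = β.app (resObj X) :=
    NatTrans.congr_app h (resObj X)
  have n : G.map (resIso X).hom ≫ γ.app X =
      γ.app (Q.obj (resObj X)) ≫ (leftDerived hT).map (resIso X).hom := γ.naturality _
  have e' := n.trans ((congrArg (γ.app (Q.obj (resObj X)) ≫ ·) (leftDerived_map_resIso hT X)).trans e)
  refine Eq.trans ?_ (congrArg (G.map (resIso X).inv ≫ ·) e')
  rw [← Category.assoc, ← Functor.map_comp, Iso.inv_hom_id,
    CategoryTheory.Functor.map_id, Category.id_comp]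

instance : (leftDerived hT).IsLeftDerivedFunctor (leftDerivedCounit hT) (quasiIso A B) where
  isRightKanExtension :=
    { nonempty_isUniversal := ⟨Limits.IsTerminal.ofUniqueHom
        (fun X => CostructuredArrow.homMk (leftDerivedLift hT X.hom) (leftDerivedLift_fac hT X.hom))
        (fun X m => by
          ext1
          exact eq_leftDerivedLift hT (CostructuredArrow.w m))⟩ }

lemma isIso_leftDerivedCounit {P : DGBimod A B} (hP : P.HProj) :
    IsIso ((leftDerivedCounit hT).app P) := by
  refine ⟨derivedMap T hP (resIso (Q.obj P)).inv, ?_, ?_⟩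
  · exact (derivedMap_comp hT (hProj_resObj _) hP _ _).symm.trans (by
      rw [Iso.hom_inv_id, derivedMap_id hT]; rfl)
  · exact (derivedMap_comp hT hP (hProj_resObj _) _ _).symm.trans (by
      rw [Iso.inv_hom_id, derivedMap_id hT])

lemma leftDerived_map_comp_counit {P P' : DGBimod A B} (hP : P.HProj)
    (φ : (Q : DGBimod A B ⥤ Derived A B).obj P ⟶ Q.obj P') :
    (leftDerived hT).map φ ≫ (leftDerivedCounit hT).app P' =
      (leftDerivedCounit hT).app P ≫ derivedMap T hP φ := by
  refine (derivedMap_comp hT (hProj_resObj (Q.obj P)) (hProj_resObj (Q.obj P')) _ _).symm.trans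
    (Eq.trans ?_ (derivedMap_comp hT (hProj_resObj (Q.obj P)) hP _ _))
  simp only [Category.assoc, Iso.inv_hom_id, Category.comp_id]

/-- The left derived functor is fully faithful if and only if it is so on homotopically projective
bimodules. -/
lemma leftDerived_fullyFaithful_iff :
    ((leftDerived hT).Full ∧ (leftDerived hT).Faithful) ↔
      ∀ (P P' : DGBimod A B), P.HProj → P'.HProj →
        (∀ f g : P ⟶ P', T.map f = T.map g → Homotopic f g) ∧
        (∀ v : T.obj P ⟶ T.obj P', ∃ f : P ⟶ P', T.map f = v) := by
  constructor
  · rintro ⟨h₁, h₂⟩ P P' hP hP'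
    have i₁ := isIso_leftDerivedCounit hT hP
    have i₂ := isIso_leftDerivedCounit hT hP'
    have key : ∀ f : P ⟶ P', (leftDerived hT).map (Q.map f) =
        (leftDerivedCounit hT).app P ≫ T.map f ≫ inv ((leftDerivedCounit hT).app P') := fun f => by
      rw [← derivedMap_Q_map hT hP, ← Category.assoc, ← leftDerived_map_comp_counit hT hP,
        Category.assoc, IsIso.hom_inv_id, Category.comp_id]
    refine ⟨fun f g e => hP.homotopic_of_Q_map_eq ((leftDerived hT).map_injective ?_), fun v => ?_⟩
    · rw [key, key, e]
    · obtain ⟨φ, hφ⟩ := (leftDerived hT).map_surjective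
        ((leftDerivedCounit hT).app P ≫ v ≫ inv ((leftDerivedCounit hT).app P'))
      obtain ⟨f, rfl⟩ := hP.exists_Q_map_eq φ
      rw [key] at hφ
      exact ⟨f, (cancel_mono _).1 ((cancel_epi _).1 hφ)⟩
  · intro h
    constructor
    · refine ⟨fun {X Y} v => ?_⟩
      obtain ⟨f, hf⟩ := (h _ _ (hProj_resObj X) (hProj_resObj Y)).2 v
      refine ⟨(resIso X).inv ≫ Q.map f ≫ (resIso Y).hom, ?_⟩
      rw [← hf, ← derivedMap_Q_map hT (hProj_resObj X)]
      refine congrArg (derivedMap T _) ?_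
      simp
    · refine ⟨fun {X Y} φ ψ e => ?_⟩
      obtain ⟨f, hf⟩ := (hProj_resObj X).exists_Q_map_eq ((resIso X).hom ≫ φ ≫ (resIso Y).inv)
      obtain ⟨g, hg⟩ := (hProj_resObj X).exists_Q_map_eq ((resIso X).hom ≫ ψ ≫ (resIso Y).inv)
      have e' : derivedMap T (hProj_resObj X) (Q.map f) =
          derivedMap T (hProj_resObj X) (Q.map g) := by rw [hf, hg]; exact e
      rw [derivedMap_Q_map hT, derivedMap_Q_map hT] at e'
      have := ((h _ _ (hProj_resObj X) (hProj_resObj Y)).1 f g e').Q_map_eq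
      rw [hf, hg] at this
      simpa using this

end LeftDerived

section Tensor

variable {R S C : DGA K}

lemma tmapR_sub {D : DGA K} {M : DGBimod R S} {N : DGBimod S C} {N' : DGBimod S D}
    {f g : KMap N N' k} (hf : f.LLin) (hg : g.LLin) (h : (f - g).LLin) :
    tmapR M (f - g) h = tmapR M f hf - tmapR M g hg :=
  kmap_tensor_ext fun i j p q hij hpq x y => by
    rw [sub_app, tmapR_tm _ _ _ hpq rfl (by omega), tmapR_tm _ _ _ hpq rfl (by omega),
      tmapR_tm _ _ _ hpq rfl (by omega), sub_app, map_sub, smul_sub]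

lemma Homotopic.tensorMap {M : DGBimod R S} {N N' : DGBimod S C} {f g : N ⟶ N'}
    (h : Homotopic f g) : Homotopic (DGBimod.tensorMap (𝟙 M) f) (DGBimod.tensorMap (𝟙 M) g) := by
  obtain ⟨s, hs, e⟩ := h
  refine ⟨tmapR M s hs.1, ⟨tmapR_lLin _, tmapR_rLin _ hs.2⟩, ?_⟩
  rw [D_tmapR, ofHom_id_tensorMap, ofHom_id_tensorMap, tmapR_congr _ e, tmapR_sub]

lemma derivedTensorFullyFaithful_iff {M : DGBimod R S} : DerivedTensorFullyFaithful M ↔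
    ∀ (P P' : DGMod S), P.HProj → P'.HProj →
      (∀ f g : P ⟶ P', (Q : DGMod R ⥤ _).map (tensorMap (𝟙 M) f) = Q.map (tensorMap (𝟙 M) g) →
        Homotopic f g) ∧
      (∀ v : (Q : DGMod R ⥤ _).obj (tensor M P) ⟶ Q.obj (tensor M P'),
        ∃ f : P ⟶ P', Q.map (tensorMap (𝟙 M) f) = v) := by
  have hT : ∀ ⦃N N' : DGMod S⦄ (f g : N ⟶ N'), Homotopic f g →
      (tensorFunctor (ground K) M ⋙ Q).map f = (tensorFunctor (ground K) M ⋙ Q).map g :=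
    fun N N' f g h => h.tensorMap.Q_map_eq
  refine Iff.trans ?_ (leftDerived_fullyFaithful_iff hT)
  constructor
  · rintro ⟨L, α, h, h₁, h₂⟩
    let e := Functor.leftDerivedUnique (leftDerived hT) L α (leftDerivedCounit hT)
      (quasiIso S (ground K))
    exact ⟨Functor.Full.of_iso e, Functor.Faithful.of_iso e⟩
  · rintro ⟨h₁, h₂⟩
    exact ⟨leftDerived hT, leftDerivedCounit hT, inferInstance, h₁, h₂⟩

end Tensor

open KMap

section FullyFaithful

variable {R S C D E : DGA K} {M : DGBimod R S}

/-- The map `Hom(F, F') → Hom(W, M ⊗ F')` sending `f` to `(M ⊗ f) ∘ ξ`. -/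
noncomputable def tensorHomAlong (F : DGBimod S C) (F' : DGBimod S D) {W : DGBimod R E}
    (ξ : KMap W (tensor M F) 0) (hξ : ξ.LLin) : KMap (homL F F') (homL W (tensor M F')) 0 :=
  (ofHom (tensorHom M F F')).comp (preL _ ξ hξ) (add_zero 0)

lemma tensorHomAlong_closed {F : DGBimod S C} {F' : DGBimod S D} {W : DGBimod R E}
    {ξ : KMap W (tensor M F) 0} (hξ : ξ.LLin) (hc : ξ.Closed) :
    (tensorHomAlong F F' ξ hξ).Closed := (ofHom_closed _).comp (preL_closed _ hc) _

lemma ofL_tensorHomAlong {F : DGBimod S C} {F' : DGBimod S D} {W : DGBimod R E}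
    {ξ : KMap W (tensor M F) 0} (hξ : ξ.LLin) (h : i + 0 = i) (f : (homL F F').X i) :
    ofL ((tensorHomAlong F F' ξ hξ).app h f) =
      ξ.comp (tmapR M (ofL f) (ofL_lLin f)) (zero_add i) := by
  rw [tensorHomAlong, comp_app _ _ _ h h h, ofL_preL, zero_mul, sgn_zero, one_smul, ofHom_app,
    ofL_tensorHom]

variable {F F' : DGMod S} {W : DGMod R} {ξ : KMap W (tensor M F) 0}

lemma homotopic_of_tensorHomAlong_qis (hW : W.HProj) (hξ : ξ.LLin) (hc : ξ.Closed)
    (hb : (tensorHomAlong F F' ξ hξ).Qis) {f g : F ⟶ F'}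
    (h : (Q : DGMod R ⥤ _).map (tensorMap (𝟙 M) f) = Q.map (tensorMap (𝟙 M) g)) :
    Homotopic f g := by
  have e : (Q : DGMod R ⥤ _).map (ξ.toHom hc hξ.bLin ≫ tensorMap (𝟙 M) f) =
      Q.map (ξ.toHom hc hξ.bLin ≫ tensorMap (𝟙 M) g) := by
    rw [Functor.map_comp, Functor.map_comp, h]
  obtain ⟨s, hs, es⟩ := hW.homotopic_of_Q_map_eq e
  have hl : (ofHom f - ofHom g).LLin := (ofHom_bLin f).1.sub (ofHom_bLin g).1
  have hcl : (ofHom f - ofHom g).Closed := (ofHom_closed f).sub (ofHom_closed g)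
  obtain ⟨t, ht, et⟩ := (mem_bdry_homL (zero_add 1)).1 ((hb 0 0 (add_zero 0)).1 (toL _ hl)
    (mem_cyc_homL.2 hcl) ((mem_bdry_homL (zero_add 1)).2 ⟨s, hs.1, by
      rw [es, ofL_tensorHomAlong, tmapR_congr _ (ofL_toL _ hl), tmapR_sub (ofHom_bLin f).1 (ofHom_bLin g).1, comp_sub,
        ofHom_comp, ofHom_comp, ofHom_toHom, ofHom_id_tensorMap, ofHom_id_tensorMap]⟩))
  exact ⟨t, ht.bLin, et⟩

lemma exists_of_tensorHomAlong_qis (hW : W.HProj) (hξ : ξ.LLin) (hc : ξ.Closed) (hq : ξ.Qis)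
    (hb : (tensorHomAlong F F' ξ hξ).Qis)
    (v : (Q : DGMod R ⥤ _).obj (tensor M F) ⟶ Q.obj (tensor M F')) :
    ∃ f : F ⟶ F', Q.map (tensorMap (𝟙 M) f) = v := by
  have hi : IsIso ((Q : DGMod R ⥤ _).map (ξ.toHom hc hξ.bLin)) := by
    rw [isIso_Q_map_iff, ← qis_ofHom_iff, ofHom_toHom]; exact hq
  obtain ⟨w, hw⟩ := hW.exists_Q_map_eq ((Q : DGMod R ⥤ _).map (ξ.toHom hc hξ.bLin) ≫ v)
  obtain ⟨f, hf, hb'⟩ := (hb 0 0 (add_zero 0)).2 (toL (ofHom w) (ofHom_bLin w).1)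
    (mem_cyc_homL.2 (ofHom_closed w))
  obtain ⟨t, ht, et⟩ := (mem_bdry_homL (zero_add 1)).1 hb'
  refine ⟨(ofL f).toHom (mem_cyc_homL.1 hf) (ofL_lLin f).bLin, ?_⟩
  have e : Homotopic w (ξ.toHom hc hξ.bLin ≫
      tensorMap (𝟙 M) ((ofL f).toHom (mem_cyc_homL.1 hf) (ofL_lLin f).bLin)) := by
    refine ⟨t, ht.bLin, ?_⟩
    rw [et, ofL_sub, ofL_toL, ofL_tensorHomAlong, ofHom_comp, ofHom_toHom, ofHom_id_tensorMap,
      tmapR_congr _ (ofHom_toHom _ _ _)]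
  have e' := e.Q_map_eq
  rw [hw, Functor.map_comp] at e'
  exact ((cancel_epi _).1 e').symm

/-- The shift of the map `ξ`. -/
noncomputable def shiftAlong (ξ : KMap W (tensor M F) 0) (n : ℤ) :
    KMap (W.shift n) (tensor M (F.shift n)) 0 :=
  ((ofShift W n (add_neg_cancel n)).comp ξ (add_zero (-n))).comp
    (tmapR M (toShift F n) (toShift_bLin F n).1) (neg_add_cancel n)

lemma shiftAlong_lLin (hξ : ξ.LLin) (n : ℤ) : (shiftAlong ξ n).LLin :=
  ((ofShift_bLin W n _).1.comp hξ _).comp (tmapR_lLin _) _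

lemma shiftAlong_closed (hc : ξ.Closed) (n : ℤ) : (shiftAlong ξ n).Closed :=
  ((ofShift_closed W n _).comp hc _).comp (tmapR_closed _ (toShift_closed F n)) _

lemma shiftAlong_qis (hc : ξ.Closed) (hq : ξ.Qis) (n : ℤ) : (shiftAlong ξ n).Qis := by
  have hn := neg_add_cancel n
  have h₁ : (ofShift W n (add_neg_cancel n)).Qis := by
    refine qis_of_comp_qis (g := toShift W n) (h := hn) (h' := add_neg_cancel n) ?_ ?_
      (toShift_closed W n)
    · rw [ofShift_comp_toShift]; exact one_qis
    · rw [toShift_comp_ofShift]; exact one_qis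
  have h₂ : (tmapR M (toShift F n) (toShift_bLin F n).1).Qis := by
    refine qis_of_comp_qis (g := tmapR M (ofShift F n (add_neg_cancel n)) (ofShift_bLin F n _).1)
      (h := add_neg_cancel n) (h' := hn) ?_ ?_ (tmapR_closed _ (ofShift_closed F n _))
    · rw [tmapR_comp, tmapR_congr _ (toShift_comp_ofShift F n _), tmapR_one]; exact one_qis
    · rw [tmapR_comp, tmapR_congr _ (ofShift_comp_toShift F n _), tmapR_one]; exact one_qis
  exact (h₁.comp hq (ofShift_closed W n _) hc _).comp h₂ ((ofShift_closed W n _).comp hc _)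
    (tmapR_closed _ (toShift_closed F n)) _

lemma shiftAlong_comp_tmapR (ξ : KMap W (tensor M F) 0) (n : ℤ) {g : KMap (F.shift n) F' 0}
    (hg : g.LLin) : (shiftAlong ξ n).comp (tmapR M g hg) (add_zero 0) =
      (ofShift W n (add_neg_cancel n)).comp (ξ.comp (tmapR M ((toShift F n).comp g (add_zero n))
        ((toShift_bLin F n).1.comp hg _)) (zero_add n)) (neg_add_cancel n) := by
  rw [shiftAlong, comp_assoc _ _ _ _ _ (add_zero n) (neg_add_cancel n), tmapR_comp,
    comp_assoc _ _ _ _ _ (zero_add n) (neg_add_cancel n)]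

/-- If `M ⊗ -` is fully faithful on homotopy classes then it is so on Hom complexes. -/
lemma tensorHomAlong_qis (h : ∀ n : ℤ,
      (∀ f g : F.shift n ⟶ F', (Q : DGMod R ⥤ _).map (tensorMap (𝟙 M) f) =
        Q.map (tensorMap (𝟙 M) g) → Homotopic f g) ∧
      (∀ v : (Q : DGMod R ⥤ _).obj (tensor M (F.shift n)) ⟶ Q.obj (tensor M F'),
        ∃ f : F.shift n ⟶ F', Q.map (tensorMap (𝟙 M) f) = v))
    (hW : W.HProj) (hξ : ξ.LLin) (hc : ξ.Closed) (hq : ξ.Qis) :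
    (tensorHomAlong F F' ξ hξ).Qis := by
  intro n n' hn
  obtain rfl : n = n' := by omega
  have hΞl := shiftAlong_lLin hξ n
  have hΞc := shiftAlong_closed hc n
  set Ξ := (shiftAlong ξ n).toHom hΞc hΞl.bLin with hΞ
  have hi : IsIso ((Q : DGMod R ⥤ _).map Ξ) := by
    rw [isIso_Q_map_iff, ← qis_ofHom_iff, ofHom_toHom]; exact shiftAlong_qis hc hq n
  have eΞ : ∀ g : F.shift n ⟶ F', ofHom (Ξ ≫ tensorMap (𝟙 M) g) =
      (ofShift W n (add_neg_cancel n)).comp (ξ.comp (tmapR M ((toShift F n).comp (ofHom g)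
        (add_zero n)) ((toShift_bLin F n).1.comp (ofHom_bLin g).1 _)) (zero_add n))
        (neg_add_cancel n) := fun g => by
    rw [ofHom_comp, ofHom_toHom, ofHom_id_tensorMap, shiftAlong_comp_tmapR]
  constructor
  · intro f hf hb
    obtain ⟨s, hs, es⟩ := (mem_bdry_homL rfl).1 hb
    rw [ofL_tensorHomAlong] at es
    have hgc : ((ofShift F n (add_neg_cancel n)).comp (ofL f) (neg_add_cancel n)).Closed :=
      (ofShift_closed F n _).comp (mem_cyc_homL.1 hf) _
    have hgl : ((ofShift F n (add_neg_cancel n)).comp (ofL f) (neg_add_cancel n)).LLin :=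
      (ofShift_bLin F n _).1.comp (ofL_lLin f) _
    set g := ((ofShift F n (add_neg_cancel n)).comp (ofL f) (neg_add_cancel n)).toHom hgc hgl.bLin
    have eg : (toShift F n).comp (ofHom g) (add_zero n) = ofL f := by
      rw [ofHom_toHom, ← comp_assoc _ _ _ (add_neg_cancel n) (zero_add n), toShift_comp_ofShift,
        one_comp]
    have e₀ : ofHom (zeroHom (F.shift n) F') = 0 := ofHom_zeroHom _ _
    have hom : Homotopic (Ξ ≫ tensorMap (𝟙 M) g) (Ξ ≫ tensorMap (𝟙 M) (zeroHom _ _)) := by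
      refine ⟨(ofShift W n (add_neg_cancel n)).comp s (by omega),
        ((ofShift_bLin W n _).1.comp hs _).bLin, ?_⟩
      rw [(ofShift_closed W n _).D_comp_left s _ (zero_add 1) rfl (neg_add_cancel n), es, eΞ,
        tmapR_congr _ eg, ofHom_comp, ofHom_id_tensorMap, tmapR_zero _ e₀, comp_zero, sub_zero]
    have := hom.Q_map_eq
    rw [Functor.map_comp, Functor.map_comp, cancel_epi] at this
    obtain ⟨t, ht, et⟩ := (h n).1 _ _ this
    refine (mem_bdry_homL rfl).2 ⟨(toShift F n).comp t rfl, (toShift_bLin F n).1.comp ht.1 _, ?_⟩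
    rw [(toShift_closed F n).D_comp_left t _ rfl (zero_add 1) (add_zero n), et, e₀, sub_zero, eg]
  · intro w hw
    have hwc : ((ofShift W n (add_neg_cancel n)).comp (ofL w) (neg_add_cancel n)).Closed :=
      (ofShift_closed W n _).comp (mem_cyc_homL.1 hw) _
    have hwl : ((ofShift W n (add_neg_cancel n)).comp (ofL w) (neg_add_cancel n)).LLin :=
      (ofShift_bLin W n _).1.comp (ofL_lLin w) _
    set w' := ((ofShift W n (add_neg_cancel n)).comp (ofL w) (neg_add_cancel n)).toHom hwc hwl.bLin
    obtain ⟨g, hg⟩ := (h n).2 (inv ((Q : DGMod R ⥤ _).map Ξ) ≫ Q.map w')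
    have e : (Q : DGMod R ⥤ _).map w' = Q.map (Ξ ≫ tensorMap (𝟙 M) g) := by
      rw [Functor.map_comp, hg, IsIso.hom_inv_id_assoc]
    obtain ⟨t, ht, et⟩ := (hW.shift n).homotopic_of_Q_map_eq e
    have hl : ((toShift F n).comp (ofHom g) (add_zero n)).LLin :=
      (toShift_bLin F n).1.comp (ofHom_bLin g).1 _
    refine ⟨toL _ hl, mem_cyc_homL.2 ((toShift_closed F n).comp (ofHom_closed g) (add_zero n)),
      (mem_bdry_homL rfl).2 ⟨(toShift W n).comp t rfl, (toShift_bLin W n).1.comp ht.1 _, ?_⟩⟩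
    rw [(toShift_closed W n).D_comp_left t _ rfl (zero_add 1) (add_zero n), et, eΞ, ofHom_toHom,
      comp_sub, ← comp_assoc _ _ _ (add_neg_cancel n) (zero_add n),
      ← comp_assoc _ _ _ (add_neg_cancel n) (zero_add n), toShift_comp_ofShift, one_comp, one_comp,
      ofL_sub, ofL_tensorHomAlong]
    exact congrArg (fun v => ofL w - ξ.comp v (zero_add n)) (tmapR_congr (ofL_lLin _) (ofL_toL _ hl)).symm

theorem DerivedTensorFullyFaithful.of_evalTensorIsIso (T : BimodRes M)
    (hM : FinitelyBuilt (regular S).right (Q.obj M.right)) (h : EvalTensorIsIso T) :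
    DerivedTensorFullyFaithful M := by
  refine derivedTensorFullyFaithful_iff.2 fun F F' hF hF' => ?_
  obtain ⟨H, p₀, hH, hp₀⟩ := exists_hProj_resolution (tensor T.P F)
  have hp := (ofHom_bLin p₀).1
  have hpc := ofHom_closed p₀
  have hpq := (qis_ofHom_iff p₀).2 hp₀
  have hε : (evalAlong T.P F (ofHom p₀) hp).Qis := by
    have := h F ⟨F, hF.kFlat, 𝟙 _, quasiIso_id _⟩ ⟨H, hH.kFlat, p₀, hp₀⟩
    rw [quasiIso_comp_isIso_iff, ← qis_ofHom_iff, ofHom_comp, ofHom_id_tensorMap] at this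
    exact this
  have hb : (tensorHomAlong F F' (T.extMap hp) (T.extMap_lLin hp)).Qis :=
    (T.tensorHom_extMap_qis_iff hM hF'.left.kFlat hH hp hpc).2 (preL_qis_of_hProj
      (T.hProj_dual_tensor (T.finitelyBuilt hM) hH) hF F' _ (evalAlong_closed hp hpc) hε)
  exact ⟨fun f g => homotopic_of_tensorHomAlong_qis (T.hProj_extension hH) _
      (T.extMap_closed hp hpc) hb,
    exists_of_tensorHomAlong_qis (T.hProj_extension hH) _ (T.extMap_closed hp hpc)
      (T.extMap_qis hF.left.kFlat hH.left.kFlat hp hpc hpq) hb⟩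

lemma tensorHomAlong_postL {F : DGBimod S C} {F' F'' : DGMod S} {W : DGBimod R E}
    {ξ : KMap W (tensor M F) 0} (hξ : ξ.LLin) {g : KMap F'' F' 0} (hg : g.LLin) :
    (tensorHomAlong F F'' ξ hξ).comp (postL W (tmapR M g hg) (tmapR_lLin hg)) (add_zero 0) =
      (postL F g hg).comp (tensorHomAlong F F' ξ hξ) (add_zero 0) :=
  KMap.ext fun i j h f => ofL_injective <| by
    obtain rfl : i = j := by omega
    rw [comp_app _ _ _ h h h, comp_app _ _ _ h h h, ofL_postL, ofL_tensorHomAlong,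
      ofL_tensorHomAlong, comp_assoc _ _ _ _ _ (add_zero i) (zero_add i), tmapR_comp]
    rfl

theorem TensorHomIsIso.of_derivedTensorFullyFaithful (h : DerivedTensorFullyFaithful M) :
    TensorHomIsIso M := by
  refine tensorHomIsIso_iff.2 fun F F' hF₀ hF' J hJ ι hι => ?_
  have hF := hF₀.hProj
  obtain ⟨W, ξ, hW, hξ⟩ := exists_hProj_resolution (tensor M F)
  obtain ⟨F'', g, hF'', hg⟩ := exists_hProj_resolution F'
  have hξq := (qis_ofHom_iff ξ).2 hξ
  have hgq := (qis_ofHom_iff g).2 hg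
  have hξl := (ofHom_bLin ξ).1
  have hgl := (ofHom_bLin g).1
  have hgc := ofHom_closed g
  rw [tensorHom_postL_qis_iff hW hξl (ofHom_closed ξ) hξq hJ _ (ofHom_closed ι)
    ((qis_ofHom_iff ι).2 hι)]
  have hb : (tensorHomAlong F F'' (ofHom ξ) hξl).Qis := tensorHomAlong_qis
    (fun n => derivedTensorFullyFaithful_iff.1 h _ _ (hF.shift n) hF'') hW hξl (ofHom_closed ξ) hξq
  have hbc : (tensorHomAlong F F' (ofHom ξ) hξl).Closed :=
    tensorHomAlong_closed hξl (ofHom_closed ξ)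
  refine (postL_qis hF.left hgl hgc hgq).of_comp_left (h := add_zero 0) ?_ (postL_closed hgl hgc) hbc
  refine Eq.mp (congrArg KMap.Qis (tensorHomAlong_postL hξl hgl)) ?_
  exact hb.comp (postL_qis hW.left _ (tmapR_closed hgl hgc)
    (KFlat.tmapR_qis hF''.left.kFlat hF'.left hgl hgc hgq M))
    (tensorHomAlong_closed hξl (ofHom_closed ξ)) (postL_closed _ (tmapR_closed hgl hgc)) _

end FullyFaithful

end DGBimod
end DG

open DG DG.DGBimod in
/-- The equivalence of six conditions for a DG `R`-`S`-bimodule `M` which is finitely built from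
`S` over `Sᵒᵖ`. The first conjunct says that `Z = RHom_{Sᵒᵖ}(M, S)` can be represented by a DG
bimodule, and the second one gives the equivalence for every such representative. -/
theorem theorem2p4 {K : Type u} [CommRing K] (R S : DGA K) (M : DGBimod R S)
    (hM : FinitelyBuilt (regular S).right (Q.obj M.right)) :
    Nonempty (BimodRes M) ∧
    ∀ T : BimodRes M, List.TFAE [
      EvalIsIso T,
      EvalTensorIsIso T,
      TensorEvalTensorIsIso T,
      CoevIsIso M,
      TensorHomIsIso M,
      DerivedTensorFullyFaithful M] := by
  refine ⟨nonempty_bimodRes M, fun T => ?_⟩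
  tfae_have 1 ↔ 2 := evalIsIso_iff_evalTensorIsIso T
  tfae_have 2 ↔ 3 := evalTensorIsIso_iff_tensorEvalTensorIsIso T
  tfae_have 2 → 6 := DerivedTensorFullyFaithful.of_evalTensorIsIso T hM
  tfae_have 6 → 5 := TensorHomIsIso.of_derivedTensorFullyFaithful
  tfae_have 5 → 4 := CoevIsIso.of_tensorHomIsIso
  tfae_have 4 → 1 := evalIsIso_of_coevIsIso T hM
  tfae_finish
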